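/- For vectors $\vec x=\langle x_0,\dots,x_{n-1}\rangle$ and $\vec y=\langle y_0,\dots,y_{n-1}\rangle$ of real numbers, the $(\mathrm{median},-)$ convolution is the vector $\langle z_0,\dots,z_{n-1}\rangle$ with $z_k=\mathrm{median}_{0\le i\le k}\,(x_i-y_{k-i})$. Here the median of an odd number of reals is the middle one in sorted order, and for an even number of reals one fixes any of the usual conventions: the smaller of the two middle ones, the larger of them, or their average. Theorem. For each of these conventions, the $(\mathrm{median},-)$ convolution of two real vectors of length $n$ can be computed in $O\!\left(n^2(\lg\lg n)^2/\lg n\right)$ time on a real RAM, where $\lg=\log_2$. That is, there is a single program that, for every $n$ and all $\vec x,\vec y\in\mathbb R^n$, halts with the convolution as its output, and whose worst-case number of steps over all inputs of length $n$ is $O\!\left(n^2(\lg\lg n)^2/\lg n\right)$ as $n\to\infty$. The real RAM has registers and indirectly addressed memory for exact real numbers, with unit-cost addition, subtraction, multiplication, division and comparison, and separate registers and memory for nonnegative integers of $O(\log n)$ bits that serve as counters and addresses, with unit-cost addition, truncated subtraction, multiplication and comparison; it cannot convert a real number to an integer (no floor function). -/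

import Mathlib

/-! ### The real RAM

The memory consists of cells holding exact real numbers and, separately, of cells holding natural
numbers, which alone serve as counters and addresses. The integers are machine words: whenever an
instruction computes a value that is not below the word bound `W`, the computation gets stuck.
There is no rounding and no other way to turn a real number into an integer. -/

namespace RealRAM

/-- A configuration of the machine: integer registers, integer memory, real registers,
real memory. A program mentions only finitely many registers; memory is addressed indirectly. -/
structure State where
  ireg : ℕ → ℕ
  imem : ℕ → ℕ
  rreg : ℕ → ℝ
  rmem : ℕ → ℝ

/-- The elementary instructions; the first argument is the target, except in the two
store instructions, where it is the integer register that holds the target address. -/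
inductive Instr where
  | iconst (a v : ℕ)
  | imove (a b : ℕ)
  | iadd (a b c : ℕ)
  | isub (a b c : ℕ)
  | imul (a b c : ℕ)
  | iload (a b : ℕ)
  | istore (a b : ℕ)
  | rconst (a : ℕ) (q : ℚ)
  | rmove (a b : ℕ)
  | radd (a b c : ℕ)
  | rsub (a b c : ℕ)
  | rmul (a b c : ℕ)
  | rdiv (a b c : ℕ)
  | rload (a b : ℕ)
  | rstore (a b : ℕ)

/-- The effect of an instruction (integer subtraction is truncated at zero). -/
noncomputable def Instr.apply : Instr → State → State
  | .iconst a v, s => { s with ireg := Function.update s.ireg a v }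
  | .imove a b, s => { s with ireg := Function.update s.ireg a (s.ireg b) }
  | .iadd a b c, s => { s with ireg := Function.update s.ireg a (s.ireg b + s.ireg c) }
  | .isub a b c, s => { s with ireg := Function.update s.ireg a (s.ireg b - s.ireg c) }
  | .imul a b c, s => { s with ireg := Function.update s.ireg a (s.ireg b * s.ireg c) }
  | .iload a b, s => { s with ireg := Function.update s.ireg a (s.imem (s.ireg b)) }
  | .istore a b, s => { s with imem := Function.update s.imem (s.ireg a) (s.ireg b) }
  | .rconst a q, s => { s with rreg := Function.update s.rreg a (q : ℝ) }
  | .rmove a b, s => { s with rreg := Function.update s.rreg a (s.rreg b) }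
  | .radd a b c, s => { s with rreg := Function.update s.rreg a (s.rreg b + s.rreg c) }
  | .rsub a b c, s => { s with rreg := Function.update s.rreg a (s.rreg b - s.rreg c) }
  | .rmul a b c, s => { s with rreg := Function.update s.rreg a (s.rreg b * s.rreg c) }
  | .rdiv a b c, s => { s with rreg := Function.update s.rreg a (s.rreg b / s.rreg c) }
  | .rload a b, s => { s with rreg := Function.update s.rreg a (s.rmem (s.ireg b)) }
  | .rstore a b, s => { s with rmem := Function.update s.rmem (s.ireg a) (s.rreg b) }

/-- An instruction may be executed if it computes no integer outside the word range and does not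
divide by zero. -/
def Instr.Legal (W : ℕ) : Instr → State → Prop
  | .iconst _ v, _ => v < W
  | .iadd _ b c, s => s.ireg b + s.ireg c < W
  | .imul _ b c, s => s.ireg b * s.ireg c < W
  | .rdiv _ _ c, s => s.rreg c ≠ 0
  | _, _ => True

/-- Comparisons of two integer registers or of two real registers. -/
inductive Test where
  | ilt (a b : ℕ)
  | ile (a b : ℕ)
  | rlt (a b : ℕ)
  | rle (a b : ℕ)

def Test.Holds : Test → State → Prop
  | .ilt a b, s => s.ireg a < s.ireg b
  | .ile a b, s => s.ireg a ≤ s.ireg b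
  | .rlt a b, s => s.rreg a < s.rreg b
  | .rle a b, s => s.rreg a ≤ s.rreg b

/-- Programs. -/
inductive Prog where
  | skip
  | instr (i : Instr)
  | seq (p q : Prog)
  | ite (b : Test) (p q : Prog)
  | loop (b : Test) (p : Prog)

/-- `Exec W p s t s'`: with word bound `W`, the program `p` started in `s` halts in `s'` after
exactly `t` steps, where every execution of an instruction and every evaluation of a test is
one step. -/
inductive Exec (W : ℕ) : Prog → State → ℕ → State → Prop where
  | skip (s : State) : Exec W .skip s 0 s
  | instr (i : Instr) (s : State) (h : i.Legal W s) : Exec W (.instr i) s 1 (i.apply s)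
  | seq {p q : Prog} {s s' s'' : State} {t t' : ℕ} (hp : Exec W p s t s')
      (hq : Exec W q s' t' s'') : Exec W (.seq p q) s (t + t') s''
  | ite_true {b : Test} {p q : Prog} {s s' : State} {t : ℕ} (h : b.Holds s)
      (hp : Exec W p s t s') : Exec W (.ite b p q) s (t + 1) s'
  | ite_false {b : Test} {p q : Prog} {s s' : State} {t : ℕ} (h : ¬ b.Holds s)
      (hq : Exec W q s t s') : Exec W (.ite b p q) s (t + 1) s'
  | loop_true {b : Test} {p : Prog} {s s' s'' : State} {t t' : ℕ} (h : b.Holds s)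
      (hp : Exec W p s t s') (hl : Exec W (.loop b p) s' t' s'') :
      Exec W (.loop b p) s (t + t' + 1) s''
  | loop_false {b : Test} {p : Prog} {s : State} (h : ¬ b.Holds s) : Exec W (.loop b p) s 1 s

/-- The input configuration: `n` is in integer register `0`, the vector `x` in the real memory
cells `0, …, n - 1`, the vector `y` in the cells `n, …, 2 n - 1`, and all else is zero. -/
noncomputable def input {n : ℕ} (x y : Fin n → ℝ) : State where
  ireg := fun a => if a = 0 then n else 0
  imem := fun _ => 0
  rreg := fun _ => 0
  rmem := fun j =>
    if h : j < n then x ⟨j, h⟩ else if h' : j - n < n then y ⟨j - n, h'⟩ else 0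

/-- The program `p` computes the vector-valued function `F` of two vectors of the same length
within `T n` steps on all inputs of length `n`, using only integers below a fixed power of `n + 2`,
that is, words of `O(log n)` bits. The result replaces `x` in the cells `0, …, n - 1`. -/
def Computes (p : Prog) (F : ∀ n : ℕ, (Fin n → ℝ) → (Fin n → ℝ) → Fin n → ℝ)
    (T : ℕ → ℕ) : Prop :=
  ∃ c : ℕ, ∀ (n : ℕ) (x y : Fin n → ℝ), ∃ (t : ℕ) (s : State),
    t ≤ T n ∧ Exec ((n + 2) ^ c) p (input x y) t s ∧ ∀ k : Fin n, s.rmem k = F n x y k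

end RealRAM

/-! ### Median convolution -/

/-- The usual conventions for the median of an even number of reals: the smaller middle element,
the larger middle element, or their average. All agree for an odd number of reals. -/
inductive MedianRule where
  | lower
  | upper
  | midpoint

/-- The element of rank `r` (counted from `0`) of the reals `w 0, …, w (m - 1)`. -/
noncomputable def orderStat {m : ℕ} (w : Fin m → ℝ) (r : Fin m) : ℝ :=
  w (Tuple.sort w r)

/-- The median of the `k + 1` reals `w 0, …, w k`. -/
noncomputable def median (ρ : MedianRule) {k : ℕ} (w : Fin (k + 1) → ℝ) : ℝ :=
  match ρ with
  | .lower => orderStat w ⟨k / 2, by omega⟩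
  | .upper => orderStat w ⟨(k + 1) / 2, by omega⟩
  | .midpoint =>
      (orderStat w ⟨k / 2, by omega⟩ + orderStat w ⟨(k + 1) / 2, by omega⟩) / 2

/-- The `(median, -)` convolution: the `k`th entry is the median of `x i - y (k - i)`, where
`0 ≤ i ≤ k`. -/
noncomputable def medianConv (ρ : MedianRule) (n : ℕ) (x y : Fin n → ℝ) (k : Fin n) : ℝ :=
  median ρ (k := k) fun i => x ⟨i, by omega⟩ - y ⟨k - i, by omega⟩

/-! ### A structured language over the real RAM -/

namespace MedConv

open RealRAM

/-! Let `d = 2 ^ L` be the largest power of two with `40 * L * 2 ^ L ≤ Nat.log 2 n`, and cut the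
indices of `x` into blocks of length `d`. The vector `y` is shifted by `d` and padded in front, so
that with `κ = k + d` the differences `X i - Y (κ - i)` for `i ≤ k` are those of the `k`th entry and
those for `k < i < κ` are larger. Suppose that for each block, starting at `B`, and each shift `τ`
the indices `B + a` are known in the order of `X (B + a) - Y (τ - a)`. Then an entry of the
convolution consists of elements of given rank in `m = k / d + 1` sorted lists of length `d`, and
selection takes `O(m * (L + 1))` steps (`wp_select`). Over all `k` this is `O(n² (L + 1) / d)`, and
since `lg n ≤ 80 (L + 1) d` and `L ≤ lg lg n` for large `n`, it is the bound claimed. Everything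
else has to stay within `O(n² / d)`.

The orders. By Fredman's trick, `X (B + a) - Y (τ - a) ≤ X (B + b) - Y (τ - b)` means `X (B + a) - X
(B + b) ≤ Y (τ - a) - Y (τ - b)`, which separates `X` from `Y`. Take a group of `g = d⁴` consecutive
blocks. For each of the `h = d²` pairs `(a, b)` the left sides are sorted; the rank of the right
side among them then settles the comparison in all `g` blocks at once, so shifts with the same list
of `h` ranks have the same orders (`BlockOrder.transfer`). They form a class and share one set of
sorted blocks, which is found by walking down a trie along the ranks in `O(h²) = O(g)` steps. There
are few classes: the comparisons are signs of linear functionals in dimension `d + 1`, their VC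
dimension is at most `d + 1` (`vcDim_trueSet`), and the Sauer–Shelah lemma leaves at most `(g d² +
1) ^ (d + 1)` classes (`card_le_of_injOn_rankList`). The choice of `d` keeps this number times `d²`
below `4 n` (`class_bound`).

Selection. The sorted lists are cut into chunks of equal length. All chunks are halved again and
again, and after each halving chunks are discarded until at most `64 m` are left. For this a pivot
near a quartile of the first elements is used. Inside a block at most one chunk straddles the pivot
(`Chunks.straddle`), so as long as there are more than `64 m` chunks, the rank of the element sought
allows an eighth of them to be dropped as too large or too small (`wp_reduce`). The pivot is found
in linear time without recursion by nested sampling: groups are sorted and every fourth element is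
kept, with group sizes that double from level to level, so that both the error and the cost are
geometric series (`wp_sample`).

The algorithm is written in a small structured language with a clock. Its programs are verified with
weakest preconditions, and a compiler to the real RAM is proved to preserve results and to increase
the time by a constant factor only (`exec_cmd`). -/

/-- Update of a two-dimensional array. -/
def upd2 {α : Type*} (f : ℕ → ℕ → α) (i j : ℕ) (v : α) : ℕ → ℕ → α :=
  fun a b => if a = i ∧ b = j then v else f a b

theorem upd2_apply {α : Type*} (f : ℕ → ℕ → α) (i j : ℕ) (v : α) (a b : ℕ) :
    upd2 f i j v a b = if a = i ∧ b = j then v else f a b := rfl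

/-- States of the structured language: integer variables, two-dimensional integer arrays, real
variables, two-dimensional real arrays, the input and output cells, and a clock. -/
structure St where
  iv : ℕ → ℕ
  ia : ℕ → ℕ → ℕ → ℕ
  rv : ℕ → ℝ
  ra : ℕ → ℕ → ℕ → ℝ
  raw : ℕ → ℝ
  time : ℕ

/-- Integer expressions. -/
inductive IE where
  | lit (v : ℕ)
  | var (a : ℕ)
  | add (e f : IE)
  | sub (e f : IE)
  | mul (e f : IE)
  | ld (A : ℕ) (i j : IE)

/-- Real expressions. -/
inductive RE where
  | lit (q : ℚ)
  | var (a : ℕ)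
  | add (e f : RE)
  | sub (e f : RE)
  | mul (e f : RE)
  | ld (A : ℕ) (i j : IE)
  | raw (i : IE)

/-- Boolean expressions, evaluated from the left with short circuit. -/
inductive BE where
  | ilt (e f : IE)
  | rlt (e f : RE)
  | not (b : BE)
  | and (b c : BE)
  | or (b c : BE)

/-- Commands. -/
inductive Cmd where
  | iset (a : ℕ) (e : IE)
  | iput (A : ℕ) (i j e : IE)
  | rset (a : ℕ) (e : RE)
  | rput (A : ℕ) (i j : IE) (e : RE)
  | rawput (i : IE) (e : RE)
  | skip
  | seq (p q : Cmd)
  | ite (b : BE) (p q : Cmd)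
  | whl (b : BE) (p : Cmd)

instance : Add IE := ⟨IE.add⟩
instance : Sub IE := ⟨IE.sub⟩
instance : Mul IE := ⟨IE.mul⟩
instance (v : ℕ) : OfNat IE v := ⟨IE.lit v⟩
instance : Add RE := ⟨RE.add⟩
instance : Sub RE := ⟨RE.sub⟩
instance : Mul RE := ⟨RE.mul⟩
instance (v : ℕ) : OfNat RE v := ⟨RE.lit v⟩

infixr:60 " ;; " => Cmd.seq

def IE.val (s : St) : IE → ℕ
  | .lit v => v
  | .var a => s.iv a
  | .add e f => e.val s + f.val s
  | .sub e f => e.val s - f.val s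
  | .mul e f => e.val s * f.val s
  | .ld A i j => s.ia A (i.val s) (j.val s)

/-- All sums and products are below `S`, as are all array indices. -/
def IE.ok (S : ℕ) (s : St) : IE → Prop
  | .lit _ => True
  | .var _ => True
  | .add e f => e.ok S s ∧ f.ok S s ∧ e.val s + f.val s < S
  | .sub e f => e.ok S s ∧ f.ok S s
  | .mul e f => e.ok S s ∧ f.ok S s ∧ e.val s * f.val s < S
  | .ld _ i j => i.ok S s ∧ j.ok S s ∧ i.val s < S ∧ j.val s < S

noncomputable def RE.val (s : St) : RE → ℝ
  | .lit q => q
  | .var a => s.rv a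
  | .add e f => e.val s + f.val s
  | .sub e f => e.val s - f.val s
  | .mul e f => e.val s * f.val s
  | .ld A i j => s.ra A (i.val s) (j.val s)
  | .raw i => s.raw (i.val s)

def RE.ok (S n : ℕ) (s : St) : RE → Prop
  | .lit _ => True
  | .var _ => True
  | .add e f => e.ok S n s ∧ f.ok S n s
  | .sub e f => e.ok S n s ∧ f.ok S n s
  | .mul e f => e.ok S n s ∧ f.ok S n s
  | .ld _ i j => i.ok S s ∧ j.ok S s ∧ i.val s < S ∧ j.val s < S
  | .raw i => i.ok S s ∧ i.val s < 2 * n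

def BE.val (s : St) : BE → Prop
  | .ilt e f => e.val s < f.val s
  | .rlt e f => e.val s < f.val s
  | .not b => ¬ b.val s
  | .and b c => b.val s ∧ c.val s
  | .or b c => b.val s ∨ c.val s

def BE.ok (S n : ℕ) (s : St) : BE → Prop
  | .ilt e f => e.ok S s ∧ f.ok S s
  | .rlt e f => e.ok S n s ∧ f.ok S n s
  | .not b => b.ok S n s
  | .and b c => b.ok S n s ∧ (b.val s → c.ok S n s)
  | .or b c => b.ok S n s ∧ (¬ b.val s → c.ok S n s)

/-- One step of the clock. -/
def St.tick (s : St) : St := { s with time := s.time + 1 }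

/-- Big-step semantics; the clock counts commands and tests. -/
inductive Run (S n : ℕ) : Cmd → St → St → Prop where
  | iset (a : ℕ) (e : IE) (s : St) (h : e.ok S s) :
      Run S n (.iset a e) s
        { s with iv := Function.update s.iv a (e.val s), time := s.time + 1 }
  | iput (A : ℕ) (i j e : IE) (s : St) (hi : i.ok S s) (hj : j.ok S s) (he : e.ok S s)
      (hi' : i.val s < S) (hj' : j.val s < S) :
      Run S n (.iput A i j e) s
        { s with ia := Function.update s.ia A (upd2 (s.ia A) (i.val s) (j.val s) (e.val s)),
                 time := s.time + 1 }
  | rset (a : ℕ) (e : RE) (s : St) (h : e.ok S n s) :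
      Run S n (.rset a e) s
        { s with rv := Function.update s.rv a (e.val s), time := s.time + 1 }
  | rput (A : ℕ) (i j : IE) (e : RE) (s : St) (hi : i.ok S s) (hj : j.ok S s) (he : e.ok S n s)
      (hi' : i.val s < S) (hj' : j.val s < S) :
      Run S n (.rput A i j e) s
        { s with ra := Function.update s.ra A (upd2 (s.ra A) (i.val s) (j.val s) (e.val s)),
                 time := s.time + 1 }
  | rawput (i : IE) (e : RE) (s : St) (hi : i.ok S s) (he : e.ok S n s) (hi' : i.val s < 2 * n) :
      Run S n (.rawput i e) s
        { s with raw := Function.update s.raw (i.val s) (e.val s), time := s.time + 1 }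
  | skip (s : St) : Run S n .skip s s
  | seq {p q : Cmd} {s s' s'' : St} (hp : Run S n p s s') (hq : Run S n q s' s'') :
      Run S n (.seq p q) s s''
  | ite_true {b : BE} {p q : Cmd} {s s' : St} (ho : b.ok S n s) (hb : b.val s)
      (hp : Run S n p s.tick s') : Run S n (.ite b p q) s s'
  | ite_false {b : BE} {p q : Cmd} {s s' : St} (ho : b.ok S n s) (hb : ¬ b.val s)
      (hq : Run S n q s.tick s') : Run S n (.ite b p q) s s'
  | whl_true {b : BE} {p : Cmd} {s s' s'' : St} (ho : b.ok S n s) (hb : b.val s)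
      (hp : Run S n p s.tick s') (hl : Run S n (.whl b p) s' s'') : Run S n (.whl b p) s s''
  | whl_false {b : BE} {p : Cmd} {s : St} (ho : b.ok S n s) (hb : ¬ b.val s) :
      Run S n (.whl b p) s s.tick

theorem Run.time_le {S n : ℕ} {c : Cmd} {s s' : St} (h : Run S n c s s') : s.time ≤ s'.time := by
  induction h <;> (try simp only [St.tick] at *) <;> omega

/-! #### Compilation -/

/-- Instructions that put the address of cell `(i, j)` of array `A` into the register
`2 * t + 1`; the indices are expected in the registers `2 * t + 1` and `2 * t + 3`. -/
def addrCode (A t : ℕ) : Prog :=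
  .seq (.instr (.iconst (2 * t + 5) A)) (.seq (.instr (.imul (2 * t + 5) (2 * t + 5) 1))
    (.seq (.instr (.iadd (2 * t + 1) (2 * t + 5) (2 * t + 1)))
      (.seq (.instr (.imul (2 * t + 1) (2 * t + 1) 1))
        (.instr (.iadd (2 * t + 1) (2 * t + 1) (2 * t + 3))))))

/-- Variables live in the even registers, intermediate results in the odd registers from `2 * t + 1`
on, which serve as a stack. Registers `1` and `3` hold the constants `S` and `2 * n`, hence `2 ≤ t`
in all uses. -/
def IE.comp : IE → ℕ → Prog
  | .lit v, t => .instr (.iconst (2 * t + 1) v)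
  | .var a, t => .instr (.imove (2 * t + 1) (2 * a))
  | .add e f, t => .seq (e.comp t) (.seq (f.comp (t + 1))
      (.instr (.iadd (2 * t + 1) (2 * t + 1) (2 * t + 3))))
  | .sub e f, t => .seq (e.comp t) (.seq (f.comp (t + 1))
      (.instr (.isub (2 * t + 1) (2 * t + 1) (2 * t + 3))))
  | .mul e f, t => .seq (e.comp t) (.seq (f.comp (t + 1))
      (.instr (.imul (2 * t + 1) (2 * t + 1) (2 * t + 3))))
  | .ld A i j, t => .seq (i.comp t) (.seq (j.comp (t + 1)) (.seq (addrCode A t)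
      (.instr (.iload (2 * t + 1) (2 * t + 1)))))

def IE.cost : IE → ℕ
  | .lit _ => 1
  | .var _ => 1
  | .add e f => e.cost + (f.cost + 1)
  | .sub e f => e.cost + (f.cost + 1)
  | .mul e f => e.cost + (f.cost + 1)
  | .ld _ i j => i.cost + (j.cost + (5 + 1))

/-- With literals below `2 ^ 16 ≤ S` and fewer than `16` arrays, all literals and addresses stay
below `32 * S * S`. -/
def IE.wf : IE → Bool
  | .lit v => decide (v < 2 ^ 16)
  | .var _ => true
  | .add e f => e.wf && f.wf
  | .sub e f => e.wf && f.wf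
  | .mul e f => e.wf && f.wf
  | .ld A i j => decide (A < 16) && i.wf && j.wf

/-- Addresses are always computed in the integer registers from `5` on, whatever the depth `t`: the
pending real operands are in the other bank. The arrays lie behind the `2 * n` input cells, so
register `3` is added to the address. -/
def RE.comp : RE → ℕ → Prog
  | .lit q, t => .instr (.rconst (2 * t + 1) q)
  | .var a, t => .instr (.rmove (2 * t + 1) (2 * a))
  | .add e f, t => .seq (e.comp t) (.seq (f.comp (t + 1))
      (.instr (.radd (2 * t + 1) (2 * t + 1) (2 * t + 3))))
  | .sub e f, t => .seq (e.comp t) (.seq (f.comp (t + 1))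
      (.instr (.rsub (2 * t + 1) (2 * t + 1) (2 * t + 3))))
  | .mul e f, t => .seq (e.comp t) (.seq (f.comp (t + 1))
      (.instr (.rmul (2 * t + 1) (2 * t + 1) (2 * t + 3))))
  | .ld A i j, t => .seq (i.comp 2) (.seq (j.comp 3) (.seq (addrCode A 2)
      (.seq (.instr (.iadd 5 5 3)) (.instr (.rload (2 * t + 1) 5)))))
  | .raw i, t => .seq (i.comp 2) (.instr (.rload (2 * t + 1) 5))

def RE.cost : RE → ℕ
  | .lit _ => 1
  | .var _ => 1
  | .add e f => e.cost + (f.cost + 1)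
  | .sub e f => e.cost + (f.cost + 1)
  | .mul e f => e.cost + (f.cost + 1)
  | .ld _ i j => i.cost + (j.cost + (5 + (1 + 1)))
  | .raw i => i.cost + 1

def RE.wf : RE → Bool
  | .lit _ => true
  | .var _ => true
  | .add e f => e.wf && f.wf
  | .sub e f => e.wf && f.wf
  | .mul e f => e.wf && f.wf
  | .ld A i j => decide (A < 16) && i.wf && j.wf
  | .raw i => i.wf

/-- The truth value is left in register `5`: zero for true, the content of register `1` for
false. -/
def BE.comp : BE → Prog
  | .ilt e f => .seq (e.comp 2) (.seq (f.comp 3)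
      (.ite (.ilt 5 7) (.instr (.iconst 5 0)) (.instr (.imove 5 1))))
  | .rlt e f => .seq (e.comp 2) (.seq (f.comp 3)
      (.ite (.rlt 5 7) (.instr (.iconst 5 0)) (.instr (.imove 5 1))))
  | .not b => .seq b.comp (.ite (.ilt 5 1) (.instr (.imove 5 1)) (.instr (.iconst 5 0)))
  | .and b c => .seq b.comp (.ite (.ilt 5 1) c.comp .skip)
  | .or b c => .seq b.comp (.ite (.ilt 5 1) .skip c.comp)

def BE.cost : BE → ℕ
  | .ilt e f => e.cost + (f.cost + 2)
  | .rlt e f => e.cost + (f.cost + 2)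
  | .not b => b.cost + 2
  | .and b c => b.cost + (c.cost + 1)
  | .or b c => b.cost + (c.cost + 1)

def BE.wf : BE → Bool
  | .ilt e f => e.wf && f.wf
  | .rlt e f => e.wf && f.wf
  | .not b => b.wf
  | .and b c => b.wf && c.wf
  | .or b c => b.wf && c.wf

def Cmd.comp : Cmd → Prog
  | .iset a e => .seq (e.comp 2) (.instr (.imove (2 * a) 5))
  | .iput A i j e => .seq (i.comp 2) (.seq (j.comp 3) (.seq (addrCode A 2)
      (.seq (e.comp 3) (.instr (.istore 5 7)))))
  | .rset a e => .seq (e.comp 2) (.instr (.rmove (2 * a) 5))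
  | .rput A i j e => .seq (e.comp 2) (.seq (i.comp 2) (.seq (j.comp 3) (.seq (addrCode A 2)
      (.seq (.instr (.iadd 5 5 3)) (.instr (.rstore 5 5))))))
  | .rawput i e => .seq (e.comp 2) (.seq (i.comp 2) (.instr (.rstore 5 5)))
  | .skip => .skip
  | .seq p q => .seq p.comp q.comp
  | .ite b p q => .seq b.comp (.ite (.ilt 5 1) p.comp q.comp)
  | .whl b p => .seq b.comp (.loop (.ilt 5 1) (.seq p.comp b.comp))

/-- A bound for the number of machine steps per unit of the clock. -/
def Cmd.kap : Cmd → ℕ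
  | .iset _ e => e.cost + 1
  | .iput _ i j e => i.cost + (j.cost + (5 + (e.cost + 1)))
  | .rset _ e => e.cost + 1
  | .rput _ i j e => e.cost + (i.cost + (j.cost + (5 + (1 + 1))))
  | .rawput i e => e.cost + (i.cost + 1)
  | .skip => 0
  | .seq p q => p.kap + q.kap
  | .ite b p q => b.cost + 1 + (p.kap + q.kap)
  | .whl b p => b.cost + 1 + p.kap

def Cmd.wf : Cmd → Bool
  | .iset _ e => e.wf
  | .iput A i j e => decide (A < 16) && i.wf && j.wf && e.wf
  | .rset _ e => e.wf
  | .rput A i j e => decide (A < 16) && i.wf && j.wf && e.wf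
  | .rawput i e => i.wf && e.wf
  | .skip => true
  | .seq p q => p.wf && q.wf
  | .ite b p q => b.wf && p.wf && q.wf
  | .whl b p => b.wf && p.wf

/-- The machine configuration `m` represents the state `s`. -/
structure Rel (S n : ℕ) (s : St) (m : State) : Prop where
  iv : ∀ a, m.ireg (2 * a) = s.iv a
  ia : ∀ A i j, i < S → j < S → m.imem ((A * S + i) * S + j) = s.ia A i j
  rv : ∀ a, m.rreg (2 * a) = s.rv a
  ra : ∀ A i j, i < S → j < S → m.rmem ((A * S + i) * S + j + 2 * n) = s.ra A i j
  raw : ∀ j, j < 2 * n → m.rmem j = s.raw j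
  hS : m.ireg 1 = S
  hN : m.ireg 3 = 2 * n

/-- The configurations agree outside the temporary registers from `2 * t + 1` on. -/
structure Same (t : ℕ) (m m' : State) : Prop where
  ireg : ∀ r, r < 2 * t + 1 ∨ r % 2 = 0 → m'.ireg r = m.ireg r
  imem : m'.imem = m.imem
  rmem : m'.rmem = m.rmem

/-- Kept apart from `Same`, because a real expression at depth `t` uses the real temporaries from
depth `t` but the integer temporaries from depth `2`. -/
structure SameR (t : ℕ) (m m' : State) : Prop where
  rreg : ∀ r, r < 2 * t + 1 ∨ r % 2 = 0 → m'.rreg r = m.rreg r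

theorem Same.trans {t : ℕ} {m m' m'' : State} (h : Same t m m') (h' : Same t m' m'') :
    Same t m m'' :=
  ⟨fun r hr => (h'.ireg r hr).trans (h.ireg r hr), h'.imem.trans h.imem, h'.rmem.trans h.rmem⟩

theorem Same.mono {t u : ℕ} {m m' : State} (h : Same t m m') (hu : u ≤ t) : Same u m m' :=
  ⟨fun r hr => h.ireg r (by omega), h.imem, h.rmem⟩

theorem Rel.same {S n t : ℕ} {s : St} {m m' : State} (h : Rel S n s m) (ht : 2 ≤ t)
    (hs : Same t m m') (hr : ∀ a, m'.rreg (2 * a) = m.rreg (2 * a)) : Rel S n s m' where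
  iv a := by rw [hs.ireg _ (by omega), h.iv]
  ia := by rw [hs.imem]; exact h.ia
  rv a := by rw [hr, h.rv]
  ra := by rw [hs.rmem]; exact h.ra
  raw := by rw [hs.rmem]; exact h.raw
  hS := by rw [hs.ireg _ (by omega), h.hS]
  hN := by rw [hs.ireg _ (by omega), h.hN]

theorem Rel.tick {S n : ℕ} {s : St} {m : State} (h : Rel S n s m) : Rel S n s.tick m :=
  ⟨h.iv, h.ia, h.rv, h.ra, h.raw, h.hS, h.hN⟩

section Compile

variable {S n W : ℕ}

/-- The extra summand `S` in the last bound leaves room for the offset `2 * n ≤ S` of the real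
arrays. -/
theorem addr_lt {S A i j : ℕ} (hA : A < 16) (hi : i < S) (hj : j < S) :
    A * S < 32 * S * S ∧ A * S + i < 32 * S * S ∧ (A * S + i) * S < 32 * S * S ∧
      (A * S + i) * S + j + S < 32 * S * S := by
  have h1 : A * S ≤ 15 * S := Nat.mul_le_mul_right _ (by omega)
  have h2 : (A * S + i) * S ≤ (16 * S) * S := Nat.mul_le_mul_right _ (by omega)
  have h3 : S ≤ S * S := Nat.le_mul_self S
  have h4 : 32 * S * S = 32 * (S * S) := by ring
  have h5 : 16 * S * S = 16 * (S * S) := by ring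
  refine ⟨?_, ?_, ?_, ?_⟩ <;> omega

theorem exec_addrCode (hW : 32 * S * S ≤ W) (hS16 : 2 ^ 16 ≤ S) {A t : ℕ} (hA : A < 16)
    (ht : 2 ≤ t) {m : State} (h1 : m.ireg 1 = S) (hi : m.ireg (2 * t + 1) < S)
    (hj : m.ireg (2 * t + 3) < S) :
    ∃ m', Exec W (addrCode A t) m 5 m' ∧ Same t m m' ∧ m'.rreg = m.rreg ∧
      m'.ireg (2 * t + 1) = (A * S + m.ireg (2 * t + 1)) * S + m.ireg (2 * t + 3) := by
  obtain ⟨b1, b2, b3, b4⟩ := addr_lt hA hi hj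
  have e1 : (1 : ℕ) ≠ 2 * t + 5 := by omega
  have e2 : 2 * t + 1 ≠ 2 * t + 5 := by omega
  have e3 : (1 : ℕ) ≠ 2 * t + 1 := by omega
  have e4 : 2 * t + 3 ≠ 2 * t + 5 := by omega
  have e6 (f : ℕ → ℕ) (v : ℕ) : Function.update f (2 * t + 1) v 1 = f 1 :=
    Function.update_of_ne e3 _ _
  have e5 : 2 * t + 3 ≠ 2 * t + 1 := by omega
  refine ⟨_, Exec.seq (Exec.instr _ _ ?_) (Exec.seq (Exec.instr _ _ ?_)
    (Exec.seq (Exec.instr _ _ ?_) (Exec.seq (Exec.instr _ _ ?_) (Exec.instr _ _ ?_)))), ?_, ?_, ?_⟩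
  · have : S ≤ S * S := Nat.le_mul_self S
    have : 32 * S * S = 32 * (S * S) := by ring
    simp only [Instr.Legal]; omega
  · simp [Instr.Legal, Instr.apply, e1, e2, e4, e5, e6, h1]; omega
  · simp [Instr.Legal, Instr.apply, e1, e2, e4, e5, e6, h1]; omega
  · simp [Instr.Legal, Instr.apply, e1, e2, e4, e5, e6, h1]; omega
  · simp [Instr.Legal, Instr.apply, e1, e2, e4, e5, e6, h1]; omega
  · refine ⟨fun r hr => ?_, rfl, rfl⟩
    have f1 : r ≠ 2 * t + 1 := by omega
    have f2 : r ≠ 2 * t + 5 := by omega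
    simp [Instr.apply, f1, f2]
  · rfl
  · simp [Instr.apply, e1, e2, e4, e5, e6, h1]

theorem exec_ie (hW : 32 * S * S ≤ W) (hS16 : 2 ^ 16 ≤ S) (s : St) (e : IE) :
    ∀ (t : ℕ) (m : State), 2 ≤ t → Rel S n s m → e.ok S s → e.wf = true →
      ∃ m', Exec W (e.comp t) m e.cost m' ∧ Same t m m' ∧ m'.rreg = m.rreg ∧
        m'.ireg (2 * t + 1) = e.val s := by
  have hSS : S ≤ S * S := Nat.le_mul_self S
  have hSS' : 32 * S * S = 32 * (S * S) := by ring
  -- The arithmetical operations differ only in their last instruction; the evaluation of the two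
  -- operands is treated once.
  have bin : ∀ (e f : IE) (ins : Instr) (t : ℕ) (m : State) (v : ℕ), 2 ≤ t → Rel S n s m →
      (∃ m', Exec W (e.comp t) m e.cost m' ∧ Same t m m' ∧ m'.rreg = m.rreg ∧
        m'.ireg (2 * t + 1) = e.val s) →
      (∀ m, Rel S n s m → ∃ m', Exec W (f.comp (t + 1)) m f.cost m' ∧ Same (t + 1) m m' ∧
        m'.rreg = m.rreg ∧ m'.ireg (2 * (t + 1) + 1) = f.val s) →
      (∀ m, m.ireg (2 * t + 1) = e.val s → m.ireg (2 * t + 3) = f.val s →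
        ins.Legal W m ∧ ins.apply m = { m with ireg := Function.update m.ireg (2 * t + 1) v }) →
      ∃ m', Exec W (.seq (e.comp t) (.seq (f.comp (t + 1)) (.instr ins))) m
        (e.cost + (f.cost + 1)) m' ∧ Same t m m' ∧ m'.rreg = m.rreg ∧
        m'.ireg (2 * t + 1) = v := by
    intro e f ins t m v ht hm ⟨m1, x1, s1, r1, v1⟩ hf hins
    obtain ⟨m2, x2, s2, r2, v2⟩ := hf m1 (hm.same ht s1 (by simp [r1]))
    obtain ⟨l, ha⟩ := hins m2 (by rw [s2.ireg _ (by omega), v1]) v2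
    refine ⟨_, Exec.seq x1 (Exec.seq x2 (Exec.instr _ _ l)), ?_, ?_, ?_⟩
    · refine (s1.trans (s2.mono (Nat.le_succ t))).trans ⟨fun r hr => ?_, ?_, ?_⟩
      · have : r ≠ 2 * t + 1 := by omega
        simp [ha, this]
      · simp [ha]
      · simp [ha]
    · simp [ha, r2, r1]
    · simp [ha]
  induction e with
  | lit v =>
    intro t m ht hm ho hw
    simp only [IE.wf, decide_eq_true_eq] at hw
    refine ⟨_, Exec.instr _ _ ?_, ⟨fun r hr => ?_, rfl, rfl⟩, rfl, ?_⟩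
    · simp only [Instr.Legal]; omega
    · have : r ≠ 2 * t + 1 := by omega
      simp [Instr.apply, this]
    · simp [Instr.apply, IE.val]
  | var a =>
    intro t m ht hm ho hw
    refine ⟨_, Exec.instr _ _ trivial, ⟨fun r hr => ?_, rfl, rfl⟩, rfl, ?_⟩
    · have : r ≠ 2 * t + 1 := by omega
      simp [Instr.apply, this]
    · simp [Instr.apply, IE.val, hm.iv]
  | add e f ihe ihf =>
    intro t m ht hm ho hw
    simp only [IE.wf, Bool.and_eq_true] at hw
    refine bin e f _ t m _ ht hm (ihe t m ht hm ho.1 hw.1)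
      (fun m hm => ihf (t + 1) m (by omega) hm ho.2.1 hw.2) fun m h1 h2 => ⟨?_, ?_⟩
    · have := ho.2.2
      simp only [Instr.Legal, h1, h2]; omega
    · simp [Instr.apply, h1, h2, IE.val]
  | sub e f ihe ihf =>
    intro t m ht hm ho hw
    simp only [IE.wf, Bool.and_eq_true] at hw
    refine bin e f _ t m _ ht hm (ihe t m ht hm ho.1 hw.1)
      (fun m hm => ihf (t + 1) m (by omega) hm ho.2 hw.2) fun m h1 h2 => ⟨trivial, ?_⟩
    simp [Instr.apply, h1, h2, IE.val]
  | mul e f ihe ihf =>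
    intro t m ht hm ho hw
    simp only [IE.wf, Bool.and_eq_true] at hw
    refine bin e f _ t m _ ht hm (ihe t m ht hm ho.1 hw.1)
      (fun m hm => ihf (t + 1) m (by omega) hm ho.2.1 hw.2) fun m h1 h2 => ⟨?_, ?_⟩
    · have := ho.2.2
      simp only [Instr.Legal, h1, h2]; omega
    · simp [Instr.apply, h1, h2, IE.val]
  | ld A i j ihi ihj =>
    intro t m ht hm ho hw
    simp only [IE.wf, Bool.and_eq_true, decide_eq_true_eq] at hw
    obtain ⟨m1, x1, s1, r1, v1⟩ := ihi t m ht hm ho.1 hw.1.2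
    have hm1 := hm.same ht s1 (by simp [r1])
    obtain ⟨m2, x2, s2, r2, v2⟩ := ihj (t + 1) m1 (by omega) hm1 ho.2.1 hw.2
    have v1' : m2.ireg (2 * t + 1) = i.val s := by rw [s2.ireg _ (by omega), v1]
    have v2' : m2.ireg (2 * t + 3) = j.val s := v2
    have hm2 := hm1.same (by omega) s2 (by simp [r2])
    obtain ⟨m3, x3, s3, r3, v3⟩ := exec_addrCode hW hS16 hw.1.1 ht hm2.hS
      (by rw [v1']; exact ho.2.2.1) (by rw [v2']; exact ho.2.2.2)
    have hm3 := hm2.same ht s3 (by simp [r3])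
    refine ⟨_, Exec.seq x1 (Exec.seq x2 (Exec.seq x3 (Exec.instr _ _ trivial))), ?_, ?_, ?_⟩
    · refine ((s1.trans (s2.mono (Nat.le_succ t))).trans s3).trans ⟨fun r hr => ?_, rfl, rfl⟩
      have : r ≠ 2 * t + 1 := by omega
      simp [Instr.apply, this]
    · simp [Instr.apply, r3, r2, r1]
    · simp only [Instr.apply, Function.update_self, v3, v1', v2', IE.val]
      exact hm3.ia _ _ _ ho.2.2.1 ho.2.2.2

theorem exec_addr (hW : 32 * S * S ≤ W) (hS16 : 2 ^ 16 ≤ S) (s : St) {A : ℕ} {i j : IE}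
    {m : State} (hA : A < 16) (hm : Rel S n s m)
    (hi : i.ok S s) (hj : j.ok S s) (hi' : i.val s < S) (hj' : j.val s < S)
    (wi : i.wf = true) (wj : j.wf = true) :
    ∃ m1 m2 m3, Exec W (i.comp 2) m i.cost m1 ∧ Exec W (j.comp 3) m1 j.cost m2 ∧
      Exec W (addrCode A 2) m2 5 m3 ∧
      Same 2 m m3 ∧ m3.rreg = m.rreg ∧ m3.ireg 5 = (A * S + i.val s) * S + j.val s := by
  obtain ⟨m1, x1, s1, r1, v1⟩ := exec_ie (n := n) hW hS16 s i 2 m le_rfl hm hi wi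
  have hm1 := hm.same le_rfl s1 (by simp [r1])
  obtain ⟨m2, x2, s2, r2, v2⟩ := exec_ie (n := n) hW hS16 s j 3 m1 (by omega) hm1 hj wj
  have v1' : m2.ireg 5 = i.val s := by rw [s2.ireg _ (by omega), v1]
  have v2' : m2.ireg 7 = j.val s := v2
  have hm2 := hm1.same (by omega) s2 (by simp [r2])
  obtain ⟨m3, x3, s3, r3, v3⟩ := exec_addrCode (t := 2) (A := A) hW hS16 hA le_rfl hm2.hS
    (by rw [v1']; exact hi') (by rw [v2']; exact hj')
  exact ⟨m1, m2, m3, x1, x2, x3, (s1.trans (s2.mono (by omega))).trans s3, by rw [r3, r2, r1],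
    by rw [v3, v1', v2']⟩

theorem exec_addrR (hW : 32 * S * S ≤ W) (hS16 : 2 ^ 16 ≤ S) (hn : 2 * n ≤ S) (s : St) {A : ℕ}
    {i j : IE} {m : State} {ins : Instr} (hA : A < 16) (hm : Rel S n s m)
    (hi : i.ok S s) (hj : j.ok S s) (hi' : i.val s < S) (hj' : j.val s < S)
    (wi : i.wf = true) (wj : j.wf = true) (hl : ∀ m, ins.Legal W m) :
    ∃ m', Exec W (.seq (i.comp 2) (.seq (j.comp 3) (.seq (addrCode A 2)
        (.seq (.instr (.iadd 5 5 3)) (.instr ins))))) m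
        (i.cost + (j.cost + (5 + (1 + 1)))) (ins.apply m') ∧
      Same 2 m m' ∧ m'.rreg = m.rreg ∧
      m'.ireg 5 = (A * S + i.val s) * S + j.val s + 2 * n := by
  obtain ⟨m1, m2, m3, x1, x2, x3, s3, r3, v3⟩ := exec_addr hW hS16 s hA hm hi hj hi' hj' wi wj
  have hm3 := hm.same le_rfl s3 (by simp [r3])
  refine ⟨{ m3 with ireg := Function.update m3.ireg 5 (m3.ireg 5 + m3.ireg 3) },
    Exec.seq x1 (Exec.seq x2 (Exec.seq x3 (Exec.seq (Exec.instr (.iadd 5 5 3) m3 ?_)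
    (Exec.instr _ _ (hl _))))), ?_, ?_, ?_⟩
  · have := addr_lt hA hi' hj'
    simp only [Instr.Legal, v3, hm3.hN]; omega
  · refine s3.trans ⟨fun r hr => ?_, rfl, rfl⟩
    have : r ≠ 5 := by omega
    simp [this]
  · simp [r3]
  · simp [v3, hm3.hN]

theorem exec_re (hW : 32 * S * S ≤ W) (hS16 : 2 ^ 16 ≤ S) (hn : 2 * n ≤ S) (s : St) (e : RE) :
    ∀ (t : ℕ) (m : State), 2 ≤ t → Rel S n s m → e.ok S n s → e.wf = true →
      ∃ m', Exec W (e.comp t) m e.cost m' ∧ Same 2 m m' ∧ SameR t m m' ∧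
        m'.rreg (2 * t + 1) = e.val s := by
  have bin : ∀ (e f : RE) (ins : Instr) (t : ℕ) (m : State) (v : ℝ), 2 ≤ t → Rel S n s m →
      (∃ m', Exec W (e.comp t) m e.cost m' ∧ Same 2 m m' ∧ SameR t m m' ∧
        m'.rreg (2 * t + 1) = e.val s) →
      (∀ m, Rel S n s m → ∃ m', Exec W (f.comp (t + 1)) m f.cost m' ∧ Same 2 m m' ∧
        SameR (t + 1) m m' ∧ m'.rreg (2 * (t + 1) + 1) = f.val s) →
      (∀ m, m.rreg (2 * t + 1) = e.val s → m.rreg (2 * t + 3) = f.val s →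
        ins.Legal W m ∧ ins.apply m = { m with rreg := Function.update m.rreg (2 * t + 1) v }) →
      ∃ m', Exec W (.seq (e.comp t) (.seq (f.comp (t + 1)) (.instr ins))) m
        (e.cost + (f.cost + 1)) m' ∧ Same 2 m m' ∧ SameR t m m' ∧
        m'.rreg (2 * t + 1) = v := by
    intro e f ins t m v ht hm ⟨m1, x1, s1, r1, v1⟩ hf hins
    obtain ⟨m2, x2, s2, r2, v2⟩ := hf m1 (hm.same le_rfl s1 fun a => r1.rreg _ (by omega))
    obtain ⟨l, ha⟩ := hins m2 (by rw [r2.rreg _ (by omega), v1]) v2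
    refine ⟨_, Exec.seq x1 (Exec.seq x2 (Exec.instr _ _ l)), ?_, ⟨fun r hr => ?_⟩, ?_⟩
    · refine (s1.trans s2).trans ⟨fun r hr => ?_, ?_, ?_⟩
      · simp [ha]
      · simp [ha]
      · simp [ha]
    · have : r ≠ 2 * t + 1 := by omega
      simp only [ha, Function.update_of_ne this]
      rw [r2.rreg _ (by omega), r1.rreg _ hr]
    · simp [ha]
  induction e with
  | lit q =>
    intro t m ht hm ho hw
    refine ⟨_, Exec.instr _ _ trivial, ⟨fun r hr => rfl, rfl, rfl⟩, ⟨fun r hr => ?_⟩, ?_⟩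
    · have : r ≠ 2 * t + 1 := by omega
      simp [Instr.apply, this]
    · simp [Instr.apply, RE.val]
  | var a =>
    intro t m ht hm ho hw
    refine ⟨_, Exec.instr _ _ trivial, ⟨fun r hr => rfl, rfl, rfl⟩, ⟨fun r hr => ?_⟩, ?_⟩
    · have : r ≠ 2 * t + 1 := by omega
      simp [Instr.apply, this]
    · simp [Instr.apply, RE.val, hm.rv]
  | add e f ihe ihf =>
    intro t m ht hm ho hw
    simp only [RE.wf, Bool.and_eq_true] at hw
    refine bin e f _ t m _ ht hm (ihe t m ht hm ho.1 hw.1)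
      (fun m hm => ihf (t + 1) m (by omega) hm ho.2 hw.2) fun m h1 h2 => ⟨trivial, ?_⟩
    simp [Instr.apply, h1, h2, RE.val]
  | sub e f ihe ihf =>
    intro t m ht hm ho hw
    simp only [RE.wf, Bool.and_eq_true] at hw
    refine bin e f _ t m _ ht hm (ihe t m ht hm ho.1 hw.1)
      (fun m hm => ihf (t + 1) m (by omega) hm ho.2 hw.2) fun m h1 h2 => ⟨trivial, ?_⟩
    simp [Instr.apply, h1, h2, RE.val]
  | mul e f ihe ihf =>
    intro t m ht hm ho hw
    simp only [RE.wf, Bool.and_eq_true] at hw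
    refine bin e f _ t m _ ht hm (ihe t m ht hm ho.1 hw.1)
      (fun m hm => ihf (t + 1) m (by omega) hm ho.2 hw.2) fun m h1 h2 => ⟨trivial, ?_⟩
    simp [Instr.apply, h1, h2, RE.val]
  | ld A i j =>
    intro t m ht hm ho hw
    simp only [RE.wf, Bool.and_eq_true, decide_eq_true_eq] at hw
    obtain ⟨m', x, hs, hr, hv⟩ := exec_addrR (ins := .rload (2 * t + 1) 5) hW hS16 hn s hw.1.1 hm
      ho.1 ho.2.1 ho.2.2.1 ho.2.2.2 hw.1.2 hw.2 fun _ => trivial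
    have hm' := hm.same le_rfl hs (by simp [hr])
    refine ⟨_, x, ?_, ⟨fun r h => ?_⟩, ?_⟩
    · exact hs.trans ⟨fun r hr => rfl, rfl, rfl⟩
    · have : r ≠ 2 * t + 1 := by omega
      simp [Instr.apply, this, hr]
    · simp only [Instr.apply, Function.update_self, hv, RE.val]
      exact hm'.ra _ _ _ ho.2.2.1 ho.2.2.2
  | raw i =>
    intro t m ht hm ho hw
    obtain ⟨m1, x1, s1, r1, v1⟩ := exec_ie (n := n) hW hS16 s i 2 m le_rfl hm ho.1 hw
    have hm1 := hm.same le_rfl s1 (by simp [r1])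
    refine ⟨_, Exec.seq x1 (Exec.instr _ _ trivial), ?_, ⟨fun r h => ?_⟩, ?_⟩
    · exact s1.trans ⟨fun r hr => rfl, rfl, rfl⟩
    · have : r ≠ 2 * t + 1 := by omega
      simp [Instr.apply, this, r1]
    · have v1' : m1.ireg 5 = i.val s := v1
      simp only [Instr.apply, Function.update_self, v1', RE.val]
      exact hm1.raw _ ho.2

theorem exec_be (hW : 32 * S * S ≤ W) (hS16 : 2 ^ 16 ≤ S) (hn : 2 * n ≤ S) (s : St) (b : BE) :
    ∀ (m : State), Rel S n s m → b.ok S n s → b.wf = true →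
      ∃ t m', t ≤ b.cost ∧ Exec W b.comp m t m' ∧ Rel S n s m' ∧ (m'.ireg 5 < S ↔ b.val s) := by
  have hS0 : 0 < S := lt_of_lt_of_le (by norm_num) hS16
  have hSW : 0 < W := by
    have : 0 < 32 * S * S := by positivity
    omega
  have setT : ∀ m, Rel S n s m → ∃ m', Exec W (.instr (.iconst 5 0)) m 1 m' ∧ Rel S n s m' ∧
      m'.ireg 5 < S := by
    intro m hm
    refine ⟨_, Exec.instr _ _ hSW, hm.same (t := 2) le_rfl ⟨fun r hr => ?_, rfl, rfl⟩
      fun _ => rfl, ?_⟩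
    · have : r ≠ 5 := by omega
      simp [Instr.apply, this]
    · simpa [Instr.apply] using hS0
  have setF : ∀ m, Rel S n s m → ∃ m', Exec W (.instr (.imove 5 1)) m 1 m' ∧ Rel S n s m' ∧
      ¬ m'.ireg 5 < S := by
    intro m hm
    refine ⟨_, Exec.instr _ _ trivial, hm.same (t := 2) le_rfl ⟨fun r hr => ?_, rfl, rfl⟩
      fun _ => rfl, ?_⟩
    · have : r ≠ 5 := by omega
      simp [Instr.apply, this]
    · simp [Instr.apply, hm.hS]
  induction b with
  | ilt e f =>
    intro m hm ho hw
    simp only [BE.wf, Bool.and_eq_true] at hw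
    obtain ⟨m1, x1, s1, r1, v1⟩ := exec_ie (n := n) hW hS16 s e 2 m le_rfl hm ho.1 hw.1
    have hm1 := hm.same le_rfl s1 (by simp [r1])
    obtain ⟨m2, x2, s2, r2, v2⟩ := exec_ie (n := n) hW hS16 s f 3 m1 (by omega) hm1 ho.2 hw.2
    have v1' : m2.ireg 5 = e.val s := by rw [s2.ireg _ (by omega), v1]
    have v2' : m2.ireg 7 = f.val s := v2
    have hm2 := hm1.same (by omega) s2 (by simp [r2])
    by_cases hc : e.val s < f.val s
    · obtain ⟨m3, x3, hm3, h3⟩ := setT m2 hm2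
      exact ⟨_, _, le_rfl, Exec.seq x1 (Exec.seq x2 (Exec.ite_true
        (by simp only [Test.Holds, v1', v2', hc]) x3)), hm3, by simp [BE.val, hc, h3]⟩
    · obtain ⟨m3, x3, hm3, h3⟩ := setF m2 hm2
      exact ⟨_, _, le_rfl, Exec.seq x1 (Exec.seq x2 (Exec.ite_false
        (by simp only [Test.Holds, v1', v2', hc, not_false_iff]) x3)), hm3,
          by simp only [BE.val, hc, h3]⟩
  | rlt e f =>
    intro m hm ho hw
    simp only [BE.wf, Bool.and_eq_true] at hw
    obtain ⟨m1, x1, s1, r1, v1⟩ := exec_re hW hS16 hn s e 2 m le_rfl hm ho.1 hw.1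
    have hm1 := hm.same le_rfl s1 (fun a => r1.rreg _ (by omega))
    obtain ⟨m2, x2, s2, r2, v2⟩ := exec_re hW hS16 hn s f 3 m1 (by omega) hm1 ho.2 hw.2
    have v1' : m2.rreg 5 = e.val s := by rw [r2.rreg _ (by omega), v1]
    have v2' : m2.rreg 7 = f.val s := v2
    have hm2 := hm1.same le_rfl s2 (fun a => r2.rreg _ (by omega))
    by_cases hc : e.val s < f.val s
    · obtain ⟨m3, x3, hm3, h3⟩ := setT m2 hm2
      exact ⟨_, _, le_rfl, Exec.seq x1 (Exec.seq x2 (Exec.ite_true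
        (by simp only [Test.Holds, v1', v2', hc]) x3)), hm3, by simp [BE.val, hc, h3]⟩
    · obtain ⟨m3, x3, hm3, h3⟩ := setF m2 hm2
      exact ⟨_, _, le_rfl, Exec.seq x1 (Exec.seq x2 (Exec.ite_false
        (by simp only [Test.Holds, v1', v2', hc, not_false_iff]) x3)), hm3,
          by simp only [BE.val, hc, h3]⟩
  | not b ih =>
    intro m hm ho hw
    obtain ⟨t, m1, ht, x1, hm1, h1⟩ := ih m hm ho hw
    by_cases hc : m1.ireg 5 < S
    · obtain ⟨m3, x3, hm3, h3⟩ := setF m1 hm1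
      exact ⟨_, _, by simp only [BE.cost]; omega, Exec.seq x1 (Exec.ite_true
        (by simp only [Test.Holds, hm1.hS, hc]) x3), hm3, by simp only [BE.val, ← h1, hc, h3]; simp⟩
    · obtain ⟨m3, x3, hm3, h3⟩ := setT m1 hm1
      exact ⟨_, _, by simp only [BE.cost]; omega, Exec.seq x1 (Exec.ite_false
        (by simp only [Test.Holds, hm1.hS, hc]; simp) x3), hm3,
          by simp only [BE.val, ← h1, hc, h3]; simp⟩
  | and b c ihb ihc =>
    intro m hm ho hw
    simp only [BE.wf, Bool.and_eq_true] at hw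
    obtain ⟨t, m1, ht, x1, hm1, h1⟩ := ihb m hm ho.1 hw.1
    by_cases hc : m1.ireg 5 < S
    · obtain ⟨t', m3, ht', x3, hm3, h3⟩ := ihc m1 hm1 (ho.2 (h1.1 hc)) hw.2
      exact ⟨_, _, by simp only [BE.cost]; omega, Exec.seq x1 (Exec.ite_true
        (by simp only [Test.Holds, hm1.hS, hc]) x3), hm3, by
          simp only [BE.val, ← h1, hc, h3]; simp⟩
    · exact ⟨_, _, by simp only [BE.cost]; omega, Exec.seq x1 (Exec.ite_false
        (by simp only [Test.Holds, hm1.hS, hc]; simp) (Exec.skip _)), hm1,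
          by simp only [BE.val, ← h1, hc]; simp⟩
  | or b c ihb ihc =>
    intro m hm ho hw
    simp only [BE.wf, Bool.and_eq_true] at hw
    obtain ⟨t, m1, ht, x1, hm1, h1⟩ := ihb m hm ho.1 hw.1
    by_cases hc : m1.ireg 5 < S
    · exact ⟨_, _, by simp only [BE.cost]; omega, Exec.seq x1 (Exec.ite_true
        (by simp only [Test.Holds, hm1.hS, hc]) (Exec.skip _)), hm1,
          by simp only [BE.val, ← h1, hc]; simp⟩
    · obtain ⟨t', m3, ht', x3, hm3, h3⟩ := ihc m1 hm1 (ho.2 (fun h => hc (h1.2 h))) hw.2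
      exact ⟨_, _, by simp only [BE.cost]; omega, Exec.seq x1 (Exec.ite_false
        (by simp only [Test.Holds, hm1.hS, hc]; simp) x3), hm3, by
          simp only [BE.val, ← h1, hc, h3]; simp⟩

/-- Uniqueness of digits in base `S`. Hence a store into one array cell leaves all others alone. -/
theorem addr_inj {S A i j A' i' j' : ℕ} (hi : i < S) (hj : j < S) (hi' : i' < S) (hj' : j' < S)
    (h : (A * S + i) * S + j = (A' * S + i') * S + j') : A = A' ∧ i = i' ∧ j = j' := by
  have key : ∀ {a b a' b' : ℕ}, b < S → b' < S → a * S + b = a' * S + b' → a = a' ∧ b = b' := by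
    intro a b a' b' hb hb' h
    have h1 : a = a' := by
      have e1 : (a * S + b) / S = a := by
        rw [mul_comm, Nat.mul_add_div (by omega), Nat.div_eq_of_lt hb, add_zero]
      have e2 : (a' * S + b') / S = a' := by
        rw [mul_comm, Nat.mul_add_div (by omega), Nat.div_eq_of_lt hb', add_zero]
      rw [← e1, ← e2, h]
    subst h1
    exact ⟨rfl, by omega⟩
  obtain ⟨h1, h2⟩ := key hj hj' h
  obtain ⟨h3, h4⟩ := key hi hi' h1
  exact ⟨h3, h4, h2⟩

/-- The compiled program simulates the structured one. -/
theorem exec_cmd (hW : 32 * S * S ≤ W) (hS16 : 2 ^ 16 ≤ S) (hn : 2 * n ≤ S) {c : Cmd}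
    {s s' : St} (h : Run S n c s s') : ∀ m, Rel S n s m → c.wf = true →
      ∃ t m', Exec W c.comp m t m' ∧ Rel S n s' m' ∧ t + c.kap * s.time ≤ c.kap * s'.time := by
  induction h with
  | iset a e s ho =>
    intro m hm hw
    obtain ⟨m1, x1, s1, r1, v1⟩ := exec_ie (n := n) hW hS16 s e 2 m le_rfl hm ho hw
    have hm1 := hm.same le_rfl s1 (by simp [r1])
    refine ⟨_, _, Exec.seq x1 (Exec.instr _ _ trivial), ⟨fun b => ?_, hm1.ia, hm1.rv, hm1.ra,
      hm1.raw, ?_, ?_⟩, by simp only [Cmd.kap]; ring_nf; rfl⟩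
    · by_cases hb : b = a
      · subst hb; simpa [Instr.apply] using v1
      · simp [Instr.apply, hb, hm1.iv]
    · have : 1 ≠ 2 * a := by omega
      simp [Instr.apply, this, hm1.hS]
    · have : 3 ≠ 2 * a := by omega
      simp [Instr.apply, this, hm1.hN]
  | iput A i j e s hi hj he hi' hj' =>
    intro m hm hw
    simp only [Cmd.wf, Bool.and_eq_true, decide_eq_true_eq] at hw
    obtain ⟨m1, m2, m3, x1, x2, x3, s3, r3, v3⟩ :=
      exec_addr hW hS16 s hw.1.1.1 hm hi hj hi' hj' hw.1.1.2 hw.1.2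
    have hm3 := hm.same le_rfl s3 (by simp [r3])
    obtain ⟨m4, x4, s4, r4, v4⟩ := exec_ie (n := n) hW hS16 s e 3 m3 (by omega) hm3 he hw.2
    have hm4 := hm3.same (by omega) s4 (by simp [r4])
    have v3' : m4.ireg 5 = _ := (s4.ireg 5 (by omega)).trans v3
    have v4' : m4.ireg 7 = _ := v4
    refine ⟨_, _, Exec.seq x1 (Exec.seq x2 (Exec.seq x3 (Exec.seq x4 (Exec.instr _ _ trivial)))),
      ⟨hm4.iv, fun B a b ha hb => ?_, hm4.rv, hm4.ra, hm4.raw, hm4.hS, hm4.hN⟩,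
      by simp only [Cmd.kap]; ring_nf; rfl⟩
    simp only [Instr.apply, v3', v4']
    by_cases hB : B = A ∧ a = i.val s ∧ b = j.val s
    · obtain ⟨rfl, rfl, rfl⟩ := hB
      simp [upd2]
    · rw [Function.update_of_ne (fun h => hB (addr_inj ha hb hi' hj' h)), hm4.ia _ _ _ ha hb]
      by_cases hB' : B = A
      · subst hB'
        have : ¬ (a = i.val s ∧ b = j.val s) := fun h => hB ⟨rfl, h⟩
        simp [upd2, this]
      · simp [hB']
  | rset a e s ho =>
    intro m hm hw
    obtain ⟨m1, x1, s1, r1, v1⟩ := exec_re hW hS16 hn s e 2 m le_rfl hm ho hw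
    have hm1 := hm.same le_rfl s1 (fun a => r1.rreg _ (by omega))
    refine ⟨_, _, Exec.seq x1 (Exec.instr _ _ trivial), ⟨hm1.iv, hm1.ia, fun b => ?_, hm1.ra,
      hm1.raw, hm1.hS, hm1.hN⟩, by simp only [Cmd.kap]; ring_nf; rfl⟩
    by_cases hb : b = a
    · subst hb; simpa [Instr.apply] using v1
    · simp [Instr.apply, hb, hm1.rv]
  | rput A i j e s hi hj he hi' hj' =>
    intro m hm hw
    simp only [Cmd.wf, Bool.and_eq_true, decide_eq_true_eq] at hw
    obtain ⟨m1, x1, s1, r1, v1⟩ := exec_re hW hS16 hn s e 2 m le_rfl hm he hw.2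
    have hm1 := hm.same le_rfl s1 (fun a => r1.rreg _ (by omega))
    obtain ⟨m2, x2, s2, r2, v2⟩ := exec_addrR (ins := .rstore 5 5) hW hS16 hn s hw.1.1.1 hm1
      hi hj hi' hj' hw.1.1.2 hw.1.2 fun _ => trivial
    have hm2 := hm1.same le_rfl s2 (by simp [r2])
    have v1' : m2.rreg 5 = _ := (congrFun r2 5).trans v1
    refine ⟨_, _, Exec.seq x1 x2, ⟨hm2.iv, hm2.ia, hm2.rv, fun B a b ha hb => ?_, fun a ha => ?_,
      hm2.hS, hm2.hN⟩, by simp only [Cmd.kap]; ring_nf; rfl⟩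
    · simp only [Instr.apply, v2, v1']
      by_cases hB : B = A ∧ a = i.val s ∧ b = j.val s
      · obtain ⟨rfl, rfl, rfl⟩ := hB
        simp [upd2]
      · rw [Function.update_of_ne (fun h => hB (addr_inj ha hb hi' hj' (by omega))),
          hm2.ra _ _ _ ha hb]
        by_cases hB' : B = A
        · subst hB'
          have : ¬ (a = i.val s ∧ b = j.val s) := fun h => hB ⟨rfl, h⟩
          simp [upd2, this]
        · simp [hB']
    · simp only [Instr.apply, v2, v1']
      rw [Function.update_of_ne (by omega), hm2.raw _ ha]
  | rawput i e s hi he hi' =>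
    intro m hm hw
    simp only [Cmd.wf, Bool.and_eq_true] at hw
    obtain ⟨m1, x1, s1, r1, v1⟩ := exec_re hW hS16 hn s e 2 m le_rfl hm he hw.2
    have hm1 := hm.same le_rfl s1 (fun a => r1.rreg _ (by omega))
    obtain ⟨m2, x2, s2, r2, v2⟩ := exec_ie (n := n) hW hS16 s i 2 m1 le_rfl hm1 hi hw.1
    have hm2 := hm1.same le_rfl s2 (by simp [r2])
    have v1' : m2.rreg 5 = _ := (congrFun r2 5).trans v1
    have v2' : m2.ireg 5 = _ := v2
    refine ⟨_, _, Exec.seq x1 (Exec.seq x2 (Exec.instr _ _ trivial)),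
      ⟨hm2.iv, hm2.ia, hm2.rv, fun B a b ha hb => ?_, fun a ha => ?_,
      hm2.hS, hm2.hN⟩, by simp only [Cmd.kap]; ring_nf; rfl⟩
    · simp only [Instr.apply, v2', v1']
      rw [Function.update_of_ne (by omega), hm2.ra _ _ _ ha hb]
    · simp only [Instr.apply, v2', v1', Function.update_apply, hm2.raw _ ha]
  | skip s => exact fun m hm hw => ⟨0, m, Exec.skip m, hm, by simp⟩
  | @seq p q s s' s'' hp hq ihp ihq =>
    intro m hm hw
    simp only [Cmd.wf, Bool.and_eq_true] at hw
    obtain ⟨t1, m1, x1, hm1, h1⟩ := ihp m hm hw.1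
    obtain ⟨t2, m2, x2, hm2, h2⟩ := ihq m1 hm1 hw.2
    refine ⟨_, _, Exec.seq x1 x2, hm2, ?_⟩
    simp only [Cmd.kap]
    -- `kap` of a sequence is the sum for both parts, so each part is overcharged by a multiple of
    -- its own elapsed time, which is nonnegative.
    have e1 := Nat.mul_le_mul_left q.kap hp.time_le
    have e2 := Nat.mul_le_mul_left p.kap hq.time_le
    linarith
  | @ite_true b p q s s' ho hb hp ihp =>
    intro m hm hw
    simp only [Cmd.wf, Bool.and_eq_true] at hw
    obtain ⟨t1, m1, ht, x1, hm1, h1⟩ := exec_be hW hS16 hn s b m hm ho hw.1.1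
    obtain ⟨t2, m2, x2, hm2, h2⟩ := ihp m1 hm1.tick hw.1.2
    refine ⟨_, _, Exec.seq x1 (Exec.ite_true (by simpa [Test.Holds, hm1.hS, h1] using hb) x2),
      hm2, ?_⟩
    have e0 := hp.time_le
    have e1 := Nat.mul_le_mul_left (b.cost + 1 + q.kap) e0
    simp only [Cmd.kap, St.tick] at *
    nlinarith
  | @ite_false b p q s s' ho hb hp ihp =>
    intro m hm hw
    simp only [Cmd.wf, Bool.and_eq_true] at hw
    obtain ⟨t1, m1, ht, x1, hm1, h1⟩ := exec_be hW hS16 hn s b m hm ho hw.1.1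
    obtain ⟨t2, m2, x2, hm2, h2⟩ := ihp m1 hm1.tick hw.2
    refine ⟨_, _, Exec.seq x1 (Exec.ite_false (by simpa [Test.Holds, hm1.hS, h1] using hb) x2),
      hm2, ?_⟩
    have e0 := hp.time_le
    have e1 := Nat.mul_le_mul_left (b.cost + 1 + p.kap) e0
    simp only [Cmd.kap, St.tick] at *
    nlinarith
  | @whl_true b p s s' s'' ho hb hp hl ihp ihl =>
    intro m hm hw
    have hw' := hw
    simp only [Cmd.wf, Bool.and_eq_true] at hw
    obtain ⟨t1, m1, ht, x1, hm1, h1⟩ := exec_be hW hS16 hn s b m hm ho hw.1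
    obtain ⟨t2, m2, x2, hm2, h2⟩ := ihp m1 hm1.tick hw.2
    obtain ⟨t3, m3, x3, hm3, h3⟩ := ihl m2 hm2 hw'
    -- The compiled loop evaluates its test at the end of the body. The induction hypothesis gives a
    -- run of the test followed by the loop; the test is split off and moved into the present
    -- iteration.
    cases x3 with
    | @seq _ _ _ mb _ ta tb hA hB =>
      refine ⟨_, _, Exec.seq x1 (Exec.loop_true (by simpa [Test.Holds, hm1.hS, h1] using hb)
        (Exec.seq x2 hA) hB), hm3, ?_⟩
      have e0 := hp.time_le
      have e1 := Nat.mul_le_mul_left (b.cost + 1) e0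
      simp only [Cmd.kap, St.tick] at *
      nlinarith
  | @whl_false b p s ho hb =>
    intro m hm hw
    simp only [Cmd.wf, Bool.and_eq_true] at hw
    obtain ⟨t1, m1, ht, x1, hm1, h1⟩ := exec_be hW hS16 hn s b m hm ho hw.1
    refine ⟨_, _, Exec.seq x1 (Exec.loop_false (by simpa [Test.Holds, hm1.hS, h1] using hb)),
      hm1.tick, ?_⟩
    simp only [Cmd.kap, St.tick]
    nlinarith

end Compile

end MedConv

namespace MedConv

open RealRAM

notation "ν" => IE.var
infix:62 " ≔ " => Cmd.iset

/-! #### Weakest preconditions and frames -/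

/-- Total correctness. The clock belongs to the state, so bounds for the running time are part of
`Q`. -/
def wp (S n : ℕ) (c : Cmd) (Q : St → Prop) (s : St) : Prop := ∃ s', Run S n c s s' ∧ Q s'

/-- The integer variables written by a command. -/
def Cmd.wI : Cmd → List ℕ
  | .iset a _ => [a]
  | .seq p q => p.wI ++ q.wI
  | .ite _ p q => p.wI ++ q.wI
  | .whl _ p => p.wI
  | _ => []

/-- The integer arrays written by a command. -/
def Cmd.wIA : Cmd → List ℕ
  | .iput A _ _ _ => [A]
  | .seq p q => p.wIA ++ q.wIA
  | .ite _ p q => p.wIA ++ q.wIA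
  | .whl _ p => p.wIA
  | _ => []

/-- The real variables written by a command. -/
def Cmd.wR : Cmd → List ℕ
  | .rset a _ => [a]
  | .seq p q => p.wR ++ q.wR
  | .ite _ p q => p.wR ++ q.wR
  | .whl _ p => p.wR
  | _ => []

/-- The real arrays written by a command. -/
def Cmd.wRA : Cmd → List ℕ
  | .rput A _ _ _ => [A]
  | .seq p q => p.wRA ++ q.wRA
  | .ite _ p q => p.wRA ++ q.wRA
  | .whl _ p => p.wRA
  | _ => []

/-- The command does not write output cells. -/
def Cmd.noraw : Cmd → Bool
  | .rawput _ _ => false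
  | .seq p q => p.noraw && q.noraw
  | .ite _ p q => p.noraw && q.noraw
  | .whl _ p => p.noraw
  | _ => true

/-- What the command `c` does not write is unchanged. -/
structure Frm (c : Cmd) (s s' : St) : Prop where
  iv : ∀ a, a ∉ c.wI → s'.iv a = s.iv a
  ia : ∀ A, A ∉ c.wIA → s'.ia A = s.ia A
  rv : ∀ a, a ∉ c.wR → s'.rv a = s.rv a
  ra : ∀ A, A ∉ c.wRA → s'.ra A = s.ra A
  raw : c.noraw = true → s'.raw = s.raw

theorem Frm.refl (c : Cmd) (s : St) : Frm c s s :=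
  ⟨fun _ _ => rfl, fun _ _ => rfl, fun _ _ => rfl, fun _ _ => rfl, fun _ => rfl⟩

theorem Frm.trans {c : Cmd} {s s' s'' : St} (h : Frm c s s') (h' : Frm c s' s'') : Frm c s s'' :=
  ⟨fun a ha => (h'.iv a ha).trans (h.iv a ha), fun a ha => (h'.ia a ha).trans (h.ia a ha),
   fun a ha => (h'.rv a ha).trans (h.rv a ha), fun a ha => (h'.ra a ha).trans (h.ra a ha),
   fun ha => (h'.raw ha).trans (h.raw ha)⟩

variable {S n : ℕ} {c p q : Cmd} {s s' : St} {Q R : St → Prop}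

/-- The sets of written variables are syntactic, so for concrete commands a frame condition is
settled by `decide`. -/
theorem Run.frm (h : Run S n c s s') : Frm c s s' := by
  induction h with
  | iset a e s h =>
    refine ⟨fun b hb => ?_, fun _ _ => rfl, fun _ _ => rfl, fun _ _ => rfl, fun _ => rfl⟩
    simp only [Cmd.wI, List.mem_singleton] at hb
    simp [hb]
  | iput A i j e s =>
    refine ⟨fun _ _ => rfl, fun b hb => ?_, fun _ _ => rfl, fun _ _ => rfl, fun _ => rfl⟩
    simp only [Cmd.wIA, List.mem_singleton] at hb
    simp [hb]
  | rset a e s h =>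
    refine ⟨fun _ _ => rfl, fun _ _ => rfl, fun b hb => ?_, fun _ _ => rfl, fun _ => rfl⟩
    simp only [Cmd.wR, List.mem_singleton] at hb
    simp [hb]
  | rput A i j e s =>
    refine ⟨fun _ _ => rfl, fun _ _ => rfl, fun _ _ => rfl, fun b hb => ?_, fun _ => rfl⟩
    simp only [Cmd.wRA, List.mem_singleton] at hb
    simp [hb]
  | rawput i e s =>
    exact ⟨fun _ _ => rfl, fun _ _ => rfl, fun _ _ => rfl, fun _ _ => rfl,
      fun h => by simp [Cmd.noraw] at h⟩
  | skip s => exact Frm.refl _ _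
  | seq hp hq ihp ihq =>
    refine Frm.trans (s' := _) ⟨fun a ha => ihp.iv a ?_, fun a ha => ihp.ia a ?_,
      fun a ha => ihp.rv a ?_, fun a ha => ihp.ra a ?_, fun ha => ihp.raw ?_⟩
      ⟨fun a ha => ihq.iv a ?_, fun a ha => ihq.ia a ?_,
      fun a ha => ihq.rv a ?_, fun a ha => ihq.ra a ?_, fun ha => ihq.raw ?_⟩ <;>
    simp only [Cmd.wI, Cmd.wIA, Cmd.wR, Cmd.wRA, Cmd.noraw, List.mem_append, not_or,
      Bool.and_eq_true] at ha <;> tauto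
  | ite_true ho hb hp ihp =>
    refine ⟨fun a ha => ihp.iv a ?_, fun a ha => ihp.ia a ?_,
      fun a ha => ihp.rv a ?_, fun a ha => ihp.ra a ?_, fun ha => ihp.raw ?_⟩ <;>
    simp only [Cmd.wI, Cmd.wIA, Cmd.wR, Cmd.wRA, Cmd.noraw, List.mem_append, not_or,
      Bool.and_eq_true] at ha <;> tauto
  | ite_false ho hb hp ihp =>
    refine ⟨fun a ha => ihp.iv a ?_, fun a ha => ihp.ia a ?_,
      fun a ha => ihp.rv a ?_, fun a ha => ihp.ra a ?_, fun ha => ihp.raw ?_⟩ <;>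
    simp only [Cmd.wI, Cmd.wIA, Cmd.wR, Cmd.wRA, Cmd.noraw, List.mem_append, not_or,
      Bool.and_eq_true] at ha <;> tauto
  | whl_true ho hb hp hl ihp ihl =>
    exact Frm.trans (s' := _) ⟨ihp.iv, ihp.ia, ihp.rv, ihp.ra, ihp.raw⟩ ihl
  | whl_false ho hb =>
    exact ⟨fun _ _ => rfl, fun _ _ => rfl, fun _ _ => rfl, fun _ _ => rfl, fun _ => rfl⟩

/-- The continuation receives the frame of the command, so specifications need to mention only what
changes. -/
theorem wp.mono (h : wp S n c Q s) (h' : ∀ s', Frm c s s' → Q s' → R s') : wp S n c R s :=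
  let ⟨s', hr, hq⟩ := h
  ⟨s', hr, h' s' hr.frm hq⟩

@[simp] theorem St.tick_iv : s.tick.iv = s.iv := rfl
@[simp] theorem St.tick_ia : s.tick.ia = s.ia := rfl
@[simp] theorem St.tick_rv : s.tick.rv = s.rv := rfl
@[simp] theorem St.tick_ra : s.tick.ra = s.ra := rfl
@[simp] theorem St.tick_raw : s.tick.raw = s.raw := rfl
@[simp] theorem St.tick_time : s.tick.time = s.time + 1 := rfl

@[simp] theorem wp_iset {a : ℕ} {e : IE} : wp S n (.iset a e) Q s ↔ e.ok S s ∧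
    Q { s with iv := Function.update s.iv a (e.val s), time := s.time + 1 } :=
  ⟨fun ⟨_, hr, hq⟩ => by cases hr with | iset _ _ _ h => exact ⟨h, hq⟩,
   fun ⟨h, hq⟩ => ⟨_, Run.iset _ _ _ h, hq⟩⟩

@[simp] theorem wp_iput {A : ℕ} {i j e : IE} : wp S n (.iput A i j e) Q s ↔
    (i.ok S s ∧ j.ok S s ∧ e.ok S s ∧ i.val s < S ∧ j.val s < S) ∧
    Q { s with ia := Function.update s.ia A (upd2 (s.ia A) (i.val s) (j.val s) (e.val s)),
               time := s.time + 1 } :=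
  ⟨fun ⟨_, hr, hq⟩ => by
    cases hr with | iput _ _ _ _ _ h1 h2 h3 h4 h5 => exact ⟨⟨h1, h2, h3, h4, h5⟩, hq⟩,
   fun ⟨⟨h1, h2, h3, h4, h5⟩, hq⟩ => ⟨_, Run.iput _ _ _ _ _ h1 h2 h3 h4 h5, hq⟩⟩

@[simp] theorem wp_rset {a : ℕ} {e : RE} : wp S n (.rset a e) Q s ↔ e.ok S n s ∧
    Q { s with rv := Function.update s.rv a (e.val s), time := s.time + 1 } :=
  ⟨fun ⟨_, hr, hq⟩ => by cases hr with | rset _ _ _ h => exact ⟨h, hq⟩,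
   fun ⟨h, hq⟩ => ⟨_, Run.rset _ _ _ h, hq⟩⟩

@[simp] theorem wp_rput {A : ℕ} {i j : IE} {e : RE} : wp S n (.rput A i j e) Q s ↔
    (i.ok S s ∧ j.ok S s ∧ e.ok S n s ∧ i.val s < S ∧ j.val s < S) ∧
    Q { s with ra := Function.update s.ra A (upd2 (s.ra A) (i.val s) (j.val s) (e.val s)),
               time := s.time + 1 } :=
  ⟨fun ⟨_, hr, hq⟩ => by
    cases hr with | rput _ _ _ _ _ h1 h2 h3 h4 h5 => exact ⟨⟨h1, h2, h3, h4, h5⟩, hq⟩,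
   fun ⟨⟨h1, h2, h3, h4, h5⟩, hq⟩ => ⟨_, Run.rput _ _ _ _ _ h1 h2 h3 h4 h5, hq⟩⟩

@[simp] theorem wp_rawput {i : IE} {e : RE} : wp S n (.rawput i e) Q s ↔
    (i.ok S s ∧ e.ok S n s ∧ i.val s < 2 * n) ∧
    Q { s with raw := Function.update s.raw (i.val s) (e.val s), time := s.time + 1 } :=
  ⟨fun ⟨_, hr, hq⟩ => by cases hr with | rawput _ _ _ h1 h2 h3 => exact ⟨⟨h1, h2, h3⟩, hq⟩,
   fun ⟨⟨h1, h2, h3⟩, hq⟩ => ⟨_, Run.rawput _ _ _ h1 h2 h3, hq⟩⟩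

@[simp] theorem wp_skip : wp S n .skip Q s ↔ Q s :=
  ⟨fun ⟨_, hr, hq⟩ => by cases hr; exact hq, fun h => ⟨_, Run.skip _, h⟩⟩

@[simp] theorem wp_seq : wp S n (.seq p q) Q s ↔ wp S n p (wp S n q Q) s :=
  ⟨fun ⟨_, hr, hq⟩ => by cases hr with | seq h1 h2 => exact ⟨_, h1, _, h2, hq⟩,
   fun ⟨_, h1, _, h2, hq⟩ => ⟨_, Run.seq h1 h2, hq⟩⟩

theorem wp_ite {b : BE} : wp S n (.ite b p q) Q s ↔ b.ok S n s ∧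
    (b.val s → wp S n p Q s.tick) ∧ (¬ b.val s → wp S n q Q s.tick) := by
  constructor
  · rintro ⟨_, hr, hq⟩
    cases hr with
    | ite_true ho hb hp => exact ⟨ho, fun _ => ⟨_, hp, hq⟩, fun h => absurd hb h⟩
    | ite_false ho hb hp => exact ⟨ho, fun h => absurd h hb, fun _ => ⟨_, hp, hq⟩⟩
  · rintro ⟨ho, h1, h2⟩
    by_cases hb : b.val s
    · obtain ⟨_, hr, hq⟩ := h1 hb
      exact ⟨_, Run.ite_true ho hb hr, hq⟩
    · obtain ⟨_, hr, hq⟩ := h2 hb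
      exact ⟨_, Run.ite_false ho hb hr, hq⟩

/-- The loop rule, with an invariant and a variant. -/
theorem wp_whl {b : BE} (I : St → Prop) (μ : St → ℕ) (h0 : I s)
    (hs : ∀ s', Frm c s s' → I s' → b.ok S n s' ∧
      (b.val s' → wp S n c (fun s'' => I s'' ∧ μ s'' < μ s') s'.tick) ∧
      (¬ b.val s' → Q s'.tick)) : wp S n (.whl b c) Q s := by
  -- The frame is carried through all iterations; invariants need not repeat what the body never
  -- writes.
  have main : ∀ k s', Frm c s s' → I s' → μ s' = k → wp S n (.whl b c) Q s' := by
    intro k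
    induction k using Nat.strong_induction_on with
    | _ k ih =>
      intro s' hf hi hk
      obtain ⟨ho, h1, h2⟩ := hs s' hf hi
      by_cases hb : b.val s'
      · obtain ⟨s'', hr, hi', hm⟩ := h1 hb
        obtain ⟨s3, hr', hq⟩ := ih _ (hk ▸ hm) s''
          (hf.trans ⟨hr.frm.iv, hr.frm.ia, hr.frm.rv, hr.frm.ra, hr.frm.raw⟩) hi' rfl
        exact ⟨s3, Run.whl_true ho hb hr hr', hq⟩
      · exact ⟨_, Run.whl_false ho hb, h2 hb⟩
  exact main _ s (Frm.refl c s) h0 rfl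

section Eval
variable {e f : IE} {x y : RE} {i j : IE} {a A : ℕ} {v : ℕ}
@[simp] theorem IE.val_lit : (no_index (OfNat.ofNat v) : IE).val s = v := rfl
@[simp] theorem IE.val_var : (ν a).val s = s.iv a := rfl
@[simp] theorem IE.val_add : (e + f).val s = e.val s + f.val s := rfl
@[simp] theorem IE.val_sub : (e - f).val s = e.val s - f.val s := rfl
@[simp] theorem IE.val_mul : (e * f).val s = e.val s * f.val s := rfl
@[simp] theorem IE.val_ld : (IE.ld A i j).val s = s.ia A (i.val s) (j.val s) := rfl
@[simp] theorem IE.ok_lit : (no_index (OfNat.ofNat v) : IE).ok S s ↔ True := Iff.rfl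
@[simp] theorem IE.ok_var : (ν a).ok S s ↔ True := Iff.rfl
@[simp] theorem IE.ok_add : (e + f).ok S s ↔ e.ok S s ∧ f.ok S s ∧ e.val s + f.val s < S :=
  Iff.rfl
@[simp] theorem IE.ok_sub : (e - f).ok S s ↔ e.ok S s ∧ f.ok S s := Iff.rfl
@[simp] theorem IE.ok_mul : (e * f).ok S s ↔ e.ok S s ∧ f.ok S s ∧ e.val s * f.val s < S :=
  Iff.rfl
@[simp] theorem IE.ok_ld : (IE.ld A i j).ok S s ↔
    i.ok S s ∧ j.ok S s ∧ i.val s < S ∧ j.val s < S := Iff.rfl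
@[simp] theorem RE.val_lit : (no_index (OfNat.ofNat v) : RE).val s = v := by
  simp [OfNat.ofNat, RE.val]
@[simp] theorem RE.val_var : (RE.var a).val s = s.rv a := rfl
@[simp] theorem RE.val_add : (x + y).val s = x.val s + y.val s := rfl
@[simp] theorem RE.val_sub : (x - y).val s = x.val s - y.val s := rfl
@[simp] theorem RE.val_mul : (x * y).val s = x.val s * y.val s := rfl
@[simp] theorem RE.val_ld : (RE.ld A i j).val s = s.ra A (i.val s) (j.val s) := rfl
@[simp] theorem RE.val_raw : (RE.raw i).val s = s.raw (i.val s) := rfl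
@[simp] theorem RE.ok_lit : (no_index (OfNat.ofNat v) : RE).ok S n s ↔ True := Iff.rfl
@[simp] theorem RE.ok_var : (RE.var a).ok S n s ↔ True := Iff.rfl
@[simp] theorem RE.ok_add : (x + y).ok S n s ↔ x.ok S n s ∧ y.ok S n s := Iff.rfl
@[simp] theorem RE.ok_sub : (x - y).ok S n s ↔ x.ok S n s ∧ y.ok S n s := Iff.rfl
@[simp] theorem RE.ok_mul : (x * y).ok S n s ↔ x.ok S n s ∧ y.ok S n s := Iff.rfl
@[simp] theorem RE.ok_ld : (RE.ld A i j).ok S n s ↔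
    i.ok S s ∧ j.ok S s ∧ i.val s < S ∧ j.val s < S := Iff.rfl
@[simp] theorem RE.ok_raw : (RE.raw i).ok S n s ↔ i.ok S s ∧ i.val s < 2 * n := Iff.rfl
variable {b b' : BE}
@[simp] theorem BE.val_ilt : (BE.ilt e f).val s ↔ e.val s < f.val s := Iff.rfl
@[simp] theorem BE.val_rlt : (BE.rlt x y).val s ↔ x.val s < y.val s := Iff.rfl
@[simp] theorem BE.val_not : (BE.not b).val s ↔ ¬ b.val s := Iff.rfl
@[simp] theorem BE.val_and : (BE.and b b').val s ↔ b.val s ∧ b'.val s := Iff.rfl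
@[simp] theorem BE.val_or : (BE.or b b').val s ↔ b.val s ∨ b'.val s := Iff.rfl
@[simp] theorem BE.ok_ilt : (BE.ilt e f).ok S n s ↔ e.ok S s ∧ f.ok S s := Iff.rfl
@[simp] theorem BE.ok_rlt : (BE.rlt x y).ok S n s ↔ x.ok S n s ∧ y.ok S n s := Iff.rfl
@[simp] theorem BE.ok_not : (BE.not b).ok S n s ↔ b.ok S n s := Iff.rfl
@[simp] theorem BE.ok_and : (BE.and b b').ok S n s ↔
    b.ok S n s ∧ (b.val s → b'.ok S n s) := Iff.rfl
@[simp] theorem BE.ok_or : (BE.or b b').ok S n s ↔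
    b.ok S n s ∧ (¬ b.val s → b'.ok S n s) := Iff.rfl
end Eval

/-! #### From structured programs to machine programs -/

/-- The initial state for the input vectors `x` and `y`. -/
noncomputable def init {n : ℕ} (x y : Fin n → ℝ) : St where
  iv := fun a => if a = 0 then n else 0
  ia := fun _ _ _ => 0
  rv := fun _ => 0
  ra := fun _ _ _ => 0
  raw := (input x y).rmem
  time := 0

/-- Computes `S = (n + 2) ^ 16` in register `1` and `2 * n` in register `3`. -/
def prelude : Prog :=
  .seq (.instr (.iconst 5 2)) (.seq (.instr (.iadd 5 5 0)) (.seq (.instr (.imul 5 5 5))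
    (.seq (.instr (.imul 5 5 5)) (.seq (.instr (.imul 5 5 5)) (.seq (.instr (.imul 1 5 5))
      (.instr (.iadd 3 0 0)))))))

theorem exec_prelude {n : ℕ} (x y : Fin n → ℝ) :
    ∃ m, Exec ((n + 2) ^ 40) prelude (input x y) 7 m ∧ Rel ((n + 2) ^ 16) n (init x y) m := by
  have hp : ∀ {a : ℕ}, a < 40 → (n + 2) ^ a < (n + 2) ^ 40 := fun h =>
    Nat.pow_lt_pow_right (by omega) h
  have h1 : 2 + n < (n + 2) ^ 40 := by have := hp (a := 1) (by norm_num); rw [pow_one] at this; omega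
  have h2 : 2 < (n + 2) ^ 40 := by omega
  have h3 : n + n < (n + 2) ^ 40 := by
    have := hp (a := 2) (by norm_num)
    nlinarith
  have e2 : (2 + n) * (2 + n) = (n + 2) ^ 2 := by ring
  have e4 : (n + 2) ^ 2 * (n + 2) ^ 2 = (n + 2) ^ 4 := by ring
  have e8 : (n + 2) ^ 4 * (n + 2) ^ 4 = (n + 2) ^ 8 := by ring
  have e16 : (n + 2) ^ 8 * (n + 2) ^ 8 = (n + 2) ^ 16 := by ring
  -- All cells behind the input are zero, so every array starts as zero. The trie and the flags rely
  -- on this, since clearing them would take too long.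
  have hz : ∀ j, n ≤ j → ¬ j - n < n → (input x y).rmem j = 0 := by
    intro j h1 h2
    have : ¬ j < n := by omega
    simp [input, this, h2]
  refine ⟨_, Exec.seq (Exec.instr _ _ ?_) (Exec.seq (Exec.instr _ _ ?_)
    (Exec.seq (Exec.instr _ _ ?_) (Exec.seq (Exec.instr _ _ ?_) (Exec.seq (Exec.instr _ _ ?_)
    (Exec.seq (Exec.instr _ _ ?_) (Exec.instr _ _ ?_)))))), ?_⟩
  · simpa [Instr.Legal] using h2
  · simpa [Instr.Legal, Instr.apply, input] using h1
  · simpa [Instr.Legal, Instr.apply, input, e2] using hp (a := 2) (by norm_num)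
  · simpa [Instr.Legal, Instr.apply, input, e2, e4] using hp (a := 4) (by norm_num)
  · simpa [Instr.Legal, Instr.apply, input, e2, e4, e8] using hp (a := 8) (by norm_num)
  · simpa [Instr.Legal, Instr.apply, input, e2, e4, e8, e16] using hp (a := 16) (by norm_num)
  · simpa [Instr.Legal, Instr.apply, input] using h3
  · refine ⟨fun a => ?_, fun A i j _ _ => rfl, fun a => rfl, fun A i j _ _ => ?_,
      fun j hj => rfl, ?_, ?_⟩
    · have f1 : 2 * a ≠ 5 := by omega
      have f2 : 2 * a ≠ 3 := by omega
      have f3 : 2 * a ≠ 1 := by omega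
      simp [Instr.apply, input, init, f1, f2, f3]
    · exact hz _ (by omega) (by omega)
    · simp [Instr.apply, input, e2, e4, e8, e16]
    · simp [Instr.apply, input]; omega

theorem word_bounds (n : ℕ) : 32 * (n + 2) ^ 16 * (n + 2) ^ 16 ≤ (n + 2) ^ 40 ∧
    2 ^ 16 ≤ (n + 2) ^ 16 ∧ 2 * n ≤ (n + 2) ^ 16 := by
  have hp : ∀ {a b : ℕ}, a ≤ b → (n + 2) ^ a ≤ (n + 2) ^ b := fun h =>
    Nat.pow_le_pow_right (by omega) h
  -- The factor `32` costs five powers of `n + 2`, and `5 + 16 + 16 ≤ 40`.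
  have h32 : 32 ≤ (n + 2) ^ 5 := Nat.pow_le_pow_left (by omega : 2 ≤ n + 2) 5
  refine ⟨?_, Nat.pow_le_pow_left (by omega) 16,
    le_trans (by nlinarith : 2 * n ≤ (n + 2) ^ 2) (hp (by norm_num))⟩
  calc 32 * (n + 2) ^ 16 * (n + 2) ^ 16 ≤ (n + 2) ^ 5 * (n + 2) ^ 16 * (n + 2) ^ 16 := by
            gcongr
        _ = (n + 2) ^ 37 := by ring
        _ ≤ (n + 2) ^ 40 := hp (by norm_num)

theorem exec_of_wp {n S W T : ℕ} {c : Cmd} (hc : c.wf = true) {G : Fin n → ℝ} {m0 m : State}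
    {s : St} (hW : 32 * S * S ≤ W) (hS : 2 ^ 16 ≤ S) (hn : 2 * n ≤ S)
    (xm : Exec W prelude m0 7 m) (hm : Rel S n s m) (hs : s.time = 0)
    (h : wp S n c (fun s => s.time ≤ T ∧ ∀ k : Fin n, s.raw k = G k) s) :
    ∃ (t : ℕ) (m' : State), t ≤ 7 + c.kap * T ∧ Exec W (.seq prelude c.comp) m0 t m' ∧
      ∀ k : Fin n, m'.rmem k = G k := by
  obtain ⟨s', hr, ht, hk⟩ := h
  obtain ⟨t, m', xm', hm', ht'⟩ := exec_cmd hW hS hn hr m hm hc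
  refine ⟨_, m', ?_, Exec.seq xm xm', fun k => ?_⟩
  · have := Nat.mul_le_mul_left c.kap ht
    rw [hs] at ht'
    omega
  · rw [hm'.raw _ (by omega), hk]

theorem computes_of_wp {c : Cmd} (hc : c.wf = true)
    {F : ∀ n : ℕ, (Fin n → ℝ) → (Fin n → ℝ) → Fin n → ℝ} {T : ℕ → ℕ}
    (h : ∀ (n : ℕ) (x y : Fin n → ℝ), wp ((n + 2) ^ 16) n c
      (fun s => s.time ≤ T n ∧ ∀ k : Fin n, s.raw k = F n x y k) (init x y)) :
    Computes (.seq prelude c.comp) F fun n => 7 + c.kap * T n := by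
  refine ⟨40, fun n x y => ?_⟩
  obtain ⟨m, xm, hm⟩ := exec_prelude x y
  obtain ⟨h1, h2, h3⟩ := word_bounds n
  exact exec_of_wp hc h1 h2 h3 xm hm rfl (h n x y)

end MedConv

namespace MedConv

open RealRAM

variable {S n : ℕ} {c p q : Cmd} {s s' : St} {Q R : St → Prop}

/-! #### Sorting by keys -/

/-- The key of index `i`: the difference `X i - Y (κ - i)`, ties being broken by `i`. -/
noncomputable def key (X Y : ℕ → ℝ) (κ i : ℕ) : ℝ ×ₗ ℕ := toLex (X i - Y (κ - i), i)

theorem key_injective (X Y : ℕ → ℝ) (κ : ℕ) : Function.Injective (key X Y κ) := by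
  intro i j h
  have := congrArg (fun a => (ofLex a).2) h
  simpa [key] using this

/-- The key function of a state: `X` and `Y` are rows of the real arrays `1` and `2`, and `κ` is the
integer variable `5`. -/
noncomputable def St.key (s : St) : ℕ → ℝ ×ₗ ℕ := MedConv.key (s.ra 1 0) (s.ra 2 0) (s.iv 5)

theorem St.key_congr (h1 : s'.ra 1 = s.ra 1) (h2 : s'.ra 2 = s.ra 2) (h3 : s'.iv 5 = s.iv 5) :
    s'.key = s.key := by
  simp only [St.key, h1, h2, h3]

/-- Variable `5` holds `κ`. The same sorting code thus serves every entry of the convolution and,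
with `κ = τ + B`, every block and shift. -/
def keyE (e : IE) : RE := .ld 1 0 e - .ld 2 0 (ν 5 - e)

/-- Equality of two differences is recognised by the failure of both strict comparisons. -/
def lexlt (e f : IE) : BE :=
  .or (.rlt (keyE e) (keyE f)) (.and (.not (.rlt (keyE f) (keyE e))) (.ilt e f))

@[simp] theorem lexlt_val {e f : IE} :
    (lexlt e f).val s ↔ s.key (e.val s) < s.key (f.val s) := by
  simp only [lexlt, keyE, St.key, key, Prod.Lex.toLex_lt_toLex, BE.val_or, BE.val_rlt,
    BE.val_and, BE.val_not, BE.val_ilt, RE.val_sub, RE.val_ld, IE.val_sub, IE.val_var, IE.val_lit]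
  constructor
  · rintro (h | ⟨h1, h2⟩)
    · exact Or.inl h
    · rcases (not_lt.1 h1).lt_or_eq with h | h
      · exact Or.inl h
      · exact Or.inr ⟨h, h2⟩
  · rintro (h | ⟨h1, h2⟩)
    · exact Or.inl h
    · exact Or.inr ⟨not_lt.2 h1.le, h2⟩

theorem lexlt_ok {e f : IE} (he : e.ok S s) (hf : f.ok S s) (he' : e.val s < S)
    (hf' : f.val s < S) (h5 : s.iv 5 < S) : (lexlt e f).ok S n s := by
  have h0 : 0 < S := by omega
  have h1 : s.iv 5 - e.val s < S := by omega
  have h2 : s.iv 5 - f.val s < S := by omega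
  simp [lexlt, keyE, *]

/-- Insertion sort of the `ν 7` entries from `ν 6` on of row `ν 8` of array `5`. -/
def sortCmd : Cmd :=
  9 ≔ 0 ;;
  .whl (.ilt (ν 9) (ν 7)) (
    10 ≔ ν 9 ;;
    .whl (.and (.ilt 0 (ν 10))
        (lexlt (.ld 5 (ν 8) (ν 6 + ν 10)) (.ld 5 (ν 8) (ν 6 + ν 10 - 1)))) (
      11 ≔ .ld 5 (ν 8) (ν 6 + ν 10) ;;
      .iput 5 (ν 8) (ν 6 + ν 10) (.ld 5 (ν 8) (ν 6 + ν 10 - 1)) ;;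
      .iput 5 (ν 8) (ν 6 + ν 10 - 1) (ν 11) ;;
      10 ≔ ν 10 - 1) ;;
    9 ≔ ν 9 + 1)

/-- Array `B` arises from array `A` by permuting the cells of `[lo, lo + len)`. -/
def Permuted (A B : ℕ → ℕ) (lo len : ℕ) : Prop :=
  ∃ σ : Equiv.Perm ℕ, (∀ j, ¬ (lo ≤ j ∧ j < lo + len) → σ j = j) ∧ ∀ j, B j = A (σ j)

theorem Permuted.refl (A : ℕ → ℕ) (lo len : ℕ) : Permuted A A lo len :=
  ⟨1, fun _ _ => rfl, fun _ => rfl⟩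

theorem Permuted.swap {A B C : ℕ → ℕ} {lo len a b : ℕ} (h : Permuted A B lo len)
    (ha : lo ≤ a ∧ a < lo + len) (hb : lo ≤ b ∧ b < lo + len)
    (hC : ∀ j, C j = if j = a then B b else if j = b then B a else B j) :
    Permuted A C lo len := by
  obtain ⟨σ, h1, h2⟩ := h
  refine ⟨σ * Equiv.swap a b, fun j hj => ?_, fun j => ?_⟩
  · have e1 : j ≠ a := by rintro rfl; exact hj ha
    have e2 : j ≠ b := by rintro rfl; exact hj hb
    simp [Equiv.swap_apply_of_ne_of_ne e1 e2, h1 j hj]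
  · rw [hC, Equiv.Perm.mul_apply, Equiv.swap_apply_def]
    split_ifs <;> rw [h2]

theorem Permuted.eq_outside {A B : ℕ → ℕ} {lo len j : ℕ} (h : Permuted A B lo len)
    (hj : ¬ (lo ≤ j ∧ j < lo + len)) : B j = A j := by
  obtain ⟨σ, h1, h2⟩ := h
  rw [h2, h1 j hj]

theorem perm_mem {σ : Equiv.Perm ℕ} {lo len : ℕ}
    (h : ∀ j, ¬ (lo ≤ j ∧ j < lo + len) → σ j = j) {j : ℕ} (hj : lo ≤ j ∧ j < lo + len) :
    lo ≤ σ j ∧ σ j < lo + len := by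
  by_contra hc
  have := h _ hc
  rw [σ.injective this] at hc
  exact hc hj

theorem Permuted.exists_eq {A B : ℕ → ℕ} {lo len j : ℕ} (h : Permuted A B lo len)
    (hj : lo ≤ j ∧ j < lo + len) : ∃ i, (lo ≤ i ∧ i < lo + len) ∧ B j = A i := by
  obtain ⟨σ, h1, h2⟩ := h
  exact ⟨σ j, perm_mem h1 hj, h2 j⟩

theorem Permuted.exists_eq' {A B : ℕ → ℕ} {lo len j : ℕ} (h : Permuted A B lo len)
    (hj : lo ≤ j ∧ j < lo + len) : ∃ i, (lo ≤ i ∧ i < lo + len) ∧ B i = A j := by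
  obtain ⟨σ, h1, h2⟩ := h
  have h3 : ∀ j, ¬ (lo ≤ j ∧ j < lo + len) → σ.symm j = j := fun j hj => by
    rw [Equiv.symm_apply_eq, h1 j hj]
  exact ⟨σ.symm j, perm_mem h3 hj, by rw [h2, Equiv.apply_symm_apply]⟩

theorem Permuted.card_filter {A B : ℕ → ℕ} {lo len : ℕ} (h : Permuted A B lo len)
    (P : ℕ → Prop) [DecidablePred P] :
    ((Finset.range len).filter fun t => P (B (lo + t))).card =
      ((Finset.range len).filter fun t => P (A (lo + t))).card := by
  obtain ⟨σ, h1, h2⟩ := h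
  refine Finset.card_bij (fun t _ => σ (lo + t) - lo) ?_ ?_ ?_
  · intro t ht
    simp only [Finset.mem_filter, Finset.mem_range] at ht ⊢
    have hm := perm_mem h1 (j := lo + t) (by omega)
    refine ⟨by omega, ?_⟩
    rw [Nat.add_sub_cancel' hm.1, ← h2]
    exact ht.2
  · intro t ht t' ht' he
    simp only [Finset.mem_filter, Finset.mem_range] at ht ht'
    have hm := perm_mem h1 (j := lo + t) (by omega)
    have hm' := perm_mem h1 (j := lo + t') (by omega)
    have := σ.injective (by omega : σ (lo + t) = σ (lo + t'))
    omega
  · intro t ht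
    simp only [Finset.mem_filter, Finset.mem_range] at ht ⊢
    have h3 : ∀ j, ¬ (lo ≤ j ∧ j < lo + len) → σ.symm j = j := fun j hj => by
      rw [Equiv.symm_apply_eq, h1 j hj]
    have hm := perm_mem h3 (j := lo + t) (by omega)
    have e1 : lo + (σ.symm (lo + t) - lo) = σ.symm (lo + t) := Nat.add_sub_cancel' hm.1
    refine ⟨σ.symm (lo + t) - lo, ⟨by omega, ?_⟩, ?_⟩
    · rw [e1, h2, Equiv.apply_symm_apply]; exact ht.2
    · rw [e1, Equiv.apply_symm_apply]; omega

/-- Quadratic time is enough: only blocks, sampling groups, final samples and at most `64` survivors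
of a selection are sorted in this way. -/
theorem wp_sort (h5 : s.iv 5 < S) (hlen : s.iv 6 + s.iv 7 < S) (hrow : s.iv 8 < S)
    (hent : ∀ t, t < s.iv 7 → s.ia 5 (s.iv 8) (s.iv 6 + t) < S) :
    wp S n sortCmd (fun s' => (∀ r, r ≠ s.iv 8 → s'.ia 5 r = s.ia 5 r) ∧
      Permuted (s.ia 5 (s.iv 8)) (s'.ia 5 (s.iv 8)) (s.iv 6) (s.iv 7) ∧
      (∀ t t', t < t' → t' < s.iv 7 →
        s.key (s'.ia 5 (s.iv 8) (s.iv 6 + t)) ≤ s.key (s'.ia 5 (s.iv 8) (s.iv 6 + t'))) ∧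
      s'.time ≤ s.time + 10 * (s.iv 7 + 1) ^ 2) s := by
  generalize hrw : s.iv 8 = row at *
  generalize hl : s.iv 6 = lo at *
  generalize hle : s.iv 7 = len at *
  have hentP : ∀ B, Permuted (s.ia 5 row) B lo len → ∀ t, t < len → B (lo + t) < S := by
    intro B hB t ht
    obtain ⟨i, hi, he⟩ := hB.exists_eq (j := lo + t) (by omega)
    rw [he]
    have := hent (i - lo) (by omega)
    rwa [Nat.add_sub_cancel' hi.1] at this
  simp only [sortCmd, wp_seq, wp_iset]
  refine ⟨trivial, ?_⟩
  refine wp_whl (fun s' => s'.iv 9 ≤ len ∧ (∀ r, r ≠ row → s'.ia 5 r = s.ia 5 r) ∧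
    Permuted (s.ia 5 row) (s'.ia 5 row) lo len ∧
    (∀ t t', t < t' → t' < s'.iv 9 →
        s.key (s'.ia 5 row (lo + t)) ≤ s.key (s'.ia 5 row (lo + t'))) ∧
    s'.time ≤ s.time + 1 + s'.iv 9 * (5 * len + 4)) (fun s' => len - s'.iv 9) ?_ ?_
  · simp [Permuted.refl]
  rintro s1 hf ⟨hq, hr, hp, hs, ht⟩
  have f5 : s1.iv 5 = s.iv 5 := by simpa using hf.iv 5 (by decide)
  have f6 : s1.iv 6 = lo := by simpa [hl] using hf.iv 6 (by decide)
  have f7 : s1.iv 7 = len := by simpa [hle] using hf.iv 7 (by decide)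
  have f8 : s1.iv 8 = row := by simpa [hrw] using hf.iv 8 (by decide)
  have g1 : s1.ra = s.ra := by
    funext A
    simpa using hf.ra A (by simp [Cmd.wRA])
  clear hf
  refine ⟨by simp, fun hb => ?_, fun hb => ?_⟩
  swap
  · simp only [BE.val_ilt, IE.val_var, f7, not_lt] at hb
    have hqe : s1.iv 9 = len := le_antisymm hq hb
    refine ⟨hr, hp, fun t t' h1 h2 => hs t t' h1 (by omega), ?_⟩
    rw [hqe] at ht
    simp only [St.tick_time]
    nlinarith
  simp only [BE.val_ilt, IE.val_var, f7] at hb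
  generalize hqd : s1.iv 9 = q at *
  simp only [wp_seq, wp_iset, St.tick_iv, St.tick_ia, St.tick_rv, St.tick_ra, St.tick_raw, St.tick_time]
  refine ⟨trivial, ?_⟩
  -- The entry on its way down stands at place `ν 10`. All pairs are in order except possibly those
  -- in which it is the later member.
  refine wp_whl (fun s' => s'.iv 10 ≤ q ∧ (∀ r, r ≠ row → s'.ia 5 r = s.ia 5 r) ∧
    Permuted (s.ia 5 row) (s'.ia 5 row) lo len ∧
    (∀ t t', t < t' → t' ≤ q → t' ≠ s'.iv 10 →
        s.key (s'.ia 5 row (lo + t)) ≤ s.key (s'.ia 5 row (lo + t'))) ∧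
    s'.time + 5 * s'.iv 10 ≤ s1.time + 2 + 5 * q) (fun s' => s'.iv 10) ?_ ?_
  · refine ⟨by simp [hqd], by simpa using hr, by simpa using hp, ?_, ?_⟩
    · simp only [IE.val_var, St.tick_iv, Function.update_self, hqd]
      exact fun t t' h1 h2 h3 => hs t t' h1 (by omega)
    · simp only [IE.val_var, St.tick_iv, Function.update_self, hqd]
      omega
  rintro s2 hf ⟨hpq, hr2, hp2, hs2, ht2⟩
  have k5 : s2.iv 5 = s.iv 5 := by simpa [f5] using hf.iv 5 (by decide)
  have k6 : s2.iv 6 = lo := by simpa [f6] using hf.iv 6 (by decide)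
  have k7 : s2.iv 7 = len := by simpa [f7] using hf.iv 7 (by decide)
  have k8 : s2.iv 8 = row := by simpa [f8] using hf.iv 8 (by decide)
  have k9 : s2.iv 9 = q := by simpa [hqd] using hf.iv 9 (by decide)
  have g2 : s2.ra = s.ra := by
    funext A
    simpa [g1] using hf.ra A (by simp [Cmd.wRA])
  have hkey : s2.key = s.key := St.key_congr (by rw [g2]) (by rw [g2]) k5
  clear hf
  generalize hpd : s2.iv 10 = p at *
  have hSpos : 0 < S := by omega
  have e1 := hentP _ hp2 p (by omega)
  refine ⟨?_, fun hb => ?_, fun hb => ?_⟩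
  · simp only [BE.ok_and, BE.ok_ilt, IE.ok_lit, IE.ok_var, true_and, BE.val_ilt, IE.val_lit,
      IE.val_var, hpd]
    intro hp0
    have e2 := hentP _ hp2 (p - 1) (by omega)
    have e3 : lo + (p - 1) = lo + p - 1 := by omega
    rw [e3] at e2
    apply lexlt_ok <;> simp [k5, k6, k8, hpd] <;> omega
  · simp only [BE.val_and, BE.val_ilt, IE.val_lit, IE.val_var, lexlt_val, IE.val_ld, IE.val_add,
      IE.val_sub, k6, k8, hkey, hpd] at hb
    obtain ⟨hp0, hlt⟩ := hb
    obtain ⟨p', rfl⟩ : ∃ p', p = p' + 1 := ⟨p - 1, by omega⟩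
    simp only [← add_assoc, Nat.add_sub_cancel] at *
    have f1 : lo + p' + 1 < S := by omega
    have f2 : lo + p' < S := by omega
    simp only [wp_seq, wp_iset, wp_iput, IE.ok_ld, IE.ok_sub, IE.ok_add, IE.ok_var, IE.ok_lit,
      IE.val_ld, IE.val_sub, IE.val_add, IE.val_var, IE.val_lit, St.tick_iv, St.tick_ia,
      St.tick_time, ne_eq, Nat.reduceEqDiff, not_false_eq_true,
      Function.update_of_ne, Function.update_self, k6, k8, hpd, ← add_assoc, Nat.add_sub_cancel,
      f1, f2, hrow, true_and, and_true]
    have hC : ∀ j, upd2 (upd2 (s2.ia 5) row (lo + p' + 1) (s2.ia 5 row (lo + p'))) row (lo + p')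
        (s2.ia 5 row (lo + p' + 1)) row j = if j = lo + p' then s2.ia 5 row (lo + p' + 1) else
          if j = lo + p' + 1 then s2.ia 5 row (lo + p') else s2.ia 5 row j := by
      intro j
      simp [upd2]
    refine ⟨⟨by omega, fun r hrr => ?_, hp2.swap (a := lo + p') (b := lo + p' + 1)
      (by omega) (by omega) hC, fun t t' h1 h2 h3 => ?_, by omega⟩, by omega⟩
    · rw [← hr2 r hrr]
      funext j
      simp [upd2, hrr]
    · rw [hC, hC]
      have c1 : t ≠ p' ∨ t = p' := by omega
      have ne1 : lo + t' ≠ lo + p' := by omega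
      rw [if_neg ne1]
      by_cases a1 : t' = p' + 1
      · subst a1
        rw [if_pos (by omega : lo + (p' + 1) = lo + p' + 1)]
        by_cases a2 : t = p'
        · subst a2; simp only [if_true]; exact hlt.le
        · rw [if_neg (by omega), if_neg (by omega)]
          exact hs2 t p' (by omega) (by omega) (by omega)
      · rw [if_neg (by omega : lo + t' ≠ lo + p' + 1)]
        by_cases a2 : t = p'
        · subst a2; simp only [if_true]
          exact hs2 (t + 1) t' (by omega) h2 a1
        · rw [if_neg (by omega : lo + t ≠ lo + p')]
          by_cases a3 : t = p' + 1
          · subst a3; rw [if_pos (by omega)]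
            exact hs2 p' t' (by omega) h2 a1
          · rw [if_neg (by omega)]
            exact hs2 t t' h1 h2 a1
  · simp only [BE.val_and, BE.val_ilt, IE.val_lit, IE.val_var, lexlt_val, IE.val_ld, IE.val_add,
      IE.val_sub, k6, k8, hkey, hpd, not_and, not_lt] at hb
    simp only [wp_iset, IE.ok_add, IE.ok_var, IE.ok_lit, IE.val_add, IE.val_var, IE.val_lit,
      St.tick_iv, St.tick_ia, St.tick_time, Function.update_self, k9, true_and]
    refine ⟨by omega, ⟨by omega, hr2, hp2, fun t t' h1 h2 => ?_, ?_⟩, by omega⟩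
    · by_cases a1 : t' = p
      · subst a1
        have h4 := hb (by omega)
        have e3 : lo + t' - 1 = lo + (t' - 1) := by omega
        rw [e3] at h4
        rcases (by omega : t < t' - 1 ∨ t = t' - 1) with h5 | h5
        · exact (hs2 t (t' - 1) h5 (by omega) (by omega)).trans h4
        · rw [h5]; exact h4
      · exact hs2 t t' h1 (by omega) a1
    · have : (q + 1) * (5 * len + 4) = q * (5 * len + 4) + (5 * len + 4) := by ring
      omega

end MedConv

namespace MedConv

open RealRAM

variable {S n : ℕ} {c p q : Cmd} {s s' : St} {Q R : St → Prop}

/-! #### Approximate quantiles -/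

open Classical in
/-- The number of `t < M` such that `A t` has the property `P`. -/
noncomputable def cnt (P : ℕ → Prop) (A : ℕ → ℕ) (M : ℕ) : ℕ := Nat.count (fun t => P (A t)) M

theorem cnt_congr {P : ℕ → Prop} {A B : ℕ → ℕ} {M : ℕ} (h : ∀ t, t < M → B t = A t) :
    cnt P B M = cnt P A M := by
  classical
  simp only [cnt, Nat.count_eq_card_filter_range]
  congr 1
  refine Finset.filter_congr fun t ht => ?_
  rw [h t (Finset.mem_range.1 ht)]

theorem cnt_add (P : ℕ → Prop) (A : ℕ → ℕ) (M N : ℕ) :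
    cnt P A (M + N) = cnt P A M + cnt P (fun t => A (M + t)) N := by
  classical
  exact Nat.count_add _ _ _

theorem cnt_le (P : ℕ → Prop) (A : ℕ → ℕ) (M : ℕ) : cnt P A M ≤ M := by
  classical
  exact Nat.count_le _

theorem Permuted.cnt_eq {A B : ℕ → ℕ} {lo len : ℕ} (h : Permuted A B lo len) (P : ℕ → Prop) :
    cnt P (fun t => B (lo + t)) len = cnt P (fun t => A (lo + t)) len := by
  classical
  simp only [cnt, Nat.count_eq_card_filter_range]
  exact h.card_filter P

/-- Below `4 * t` the predicate holds exactly for the first `c` places, say. Place `4 * u + 3`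
closes the quadruple number `u`, so the sample counts the complete quadruples, of which there are `c
/ 4`. -/
theorem count_quarter (p : ℕ → Prop) [DecidablePred p] (t : ℕ)
    (h : ∀ u u', u ≤ u' → u' < 4 * t → p u' → p u) :
    4 * Nat.count (fun u => p (4 * u + 3)) t ≤ Nat.count p (4 * t) ∧
      Nat.count p (4 * t) ≤ 4 * Nat.count (fun u => p (4 * u + 3)) t + 3 := by
  induction t with
  | zero => simp
  | succ t ih =>
    obtain ⟨h1, h2⟩ := ih fun u u' hu hu' => h u u' hu (by omega)
    have e : Nat.count p (4 * (t + 1)) = Nat.count p (4 * t) + (if p (4 * t) then 1 else 0) +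
        (if p (4 * t + 1) then 1 else 0) + (if p (4 * t + 2) then 1 else 0) +
        (if p (4 * t + 3) then 1 else 0) := by
      rw [show 4 * (t + 1) = 4 * t + 1 + 1 + 1 + 1 by ring]
      simp only [Nat.count_succ]
    have full : p (4 * t) → Nat.count (fun u => p (4 * u + 3)) t = t := by
      intro hp
      rw [Nat.count_iff_forall]
      exact fun u hu => h _ (4 * t) (by omega) (by omega) hp
    have b1 : Nat.count p (4 * t) ≤ 4 * t := Nat.count_le _
    rw [e, Nat.count_succ]
    by_cases p3 : p (4 * t + 3)
    · have p2 := h (4 * t + 2) (4 * t + 3) (by omega) (by omega) p3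
      have p1 := h (4 * t + 1) (4 * t + 3) (by omega) (by omega) p3
      have p0 := h (4 * t) (4 * t + 3) (by omega) (by omega) p3
      have := full p0
      simp only [p0, p1, p2, p3, if_true]
      omega
    · by_cases p0 : p (4 * t)
      · have := full p0
        simp only [p3, if_false]
        split_ifs <;> omega
      · have n1 : ¬ p (4 * t + 1) := fun hp => p0 (h _ _ (by omega) (by omega) hp)
        have n2 : ¬ p (4 * t + 2) := fun hp => p0 (h _ _ (by omega) (by omega) hp)
        simp only [p0, n1, n2, p3, if_false]
        omega

/-- The property `P` of indices is inherited by indices with smaller keys. -/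
def Init (kf : ℕ → ℝ ×ₗ ℕ) (P : ℕ → Prop) : Prop := ∀ i j, kf i ≤ kf j → P j → P i

theorem cnt_quarter {kf : ℕ → ℝ ×ₗ ℕ} {P : ℕ → Prop} (hP : Init kf P) {B C : ℕ → ℕ} {t : ℕ}
    (hB : ∀ u u', u < u' → u' < 4 * t → kf (B u) ≤ kf (B u'))
    (hC : ∀ u, u < t → C u = B (4 * u + 3)) :
    4 * cnt P C t ≤ cnt P B (4 * t) ∧ cnt P B (4 * t) ≤ 4 * cnt P C t + 3 := by
  classical
  rw [cnt_congr (A := fun u => B (4 * u + 3)) hC]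
  refine count_quarter (fun u => P (B u)) t fun u u' h1 h2 h3 => ?_
  rcases h1.lt_or_eq with h | h
  · exact hP _ _ (hB u u' h h2) h3
  · exact h ▸ h3

/-- Sorts one group and appends every fourth element to the other row. -/
def groupCmd : Cmd :=
  6 ≔ ν 25 ;; 7 ≔ ν 22 ;; 8 ≔ ν 23 ;; sortCmd ;;
  27 ≔ 3 ;;
  .whl (.ilt (ν 27) (ν 22)) (
    .iput 5 (ν 24) (ν 26) (.ld 5 (ν 23) (ν 25 + ν 27)) ;;
    26 ≔ ν 26 + 1 ;;
    27 ≔ ν 27 + 4) ;;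
  25 ≔ ν 25 + ν 22

/-- From `64 ≤ t` on, the time `10 * (4 * t + 1) ^ 2` of the sort together with the copying is below
`11 * (4 * t) ^ 2`. -/
theorem wp_group {t : ℕ} (h5 : s.iv 5 < S) (hg : s.iv 22 = 4 * t) (ht : 64 ≤ t) (ht4 : 4 * t + 4 < S)
    (hlo : s.iv 25 + 4 * t < S) (hw : s.iv 26 + 4 * t < S)
    (h23 : s.iv 23 < S) (h24 : s.iv 24 < S) (hne : s.iv 24 ≠ s.iv 23)
    (hent : ∀ u, u < 4 * t → s.ia 5 (s.iv 23) (s.iv 25 + u) < S) :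
    wp S n groupCmd (fun s' => s'.iv 25 = s.iv 25 + 4 * t ∧ s'.iv 26 = s.iv 26 + t ∧
      Permuted (s.ia 5 (s.iv 23)) (s'.ia 5 (s.iv 23)) (s.iv 25) (4 * t) ∧
      (∀ j, j < s.iv 26 → s'.ia 5 (s.iv 24) j = s.ia 5 (s.iv 24) j) ∧
      (∀ u, u < t → ∃ u', u' < 4 * t ∧
        s'.ia 5 (s.iv 24) (s.iv 26 + u) = s.ia 5 (s.iv 23) (s.iv 25 + u')) ∧
      (∀ P, Init s.key P →
        4 * cnt P (fun u => s'.ia 5 (s.iv 24) (s.iv 26 + u)) t ≤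
          cnt P (fun u => s.ia 5 (s.iv 23) (s.iv 25 + u)) (4 * t) ∧
        cnt P (fun u => s.ia 5 (s.iv 23) (s.iv 25 + u)) (4 * t) ≤
          4 * cnt P (fun u => s'.ia 5 (s.iv 24) (s.iv 26 + u)) t + 3) ∧
      s'.time ≤ s.time + 11 * (4 * t) ^ 2) s := by
  generalize e23 : s.iv 23 = ρ at *
  generalize e24 : s.iv 24 = ρ' at *
  generalize e25 : s.iv 25 = lo at *
  generalize e26 : s.iv 26 = w at *
  simp only [groupCmd, wp_seq, wp_iset]
  refine ⟨trivial, trivial, trivial, ?_⟩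
  refine (wp_sort ?_ ?_ ?_ ?_).mono ?_
  · simpa using h5
  · simpa [e25, hg] using hlo
  · simpa [e23] using h23
  · simpa [e25, e23, hg] using hent
  rintro s1 hf ⟨hr, hp, hs, htm⟩
  simp only [IE.val_var, ne_eq, Nat.reduceEqDiff, not_false_eq_true, Function.update_of_ne,
    Function.update_self, e25, e23, hg, OfNat.ofNat_ne_zero] at hr hp hs htm
  have f22 : s1.iv 22 = 4 * t := by simpa [hg] using hf.iv 22 (by decide)
  have f23 : s1.iv 23 = ρ := by simpa [e23] using hf.iv 23 (by decide)
  have f24 : s1.iv 24 = ρ' := by simpa [e24] using hf.iv 24 (by decide)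
  have f25 : s1.iv 25 = lo := by simpa [e25] using hf.iv 25 (by decide)
  have f26 : s1.iv 26 = w := by simpa [e26] using hf.iv 26 (by decide)
  clear hf
  simp only [wp_seq, wp_iset]
  refine ⟨trivial, ?_⟩
  refine wp_whl (fun s' => ∃ u, u ≤ t ∧ s'.iv 27 = 4 * u + 3 ∧ s'.iv 26 = w + u ∧
    s'.ia 5 ρ = s1.ia 5 ρ ∧ (∀ j, j < w → s'.ia 5 ρ' j = s1.ia 5 ρ' j) ∧
    (∀ v, v < u → s'.ia 5 ρ' (w + v) = s1.ia 5 ρ (lo + (4 * v + 3))) ∧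
    s'.time = s1.time + 1 + 4 * u) (fun s' => 4 * t + 4 - s'.iv 27) ?_ ?_
  · exact ⟨0, by simp [f26]⟩
  rintro s2 hf ⟨u, hu, i27, i26, r1, r2, r3, tm⟩
  have g22 : s2.iv 22 = 4 * t := by simpa [f22] using hf.iv 22 (by decide)
  have g23 : s2.iv 23 = ρ := by simpa [f23] using hf.iv 23 (by decide)
  have g24 : s2.iv 24 = ρ' := by simpa [f24] using hf.iv 24 (by decide)
  have g25 : s2.iv 25 = lo := by simpa [f25] using hf.iv 25 (by decide)
  clear hf
  refine ⟨by simp, fun hb => ?_, fun hb => ?_⟩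
  · simp only [BE.val_ilt, IE.val_var, i27, g22] at hb
    have b1 : lo + (4 * u + 3) < S := by omega
    have b2 : w + u + 1 < S := by omega
    have b3 : 4 * u + 3 + 4 < S := by omega
    have b4 : w + u < S := by omega
    simp only [wp_seq, wp_iset, wp_iput, IE.ok_ld, IE.ok_add, IE.ok_var, IE.ok_lit,
      IE.val_ld, IE.val_add, IE.val_var, IE.val_lit, St.tick_iv, St.tick_ia,
      St.tick_time, ne_eq, Nat.reduceEqDiff, not_false_eq_true,
      Function.update_of_ne, Function.update_self, i27, i26, g22, g23, g24, g25,
      b1, b2, b3, b4, h23, h24, true_and, and_true]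
    refine ⟨⟨u + 1, by omega, by omega, by omega, ?_, fun j hj => ?_, fun v hv => ?_, by omega⟩,
      by omega⟩
    · rw [← r1]; funext j; simp [upd2, hne.symm]
    · rw [← r2 j hj]; simp [upd2]; omega
    · by_cases hvu : v = u
      · subst hvu; simp [upd2, r1]
      · rw [← r3 v (by omega)]; simp [upd2]; omega
  · simp only [BE.val_ilt, IE.val_var, i27, g22] at hb
    have hut : u = t := by omega
    subst hut
    simp only [wp_iset, IE.ok_add, IE.ok_var, IE.val_add, IE.val_var,
      St.tick_iv, St.tick_ia, St.tick_time, ne_eq, Nat.reduceEqDiff, not_false_eq_true,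
      Function.update_of_ne, Function.update_self, i26, g22, g25, hlo, true_and]
    refine ⟨?_, fun j hj => ?_, fun u hu => ?_, fun P hP => ?_, ?_⟩
    · rw [r1]; exact hp
    · rw [r2 j hj, hr _ hne]
    · obtain ⟨i, hi, he⟩ := hp.exists_eq (j := lo + (4 * u + 3)) (by omega)
      exact ⟨i - lo, by omega, by rw [r3 u hu, he, Nat.add_sub_cancel' hi.1]⟩
    · rw [← hp.cnt_eq P]
      refine cnt_quarter (kf := s.key) hP ?_ r3
      intro a b hab hb
      exact hs a b hab hb
    · nlinarith

/-- One level of sampling. -/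
def levelCmd : Cmd :=
  25 ≔ 0 ;; 26 ≔ 0 ;; 24 ≔ 1 - ν 23 ;;
  .whl (.not (.ilt (ν 21) (ν 25 + ν 22))) groupCmd ;;
  21 ≔ ν 26 ;; 23 ≔ ν 24 ;; 22 ≔ ν 22 + ν 22

/-- The error has two sources: each complete group loses at most `3` elements of an initial segment,
and the incomplete group at the end, with fewer than `4 * t` elements, is dropped. -/
theorem wp_level {t Bd : ℕ} (h5 : s.iv 5 < S) (hg : s.iv 22 = 4 * t) (ht : 64 ≤ t)
    (hM : 4 * t ≤ s.iv 21) (hMS : 2 * s.iv 21 + 2 < S) (h23 : s.iv 23 ≤ 1) (hBd : Bd ≤ S)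
    (hent : ∀ u, u < s.iv 21 → s.ia 5 (s.iv 23) u < Bd) :
    wp S n levelCmd (fun s' => s'.iv 21 = s.iv 21 / (4 * t) * t ∧ s'.iv 23 ≤ 1 ∧
      s'.iv 22 = 4 * (2 * t) ∧
      (∀ u, u < s'.iv 21 → s'.ia 5 (s'.iv 23) u < Bd) ∧
      (∀ P, Init s.key P →
        4 * cnt P (s'.ia 5 (s'.iv 23)) (s'.iv 21) ≤ cnt P (s.ia 5 (s.iv 23)) (s.iv 21) ∧
        cnt P (s.ia 5 (s.iv 23)) (s.iv 21) ≤ 4 * cnt P (s'.ia 5 (s'.iv 23)) (s'.iv 21) +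
          (3 * (s.iv 21 / (4 * t)) + 4 * t)) ∧
      s'.time ≤ s.time + 12 * (s.iv 21 * (4 * t))) s := by
  generalize e21 : s.iv 21 = M at *
  generalize e23 : s.iv 23 = ρ at *
  have hρ' : 1 - ρ ≠ ρ := by omega
  simp only [levelCmd, wp_seq, wp_iset]
  refine ⟨trivial, trivial, ⟨trivial, trivial⟩, ?_⟩
  refine wp_whl (fun s' => ∃ q, q * (4 * t) ≤ M ∧ s'.iv 25 = q * (4 * t) ∧ s'.iv 26 = q * t ∧
    (∀ j, q * (4 * t) ≤ j → s'.ia 5 ρ j = s.ia 5 ρ j) ∧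
    (∀ j, j < q * t → s'.ia 5 (1 - ρ) j < Bd) ∧
    (∀ P, Init s.key P →
      4 * cnt P (s'.ia 5 (1 - ρ)) (q * t) ≤ cnt P (s.ia 5 ρ) (q * (4 * t)) ∧
      cnt P (s.ia 5 ρ) (q * (4 * t)) ≤ 4 * cnt P (s'.ia 5 (1 - ρ)) (q * t) + 3 * q) ∧
    s'.time ≤ s.time + 3 + q * (11 * (4 * t) ^ 2 + 1)) (fun s' => M - s'.iv 25) ?_ ?_
  · refine ⟨0, by simp [cnt]⟩
  rintro s1 hf ⟨q, hqM, i25, i26, r1, r2, r3, tm⟩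
  have g5 : s1.iv 5 = s.iv 5 := by simpa using hf.iv 5 (by decide)
  have g21 : s1.iv 21 = M := by simpa [e21] using hf.iv 21 (by decide)
  have g22 : s1.iv 22 = 4 * t := by simpa [hg] using hf.iv 22 (by decide)
  have g23 : s1.iv 23 = ρ := by simpa [e23] using hf.iv 23 (by decide)
  have g24 : s1.iv 24 = 1 - ρ := by simpa [e23] using hf.iv 24 (by decide)
  have hkey : s1.key = s.key := St.key_congr (by simpa using hf.ra 1 (by decide))
    (by simpa using hf.ra 2 (by decide)) g5
  clear hf
  have hqt : q * (4 * t) = 4 * (q * t) := by ring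
  have hq1 : (q + 1) * (4 * t) = 4 * (q * t) + 4 * t := by ring
  have hq1' : (q + 1) * t = q * t + t := by ring
  refine ⟨by simp [i25, g22]; omega, fun hb => ?_, fun hb => ?_⟩
  · simp only [BE.val_not, BE.val_ilt, IE.val_add, IE.val_var, i25, g22, g21, not_lt] at hb
    refine (wp_group (t := t) ?_ ?_ ht (by omega) ?_ ?_ ?_ ?_ ?_ ?_).mono ?_
    · simpa [g5] using h5
    · simpa using g22
    · simp only [St.tick_iv, i25]; omega
    · simp only [St.tick_iv, i26]; omega
    · simp only [St.tick_iv, g23]; omega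
    · simp only [St.tick_iv, g24]; omega
    · simpa [g23, g24] using hρ'
    · intro u hu
      simp only [St.tick_iv, St.tick_ia, g23, i25]
      rw [r1 _ (by omega)]
      exact (hent _ (by omega)).trans_le hBd
    rintro s2 - ⟨k25, k26, k1, k2, k3, k4, k5⟩
    have hkey' : s1.tick.key = s.key := hkey
    simp only [St.tick_iv, St.tick_ia, St.tick_time, i25, i26, g23, g24, hkey'] at k25 k26 k1 k2 k3 k4 k5
    have ea : ∀ u, u < 4 * t → s1.ia 5 ρ (q * (4 * t) + u) = s.ia 5 ρ (q * (4 * t) + u) :=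
      fun u hu => r1 _ (by omega)
    refine ⟨⟨q + 1, by omega, by omega, by omega, fun j hj => ?_, fun j hj => ?_, fun P hP => ?_, ?_⟩,
      by omega⟩
    · rw [k1.eq_outside (by omega), r1 j (by omega)]
    · by_cases hjq : j < q * t
      · rw [k2 j hjq]; exact r2 j hjq
      · obtain ⟨u', hu', he⟩ := k3 (j - q * t) (by omega)
        rw [Nat.add_sub_cancel' (by omega)] at he
        rw [he, ea u' hu']
        exact hent _ (by omega)
    · obtain ⟨a1, a2⟩ := k4 P hP
      obtain ⟨b1, b2⟩ := r3 P hP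
      rw [cnt_congr ea] at a1 a2
      rw [hq1', show (q + 1) * (4 * t) = q * (4 * t) + 4 * t by ring, cnt_add, cnt_add,
        cnt_congr k2]
      omega
    · have : (q + 1) * (11 * (4 * t) ^ 2 + 1) =
        q * (11 * (4 * t) ^ 2 + 1) + (11 * (4 * t) ^ 2 + 1) := by ring
      omega
  · simp only [BE.val_not, BE.val_ilt, IE.val_add, IE.val_var, i25, g22, g21, not_lt, not_le] at hb
    have hq : M / (4 * t) = q := by
      rw [Nat.div_eq_iff (by omega)]
      omega
    rw [hq]
    simp only [wp_seq, wp_iset, IE.ok_add, IE.ok_var, IE.val_add, IE.val_var,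
      St.tick_iv, St.tick_ia, St.tick_time, ne_eq, Nat.reduceEqDiff, not_false_eq_true,
      Function.update_of_ne, Function.update_self, i26, g22, g24, true_and]
    refine ⟨by omega, by omega, by ring, r2, fun P hP => ?_, ?_⟩
    · obtain ⟨b1, b2⟩ := r3 P hP
      have : cnt P (s.ia 5 ρ) M = cnt P (s.ia 5 ρ) (q * (4 * t)) +
          cnt P (fun u => s.ia 5 ρ (q * (4 * t) + u)) (M - q * (4 * t)) := by
        rw [← cnt_add, Nat.add_sub_cancel' hqM]
      have h2 := cnt_le P (fun u => s.ia 5 ρ (q * (4 * t) + u)) (M - q * (4 * t))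
      omega
    · have h1 : q * (4 * t) * (4 * t) ≤ M * (4 * t) := Nat.mul_le_mul_right _ hqM
      have h2 : 256 * q ≤ q * (4 * t) := by nlinarith
      have h3 : 256 * 256 ≤ M * (4 * t) := Nat.mul_le_mul (by omega) (by omega)
      have h4 : M * 256 ≤ M * (4 * t) := Nat.mul_le_mul_left _ (by omega)
      nlinarith

end MedConv

/-! ### Nested sampling with doubling groups, and the choice of a pivot -/

namespace MedConv

open RealRAM

variable {S n : ℕ} {c p q : Cmd} {s s' : St} {Q R : St → Prop}

/-- Nested sampling from row `0` of array `5`. -/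
def sampleCmd : Cmd :=
  23 ≔ 0 ;; 22 ≔ 256 ;; 21 ≔ ν 20 ;;
  .whl (.not (.ilt (ν 21) (32 * ν 22))) levelCmd

/-- Nested sampling, then sorting of the final sample. -/
def quantCmd : Cmd :=
  sampleCmd ;;
  6 ≔ 0 ;; 7 ≔ ν 21 ;; 8 ≔ ν 23 ;; sortCmd

/-- After `h` levels a sampled element stands for `4 ^ h` elements and the groups have size `256 * 2
^ h`. The losses inside groups sum to at most `(6 K / 256) (1 - 2⁻ʰ)`, those of incomplete groups to
at most `256 (8 ^ h - 1) / 7`; both geometric sums are written without division. The last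
conclusion, which comes from the loop test, makes the second sum at most `K / 28`. -/
theorem sample_error {K M h E₁ E₂ t : ℕ} (ht : t = 64 * 2 ^ h) (hM : 32 * (4 * t) ≤ M)
    (hK : 4 ^ h * M ≤ K) (h1 : 256 * 2 ^ h * E₁ + 6 * K ≤ 6 * K * 2 ^ h)
    (h2 : 7 * E₂ + 256 ≤ 256 * 8 ^ h) :
    256 * 2 ^ (h + 1) * (E₁ + 4 ^ h * (3 * (M / (4 * t)))) + 6 * K ≤ 6 * K * 2 ^ (h + 1) ∧
      7 * (E₂ + 4 ^ h * (4 * t)) + 256 ≤ 256 * 8 ^ (h + 1) ∧ 8 ^ (h + 1) * 2 ^ 10 ≤ K := by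
  have e8 : (8 : ℕ) ^ h = 4 ^ h * 2 ^ h := by rw [← mul_pow]; norm_num
  have hd : M / (4 * t) * (4 * t) ≤ M := Nat.div_mul_le_self _ _
  refine ⟨?_, ?_, ?_⟩
  · have a1 : 4 ^ h * (M / (4 * t) * (4 * t)) ≤ K := (Nat.mul_le_mul_left _ hd).trans hK
    have a2 : 256 * 2 ^ (h + 1) * (4 ^ h * (3 * (M / (4 * t)))) =
        6 * (4 ^ h * (M / (4 * t) * (4 * t))) := by rw [ht, pow_succ]; ring
    rw [mul_add, a2, pow_succ]
    nlinarith
  · rw [pow_succ, ht, e8]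
    rw [e8] at h2
    nlinarith
  · have a1 : 4 ^ h * (32 * (4 * t)) ≤ K := (Nat.mul_le_mul_left _ hM).trans hK
    rw [pow_succ, e8]
    rw [ht] at a1
    nlinarith

theorem cnt_sorted {kf : ℕ → ℝ ×ₗ ℕ} {A : ℕ → ℕ} {M i : ℕ} (hi : i < M)
    (h : ∀ t t', t < t' → t' < M → kf (A t) ≤ kf (A t')) :
    cnt (fun j => kf j < kf (A i)) A M ≤ i ∧ i + 1 ≤ cnt (fun j => kf j ≤ kf (A i)) A M := by
  classical
  simp only [cnt, Nat.count_eq_card_filter_range]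
  constructor
  · calc _ ≤ (Finset.range i).card := Finset.card_le_card fun t ht => by
          simp only [Finset.mem_filter, Finset.mem_range] at ht ⊢
          by_contra hc
          rcases (not_lt.1 hc).lt_or_eq with h1 | h1
          · exact absurd (h i t h1 ht.1) (not_le.2 ht.2)
          · subst h1; exact lt_irrefl _ ht.2
      _ = i := Finset.card_range i
  · calc i + 1 = (Finset.range (i + 1)).card := (Finset.card_range _).symm
      _ ≤ _ := Finset.card_le_card fun t ht => by
          simp only [Finset.mem_filter, Finset.mem_range] at ht ⊢
          refine ⟨by omega, ?_⟩
          rcases (by omega : t < i ∨ t = i) with h1 | h1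
          · exact h t i h1 hi
          · rw [h1]

/-- A level costs `13 * (M * (4 * t)) ≤ 13 * 256 * K / 2 ^ h`, so all levels together cost at most
`2 * 13 * 256 * K = 6656 * K`. -/
theorem sample_time {K M h X t : ℕ} (ht : t = 64 * 2 ^ h) (hK : 4 ^ h * M ≤ K)
    (hX : 2 ^ h * X + 6656 * K ≤ 6656 * K * 2 ^ h) :
    2 ^ (h + 1) * (X + 13 * (M * (4 * t))) + 6656 * K ≤ 6656 * K * 2 ^ (h + 1) := by
  have : 2 ^ h * (M * (4 * t)) = 256 * (4 ^ h * M) := by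
    have : (4 : ℕ) ^ h = 2 ^ h * 2 ^ h := by rw [← mul_pow]; norm_num
    rw [ht, this]; ring
  rw [pow_succ]
  nlinarith

/-- The final sample is small enough for a quadratic sort: `M * M ≤ M * 32 * 256 * 2 ^ h`, while `M
* 2 ^ h ≤ M * 4 ^ h ≤ K`. -/
theorem sort_time {K M h t : ℕ} (ht : t = 64 * 2 ^ h) (hK : 4 ^ h * M ≤ K)
    (hM : M < 32 * (4 * t)) : (M + 1) ^ 2 ≤ 32 * (256 * K) + 2 * K + 1 := by
  have p2 : 0 < 2 ^ h := by positivity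
  have e4 : (4 : ℕ) ^ h = 2 ^ h * 2 ^ h := by rw [← mul_pow]; norm_num
  rw [e4] at hK
  have h1 : M * 2 ^ h ≤ K := by
    calc M * 2 ^ h ≤ M * 2 ^ h * 2 ^ h := Nat.le_mul_of_pos_right _ p2
      _ = 2 ^ h * 2 ^ h * M := by ring
      _ ≤ K := hK
  have h0 : M ≤ K := (Nat.le_mul_of_pos_right _ p2).trans h1
  have h2 : M * M ≤ M * (32 * (4 * t)) := Nat.mul_le_mul_left _ hM.le
  have h3 : M * (32 * (4 * t)) = 32 * (256 * (M * 2 ^ h)) := by rw [ht]; ring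
  have h4 : (M + 1) ^ 2 = M * M + 2 * M + 1 := by ring
  omega

theorem level_counts {a b k p x y E₁ E₂ : ℕ} (h1 : 4 * b ≤ a) (h2 : a ≤ 4 * b + (x + y))
    (h3 : p * a ≤ k) (h4 : k ≤ p * a + (E₁ + E₂)) :
    p * 4 * b ≤ k ∧ k ≤ p * 4 * b + (E₁ + p * x + (E₂ + p * y)) := by
  have h1' := Nat.mul_le_mul_left p h1
  have h2' := Nat.mul_le_mul_left p h2
  have e1 : p * (4 * b) = p * 4 * b := by ring
  have e2 : p * (4 * b + (x + y)) = p * 4 * b + p * x + p * y := by ring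
  omega

/-- In units of `K`, the total error is at most `6 / 256 + 1 / 28 < 1 / 16`; for `h = 0` there is
none. -/
theorem sample_total {K h E₁ E₂ X : ℕ} (h1 : 256 * 2 ^ h * E₁ + 6 * K ≤ 6 * K * 2 ^ h)
    (h2 : 7 * E₂ + 256 ≤ 256 * 8 ^ h) (h0 : h = 0 ∨ 8 ^ h * 2 ^ 10 ≤ K)
    (hX : 2 ^ h * X + 6656 * K ≤ 6656 * K * 2 ^ h) : 16 * (E₁ + E₂) ≤ K ∧ X ≤ 6656 * K := by
  have p2 : 0 < 2 ^ h := by positivity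
  have a1 : 256 * E₁ ≤ 6 * K := by
    have : 2 ^ h * (256 * E₁) ≤ 2 ^ h * (6 * K) := by nlinarith
    exact Nat.le_of_mul_le_mul_left this p2
  have a2 : X ≤ 6656 * K := by
    have : 2 ^ h * X ≤ 2 ^ h * (6656 * K) := by nlinarith
    exact Nat.le_of_mul_le_mul_left this p2
  refine ⟨?_, a2⟩
  rcases h0 with h0 | h0
  · subst h0; omega
  · omega

/-- Here `p` is the weight of a sampled element and `qq = M / 4`. At the upper quartile of the
sample `a ≤ 3 K / 4 + K / 16`, and `b` is at least three quarters of `p * M ≥ 15 K / 16`. The lower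
quartile is treated in the same way in `pivot_low`. -/
theorem pivot_high {K E M p qq a b : ℕ} (hE : 16 * E ≤ K) (hM : p * M ≤ K) (hK : K ≤ p * M + E)
    (hq : 4 * qq ≤ M) (hM0 : 0 < M) (hb : M < 4 * qq + 4) (h1 : a ≤ p * (M - 1 - qq) + E)
    (h2 : p * (M - 1 - qq + 1) ≤ b) : 11 * K ≤ 16 * b ∧ 16 * a ≤ 13 * K := by
  have e1 : 3 * M ≤ 4 * (M - 1 - qq + 1) := by omega
  have e2 : 4 * (M - 1 - qq) ≤ 3 * M := by omega
  have e1' := Nat.mul_le_mul_left p e1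
  have e2' := Nat.mul_le_mul_left p e2
  generalize M - 1 - qq = r at *
  constructor <;> nlinarith

theorem pivot_low {K E M p qq a b : ℕ} (hE : 16 * E ≤ K) (hM : p * M ≤ K) (hK : K ≤ p * M + E)
    (hq : 4 * qq ≤ M) (hb : M < 4 * qq + 4) (h1 : a ≤ p * qq + E)
    (h2 : p * (qq + 1) ≤ b) : 16 * a ≤ 5 * K ∧ 15 * K ≤ 64 * b := by
  have e1 : M ≤ 4 * (qq + 1) := by omega
  have e1' := Nat.mul_le_mul_left p e1
  have e2' := Nat.mul_le_mul_left p hq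
  constructor <;> nlinarith

/-- With groups of constant size each level would add the same relative error, and the number of
levels is not bounded. Doubling the size halves the error from level to level, and the cost still
decreases because the sample shrinks by a factor of four. -/
theorem wp_sample {K Bd : ℕ} (h5 : s.iv 5 < S) (hK : s.iv 20 = K) (hKS : 2 ^ 15 + 100 * K ≤ S)
    (hBd : Bd ≤ S) (hent : ∀ u, u < K → s.ia 5 0 u < Bd) :
    wp S n sampleCmd (fun s' => ∃ h t E, t = 64 * 2 ^ h ∧ s'.iv 23 ≤ 1 ∧
      4 ^ h * s'.iv 21 ≤ K ∧ 16 * E ≤ K ∧ s'.iv 21 < 32 * (4 * t) ∧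
      (∀ u, u < s'.iv 21 → s'.ia 5 (s'.iv 23) u < Bd) ∧
      (∀ P, Init s.key P →
        4 ^ h * cnt P (s'.ia 5 (s'.iv 23)) (s'.iv 21) ≤ cnt P (s.ia 5 0) K ∧
        cnt P (s.ia 5 0) K ≤ 4 ^ h * cnt P (s'.ia 5 (s'.iv 23)) (s'.iv 21) + E) ∧
      s'.time ≤ s.time + 4 + 6656 * K) s := by
  simp only [sampleCmd, wp_seq, wp_iset]
  refine ⟨trivial, trivial, trivial, ?_⟩
  refine wp_whl (fun s' => ∃ h t E₁ E₂ X, t = 64 * 2 ^ h ∧ s'.iv 22 = 4 * t ∧ s'.iv 23 ≤ 1 ∧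
    4 ^ h * s'.iv 21 ≤ K ∧
    256 * 2 ^ h * E₁ + 6 * K ≤ 6 * K * 2 ^ h ∧ 7 * E₂ + 256 ≤ 256 * 8 ^ h ∧
    (h = 0 ∨ 8 ^ h * 2 ^ 10 ≤ K) ∧
    (∀ u, u < s'.iv 21 → s'.ia 5 (s'.iv 23) u < Bd) ∧
    (∀ P, Init s.key P →
      4 ^ h * cnt P (s'.ia 5 (s'.iv 23)) (s'.iv 21) ≤ cnt P (s.ia 5 0) K ∧
      cnt P (s.ia 5 0) K ≤ 4 ^ h * cnt P (s'.ia 5 (s'.iv 23)) (s'.iv 21) + (E₁ + E₂)) ∧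
    s'.time ≤ s.time + 3 + X ∧ 2 ^ h * X + 6656 * K ≤ 6656 * K * 2 ^ h)
    (fun s' => s'.iv 21) ?_ ?_
  · exact ⟨0, 64, 0, 0, 0, by simp [hK]; exact hent⟩
  rintro s1 hf ⟨h, t, E₁, E₂, X, ht, i22, i23, hM, hE1, hE2, h0, hB, hc, tm, hX⟩
  have g5 : s1.iv 5 = s.iv 5 := by simpa using hf.iv 5 (by decide)
  have hkey : s1.key = s.key := St.key_congr (by simpa using hf.ra 1 (by decide))
    (by simpa using hf.ra 2 (by decide)) g5
  clear hf
  have p2 : 0 < 2 ^ h := by positivity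
  have p4 : 0 < 4 ^ h := by positivity
  have e8 : (8 : ℕ) ^ h = 4 ^ h * 2 ^ h := by rw [← mul_pow]; norm_num
  have hMK : s1.iv 21 ≤ K := (Nat.le_mul_of_pos_left _ p4).trans hM
  have htb : 2 ^ h ≤ 1 + K := by
    rcases h0 with h0 | h0
    · subst h0; simp
    · nlinarith
  have hgS : 32 * (4 * t) < S := by
    rcases h0 with h0 | h0
    · subst h0; omega
    · have : 2 ^ h ≤ 8 ^ h := Nat.pow_le_pow_left (by norm_num) h
      omega
  refine ⟨by simpa [i22] using hgS, fun hb => ?_, fun hb => ?_⟩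
  · simp only [BE.val_not, BE.val_ilt, IE.val_mul, IE.val_lit, IE.val_var, i22, not_lt] at hb
    refine (wp_level (t := t) (Bd := Bd) ?_ ?_ (by omega) ?_ ?_ ?_ hBd ?_).mono ?_
    · simpa [g5] using h5
    · simpa using i22
    · simp only [St.tick_iv]; omega
    · simp only [St.tick_iv]; omega
    · simpa using i23
    · simpa using hB
    rintro s2 - ⟨k21, k23, k22, kB, kc, ktm⟩
    have hkey' : s1.tick.key = s.key := hkey
    simp only [St.tick_iv, St.tick_ia, St.tick_time, hkey'] at k21 kc ktm
    obtain ⟨a1, a2, a3⟩ := sample_error ht hb hM hE1 hE2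
    refine ⟨⟨h + 1, 2 * t, E₁ + 4 ^ h * (3 * (s1.iv 21 / (4 * t))), E₂ + 4 ^ h * (4 * t),
      X + 13 * (s1.iv 21 * (4 * t)), by rw [ht, pow_succ]; ring, k22, k23, ?_, a1, a2,
      Or.inr a3, kB, fun P hP => ?_, ?_, ?_⟩, ?_⟩
    · rw [k21]
      have hd : s1.iv 21 / (4 * t) * (4 * t) ≤ s1.iv 21 := Nat.div_mul_le_self _ _
      calc 4 ^ (h + 1) * (s1.iv 21 / (4 * t) * t)
          = 4 ^ h * (s1.iv 21 / (4 * t) * (4 * t)) := by rw [pow_succ]; ring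
        _ ≤ 4 ^ h * s1.iv 21 := Nat.mul_le_mul_left _ hd
        _ ≤ K := hM
    · obtain ⟨b1, b2⟩ := kc P hP
      obtain ⟨c1, c2⟩ := hc P hP
      rw [pow_succ]
      exact level_counts b1 b2 c1 c2
    · have : 0 < s1.iv 21 * (4 * t) := by
        have : 0 < 4 * t := by omega
        have : 0 < s1.iv 21 := by omega
        positivity
      omega
    · exact sample_time ht hM hX
    · rw [k21]
      have hd : s1.iv 21 / (4 * t) * (4 * t) ≤ s1.iv 21 := Nat.div_mul_le_self _ _
      have : s1.iv 21 / (4 * t) * (4 * t) = 4 * (s1.iv 21 / (4 * t) * t) := by ring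
      omega
  · simp only [BE.val_not, BE.val_ilt, IE.val_mul, IE.val_lit, IE.val_var, i22, not_lt,
      not_le] at hb
    obtain ⟨a1, a2⟩ := sample_total hE1 hE2 h0 hX
    refine ⟨h, t, E₁ + E₂, ht, i23, hM, a1, hb, hB, hc, ?_⟩
    simp only [St.tick_time]
    omega

theorem cnt_true (A : ℕ → ℕ) (M : ℕ) : cnt (fun _ => True) A M = M := by
  classical
  simp [cnt, Nat.count_eq_card_filter_range]

/-- The sampling estimate, applied to the keys below and to the keys up to a sampled element, turns
its place `i` in the sorted sample into bounds for its rank among all `K` entries. -/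
theorem wp_quant {K Bd : ℕ} (h5 : s.iv 5 < S) (hK : s.iv 20 = K) (hKS : 2 ^ 15 + 100 * K ≤ S)
    (hK64 : 64 ≤ K) (hBd : Bd ≤ S) (hent : ∀ u, u < K → s.ia 5 0 u < Bd) :
    wp S n quantCmd (fun s' => ∃ h E M ρ, s'.iv 21 = M ∧ s'.iv 23 = ρ ∧ ρ ≤ 1 ∧ 0 < M ∧
      16 * E ≤ K ∧ 4 ^ h * M ≤ K ∧ K ≤ 4 ^ h * M + E ∧ (∀ i, i < M → s'.ia 5 ρ i < Bd ∧
        cnt (fun j => s.key j < s.key (s'.ia 5 ρ i)) (s.ia 5 0) K ≤ 4 ^ h * i + E ∧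
        4 ^ h * (i + 1) ≤ cnt (fun j => s.key j ≤ s.key (s'.ia 5 ρ i)) (s.ia 5 0) K) ∧
      s'.time ≤ s.time + 400000 * K) s := by
  simp only [quantCmd, wp_seq]
  refine (wp_sample (Bd := Bd) h5 hK hKS hBd hent).mono ?_
  rintro s1 hf ⟨h, t, E, ht, i23, hM, hE, hMt, hB, hc, tm⟩
  have g5 : s1.iv 5 = s.iv 5 := hf.iv 5 (by decide)
  have hkey : s1.key = s.key := St.key_congr (hf.ra 1 (by decide)) (hf.ra 2 (by decide)) g5
  clear hf
  have p4 : 0 < 4 ^ h := by positivity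
  have hMK : s1.iv 21 ≤ K := (Nat.le_mul_of_pos_left _ p4).trans hM
  generalize e21 : s1.iv 21 = M at *
  generalize e23 : s1.iv 23 = ρ at *
  simp only [wp_seq, wp_iset]
  refine ⟨trivial, trivial, trivial, ?_⟩
  refine (wp_sort ?_ ?_ ?_ ?_).mono ?_
  · simpa [g5] using h5
  · simp [e21]; omega
  · simp [e23]; omega
  · simp only [IE.val_var, IE.val_lit, ne_eq, Nat.reduceEqDiff, not_false_eq_true,
      Function.update_of_ne, Function.update_self, e21, e23, zero_add]
    exact fun t ht => (hB t ht).trans_le hBd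
  rintro s2 hf ⟨-, hp, hs, htm⟩
  have k21 : s2.iv 21 = M := by simpa [e21] using hf.iv 21 (by decide)
  have k23 : s2.iv 23 = ρ := by simpa [e23] using hf.iv 23 (by decide)
  have hkey'' : ∀ iv tm, St.key ⟨Function.update (Function.update (Function.update s1.iv
      6 0) 7 M) 8 iv, s1.ia, s1.rv, s1.ra, s1.raw, tm⟩ = s.key := fun _ _ => by
    rw [← hkey]; exact St.key_congr rfl rfl (by simp)
  clear hf
  simp only [IE.val_var, IE.val_lit, ne_eq, Nat.reduceEqDiff, not_false_eq_true,
    Function.update_of_ne, Function.update_self, e21, e23, zero_add, hkey''] at hp hs htm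
  have hcnt : ∀ P, cnt P (s2.ia 5 ρ) M = cnt P (s1.ia 5 ρ) M := fun P => by
    simpa using hp.cnt_eq P
  -- The initial segment that contains everything shows how much the sample represents.
  have htot : K ≤ 4 ^ h * M + E := by
    have := (hc (fun _ => True) fun _ _ _ _ => trivial).2
    rwa [cnt_true, cnt_true] at this
  refine ⟨h, E, M, ρ, k21, k23, i23, ?_, hE, hM, htot, fun i hi => ⟨?_, ?_, ?_⟩, ?_⟩
  · rcases Nat.eq_zero_or_pos M with h1 | h1
    · subst h1; omega
    · exact h1
  · obtain ⟨i', hi', he⟩ := hp.exists_eq (j := i) (by omega)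
    rw [he]; exact hB _ (by omega)
  · have h1 := (hc (fun j => s.key j < s.key (s2.ia 5 ρ i))
      fun i j h1 h2 => lt_of_le_of_lt h1 h2).2
    rw [← hcnt] at h1
    have h2 := (cnt_sorted hi hs).1
    have := Nat.mul_le_mul_left (4 ^ h) h2
    omega
  · have h1 := (hc (fun j => s.key j ≤ s.key (s2.ia 5 ρ i))
      fun i j h1 h2 => le_trans h1 h2).1
    rw [← hcnt] at h1
    have h2 := (cnt_sorted hi hs).2
    have := Nat.mul_le_mul_left (4 ^ h) h2
    omega
  · have := sort_time ht hM hMt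
    omega

/-- Chooses the pivot `ν 32` among the sampled quartiles. -/
def pivotCmd : Cmd :=
  quantCmd ;;
  28 ≔ 0 ;; 29 ≔ 4 ;;
  .whl (.not (.ilt (ν 21) (ν 29))) (28 ≔ ν 28 + 1 ;; 29 ≔ ν 29 + 4) ;;
  .ite (.ilt (2 * ν 30) (ν 20 * ν 31))
    (32 ≔ .ld 5 (ν 23) (ν 21 - 1 - ν 28)) (32 ≔ .ld 5 (ν 23) (ν 28))

theorem wp_pivot {K Bd : ℕ} (h5 : s.iv 5 < S) (hK : s.iv 20 = K) (hKS : 2 ^ 15 + 100 * K ≤ S)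
    (hK64 : 64 ≤ K) (hBd : Bd ≤ S) (hent : ∀ u, u < K → s.ia 5 0 u < Bd)
    (hr : 2 * s.iv 30 < S) (hl : K * s.iv 31 < S) :
    wp S n pivotCmd (fun s' => s'.iv 32 < Bd ∧
      (2 * s.iv 30 < K * s.iv 31 →
        11 * K ≤ 16 * cnt (fun j => s.key j ≤ s.key (s'.iv 32)) (s.ia 5 0) K ∧
        16 * cnt (fun j => s.key j < s.key (s'.iv 32)) (s.ia 5 0) K ≤ 13 * K) ∧
      (¬ 2 * s.iv 30 < K * s.iv 31 →
        16 * cnt (fun j => s.key j < s.key (s'.iv 32)) (s.ia 5 0) K ≤ 5 * K ∧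
        15 * K ≤ 64 * cnt (fun j => s.key j ≤ s.key (s'.iv 32)) (s.ia 5 0) K) ∧
      s'.time ≤ s.time + 500000 * K) s := by
  simp only [pivotCmd, wp_seq]
  refine (wp_quant (Bd := Bd) h5 hK hKS hK64 hBd hent).mono ?_
  rintro s1 hf ⟨h, E, M, ρ, i21, i23, hρ, hM0, hE, hMK, hKM, hi, tm⟩
  have f30 : s1.iv 30 = s.iv 30 := hf.iv 30 (by decide)
  have f31 : s1.iv 31 = s.iv 31 := hf.iv 31 (by decide)
  have f20 : s1.iv 20 = K := (hf.iv 20 (by decide)).trans hK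
  clear hf
  have hMK' : M ≤ K := (Nat.le_mul_of_pos_left _ (by positivity)).trans hMK
  simp only [wp_seq, wp_iset]
  refine ⟨trivial, trivial, ?_⟩
  -- The quotient `M / 4` is found by counting, because the machine does not divide integers.
  refine wp_whl (fun s' => 4 * s'.iv 28 ≤ M ∧ s'.iv 29 = 4 * s'.iv 28 + 4 ∧
    s'.time = s1.time + 2 + 3 * s'.iv 28) (fun s' => M - s'.iv 28) (by simp) ?_
  rintro s2 hf ⟨hq, i29, tm2⟩
  have g21 : s2.iv 21 = M := by simpa [i21] using hf.iv 21 (by decide)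
  have g23 : s2.iv 23 = ρ := by simpa [i23] using hf.iv 23 (by decide)
  have g30 : s2.iv 30 = s.iv 30 := by simpa [f30] using hf.iv 30 (by decide)
  have g31 : s2.iv 31 = s.iv 31 := by simpa [f31] using hf.iv 31 (by decide)
  have g20 : s2.iv 20 = K := by simpa [f20] using hf.iv 20 (by decide)
  have gia : s2.ia 5 = s1.ia 5 := by simpa using hf.ia 5 (by decide)
  clear hf
  generalize e28 : s2.iv 28 = qq at *
  refine ⟨by simp, fun hb => ?_, fun hb => ?_⟩
  · simp only [BE.val_not, BE.val_ilt, IE.val_var, i29, g21, not_lt] at hb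
    have b1 : qq + 1 < S := by omega
    have b2 : 4 * qq + 4 + 4 < S := by omega
    simp only [wp_seq, wp_iset, IE.ok_add, IE.ok_var, IE.ok_lit, IE.val_add, IE.val_var,
      IE.val_lit, St.tick_iv, St.tick_time, ne_eq, Nat.reduceEqDiff, not_false_eq_true,
      Function.update_of_ne, Function.update_self, e28, i29, b1, b2, true_and]
    omega
  · simp only [BE.val_not, BE.val_ilt, IE.val_var, i29, g21, not_lt, not_le] at hb
    have b1 : M - 1 - qq < S := by omega
    have b2 : qq < S := by omega
    have b3 : ρ < S := by omega
    simp only [wp_ite, wp_iset, IE.ok_mul, IE.ok_sub, IE.ok_var, IE.ok_lit, IE.ok_ld, IE.val_mul,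
      IE.val_sub, IE.val_var, IE.val_ld, BE.ok_ilt, BE.val_ilt, St.tick_ia,
      IE.val_lit, St.tick_iv, St.tick_time, ne_eq, Nat.reduceEqDiff, not_false_eq_true,
      Function.update_self, e28, g21, g20, g30, g31, g23, gia, b1, b2, b3, hr, hl, true_and]
    refine ⟨fun hc => ?_, fun hc => ?_⟩
    · obtain ⟨d1, d2, d3⟩ := hi (M - 1 - qq) (by omega)
      exact ⟨d1, fun _ => pivot_high hE hMK hKM hq hM0 hb d2 d3, fun h => absurd hc h, by omega⟩
    · obtain ⟨d1, d2, d3⟩ := hi qq (by omega)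
      exact ⟨d1, fun h => absurd h hc, fun _ => pivot_low hE hMK hKM hq hb d2 d3, by omega⟩

end MedConv

namespace MedConv

open Finset

/-! #### Selection among chunks of sorted lists: combinatorics -/

theorem cnt_eq_card (P : ℕ → Prop) [DecidablePred P] (A : ℕ → ℕ) (M : ℕ) :
    cnt P A M = ((range M).filter fun t => P (A t)).card := by
  classical
  rw [cnt, Nat.count_eq_card_filter_range]
  congr

theorem cnt_eq_sum (P : ℕ → Prop) [DecidablePred P] (A : ℕ → ℕ) (M : ℕ) :
    cnt P A M = ∑ t ∈ range M, if P (A t) then 1 else 0 := by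
  classical
  rw [cnt, Nat.count_eq_card_filter_range, card_filter]
  refine sum_congr rfl fun t _ => ?_
  congr

/-- `K` chunks of length `ℓ` start at the positions `C 0 < C 1 < …` below `N`; positions in the same
block of length `d` have increasing values `f`. The value `v` occurs in a chunk, and `r` of the
values in chunks are smaller. -/
structure Chunks {α : Type*} [LinearOrder α] (f : ℕ → α) (d N : ℕ) (C : ℕ → ℕ) (K ℓ : ℕ) (v : α)
    (r : ℕ) : Prop where
  pos : 0 < ℓ
  dvd : ℓ ∣ d
  mono : ∀ c c', c < c' → c' < K → C c < C c'
  al : ∀ c, c < K → ℓ ∣ C c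
  bd : ∀ c, c < K → C c + ℓ ≤ N
  tot : K * ℓ ≤ N
  mem : ∃ c, c < K ∧ ∃ t, t < ℓ ∧ f (C c + t) = v
  cntlt : ∑ c ∈ range K, ((range ℓ).filter fun t => f (C c + t) < v).card = r

section

variable {α : Type*} [LinearOrder α] {f : ℕ → α} {d N K ℓ r : ℕ} {C : ℕ → ℕ} {v : α}

/-- An aligned chunk does not cross the boundary of a block, since its length divides `d`. -/
theorem block_last {x ℓ d : ℕ} (hl : 0 < ℓ) (hd : ℓ ∣ d) (hx : ℓ ∣ x) {t : ℕ} (ht : t < ℓ) :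
    (x + t) / d = x / d := by
  obtain ⟨a, rfl⟩ := hd
  obtain ⟨b, rfl⟩ := hx
  rw [← Nat.div_div_eq_div_mul, ← Nat.div_div_eq_div_mul, Nat.mul_add_div hl,
    Nat.div_eq_of_lt ht, Nat.mul_div_cancel_left _ hl, add_zero]

/-- An initial segment of the order. -/
def Down (P : α → Prop) : Prop := ∀ x y, x ≤ y → P y → P x

theorem Chunks.mono_in (h : Chunks f d N C K ℓ v r)
    (hf : ∀ i j, i < j → j < N → i / d = j / d → f i < f j) {c t t' : ℕ} (hc : c < K)
    (ht : t ≤ t') (ht' : t' < ℓ) : f (C c + t) ≤ f (C c + t') := by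
  have hb := h.bd c hc
  rcases ht.lt_or_eq with h1 | h1
  · refine (hf _ _ (by omega) (by omega) ?_).le
    rw [block_last h.pos h.dvd (h.al c hc) (h1.trans ht'),
      block_last h.pos h.dvd (h.al c hc) ht']
  · rw [h1]

/-- All but `m` of the chunks that start in an initial segment lie in it. -/
theorem Chunks.straddle (h : Chunks f d N C K ℓ v r)
    (hf : ∀ i j, i < j → j < N → i / d = j / d → f i < f j) {m : ℕ} (hd : 0 < d)
    (hm : N ≤ m * d ∨ ℓ = 1) {P : α → Prop} (hP : Down P) :
    cnt (fun x => P (f x)) C K ≤ cnt (fun x => P (f (x + (ℓ - 1)))) C K + m := by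
  classical
  have hl := h.pos
  rcases hm with hm | hm
  · rw [cnt, Nat.count_eq_card_filter_range, cnt, Nat.count_eq_card_filter_range]
    -- The block number is injective on the chunks that start in `P` and end outside. If two chunks
    -- of a block start in `P`, the end of the first comes before the start of the second and
    -- therefore lies in `P`.
    have key : (((range K).filter fun c => P (f (C c))) \
        ((range K).filter fun c => P (f (C c + (ℓ - 1))))).card ≤ (range m).card := by
      refine card_le_card_of_injOn (fun c => C c / d) ?_ ?_
      · intro c hc
        simp only [coe_sdiff, coe_filter, Set.mem_sdiff, Set.mem_ofPred_eq, mem_range] at hc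
        simp only [coe_range, Set.mem_Iio]
        have := h.bd c hc.1.1
        rw [Nat.div_lt_iff_lt_mul hd]
        omega
      · have main : ∀ c c', c < c' → c' < K → C c / d = C c' / d → P (f (C c')) →
            P (f (C c + (ℓ - 1))) := by
          intro c c' hcc hc' he hp
          have h1 := h.mono c c' hcc hc'
          have h2 := h.bd c' hc'
          have h3 : C c + (ℓ - 1) < C c' := by
            obtain ⟨a, ha⟩ := h.al c (hcc.trans hc')
            obtain ⟨b, hb⟩ := h.al c' hc'
            have hab : a < b := by
              rw [ha, hb] at h1
              exact lt_of_mul_lt_mul_left h1 (Nat.zero_le _)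
            have := Nat.mul_le_mul_left ℓ hab
            rw [Nat.mul_succ] at this
            omega
          refine hP _ _ (hf _ _ h3 (by omega) ?_).le hp
          rw [block_last hl h.dvd (h.al c (hcc.trans hc')) (by omega), he]
        intro c hc c' hc' he
        simp only [coe_sdiff, coe_filter, Set.mem_sdiff, Set.mem_ofPred_eq, mem_range, not_and]
          at hc hc' he
        rcases lt_trichotomy c c' with hlt | heq | hgt
        · exact absurd (main c c' hlt hc'.1.1 he hc'.1.2) (hc.2 hc.1.1)
        · exact heq
        · exact absurd (main c' c hgt hc.1.1 he.symm hc.1.2) (hc'.2 hc'.1.1)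
    rw [card_range] at key
    have := le_card_sdiff ((range K).filter fun c => P (f (C c + (ℓ - 1))))
      ((range K).filter fun c => P (f (C c)))
    omega
  · subst hm
    simp

theorem Chunks.inj (h : Chunks f d N C K ℓ v r) {c c' : ℕ} (hc : c < K) (hc' : c' < K)
    (he : C c = C c') : c = c' := by
  rcases lt_trichotomy c c' with hlt | heq | hgt
  · exact absurd he (h.mono c c' hlt hc').ne
  · exact heq
  · exact absurd he.symm (h.mono c' c hgt hc).ne

theorem Chunks.cnt_le_succ (h : Chunks f d N C K ℓ v r)
    (hinj : ∀ i j, i < N → j < N → f i = f j → i = j) (p : α) :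
    cnt (fun x => f x ≤ p) C K ≤ cnt (fun x => f x < p) C K + 1 := by
  classical
  rw [cnt_eq_card, cnt_eq_card]
  have hl := h.pos
  have key : (((range K).filter fun c => f (C c) ≤ p) \
      ((range K).filter fun c => f (C c) < p)).card ≤ 1 := by
    rw [card_le_one]
    intro c hc c' hc'
    simp only [mem_sdiff, mem_filter, mem_range, not_and, not_lt] at hc hc'
    have e1 := le_antisymm hc.1.2 (hc.2 hc.1.1)
    have e2 := le_antisymm hc'.1.2 (hc'.2 hc'.1.1)
    have b1 := h.bd c hc.1.1
    have b2 := h.bd c' hc'.1.1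
    exact h.inj hc.1.1 hc'.1.1 (hinj _ _ (by omega) (by omega) (e1.trans e2.symm))
  have := le_card_sdiff ((range K).filter fun c => f (C c) < p)
      ((range K).filter fun c => f (C c) ≤ p)
  omega

theorem Chunks.rank_lt (h : Chunks f d N C K ℓ v r) : r < K * ℓ := by
  classical
  obtain ⟨c, hc, t, ht, hv⟩ := h.mem
  rw [← h.cntlt]
  calc _ < ∑ c ∈ range K, ℓ := by
        refine sum_lt_sum (fun c _ => ?_) ⟨c, mem_range.2 hc, ?_⟩
        · exact (card_filter_le _ _).trans (card_range ℓ).le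
        · calc _ ≤ ((range ℓ).erase t).card := card_le_card fun u hu => by
                simp only [mem_filter, mem_range, mem_erase] at hu ⊢
                refine ⟨?_, hu.1⟩
                rintro rfl
                exact absurd hu.2 (by rw [hv]; exact lt_irrefl _)
            _ < (range ℓ).card := card_erase_lt_of_mem (mem_range.2 ht)
            _ = ℓ := card_range ℓ
    _ = K * ℓ := by simp

/-- If `v` had the property, so would every smaller value. All of these would lie in chunks that
start in `P`, and one of these chunks also contains `v` itself, so there would be fewer than `ℓ`
times as many of them as such chunks. -/
theorem Chunks.not_of_le (h : Chunks f d N C K ℓ v r)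
    (hf : ∀ i j, i < j → j < N → i / d = j / d → f i < f j) {P : α → Prop} (hP : Down P)
    (hr : ℓ * cnt (fun x => P (f x)) C K ≤ r) : ¬ P v := by
  classical
  intro hv
  obtain ⟨c, hc, t, ht, hct⟩ := h.mem
  have key : r < ℓ * cnt (fun x => P (f x)) C K := by
    rw [← h.cntlt, cnt_eq_sum, mul_sum]
    refine sum_lt_sum (fun c hc => ?_) ⟨c, mem_range.2 hc, ?_⟩
    · by_cases hp : P (f (C c))
      · rw [if_pos hp, mul_one]
        exact (card_filter_le _ _).trans (card_range ℓ).le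
      · rw [if_neg hp, mul_zero, Nat.le_zero, card_eq_zero, filter_eq_empty_iff]
        intro u hu hlt
        refine hp (hP _ _ ?_ (hP _ _ hlt.le hv))
        exact h.mono_in hf (mem_range.1 hc) (Nat.zero_le u) (mem_range.1 hu)
    · have hp : P (f (C c)) := by
        refine hP _ _ ?_ hv
        rw [← hct]
        exact h.mono_in hf hc (Nat.zero_le t) ht
      rw [if_pos hp, mul_one]
      calc _ ≤ ((range ℓ).erase t).card := card_le_card fun u hu => by
              simp only [mem_filter, mem_range, mem_erase] at hu ⊢
              refine ⟨?_, hu.1⟩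
              rintro rfl
              exact absurd hu.2 (by rw [hct]; exact lt_irrefl _)
        _ < (range ℓ).card := card_erase_lt_of_mem (mem_range.2 ht)
        _ = ℓ := card_range ℓ
  omega

/-- If `v` did not have the property, all values in `P` would be smaller than `v`, and each chunk
that ends in `P` would contribute `ℓ` of them to the rank. -/
theorem Chunks.of_lt (h : Chunks f d N C K ℓ v r)
    (hf : ∀ i j, i < j → j < N → i / d = j / d → f i < f j) {P : α → Prop} (hP : Down P)
    (hr : r < ℓ * cnt (fun x => P (f (x + (ℓ - 1)))) C K) : P v := by
  classical
  by_contra hv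
  have hl := h.pos
  have key : ℓ * cnt (fun x => P (f (x + (ℓ - 1)))) C K ≤ r := by
    rw [← h.cntlt, cnt_eq_sum, mul_sum]
    refine sum_le_sum fun c hc => ?_
    by_cases hp : P (f (C c + (ℓ - 1)))
    · rw [if_pos hp, mul_one, filter_true_of_mem, card_range]
      intro u hu
      have := mem_range.1 hu
      have h1 := h.mono_in hf (mem_range.1 hc) (by omega : u ≤ ℓ - 1) (by omega)
      by_contra hc'
      exact hv (hP _ _ (not_lt.1 hc') (hP _ _ h1 hp))
    · rw [if_neg hp, mul_zero]
      exact Nat.zero_le _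
  omega

/-- `C'` lists, in the same order, those of the `K` entries of `C` that have the property `keep`. -/
structure Filtered (C : ℕ → ℕ) (K : ℕ) (C' : ℕ → ℕ) (K' : ℕ) (keep : ℕ → Prop) : Prop where
  mono : ∀ c c', c < c' → c' < K' → C' c < C' c'
  mem : ∀ i, i < K' → ∃ c, c < K ∧ keep (C c) ∧ C' i = C c
  -- Sums over arbitrary functions express that every kept entry is listed exactly once, in a form
  -- that a copying loop preserves directly.
  sum : ∀ (φ : ℕ → ℕ), (∀ x, ¬ keep x → φ x = 0) →
    ∑ i ∈ range K', φ (C' i) = ∑ c ∈ range K, φ (C c)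

theorem Filtered.card {C' : ℕ → ℕ} {K' : ℕ} {keep : ℕ → Prop} (h : Filtered C K C' K' keep) :
    K' = cnt keep C K := by
  classical
  have := h.sum (fun x => if keep x then 1 else 0) fun x hx => if_neg hx
  rw [← cnt_eq_sum, ← cnt_eq_sum] at this
  rw [← this, cnt, Nat.count_iff_forall.2]
  intro i hi
  obtain ⟨c, -, hk, he⟩ := h.mem i hi
  rwa [he]

/-- As long as no chunk containing `v` is dropped, the rank of `v` decreases by the number of
smaller values in the dropped chunks. -/
theorem Chunks.filter {C' : ℕ → ℕ} {K' : ℕ} {keep : ℕ → Prop} (h : Chunks f d N C K ℓ v r)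
    (hF : Filtered C K C' K' keep)
    (hv : ∀ c, c < K → ∀ t, t < ℓ → f (C c + t) = v → keep (C c)) {r' : ℕ}
    (hr : r' + ∑ c ∈ range K, (open Classical in if keep (C c) then 0 else
      ((range ℓ).filter fun t => f (C c + t) < v).card) = r) :
    Chunks f d N C' K' ℓ v r' := by
  classical
  refine ⟨h.pos, h.dvd, hF.mono, fun c hc => ?_, fun c hc => ?_, ?_, ?_, ?_⟩
  · obtain ⟨c', hc', -, he⟩ := hF.mem c hc
    rw [he]; exact h.al c' hc'
  · obtain ⟨c', hc', -, he⟩ := hF.mem c hc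
    rw [he]; exact h.bd c' hc'
  · exact le_trans (Nat.mul_le_mul_right _ (hF.card.le.trans (cnt_le _ _ _))) h.tot
  · obtain ⟨c, hc, t, ht, hct⟩ := h.mem
    have hk := hv c hc t ht hct
    -- The indicator of the chunk of `v` has a positive sum over the old list, hence over the new
    -- one, which must contain this chunk.
    have h1 := hF.sum (fun x => if x = C c then 1 else 0) fun x hx => if_neg (by
      rintro rfl; exact hx hk)
    have h2 : 0 < ∑ i ∈ range K', if C' i = C c then 1 else 0 := by
      rw [h1]
      exact sum_pos' (fun _ _ => Nat.zero_le _) ⟨c, mem_range.2 hc, by simp⟩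
    obtain ⟨i, hi, hne⟩ := exists_ne_zero_of_sum_ne_zero h2.ne'
    have he : C' i = C c := by
      by_contra hc
      exact hne (if_neg hc)
    exact ⟨i, mem_range.1 hi, t, ht, by rw [he, hct]⟩
  · have h1 := hF.sum (fun x => if keep x then ((range ℓ).filter fun t => f (x + t) < v).card
      else 0) fun x hx => if_neg hx
    have h2 : ∑ i ∈ range K', ((range ℓ).filter fun t => f (C' i + t) < v).card =
        ∑ i ∈ range K', if keep (C' i) then ((range ℓ).filter fun t => f (C' i + t) < v).card
          else 0 := by
      refine sum_congr rfl fun i hi => ?_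
      obtain ⟨c, -, hk, he⟩ := hF.mem i (mem_range.1 hi)
      rw [if_pos (by rwa [he])]
    rw [h2, h1]
    have h3 := h.cntlt
    have h4 : ∑ c ∈ range K, ((range ℓ).filter fun t => f (C c + t) < v).card =
        (∑ c ∈ range K, if keep (C c) then ((range ℓ).filter fun t => f (C c + t) < v).card
          else 0) + ∑ c ∈ range K, if keep (C c) then 0 else
            ((range ℓ).filter fun t => f (C c + t) < v).card := by
      rw [← sum_add_distrib]
      refine sum_congr rfl fun c _ => ?_
      split_ifs <;> simp
    omega

/-- The dropped chunks lie entirely above `p ≥ v`, so they contribute nothing to the rank. -/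
theorem Chunks.filter_high {C' : ℕ → ℕ} {K' : ℕ} {p : α} (h : Chunks f d N C K ℓ v r)
    (hf : ∀ i j, i < j → j < N → i / d = j / d → f i < f j) (hp : v ≤ p)
    (hF : Filtered C K C' K' fun x => ¬ p < f x) : Chunks f d N C' K' ℓ v r := by
  classical
  refine h.filter hF (fun c hc t ht he => ?_) ?_
  · rw [not_lt]
    refine le_trans ?_ hp
    rw [← he]
    exact h.mono_in hf hc (Nat.zero_le t) ht
  · rw [sum_eq_zero, add_zero]
    intro c hc
    by_cases hk : p < f (C c)
    · rw [if_neg (not_not.2 hk), card_eq_zero, filter_eq_empty_iff]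
      intro t ht hlt
      have := h.mono_in hf (mem_range.1 hc) (Nat.zero_le t) (mem_range.1 ht)
      exact absurd (hk.trans_le (this.trans (hlt.le.trans hp))) (lt_irrefl _)
    · rw [if_pos hk]

/-- The dropped chunks lie entirely below `p ≤ v`, so each of them accounts for exactly `ℓ` of the
rank. -/
theorem Chunks.filter_low {C' : ℕ → ℕ} {K' : ℕ} {p : α} (h : Chunks f d N C K ℓ v r)
    (hf : ∀ i j, i < j → j < N → i / d = j / d → f i < f j) (hp : p ≤ v)
    (hF : Filtered C K C' K' fun x => ¬ f (x + (ℓ - 1)) < p) :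
    Chunks f d N C' K' ℓ v (r - (K - K') * ℓ) := by
  classical
  have hl := h.pos
  have hs : (∑ c ∈ range K, if ¬ f (C c + (ℓ - 1)) < p then 0 else
      ((range ℓ).filter fun t => f (C c + t) < v).card) = (K - K') * ℓ := by
    have h1 : K' + cnt (fun x => f (x + (ℓ - 1)) < p) C K = K := by
      rw [hF.card, cnt_eq_sum, cnt_eq_sum, ← sum_add_distrib]
      calc _ = ∑ c ∈ range K, 1 := by
            refine sum_congr rfl fun c _ => ?_
            split_ifs <;> simp
        _ = K := by simp
    have h2 : K - K' = cnt (fun x => f (x + (ℓ - 1)) < p) C K := by omega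
    rw [h2, cnt_eq_sum, sum_mul]
    refine sum_congr rfl fun c hc => ?_
    by_cases hk : f (C c + (ℓ - 1)) < p
    · rw [if_neg (not_not.2 hk), if_pos hk, one_mul, filter_true_of_mem, card_range]
      intro t ht
      have := mem_range.1 ht
      have h1 := h.mono_in hf (mem_range.1 hc) (by omega : t ≤ ℓ - 1) (by omega)
      exact h1.trans_lt (hk.trans_le hp)
    · rw [if_pos hk, if_neg hk, zero_mul]
  have hle : (K - K') * ℓ ≤ r := by
    rw [← hs, ← h.cntlt]
    refine sum_le_sum fun c _ => ?_
    split_ifs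
    · exact le_rfl
    · exact Nat.zero_le _
  refine h.filter hF (fun c hc t ht he => ?_) ?_
  · rw [not_lt]
    refine hp.trans ?_
    rw [← he]
    exact h.mono_in hf hc (by omega) (by omega)
  · have e : (∑ c ∈ range K, (if ¬ f (C c + (ℓ - 1)) < p then 0 else
      ((range ℓ).filter fun t => f (C c + t) < v).card)) = (K - K') * ℓ := hs
    convert Nat.sub_add_cancel hle using 2
    rw [← hs]
    refine sum_congr rfl fun c _ => ?_
    congr

/-- Splitting every chunk into two halves. -/
theorem Chunks.split {C' : ℕ → ℕ} {k : ℕ} (h : Chunks f d N C K (2 * k) v r)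
    (h0 : ∀ c, c < K → C' (2 * c) = C c) (h1 : ∀ c, c < K → C' (2 * c + 1) = C c + k) :
    Chunks f d N C' (2 * K) k v r := by
  have hk : 0 < k := by have := h.pos; omega
  have cases2 : ∀ c, c < 2 * K → ∃ c', c' < K ∧ (c = 2 * c' ∧ C' c = C c' ∨
      c = 2 * c' + 1 ∧ C' c = C c' + k) := by
    intro c hc
    refine ⟨c / 2, by omega, ?_⟩
    rcases Nat.mod_two_eq_zero_or_one c with h2 | h2
    · left
      have e : c = 2 * (c / 2) := by omega
      exact ⟨e, by conv_lhs => rw [e, h0 _ (by omega)]⟩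
    · right
      have e : c = 2 * (c / 2) + 1 := by omega
      exact ⟨e, by conv_lhs => rw [e, h1 _ (by omega)]⟩
  refine ⟨hk, (Dvd.intro_left 2 rfl).trans h.dvd, ?_, ?_, ?_, ?_, ?_, ?_⟩
  · intro c c' hcc hc'
    obtain ⟨a, ha, ha'⟩ := cases2 c (by omega)
    obtain ⟨b, hb, hb'⟩ := cases2 c' hc'
    have gap : ∀ a b, a < b → b < K → C a + 2 * k ≤ C b := by
      intro a b hab hb
      have h2 := h.mono a b hab hb
      obtain ⟨x, hx⟩ := h.al a (by omega)
      obtain ⟨y, hy⟩ := h.al b hb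
      have hxy : x < y := by
        rw [hx, hy] at h2
        exact lt_of_mul_lt_mul_left h2 (Nat.zero_le _)
      have := Nat.mul_le_mul_left (2 * k) hxy
      rw [Nat.mul_succ] at this
      omega
    rcases (by omega : a < b ∨ a = b) with hab | hab
    · have := gap a b hab hb
      omega
    · subst hab
      omega
  · intro c hc
    obtain ⟨a, ha, ha'⟩ := cases2 c hc
    have hd : k ∣ C a := (Dvd.intro_left 2 rfl).trans (h.al a ha)
    rcases ha' with ⟨-, e⟩ | ⟨-, e⟩
    · rw [e]; exact hd
    · rw [e]; exact dvd_add hd dvd_rfl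
  · intro c hc
    obtain ⟨a, ha, ha'⟩ := cases2 c hc
    have := h.bd a ha
    omega
  · have := h.tot
    have e : 2 * K * k = K * (2 * k) := by ring
    omega
  · obtain ⟨c, hc, t, ht, hct⟩ := h.mem
    by_cases htk : t < k
    · exact ⟨2 * c, by omega, t, htk, by rw [h0 c hc, hct]⟩
    · exact ⟨2 * c + 1, by omega, t - k, by omega, by
        rw [h1 c hc, ← hct]; congr 1; omega⟩
  · rw [← h.cntlt]
    have key : ∀ M, M ≤ K → ∑ c ∈ range (2 * M), ((range k).filter fun t => f (C' c + t) < v).card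
        = ∑ c ∈ range M, ((range (2 * k)).filter fun t => f (C c + t) < v).card := by
      intro M
      induction M with
      | zero => simp
      | succ M ih =>
        intro hM
        rw [show 2 * (M + 1) = 2 * M + 1 + 1 by ring, sum_range_succ, sum_range_succ,
          sum_range_succ, ih (by omega), h0 M (by omega), h1 M (by omega), add_assoc]
        congr 1
        rw [← Nat.count_eq_card_filter_range, ← Nat.count_eq_card_filter_range,
          ← Nat.count_eq_card_filter_range, two_mul, Nat.count_add]
        simp only [add_assoc]
    exact key K le_rfl

end

end MedConv

/-! ### Programs that collect and filter chunks -/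

namespace MedConv

open Finset

variable {S n : ℕ} {c p q : Cmd} {s s' : St} {Q R : St → Prop}

/-- Copies the chunks with property `b` to the other row; the rank `ν 30` drops by `ν 33` for every
other chunk. -/
def filterCmd (b : BE) : Cmd :=
  34 ≔ 0 ;; 35 ≔ 0 ;; 36 ≔ 1 - ν 37 ;;
  .whl (.ilt (ν 34) (ν 20)) (
    .ite b (
      .iput 7 (ν 36) (ν 35) (.ld 7 (ν 37) (ν 34)) ;;
      .iput 8 (ν 36) (ν 35) (.ld 8 (ν 37) (ν 34)) ;;
      35 ≔ ν 35 + 1)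
      (30 ≔ ν 30 - ν 33) ;;
    34 ≔ ν 34 + 1) ;;
  20 ≔ ν 35 ;; 37 ≔ ν 36

/-- The test `b` stays abstract. It has to decide `keep` in every state that the copying loop can
reach, that is, one that differs from the initial state only in the loop variables, the rank, and
the target rows. -/
theorem wp_filter {b : BE} {keep : ℕ → Prop} {K ρ : ℕ} (hK : s.iv 20 = K) (h37 : s.iv 37 = ρ)
    (hρ : ρ ≤ 1) (hS : 2 ≤ S) (hKS : K < S)
    (hmono : ∀ c c', c < c' → c' < K → s.ia 8 ρ c < s.ia 8 ρ c')
    (hb : ∀ s', (∀ a, a ∉ [30, 34, 35, 36] → s'.iv a = s.iv a) → s'.ra = s.ra →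
      (∀ A, A ≠ 7 → A ≠ 8 → s'.ia A = s.ia A) → s'.ia 7 ρ = s.ia 7 ρ → s'.ia 8 ρ = s.ia 8 ρ →
      s'.iv 34 < K → b.ok S n s' ∧ (b.val s' ↔ keep (s.ia 8 ρ (s'.iv 34)))) :
    wp S n (filterCmd b) (fun s' => ∃ K', K' ≤ K ∧ s'.iv 20 = K' ∧ s'.iv 37 = 1 - ρ ∧
      Filtered (s.ia 8 ρ) K (s'.ia 8 (1 - ρ)) K' keep ∧
      (∀ i, i < K' → ∃ c, c < K ∧ s'.ia 8 (1 - ρ) i = s.ia 8 ρ c ∧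
        s'.ia 7 (1 - ρ) i = s.ia 7 ρ c) ∧
      s'.iv 30 = s.iv 30 - (K - K') * s.iv 33 ∧ s'.time ≤ s.time + 6 * K + 6) s := by
  have hρ' : ρ ≠ 1 - ρ := by omega
  simp only [filterCmd, wp_seq, wp_iset]
  refine ⟨trivial, trivial, ⟨trivial, trivial⟩, ?_⟩
  refine wp_whl (fun s' => ∃ c w, c ≤ K ∧ w ≤ c ∧ s'.iv 34 = c ∧ s'.iv 35 = w ∧
    s'.ia 7 ρ = s.ia 7 ρ ∧ s'.ia 8 ρ = s.ia 8 ρ ∧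
    (∀ i, i < w → ∃ j, j < c ∧ keep (s.ia 8 ρ j) ∧ s'.ia 8 (1 - ρ) i = s.ia 8 ρ j ∧
        s'.ia 7 (1 - ρ) i = s.ia 7 ρ j) ∧
    (∀ i i', i < i' → i' < w → s'.ia 8 (1 - ρ) i < s'.ia 8 (1 - ρ) i') ∧
    (∀ φ : ℕ → ℕ, (∀ x, ¬ keep x → φ x = 0) → ∑ i ∈ range w, φ (s'.ia 8 (1 - ρ) i) =
      ∑ j ∈ range c, φ (s.ia 8 ρ j)) ∧
    s'.iv 30 = s.iv 30 - (c - w) * s.iv 33 ∧ s'.time ≤ s.time + 3 + 6 * c)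
    (fun s' => K - s'.iv 34) ⟨0, 0, by simp⟩ ?_
  rintro s1 hf ⟨c, w, hc, hw, i34, i35, r7, r8, hm, hmo, hsum, i30, tm⟩
  have g20 : s1.iv 20 = K := by simpa [hK] using hf.iv 20 (by simp [Cmd.wI])
  have g33 : s1.iv 33 = s.iv 33 := by simpa using hf.iv 33 (by simp [Cmd.wI])
  have g36 : s1.iv 36 = 1 - ρ := by simpa [h37] using hf.iv 36 (by simp [Cmd.wI])
  have g37 : s1.iv 37 = ρ := by simpa [h37] using hf.iv 37 (by simp [Cmd.wI])
  have gb : s1.iv 34 < K → b.ok S n s1.tick ∧ (b.val s1.tick ↔ keep (s.ia 8 ρ (s1.iv 34))) := by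
    refine hb s1.tick (fun a ha => ?_) ?_ (fun A h7 h8 => ?_) r7 r8
    · have := hf.iv a (by
        simp only [List.mem_cons, List.not_mem_nil, or_false, not_or] at ha
        simp [Cmd.wI, ha])
      simp only [List.mem_cons, List.not_mem_nil, or_false, not_or] at ha
      simpa [ha] using this
    · funext A
      simpa using hf.ra A (by simp [Cmd.wRA])
    · simpa using hf.ia A (by simp [Cmd.wIA, h7, h8])
  clear hf
  refine ⟨by simp, fun hbv => ?_, fun hbv => ?_⟩
  · simp only [BE.val_ilt, IE.val_var, i34, g20] at hbv
    obtain ⟨ob, vb⟩ := gb (by omega)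
    rw [i34] at vb
    have b0 : ρ < S := by omega
    have b1 : c + 1 < S := by omega
    have b2 : w + 1 < S := by omega
    have b3 : c < S := by omega
    have b4 : w < S := by omega
    have b5 : 1 - ρ < S := by omega
    simp only [wp_seq, wp_ite, wp_iset, wp_iput, IE.ok_ld, IE.ok_add, IE.ok_sub, IE.ok_var,
      IE.ok_lit, IE.val_ld, IE.val_add, IE.val_sub, IE.val_var, IE.val_lit, St.tick_iv, St.tick_ia,
      St.tick_time, ne_eq, Nat.reduceEqDiff, not_false_eq_true,
      Function.update_of_ne, Function.update_self, i34, i35, g36, g37, g33, b0, b1, b2, b3, b4, b5,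
      true_and, and_true]
    refine ⟨ob, fun hk => ?_, fun hk => ?_⟩
    · have hk' := vb.1 hk
      have u1 : ∀ (A : ℕ → ℕ → ℕ) v i, i < w → upd2 A (1 - ρ) w v (1 - ρ) i = A (1 - ρ) i :=
        fun A v i hi => by simp [upd2, hi.ne]
      have u2 : ∀ (A : ℕ → ℕ → ℕ) v, upd2 A (1 - ρ) w v (1 - ρ) w = v :=
        fun A v => by simp [upd2]
      have u3 : ∀ (A : ℕ → ℕ → ℕ) v, upd2 A (1 - ρ) w v ρ = A ρ :=
        fun A v => by funext j; simp [upd2, hρ']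
      refine ⟨⟨c + 1, w + 1, by omega, by omega, rfl, rfl, ?_, ?_, fun i hi => ?_,
        fun i i' hii hi' => ?_, fun φ hφ => ?_, ?_, by omega⟩, by omega⟩
      · rw [u3, r7]
      · rw [u3, r8]
      · by_cases hiw : i = w
        · subst hiw
          exact ⟨c, by omega, hk', by rw [u2, r8], by rw [u2, r7]⟩
        · obtain ⟨j, hj, h1, h2, h3⟩ := hm i (by omega)
          exact ⟨j, by omega, h1, by rw [u1 _ _ _ (by omega), h2],
            by rw [u1 _ _ _ (by omega), h3]⟩
      · rw [u1 _ _ i (by omega)]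
        by_cases hiw : i' = w
        · subst hiw
          obtain ⟨j, hj, h1, h2, h3⟩ := hm i (by omega)
          rw [u2, h2, r8]
          exact hmono j c hj hbv
        · rw [u1 _ _ i' (by omega)]
          exact hmo i i' hii (by omega)
      · rw [sum_range_succ, sum_range_succ, u2, r8, ← hsum φ hφ]
        congr 1
        refine sum_congr rfl fun i hi => ?_
        rw [u1 _ _ i (mem_range.1 hi)]
      · rw [i30, Nat.add_sub_add_right]
    · have hk' : ¬ keep _ := fun h => hk (vb.2 h)
      refine ⟨⟨c + 1, w, by omega, by omega, rfl, rfl, r7, r8, fun i hi => ?_, hmo,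
        fun φ hφ => ?_, ?_, by omega⟩, by omega⟩
      · obtain ⟨j, hj, h⟩ := hm i hi
        exact ⟨j, by omega, h⟩
      · rw [sum_range_succ, hφ _ hk', add_zero, hsum φ hφ]
      · rw [i30, Nat.sub_sub, Nat.succ_sub hw, Nat.succ_mul]
  · simp only [BE.val_ilt, IE.val_var, i34, g20] at hbv
    have hcK : c = K := by omega
    subst hcK
    simp only [wp_seq, wp_iset, IE.ok_var, IE.val_var, St.tick_iv, St.tick_ia,
      St.tick_time, ne_eq, Nat.reduceEqDiff, not_false_eq_true,
      Function.update_of_ne, Function.update_self, i35, g36, true_and]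
    refine ⟨w, hw, rfl, ⟨hmo, fun i hi => ?_, hsum⟩, fun i hi => ?_, i30, by omega⟩
    · obtain ⟨j, h1, h2, h3, _⟩ := hm i hi
      exact ⟨j, h1, h2, h3⟩
    · obtain ⟨j, h1, _, h3, h4⟩ := hm i hi
      exact ⟨j, h1, h3, h4⟩

/-- The state holds chunks of the lists described by `F`, which maps positions to indices. -/
structure SChunks (F : ℕ → ℕ) (d N S : ℕ) (v : ℝ ×ₗ ℕ) (s : St) : Prop where
  ch : Chunks (fun x => s.key (F x)) d N (s.ia 8 (s.iv 37)) (s.iv 20) (s.iv 31) v (s.iv 30)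
  row : s.iv 37 ≤ 1
  cons : ∀ c, c < s.iv 20 → ∀ t, t < s.iv 31 →
    s.ia 1 (s.ia 7 (s.iv 37) c) (s.ia 8 (s.iv 37) c + t) = F (s.ia 8 (s.iv 37) c + t)
  rowS : ∀ c, c < s.iv 20 → s.ia 7 (s.iv 37) c < S

/-- The index at the beginning of chunk `ν 34`. -/
def firstE : IE := .ld 1 (.ld 7 (ν 37) (ν 34)) (.ld 8 (ν 37) (ν 34))

/-- The index at the end of chunk `ν 34`. -/
def lastE : IE := .ld 1 (.ld 7 (ν 37) (ν 34)) (.ld 8 (ν 37) (ν 34) + (ν 31 - 1))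

/-- Collects the first indices of the chunks. -/
def fillCmd : Cmd :=
  34 ≔ 0 ;; .whl (.ilt (ν 34) (ν 20)) (.iput 5 0 (ν 34) firstE ;; 34 ≔ ν 34 + 1)

/-- Discards a constant fraction of the chunks. -/
def reduceCmd : Cmd :=
  fillCmd ;; pivotCmd ;;
  .ite (.ilt (2 * ν 30) (ν 20 * ν 31))
    (33 ≔ 0 ;; filterCmd (.not (lexlt (ν 32) firstE)))
    (33 ≔ ν 31 ;; filterCmd (.not (lexlt lastE (ν 32))))

/-- What is known of the lists: their values increase within blocks of length `d`. -/
structure Lists (F : ℕ → ℕ) (kf : ℕ → ℝ ×ₗ ℕ) (d N Bd : ℕ) : Prop where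
  dpos : 0 < d
  inj : ∀ i j, i < N → j < N → kf (F i) = kf (F j) → i = j
  inc : ∀ i j, i < j → j < N → i / d = j / d → kf (F i) < kf (F j)
  bd : ∀ i, i < N → F i < Bd

theorem wp_fill {F : ℕ → ℕ} {d N : ℕ} {v : ℝ ×ₗ ℕ} (hs : SChunks F d N S v s)
    (hNS : N < S) (hKS : s.iv 20 < S) :
    wp S n fillCmd
      (fun s' => (∀ c, c < s.iv 20 → s'.ia 5 0 c = F (s.ia 8 (s.iv 37) c)) ∧
        s'.time ≤ s.time + 2 + 3 * s.iv 20) s := by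
  generalize hK : s.iv 20 = K at *
  have h8 : ∀ c, c < K → s.ia 8 (s.iv 37) c + s.iv 31 ≤ N := fun c hc => hs.ch.bd c (by omega)
  have hrow := hs.row
  have hl := hs.ch.pos
  simp only [fillCmd, wp_seq, wp_iset]
  refine ⟨trivial, ?_⟩
  refine wp_whl (fun s' => s'.iv 34 ≤ K ∧
    (∀ c, c < s'.iv 34 → s'.ia 5 0 c = F (s.ia 8 (s.iv 37) c)) ∧
    s'.time ≤ s.time + 1 + 3 * s'.iv 34) (fun s' => K - s'.iv 34) (by simp) ?_
  rintro s1 hf ⟨hc, hA, tm⟩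
  have g20 : s1.iv 20 = K := by simpa [hK] using hf.iv 20 (by decide)
  have g37 : s1.iv 37 = s.iv 37 := by simpa using hf.iv 37 (by decide)
  have a1 : s1.ia 1 = s.ia 1 := by simpa using hf.ia 1 (by decide)
  have a7 : s1.ia 7 = s.ia 7 := by simpa using hf.ia 7 (by decide)
  have a8 : s1.ia 8 = s.ia 8 := by simpa using hf.ia 8 (by decide)
  clear hf
  generalize i34 : s1.iv 34 = c at *
  refine ⟨by simp, fun hb => ?_, fun hb => ?_⟩
  · simp only [BE.val_ilt, IE.val_var, i34, g20] at hb
    have b1 := hs.rowS c (by omega)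
    have b2 := h8 c hb
    have b3 := hs.cons c (by omega) 0 hl
    have b4 : s.ia 8 (s.iv 37) c < S := by omega
    have b5 : c < S := by omega
    have b6 : c + 1 < S := by omega
    have b7 : s.iv 37 < S := by omega
    have b8 : 0 < S := by omega
    rw [add_zero] at b3
    simp only [firstE, wp_seq, wp_iset, wp_iput, IE.ok_ld, IE.ok_add, IE.ok_var, IE.ok_lit,
      IE.val_ld, IE.val_add, IE.val_var, IE.val_lit, St.tick_iv, St.tick_ia, St.tick_time,
      Function.update_self, i34, g37, a1, a7, a8, b1, b4, b5, b6, b7, b8, true_and, and_true]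
    refine ⟨⟨by omega, fun j hj => ?_, by omega⟩, by omega⟩
    by_cases hjc : j = c
    · subst hjc; simp [upd2, b3]
    · simp only [upd2, hjc, and_false, if_false]
      exact hA j (by omega)
  · simp only [BE.val_ilt, IE.val_var, i34, g20] at hb
    exact ⟨fun j hj => hA j (by omega), by simp only [St.tick_time]; omega⟩

theorem cnt_not_add (P : ℕ → Prop) (A : ℕ → ℕ) (M : ℕ) :
    cnt (fun x => ¬ P x) A M + cnt P A M = M := by
  classical
  rw [cnt_eq_sum, cnt_eq_sum, ← sum_add_distrib]
  calc _ = ∑ t ∈ range M, 1 := by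
        refine sum_congr rfl fun t _ => ?_
        split_ifs <;> simp
    _ = M := by simp

/-- After subtracting the straddling chunks at least `11 K / 16 - K / 64 ≥ K / 2` chunks lie below
the pivot, more than the rank can exhaust. -/
theorem reduce_high_rank {K ℓ r m a b : ℕ} (h1 : 64 * m < K) (hr : 2 * r < K * ℓ)
    (ha : 11 * K ≤ 16 * a) (hab : a ≤ b + m) : r < ℓ * b := by
  have h2 : K ≤ 2 * b := by omega
  have h3 := Nat.mul_le_mul_right ℓ h2
  have h4 : 2 * b * ℓ = 2 * (ℓ * b) := by ring
  omega

theorem reduce_low_rank {K ℓ r a : ℕ} (hr : ¬ 2 * r < K * ℓ) (ha : 16 * a ≤ 5 * K) :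
    ℓ * a ≤ r := by
  have h2 : 2 * a ≤ K := by omega
  have h3 := Nat.mul_le_mul_right ℓ h2
  have h4 : 2 * a * ℓ = 2 * (ℓ * a) := by ring
  omega

end MedConv

/-! ### Discarding an eighth of the chunks -/

namespace MedConv

open Finset

variable {S n : ℕ} {c p q : Cmd} {s s' : St} {Q R : St → Prop}

theorem SChunks.of_filter {F : ℕ → ℕ} {d N K' r' : ℕ} {v : ℝ ×ₗ ℕ} (hs : SChunks F d N S v s)
    (hk : s'.key = s.key) (h1 : s'.ia 1 = s.ia 1) (h37 : s'.iv 37 = 1 - s.iv 37)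
    (h20 : s'.iv 20 = K') (h31 : s'.iv 31 = s.iv 31) (h30 : s'.iv 30 = r')
    (hch : Chunks (fun x => s.key (F x)) d N (s'.ia 8 (1 - s.iv 37)) K' (s.iv 31) v r')
    (hc : ∀ i, i < K' → ∃ c, c < s.iv 20 ∧ s'.ia 8 (1 - s.iv 37) i = s.ia 8 (s.iv 37) c ∧
        s'.ia 7 (1 - s.iv 37) i = s.ia 7 (s.iv 37) c) : SChunks F d N S v s' := by
  subst h20
  refine ⟨by rw [hk, h37, h31, h30]; exact hch, by omega, fun c hcK t ht => ?_, fun c hcK => ?_⟩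
  · obtain ⟨c', h2, h3, h4⟩ := hc c hcK
    rw [h37, h1, h3, h4]
    exact hs.cons c' h2 t (by omega)
  · obtain ⟨c', h2, h3, h4⟩ := hc c hcK
    rw [h37, h4]
    exact hs.rowS c' h2

/-- If the rank is in the lower half, the pivot is the upper quartile and at most `13 K / 16 + 1`
chunks start at or below it. Otherwise the pivot is the lower quartile, and at least `15 K / 64 - 1
- m` chunks end below it. As `64 * m < K`, at most `7 K / 8` chunks remain in both cases. The `1` is
for the chunk that starts with the pivot. -/
theorem wp_reduce {F : ℕ → ℕ} {d N Bd m : ℕ} {v : ℝ ×ₗ ℕ} (hs : SChunks F d N S v s)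
    (hL : Lists F s.key d N Bd) (h5 : s.iv 5 < S) (hBd : Bd ≤ S) (hNS : 2 * N < S)
    (hm : 0 < m) (hmK : 64 * m < s.iv 20) (hmN : N ≤ m * d ∨ s.iv 31 = 1)
    (hKS : 2 ^ 15 + 100 * s.iv 20 ≤ S) :
    wp S n reduceCmd (fun s' => SChunks F d N S v s' ∧ 8 * s'.iv 20 ≤ 7 * s.iv 20 ∧
      s'.iv 31 = s.iv 31 ∧ s'.time ≤ s.time + 600000 * s.iv 20) s := by
  have hrk := hs.ch.rank_lt
  have htot := hs.ch.tot
  have hl := hs.ch.pos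
  have hch := hs.ch
  have hrow := hs.row
  have hbd : ∀ c, c < s.iv 20 → F (s.ia 8 (s.iv 37) c) < Bd := fun c hc =>
    hL.bd _ (by have := hs.ch.bd c hc; omega)
  have hbd' : ∀ c, c < s.iv 20 → F (s.ia 8 (s.iv 37) c + (s.iv 31 - 1)) < Bd := fun c hc =>
    hL.bd _ (by have := hs.ch.bd c hc; omega)
  simp only [reduceCmd, wp_seq]
  refine (wp_fill hs (by omega) (by omega)).mono ?_
  rintro s1 hf ⟨hA, tm1⟩
  have k1 : s1.key = s.key := St.key_congr (hf.ra 1 (by decide)) (hf.ra 2 (by decide))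
    (hf.iv 5 (by decide))
  have e5 := hf.iv 5 (by decide)
  have e20 := hf.iv 20 (by decide)
  have e30 := hf.iv 30 (by decide)
  have e31 := hf.iv 31 (by decide)
  have e37 := hf.iv 37 (by decide)
  have a1 := hf.ia 1 (by decide)
  have a7 := hf.ia 7 (by decide)
  have a8 := hf.ia 8 (by decide)
  clear hf
  rw [wp_seq]
  refine (wp_pivot (K := s.iv 20) (Bd := Bd) (by omega) e20 hKS (by omega) hBd
    (fun u hu => by rw [hA u hu]; exact hbd u hu) (by omega) (by rw [e31]; omega)).mono ?_
  rintro s2 hf ⟨hp, hhi, hlo, tm2⟩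
  rw [e30, e31, k1, cnt_congr hA, cnt_congr hA] at hhi hlo
  have k2 : s2.key = s.key := (St.key_congr (hf.ra 1 (by decide)) (hf.ra 2 (by decide))
    (hf.iv 5 (by decide))).trans k1
  replace e5 := (hf.iv 5 (by decide)).trans e5
  replace e20 := (hf.iv 20 (by decide)).trans e20
  replace e30 := (hf.iv 30 (by decide)).trans e30
  replace e31 := (hf.iv 31 (by decide)).trans e31
  replace e37 := (hf.iv 37 (by decide)).trans e37
  replace a1 := (hf.ia 1 (by decide)).trans a1
  replace a7 := (hf.ia 7 (by decide)).trans a7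
  replace a8 := (hf.ia 8 (by decide)).trans a8
  clear hf hA k1
  have htk : s2.tick.key = s.key := by rw [← k2]; exact St.key_congr rfl rfl rfl
  have b1 : 2 * s.iv 30 < S := by omega
  have b2 : s.iv 20 * s.iv 31 < S := by omega
  have b3 : 2 < S := by omega
  set K := s.iv 20 with hKdef
  set ℓ := s.iv 31
  set r := s.iv 30
  set ρ := s.iv 37
  have hstr := fun (P : ℝ ×ₗ ℕ → Prop) (hP : Down P) => hch.straddle hL.inc hL.dpos hmN hP
  have hrS : ∀ c, c < K → s.ia 7 ρ c < S := hs.rowS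
  have hcons := hs.cons
  have hKK : K ≤ N := (Nat.le_mul_of_pos_right _ hl).trans htot
  refine wp_ite.2 ⟨by simp [e30, e20, e31, b1, b2, b3], fun hb => ?_, fun hb => ?_⟩
  · simp only [BE.val_ilt, IE.val_mul, IE.val_lit, IE.val_var, e30, e20, e31] at hb
    obtain ⟨h1, h2⟩ := hhi hb
    have hvp : v ≤ s.key (s2.iv 32) := by
      refine hch.of_lt hL.inc (P := fun x => x ≤ s.key (s2.iv 32)) (fun x y h h' => h.trans h') ?_
      exact reduce_high_rank hmK hb h1 (hstr (fun x => x ≤ s.key (s2.iv 32))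
        (fun x y h h' => h.trans h'))
    have hcl := hch.cnt_le_succ hL.inj (s.key (s2.iv 32))
    simp only [wp_seq, wp_iset]
    refine ⟨by simp, ?_⟩
    refine (wp_filter (K := K) (ρ := ρ) (keep := fun x => ¬ s.key (s2.iv 32) < s.key (F x))
      (by simpa using e20) (by simpa using e37) hrow (by omega) (by omega) ?_ ?_).mono ?_
    · simpa [a8] using hch.mono
    · rintro s3 hiv hra hia h7 h8 hlt
      have j20 : s3.iv 20 = K := by simpa [e20] using hiv 20 (by decide)
      have j5 : s3.iv 5 = s.iv 5 := by simpa [e5] using hiv 5 (by decide)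
      have j37 : s3.iv 37 = ρ := by simpa [e37] using hiv 37 (by decide)
      have j32 : s3.iv 32 = s2.iv 32 := by simpa using hiv 32 (by decide)
      have j1 : s3.ia 1 = s.ia 1 := by simpa [a1] using hia 1 (by decide) (by decide)
      have jk : s3.key = s.key := by
        rw [← htk]
        refine St.key_congr (by rw [hra]) (by rw [hra]) ?_
        rw [j5]; exact e5.symm
      have j7 : s3.ia 7 ρ = s.ia 7 ρ := by simpa [a7] using h7
      have j8 : s3.ia 8 ρ = s.ia 8 ρ := by simpa [a8] using h8
      have hv : firstE.val s3 = F (s.ia 8 ρ (s3.iv 34)) := by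
        simpa [firstE, j37, j1, j7, j8] using hcons _ hlt 0 hl
      have c1 := hrS _ hlt
      have c2 := hch.bd _ hlt
      have c3 := hbd _ hlt
      refine ⟨?_, ?_⟩
      · rw [BE.ok_not]
        refine lexlt_ok (by simp) ?_ (by simp [j32]; omega) (by rw [hv]; omega) (by omega)
        simp [firstE, j37, j7, j8]
        omega
      · simp only [BE.val_not, lexlt_val, hv, jk, IE.val_var, j32, St.tick_ia, a8]
    · rintro s4 hf ⟨K', hK', i20, i37, hF, hcp, i30, tm⟩
      simp only [St.tick_ia, a8, a7, ne_eq, Nat.reduceEqDiff, not_false_eq_true,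
        Function.update_of_ne, Function.update_self, IE.val_lit, e30, mul_zero, Nat.sub_zero]
        at hF hcp i30 tm
      have hb4 : s4.key = s.key := by
        rw [← htk]
        exact St.key_congr (by simpa using hf.ra 1 (by decide)) (by simpa using hf.ra 2 (by decide))
          (by simpa using hf.iv 5 (by decide))
      have i31 : s4.iv 31 = ℓ := by simpa [e31] using hf.iv 31 (by decide)
      have i1 : s4.ia 1 = s.ia 1 := by simpa [a1] using hf.ia 1 (by decide)
      refine ⟨hs.of_filter hb4 i1 i37 i20 i31 (i30.trans e30) (hch.filter_high hL.inc hvp hF) hcp,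
        ?_, i31, ?_⟩
      · have := hF.card
        simp only [not_lt] at this
        rw [i20]
        have h3 : cnt (fun x => s.key (F x) < s.key (s2.iv 32)) (s.ia 8 ρ) K =
          cnt (fun j => s.key j < s.key (s2.iv 32)) (fun c => F (s.ia 8 ρ c)) K := rfl
        omega
      · simp only [St.tick_time] at tm
        omega
  · simp only [BE.val_ilt, IE.val_mul, IE.val_lit, IE.val_var, e30, e20, e31] at hb
    obtain ⟨h1, h2⟩ := hlo hb
    have hvp : s.key (s2.iv 32) ≤ v := by
      refine not_lt.1 (hch.not_of_le hL.inc (P := fun x => x < s.key (s2.iv 32))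
        (fun x y h h' => h.trans_lt h') ?_)
      exact reduce_low_rank hb h1
    have hcl := hch.cnt_le_succ hL.inj (s.key (s2.iv 32))
    have hst := hstr (fun x => x < s.key (s2.iv 32)) (fun x y h h' => h.trans_lt h')
    have hlS : ℓ < S := by
      obtain ⟨c, hc, -⟩ := hch.mem
      have := hch.bd c hc
      omega
    simp only [wp_seq, wp_iset]
    refine ⟨by simp, ?_⟩
    refine (wp_filter (K := K) (ρ := ρ)
      (keep := fun x => ¬ s.key (F (x + (ℓ - 1))) < s.key (s2.iv 32))
      (by simpa using e20) (by simpa using e37) hrow (by omega) (by omega) ?_ ?_).mono ?_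
    · simpa [a8] using hch.mono
    · rintro s3 hiv hra hia h7 h8 hlt
      have j20 : s3.iv 20 = K := by simpa [e20] using hiv 20 (by decide)
      have j5 : s3.iv 5 = s.iv 5 := by simpa [e5] using hiv 5 (by decide)
      have j37 : s3.iv 37 = ρ := by simpa [e37] using hiv 37 (by decide)
      have j31 : s3.iv 31 = ℓ := by simpa [e31] using hiv 31 (by decide)
      have j32 : s3.iv 32 = s2.iv 32 := by simpa using hiv 32 (by decide)
      have j1 : s3.ia 1 = s.ia 1 := by simpa [a1] using hia 1 (by decide) (by decide)
      have jk : s3.key = s.key := by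
        rw [← htk]
        refine St.key_congr (by rw [hra]) (by rw [hra]) ?_
        rw [j5]; exact e5.symm
      have j7 : s3.ia 7 ρ = s.ia 7 ρ := by simpa [a7] using h7
      have j8 : s3.ia 8 ρ = s.ia 8 ρ := by simpa [a8] using h8
      have hv : lastE.val s3 = F (s.ia 8 ρ (s3.iv 34) + (ℓ - 1)) := by
        simpa [lastE, j37, j1, j7, j8, j31] using hcons _ hlt (ℓ - 1) (by omega)
      have c1 := hrS _ hlt
      have c2 := hch.bd _ hlt
      have c3 := hbd' _ hlt
      refine ⟨?_, ?_⟩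
      · rw [BE.ok_not]
        refine lexlt_ok ?_ (by simp) (by rw [hv]; omega) (by simp [j32]; omega) (by omega)
        simp [lastE, j37, j7, j8, j31]
        omega
      · simp only [BE.val_not, lexlt_val, hv, jk, IE.val_var, j32, St.tick_ia, a8]
    · rintro s4 hf ⟨K', hK', i20, i37, hF, hcp, i30, tm⟩
      simp only [St.tick_ia, a8, a7, ne_eq, Nat.reduceEqDiff, not_false_eq_true, St.tick_iv,
        Function.update_of_ne, Function.update_self, IE.val_var, e30, e31] at hF hcp i30 tm
      have hb4 : s4.key = s.key := by
        rw [← htk]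
        exact St.key_congr (by simpa using hf.ra 1 (by decide)) (by simpa using hf.ra 2 (by decide))
          (by simpa using hf.iv 5 (by decide))
      have i31 : s4.iv 31 = ℓ := by simpa [e31] using hf.iv 31 (by decide)
      have i1 : s4.ia 1 = s.ia 1 := by simpa [a1] using hf.ia 1 (by decide)
      refine ⟨hs.of_filter hb4 i1 i37 i20 i31 i30 (hch.filter_low hL.inc hvp hF) hcp, ?_, i31, ?_⟩
      · have h3 := hF.card
        have h4 := cnt_not_add (fun x => s.key (F (x + (ℓ - 1))) < s.key (s2.iv 32)) (s.ia 8 ρ) K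
        rw [i20]
        have h5 : cnt (fun x => s.key (F x) ≤ s.key (s2.iv 32)) (s.ia 8 ρ) K =
          cnt (fun j => s.key j ≤ s.key (s2.iv 32)) (fun c => F (s.ia 8 ρ c)) K := rfl
        omega
      · simp only [St.tick_time] at tm
        omega

end MedConv

/-! ### Repeated reduction, and halving of chunks -/

namespace MedConv

open Finset

variable {S n : ℕ} {c p q : Cmd} {s s' : St} {Q R : St → Prop}

theorem SChunks.congr {F : ℕ → ℕ} {d N : ℕ} {v : ℝ ×ₗ ℕ} (hs : SChunks F d N S v s)
    (hk : s'.key = s.key) (h1 : s'.ia 1 = s.ia 1) (h7 : s'.ia 7 = s.ia 7) (h8 : s'.ia 8 = s.ia 8)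
    (h20 : s'.iv 20 = s.iv 20) (h30 : s'.iv 30 = s.iv 30) (h31 : s'.iv 31 = s.iv 31)
    (h37 : s'.iv 37 = s.iv 37) : SChunks F d N S v s' := by
  obtain ⟨a1, a2, a3, a4⟩ := hs
  refine ⟨?_, ?_, ?_, ?_⟩
  · rw [hk, h8, h20, h30, h31, h37]; exact a1
  · rw [h37]; exact a2
  · rw [h1, h7, h8, h20, h31, h37]; exact a3
  · rw [h7, h20, h37]; exact a4

/-- Reduces the number of chunks to `64 * ν 45`. -/
def reduceAllCmd : Cmd := .whl (.ilt (64 * ν 45) (ν 20)) reduceCmd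

/-- A pass over `K` chunks takes at most `600000 * K + 1` steps and removes at least `K / 8` of
them, so a charge of `4800008 = 8 * 600001` for each removed chunk pays for all passes. -/
theorem wp_reduceAll {F : ℕ → ℕ} {d N Bd m : ℕ} {v : ℝ ×ₗ ℕ} (hs : SChunks F d N S v s)
    (hL : Lists F s.key d N Bd) (h5 : s.iv 5 < S) (hBd : Bd ≤ S) (hNS : 2 * N < S)
    (h45 : s.iv 45 = m) (hm : 0 < m) (hmN : N ≤ m * d ∨ s.iv 31 = 1) (hmS : 64 * m < S)
    (hKS : 2 ^ 15 + 100 * s.iv 20 ≤ S) :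
    wp S n reduceAllCmd (fun s' => SChunks F d N S v s' ∧ s'.iv 20 ≤ 64 * m ∧
      s'.iv 31 = s.iv 31 ∧ s'.time ≤ s.time + 4800008 * s.iv 20 + 1) s := by
  rw [reduceAllCmd]
  refine wp_whl (fun s' => SChunks F d N S v s' ∧ s'.iv 20 ≤ s.iv 20 ∧ s'.iv 31 = s.iv 31 ∧
    s'.time + 4800008 * s'.iv 20 ≤ s.time + 4800008 * s.iv 20) (fun s' => s'.iv 20)
    ⟨hs, le_rfl, rfl, le_rfl⟩ ?_
  rintro s1 hf ⟨h1, h2, h3, h4⟩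
  have e45 := (hf.iv 45 (by decide)).trans h45
  have e5 := hf.iv 5 (by decide)
  have hk : s1.tick.key = s.key :=
    St.key_congr (hf.ra 1 (by decide)) (hf.ra 2 (by decide)) (hf.iv 5 (by decide))
  clear hf
  have b1 : 64 < S := by omega
  refine ⟨by simp [e45, hmS, b1], fun hb => ?_, fun hb => ?_⟩
  · simp only [BE.val_ilt, IE.val_mul, IE.val_lit, IE.val_var, e45] at hb
    refine (wp_reduce (s := s1.tick) (m := m) (Bd := Bd) (d := d) (N := N) (F := F) (v := v)
      (h1.congr (St.key_congr rfl rfl rfl) rfl rfl rfl rfl rfl rfl rfl) (by rw [hk]; exact hL)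
      (by simpa [e5] using h5) hBd hNS hm (by simpa using hb) (by simpa [h3] using hmN)
      (by simp only [St.tick_iv]; omega)).mono ?_
    rintro s2 - ⟨g1, g2, g3, g4⟩
    simp only [St.tick_iv, St.tick_time] at g2 g3 g4
    exact ⟨⟨g1, by omega, by omega, by omega⟩, by omega⟩
  · simp only [BE.val_ilt, IE.val_mul, IE.val_lit, IE.val_var, e45] at hb
    refine ⟨h1.congr (St.key_congr rfl rfl rfl) rfl rfl rfl rfl rfl rfl rfl, ?_, ?_, ?_⟩
    · simpa using hb
    · simpa using h3
    · simp only [St.tick_time]; omega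

/-- Halves all chunks. -/
def splitCmd : Cmd :=
  -- Half the length is looked up in the table of powers of two, because integers cannot be divided.
  46 ≔ ν 46 - 1 ;; 31 ≔ .ld 4 0 (ν 46) ;; 47 ≔ 0 ;; 48 ≔ 1 - ν 37 ;;
  .whl (.ilt (ν 47) (ν 20)) (
    .iput 7 (ν 48) (2 * ν 47) (.ld 7 (ν 37) (ν 47)) ;;
    .iput 7 (ν 48) (2 * ν 47 + 1) (.ld 7 (ν 37) (ν 47)) ;;
    .iput 8 (ν 48) (2 * ν 47) (.ld 8 (ν 37) (ν 47)) ;;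
    .iput 8 (ν 48) (2 * ν 47 + 1) (.ld 8 (ν 37) (ν 47) + ν 31) ;;
    47 ≔ ν 47 + 1) ;;
  20 ≔ 2 * ν 20 ;; 37 ≔ ν 48

theorem wp_split {F : ℕ → ℕ} {d N : ℕ} {v : ℝ ×ₗ ℕ} (hs : SChunks F d N S v s)
    (hNS : 2 * N < S) (h46 : 0 < s.iv 46) (h46S : s.iv 46 < S)
    (h4 : 2 * s.ia 4 0 (s.iv 46 - 1) = s.iv 31) :
    wp S n splitCmd (fun s' => SChunks F d N S v s' ∧ s'.iv 20 = 2 * s.iv 20 ∧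
      s'.iv 46 = s.iv 46 - 1 ∧
      s'.iv 31 = s.ia 4 0 (s.iv 46 - 1) ∧ s'.time ≤ s.time + 6 * s.iv 20 + 7) s := by
  have hl := hs.ch.pos
  have hch := hs.ch
  have hbd := hs.ch.bd
  have htot := hs.ch.tot
  have hrow := hs.row
  have hcons := hs.cons
  have hrS := hs.rowS
  generalize e4 : s.ia 4 0 (s.iv 46 - 1) = w at *
  generalize eρ : s.iv 37 = ρ at *
  generalize eK : s.iv 20 = K at *
  have hρ' : ρ ≠ 1 - ρ := by omega
  have hKN : K ≤ N := (Nat.le_mul_of_pos_right _ hl).trans htot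
  have c1 : 1 < S := by omega
  have c0 : 0 < S := by omega
  have c2 : 2 < S := by
    obtain ⟨c, hc, -⟩ := hch.mem
    omega
  simp only [splitCmd, wp_seq, wp_iset]
  refine ⟨by simp [c1], by simp; omega, by simp, by simp, ?_⟩
  refine wp_whl (fun s' => s'.iv 47 ≤ K ∧ s'.ia 7 ρ = s.ia 7 ρ ∧ s'.ia 8 ρ = s.ia 8 ρ ∧
    (∀ c, c < s'.iv 47 → s'.ia 7 (1 - ρ) (2 * c) = s.ia 7 ρ c ∧
      s'.ia 7 (1 - ρ) (2 * c + 1) = s.ia 7 ρ c ∧ s'.ia 8 (1 - ρ) (2 * c) = s.ia 8 ρ c ∧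
      s'.ia 8 (1 - ρ) (2 * c + 1) = s.ia 8 ρ c + w) ∧
    s'.time ≤ s.time + 4 + 6 * s'.iv 47) (fun s' => K - s'.iv 47) (by simp) ?_
  rintro s1 hf ⟨hc, h7, h8, hA, tm⟩
  have g20 : s1.iv 20 = K := by simpa [eK] using hf.iv 20 (by decide)
  have g30 : s1.iv 30 = s.iv 30 := by simpa using hf.iv 30 (by decide)
  have g31 : s1.iv 31 = w := by simpa [e4] using hf.iv 31 (by decide)
  have g37 : s1.iv 37 = ρ := by simpa [eρ] using hf.iv 37 (by decide)
  have g46 : s1.iv 46 = s.iv 46 - 1 := by simpa using hf.iv 46 (by decide)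
  have g48 : s1.iv 48 = 1 - ρ := by simpa [eρ] using hf.iv 48 (by decide)
  have a1 : s1.ia 1 = s.ia 1 := by simpa using hf.ia 1 (by decide)
  have hk : s1.key = s.key := St.key_congr (by simpa using hf.ra 1 (by decide))
    (by simpa using hf.ra 2 (by decide)) (by simpa using hf.iv 5 (by decide))
  clear hf
  generalize i47 : s1.iv 47 = c at *
  refine ⟨by simp, fun hb => ?_, fun hb => ?_⟩
  · simp only [BE.val_ilt, IE.val_var, i47, g20] at hb
    have b1 := hbd c hb
    have b2 := hrS c hb
    have b3 : ρ < S := by omega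
    have b4 : 1 - ρ < S := by omega
    have b5 : 2 * c + 1 < S := by omega
    have b6 : 2 * c < S := by omega
    have b7 : s.ia 8 ρ c + w < S := by omega
    have b8 : c < S := by omega
    have b9 : c + 1 < S := by omega
    have b10 : s.ia 8 ρ c < S := by omega
    have b11 : 2 < S := by omega
    have u3 : ∀ (A : ℕ → ℕ → ℕ) x v, upd2 A (1 - ρ) x v ρ = A ρ :=
        fun A x v => by funext j; simp [upd2, hρ']
    simp only [wp_seq, wp_iset, wp_iput, IE.ok_ld, IE.ok_add, IE.ok_mul, IE.ok_var, IE.ok_lit,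
      IE.val_ld, IE.val_add, IE.val_mul, IE.val_var, IE.val_lit, St.tick_iv, St.tick_ia,
      St.tick_time, ne_eq, Nat.reduceEqDiff, not_false_eq_true, Function.update_of_ne,
      Function.update_self, i47, g37, g48, g31, h7, h8, u3, b2, b3, b4, b5, b6, b7, b8, b9, b10,
      b11, c1, true_and, and_true]
    refine ⟨⟨by omega, fun j hj => ?_, by omega⟩, by omega⟩
    by_cases hjc : j = c
    · subst hjc
      simp [upd2]
    · have q1 : 2 * j ≠ 2 * c := by omega
      have q2 : 2 * j ≠ 2 * c + 1 := by omega
      have q3 : 2 * j + 1 ≠ 2 * c := by omega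
      have q4 : 2 * j + 1 ≠ 2 * c + 1 := by omega
      simp only [upd2, q1, q2, q3, q4, and_false, if_false]
      exact hA j (by omega)
  · simp only [BE.val_ilt, IE.val_var, i47, g20] at hb
    have hcK : c = K := by omega
    subst hcK
    have b1 : 2 * c < S := by omega
    simp only [wp_seq, wp_iset, IE.ok_mul, IE.ok_var, IE.ok_lit,
      IE.val_mul, IE.val_var, IE.val_lit, St.tick_iv, St.tick_ia,
      St.tick_time, ne_eq, Nat.reduceEqDiff, not_false_eq_true, Function.update_of_ne,
      Function.update_self, g20, g48, g31, g46, b1, c2, true_and, and_true]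
    refine ⟨?_, by omega⟩
    have hsp : Chunks (fun x => s.key (F x)) d N (s1.ia 8 (1 - ρ)) (2 * c) w v (s.iv 30) := by
      refine Chunks.split (by rw [h4]; exact hch) (fun j hj => (hA j hj).2.2.1)
        (fun j hj => (hA j hj).2.2.2)
    have hk2 : ∀ t : St, t.ra = s1.ra → t.iv 5 = s1.iv 5 → t.key = s.key := fun t h h' => by
      rw [← hk]; exact St.key_congr (by rw [h]) (by rw [h]) h'
    refine ⟨?_, ?_, ?_, ?_⟩
    · rw [hk2 _ (by simp) (by simp)]
      simpa [g20, g48, g31, g30] using hsp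
    · simp
    · intro j hj t ht
      simp only [ne_eq, Nat.reduceEqDiff, not_false_eq_true, Function.update_of_ne,
        Function.update_self, St.tick_iv, g31] at hj ht
      simp only [Function.update_self, St.tick_ia]
      have hj2 : j / 2 < c := by omega
      obtain ⟨q1, q2, q3, q4⟩ := hA (j / 2) hj2
      rw [a1]
      rcases Nat.mod_two_eq_zero_or_one j with h2 | h2
      · have e : j = 2 * (j / 2) := by omega
        rw [e, q1, q3]
        exact hcons _ hj2 t (by omega)
      · have e : j = 2 * (j / 2) + 1 := by omega
        rw [e, q2, q4, add_assoc]
        exact hcons _ hj2 _ (by omega)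
    · intro j hj
      simp only [ne_eq, Nat.reduceEqDiff, not_false_eq_true, Function.update_of_ne,
        Function.update_self, St.tick_iv] at hj
      simp only [Function.update_self, St.tick_ia]
      have hj2 : j / 2 < c := by omega
      obtain ⟨q1, q2, q3, q4⟩ := hA (j / 2) hj2
      rcases Nat.mod_two_eq_zero_or_one j with h2 | h2
      · have e : j = 2 * (j / 2) := by omega
        rw [e, q1]
        exact hrS _ hj2
      · have e : j = 2 * (j / 2) + 1 := by omega
        rw [e, q2]
        exact hrS _ hj2

end MedConv

/-! ### Selection in sorted blocks -/

namespace MedConv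

open Finset

variable {S n : ℕ} {c p q : Cmd} {s s' : St} {Q R : St → Prop}

/-- The index at a position, read from the table row that belongs to its block of length `d`. -/
def St.list (s : St) (d pos : ℕ) : ℕ := s.ia 1 (s.ia 3 (pos / d) (s.iv 5 - pos / d * d)) pos

/-- Sets up one chunk for each block. -/
def startCmd : Cmd :=
  20 ≔ 0 ;; 43 ≔ 0 ;; 37 ≔ 0 ;;
  .whl (.ilt (ν 43) (ν 42 + 1)) (
    .iput 7 0 (ν 20) (.ld 3 (ν 20) (ν 5 - ν 43)) ;;
    .iput 8 0 (ν 20) (ν 43) ;;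
    20 ≔ ν 20 + 1 ;; 43 ≔ ν 43 + ν 40) ;;
  45 ≔ ν 20 ;; 46 ≔ ν 41 ;; 31 ≔ ν 40

/-- The two inequalities on `m * d` say that `m = k / d + 1`, the number of blocks that meet `[0,
k]`. -/
theorem wp_start {d m k : ℕ} (h42 : s.iv 42 = k) (h40 : s.iv 40 = d) (hd : 0 < d)
    (h5 : s.iv 5 < S) (hm1 : m * d ≤ k + d) (hm2 : k < m * d) (hS : k + d < S) :
    wp S n startCmd (fun s' => s'.iv 20 = m ∧ s'.iv 37 = 0 ∧ s'.iv 45 = m ∧ s'.iv 46 = s.iv 41 ∧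
      s'.iv 31 = d ∧ (∀ c, c < m → s'.ia 7 0 c = s.ia 3 c (s.iv 5 - c * d) ∧
        s'.ia 8 0 c = c * d) ∧ s'.time ≤ s.time + 5 * m + 7) s := by
  have hmS : m ≤ k + d := (Nat.le_mul_of_pos_right _ hd).trans hm1
  simp only [startCmd, wp_seq, wp_iset]
  have c0 : 0 < S := by omega
  refine ⟨by simp [c0], by simp [c0], by simp [c0], ?_⟩
  refine wp_whl (fun s' => s'.iv 20 ≤ m ∧ s'.iv 43 = s'.iv 20 * d ∧
    (∀ c, c < s'.iv 20 → s'.ia 7 0 c = s.ia 3 c (s.iv 5 - c * d) ∧ s'.ia 8 0 c = c * d) ∧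
    s'.time ≤ s.time + 3 + 5 * s'.iv 20) (fun s' => m - s'.iv 20) (by simp) ?_
  rintro s1 hf ⟨hc, h43, hA, tm⟩
  have g5 : s1.iv 5 = s.iv 5 := by simpa using hf.iv 5 (by decide)
  have g40 : s1.iv 40 = d := by simpa [h40] using hf.iv 40 (by decide)
  have g41 : s1.iv 41 = s.iv 41 := by simpa using hf.iv 41 (by decide)
  have g42 : s1.iv 42 = k := by simpa [h42] using hf.iv 42 (by decide)
  have g37 : s1.iv 37 = 0 := by simpa using hf.iv 37 (by decide)
  have a3 : s1.ia 3 = s.ia 3 := by simpa using hf.ia 3 (by decide)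
  clear hf
  generalize i20 : s1.iv 20 = K at *
  refine ⟨by simp [g42]; omega, fun hb => ?_, fun hb => ?_⟩
  · simp only [BE.val_ilt, IE.val_add, IE.val_lit, IE.val_var, h43, g42] at hb
    have hKm : K < m := Nat.lt_of_mul_lt_mul_right (a := d) (by omega)
    have hKm' : (K + 1) * d ≤ m * d := Nat.mul_le_mul_right d hKm
    rw [Nat.succ_mul] at hKm'
    have b1 : K < S := by omega
    have b2 : K + 1 < S := by omega
    have b3 : s.iv 5 - K * d < S := by omega
    have b4 : K * d < S := by omega
    have b5 : K * d + d < S := by omega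
    simp only [wp_seq, wp_iset, wp_iput, IE.ok_ld, IE.ok_add, IE.ok_sub, IE.ok_var, IE.ok_lit,
      IE.val_ld, IE.val_add, IE.val_sub, IE.val_var, IE.val_lit, St.tick_iv, St.tick_ia,
      St.tick_time, ne_eq, Nat.reduceEqDiff, not_false_eq_true, Function.update_of_ne,
      Function.update_self, i20, h43, g5, g40, a3, b1, b2, b3, b4, b5, c0, true_and, and_true]
    refine ⟨⟨by omega, by rw [Nat.succ_mul], fun j hj => ?_, by omega⟩, by omega⟩
    by_cases hjc : j = K
    · subst hjc
      simp [upd2]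
    · simp only [upd2, hjc, and_false, if_false]
      exact hA j (by omega)
  · simp only [BE.val_ilt, IE.val_add, IE.val_lit, IE.val_var, h43, g42] at hb
    have hKm : m < K + 1 := Nat.lt_of_mul_lt_mul_right (a := d) (by rw [Nat.succ_mul]; omega)
    have hcK : K = m := by omega
    subst hcK
    simp only [wp_seq, wp_iset, IE.ok_var, IE.val_var, St.tick_iv, St.tick_ia,
      St.tick_time, ne_eq, Nat.reduceEqDiff, not_false_eq_true, Function.update_of_ne,
      Function.update_self, i20, g37, g40, g41, true_and]
    exact ⟨hA, by omega⟩

theorem count_blocks (P : ℕ → Prop) [DecidablePred P] (m d : ℕ) :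
    ∑ c ∈ range m, ((range d).filter fun t => P (c * d + t)).card = Nat.count P (m * d) := by
  induction m with
  | zero => simp
  | succ m ih =>
    rw [sum_range_succ, ih, Nat.succ_mul, Nat.count_add, Nat.count_eq_card_filter_range
      (fun t => P (m * d + t))]

theorem SChunks.start {d m κ r : ℕ} {v : ℝ ×ₗ ℕ} (hd : 0 < d) {s0 : St}
    (hv : ∃ pos, pos < m * d ∧ s0.key (s0.list d pos) = v)
    (hr : (open Classical in Nat.count (fun pos => s0.key (s0.list d pos) < v) (m * d)) = r)
    (hrow : ∀ c, c < m → s0.ia 3 c (κ - c * d) < S) (h5 : s0.iv 5 = κ)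
    (hk : s.key = s0.key) (h1 : s.ia 1 = s0.ia 1) (h30 : s.iv 30 = r)
    (h20 : s.iv 20 = m) (h37 : s.iv 37 = 0) (h31 : s.iv 31 = d)
    (hA : ∀ c, c < m → s.ia 7 0 c = s0.ia 3 c (κ - c * d) ∧ s.ia 8 0 c = c * d) :
    SChunks (s0.list d) d (m * d) S v s := by
  classical
  refine ⟨?_, by omega, ?_, ?_⟩
  · rw [hk, h30, h20, h37, h31]
    refine ⟨hd, dvd_rfl, fun c c' hc hc' => ?_, fun c hc => ?_, fun c hc => ?_, le_rfl, ?_, ?_⟩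
    · rw [(hA c (by omega)).2, (hA c' hc').2]
      exact Nat.mul_lt_mul_of_pos_right hc hd
    · rw [(hA c hc).2]; exact Nat.dvd_mul_left d c
    · rw [(hA c hc).2, ← Nat.succ_mul]
      exact Nat.mul_le_mul_right d hc
    · obtain ⟨pos, hp, hpv⟩ := hv
      have hpm : pos / d < m := (Nat.div_lt_iff_lt_mul hd).2 hp
      refine ⟨pos / d, hpm, pos % d, Nat.mod_lt _ hd, ?_⟩
      rw [(hA _ hpm).2, mul_comm, Nat.div_add_mod]
      exact hpv
    · rw [← hr]
      have h := count_blocks (fun pos => s0.key (s0.list d pos) < v) m d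
      rw [← h]
      refine sum_congr rfl fun c hc => ?_
      rw [(hA c (mem_range.1 hc)).2]
  · rw [h20, h37, h31, h1]
    intro c hc t ht
    have e : (c * d + t) / d = c := by
      rw [mul_comm, Nat.mul_add_div hd, Nat.div_eq_of_lt ht, add_zero]
    rw [(hA c hc).1, (hA c hc).2, St.list, e, h5]
  · rw [h20, h37]
    intro c hc
    rw [(hA c hc).1]; exact hrow c hc

/-- In a sorted list, the element of rank `r` is at position `r`. -/
theorem eq_of_rank {α : Type*} [LinearOrder α] {f : ℕ → α} {B : ℕ → ℕ} {K r : ℕ} {v : α}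
    (hs : ∀ t t', t < t' → t' < K → f (B t) ≤ f (B t')) (hv : ∃ t, t < K ∧ f (B t) = v)
    (hr : cnt (fun x => f x < v) B K = r) : r < K ∧ f (B r) = v := by
  classical
  have hs' : ∀ t t', t ≤ t' → t' < K → f (B t) ≤ f (B t') := fun t t' h h' => by
    rcases h.lt_or_eq with h | rfl
    · exact hs t t' h h'
    · exact le_rfl
  obtain ⟨t, ht, hvt⟩ := hv
  rw [cnt_eq_card] at hr
  have h1 : r ≤ t := by
    rw [← hr, ← card_range t]
    refine card_le_card fun u hu => ?_
    simp only [mem_filter, mem_range] at hu ⊢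
    by_contra hc
    exact absurd (hu.2.trans_eq hvt.symm) (hs' t u (by omega) hu.1).not_gt
  refine ⟨by omega, le_antisymm ?_ ?_⟩
  · rw [← hvt]; exact hs' _ _ h1 ht
  · by_contra hc
    rw [not_le] at hc
    have h2 : (range (r + 1)).card ≤ r := by
      conv_rhs => rw [← hr]
      refine card_le_card fun u hu => ?_
      simp only [mem_filter, mem_range] at hu ⊢
      exact ⟨by omega, (hs' u r (by omega) (by omega)).trans_lt hc⟩
    simp at h2

/-- Splits and reduces the chunks until their length is `1`. -/
def descendCmd : Cmd := .whl (.ilt 0 (ν 46)) (splitCmd ;; reduceAllCmd)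

/-- Each level reduces at most `128 * m` chunks at `4800008` steps per chunk, about `6.2 * 10 ^ 8 *
m` steps; the rest of `10 ^ 9 * m` covers the splitting. -/
theorem descend_cost {m L w t0 t1 t2 t3 K : ℕ} (hm : 0 < m) (hw : w ≤ L) (hw0 : 0 < w)
    (hK : K ≤ 64 * m)
    (h1 : t1 ≤ t0 + 1000000000 * m * (L - w)) (h2 : t2 ≤ t1 + 1 + 6 * K + 7)
    (h3 : t3 ≤ t2 + 4800008 * (2 * K) + 1) :
    t3 ≤ t0 + 1000000000 * m * (L - (w - 1)) := by
  have e : L - (w - 1) = L - w + 1 := by omega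
  rw [e, Nat.mul_succ]
  omega

theorem wp_descend {F : ℕ → ℕ} {d N Bd m L : ℕ} {v : ℝ ×ₗ ℕ} (hs : SChunks F d N S v s)
    (hL : Lists F s.key d N Bd) (h5 : s.iv 5 < S) (hBd : Bd ≤ S) (hNS : 2 * N < S)
    (h45 : s.iv 45 = m) (h20 : s.iv 20 ≤ 64 * m) (hm : 0 < m) (hmN : N ≤ m * d)
    (h46 : s.iv 46 = L) (hLS : L < S) (h31 : s.iv 31 = 2 ^ L)
    (hpw : ∀ i, i ≤ L → s.ia 4 0 i = 2 ^ i) (hmS : 2 ^ 15 + 12800 * m ≤ S) :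
    wp S n descendCmd (fun s' => SChunks F d N S v s' ∧ s'.iv 31 = 1 ∧ s'.iv 20 ≤ 64 * m ∧
      s'.time ≤ s.time + 1000000000 * m * L + 1) s := by
  rw [descendCmd]
  refine wp_whl (fun s' => SChunks F d N S v s' ∧ s'.iv 20 ≤ 64 * m ∧ s'.iv 31 = 2 ^ s'.iv 46 ∧
    s'.iv 46 ≤ L ∧
    s'.time ≤ s.time + 1000000000 * m * (L - s'.iv 46)) (fun s' => s'.iv 46)
    ⟨hs, h20, by rw [h31, h46], h46.le, by simp⟩ ?_
  rintro s1 hf ⟨h1, h2, h3, h4, tm⟩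
  have e45 := (hf.iv 45 (by decide)).trans h45
  have e5 := hf.iv 5 (by decide)
  have a4 := hf.ia 4 (by decide)
  have hk : s1.key = s.key :=
    St.key_congr (hf.ra 1 (by decide)) (hf.ra 2 (by decide)) (hf.iv 5 (by decide))
  clear hf
  have h1' : SChunks F d N S v s1.tick :=
    h1.congr (St.key_congr rfl rfl rfl) rfl rfl rfl rfl rfl rfl rfl
  refine ⟨by simp, fun hb => ?_, fun hb => ?_⟩
  · simp only [BE.val_ilt, IE.val_lit, IE.val_var] at hb
    rw [wp_seq]
    have hpow : 2 * 2 ^ (s1.iv 46 - 1) = 2 ^ s1.iv 46 := by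
      rw [← pow_succ', Nat.sub_add_cancel hb]
    refine (wp_split h1' hNS hb (by simp only [St.tick_iv]; omega) ?_).mono ?_
    · simp only [St.tick_iv, St.tick_ia, a4, h3]
      rw [hpw _ (by omega), hpow]
    rintro s2 hf ⟨g1, g2, g3, g4, g5⟩
    have k2 : s2.key = s.key := (St.key_congr (hf.ra 1 (by decide)) (hf.ra 2 (by decide))
      (hf.iv 5 (by decide))).trans hk
    have e45' : s2.iv 45 = m := (hf.iv 45 (by decide)).trans e45
    have e5' : s2.iv 5 = s.iv 5 := (hf.iv 5 (by decide)).trans e5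
    clear hf
    simp only [St.tick_iv, St.tick_ia, St.tick_time] at g2 g3 g4 g5
    rw [a4, hpw _ (by omega)] at g4
    refine (wp_reduceAll (m := m) (Bd := Bd) g1 (by rw [k2]; exact hL) (by omega) hBd hNS e45' hm
      (Or.inl hmN) (by omega) (by omega)).mono ?_
    rintro s3 hf ⟨j1, j2, j3, j4⟩
    have e46 := hf.iv 46 (by decide)
    refine ⟨⟨j1, j2, by rw [j3, g4, e46, g3], by omega, ?_⟩, by omega⟩
    rw [e46, g3]
    exact descend_cost hm h4 hb h2 tm g5 (by rw [← g2]; exact j4)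
  · simp only [BE.val_ilt, IE.val_lit, IE.val_var] at hb
    have h0 : s1.iv 46 = 0 := by omega
    rw [h0] at h3 tm
    simp only [Nat.sub_zero] at tm
    exact ⟨h1', by simpa using h3, h2, by simp only [St.tick_time]; omega⟩

/-- Takes the element of rank `ν 30` of at most `64` chunks of length `1`. -/
def pickCmd : Cmd :=
  fillCmd ;; 6 ≔ 0 ;; 7 ≔ ν 20 ;; 8 ≔ 0 ;; sortCmd ;; 49 ≔ .ld 5 0 (ν 30)

theorem wp_pick {F : ℕ → ℕ} {d N Bd : ℕ} {v : ℝ ×ₗ ℕ} (hs : SChunks F d N S v s)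
    (hL : Lists F s.key d N Bd) (h5 : s.iv 5 < S) (hBd : Bd ≤ S) (hNS : 2 * N < S)
    (h31 : s.iv 31 = 1) (h20 : s.iv 20 ≤ 64) :
    wp S n pickCmd (fun s' => s'.iv 49 < Bd ∧ s.key (s'.iv 49) = v ∧
      s'.time ≤ s.time + 50000) s := by
  classical
  have htot := hs.ch.tot
  have hbd := hs.ch.bd
  have hrank := hs.ch.rank_lt
  rw [h31, mul_one] at htot hrank
  rw [h31] at hbd
  have hv : ∃ t, t < s.iv 20 ∧ s.key (F (s.ia 8 (s.iv 37) t)) = v := by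
    obtain ⟨c, hc, t, ht, h⟩ := hs.ch.mem
    rw [h31, Nat.lt_one_iff] at ht
    subst ht
    exact ⟨c, hc, h⟩
  have hcnt : cnt (fun x => s.key x < v) (fun c => F (s.ia 8 (s.iv 37) c)) (s.iv 20) =
      s.iv 30 := by
    rw [← hs.ch.cntlt, h31, cnt_eq_sum]
    refine sum_congr rfl fun c _ => ?_
    rw [range_one, filter_singleton]
    split_ifs with h1 h2 h2
    · simp
    · exact absurd h1 h2
    · exact absurd h2 h1
    · simp
  simp only [pickCmd, wp_seq]
  refine (wp_fill hs (by omega) (by omega)).mono ?_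
  rintro s1 hf ⟨hA, tm1⟩
  have k1 : s1.key = s.key := St.key_congr (hf.ra 1 (by decide)) (hf.ra 2 (by decide))
    (hf.iv 5 (by decide))
  have e5 := hf.iv 5 (by decide)
  have e20 := hf.iv 20 (by decide)
  have e30 := hf.iv 30 (by decide)
  clear hf
  simp only [wp_seq, wp_iset]
  have c0 : 0 < S := by omega
  refine ⟨by simp [c0], by simp, by simp [c0], ?_⟩
  refine (wp_sort (by simpa [e5] using h5) (by simp [e20]; omega) (by simp [c0]) ?_).mono ?_
  · intro t ht
    simp only [ne_eq, Nat.reduceEqDiff, not_false_eq_true, Function.update_of_ne, IE.val_var,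
      Function.update_self, IE.val_lit, zero_add] at ht ⊢
    rw [hA t (e20 ▸ ht)]
    exact (hL.bd _ (by have := hbd t (e20 ▸ ht); omega)).trans_le hBd
  rintro s2 hf ⟨-, hperm, hsort, tm⟩
  have f30 : s2.iv 30 = s.iv 30 := by simpa [e30] using hf.iv 30 (by decide)
  simp only [ne_eq, Nat.reduceEqDiff, not_false_eq_true, Function.update_of_ne, IE.val_var,
    Function.update_self, IE.val_lit, zero_add, e20] at hperm hsort tm
  have kk : ∀ t : St, t.ra = s1.ra → t.iv 5 = s1.iv 5 → t.key = s.key := fun t h h' => by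
    rw [← k1]; exact St.key_congr (by rw [h]) (by rw [h]) h'
  rw [kk _ (by simp) (by simp)] at hsort
  have hcnt2 := hperm.cnt_eq (fun x => s.key x < v)
  simp only [zero_add] at hcnt2
  have hrk := eq_of_rank hsort (v := v) (r := s.iv 30) ?_ ?_
  · obtain ⟨i, hi, he⟩ := hperm.exists_eq (j := s.iv 30) (by omega)
    have hent : s2.ia 5 0 (s.iv 30) < Bd := by
      rw [he, hA i (by omega)]
      exact hL.bd _ (by have := hbd i (by omega); omega)
    simp only [wp_iset, IE.ok_ld, IE.ok_lit, IE.ok_var, IE.val_ld, IE.val_lit, IE.val_var, f30,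
      Function.update_self, c0, true_and]
    refine ⟨by omega, hent, hrk.2, ?_⟩
    -- Sorting the survivors takes at most `10 * 65 ^ 2 = 42250` steps.
    have : (s.iv 20 + 1) ^ 2 ≤ 65 ^ 2 := Nat.pow_le_pow_left (by omega) 2
    omega
  · obtain ⟨t, ht, h⟩ := hv
    obtain ⟨i, hi, he⟩ := hperm.exists_eq' (j := t) (by omega)
    exact ⟨i, by omega, by rw [he, hA t ht]; exact h⟩
  · rw [← hcnt, ← cnt_congr hA]
    exact hcnt2

/-- Finds the index of rank `ν 30` in the lists. -/
def selectCmd : Cmd :=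
  startCmd ;; descendCmd ;; 45 ≔ 1 ;; reduceAllCmd ;; pickCmd

/-- As long as chunks are longer than `1`, the allowance for straddling chunks is one per block,
which is `m`. At length `1` nothing straddles, so the allowance is reset to `1` and the reduction
continues down to `64` chunks, which are sorted. -/
theorem wp_select {d L m k Bd : ℕ} {v : ℝ ×ₗ ℕ} (h42 : s.iv 42 = k) (h40 : s.iv 40 = d)
    (h41 : s.iv 41 = L) (hLS : L < S) (hd : d = 2 ^ L)
    (hpw : ∀ i, i ≤ L → s.ia 4 0 i = 2 ^ i) (h5 : s.iv 5 < S)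
    (hm1 : m * d ≤ k + d) (hm2 : k < m * d) (hm : 0 < m) (hS : k + d < S)
    (hL : Lists (s.list d) s.key d (m * d) Bd) (hBd : Bd ≤ S)
    (hv : ∃ pos, pos < m * d ∧ s.key (s.list d pos) = v)
    (hr : (open Classical in Nat.count (fun pos => s.key (s.list d pos) < v) (m * d)) = s.iv 30)
    (hrow : ∀ c, c < m → s.ia 3 c (s.iv 5 - c * d) < S)
    (hmS : 2 ^ 15 + 12800 * m ≤ S) (hNS : 2 * (m * d) < S) :
    wp S n selectCmd (fun s' => s'.iv 49 < Bd ∧ s.key (s'.iv 49) = v ∧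
      s'.time ≤ s.time + 1000000000 * m * (L + 1)) s := by
  have hd0 : 0 < d := hL.dpos
  simp only [selectCmd, wp_seq]
  refine (wp_start h42 h40 hd0 h5 hm1 hm2 hS).mono ?_
  rintro s1 hf ⟨g20, g37, g45, g46, g31, hA, tm1⟩
  have k1 : s1.key = s.key := St.key_congr (hf.ra 1 (by decide)) (hf.ra 2 (by decide))
    (hf.iv 5 (by decide))
  have e5 := hf.iv 5 (by decide)
  have e30 := hf.iv 30 (by decide)
  have a1 := hf.ia 1 (by decide)
  have a4 := hf.ia 4 (by decide)
  clear hf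
  have hch := SChunks.start (S := S) hd0 hv hr hrow rfl k1 a1 e30 g20 g37 g31 hA
  rw [wp_seq]
  refine (wp_descend (L := L) (m := m) hch (by rw [k1]; exact hL) (by omega) hBd hNS g45 (by omega)
    hm le_rfl (g46.trans h41) hLS (g31.trans hd) (by rw [a4]; exact hpw) hmS).mono ?_
  rintro s2 hf ⟨hc2, g31', g20', tm2⟩
  have k2 : s2.key = s.key := (St.key_congr (hf.ra 1 (by decide)) (hf.ra 2 (by decide))
    (hf.iv 5 (by decide))).trans k1
  have e5' := (hf.iv 5 (by decide)).trans e5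
  clear hf
  simp only [wp_seq, wp_iset]
  refine ⟨by simp, ?_⟩
  generalize hs3 : ({ s2 with
    iv := Function.update s2.iv 45 (IE.val s2 1), time := s2.time + 1 } : St) = s3
  have k3 : s3.key = s.key := by
    rw [← k2, ← hs3]; exact St.key_congr rfl rfl rfl
  have c3 : SChunks (s.list d) d (m * d) S v s3 := by
    rw [← hs3]
    exact hc2.congr (St.key_congr rfl rfl rfl) rfl rfl rfl rfl rfl rfl rfl
  have e53 : s3.iv 5 = s.iv 5 := by rw [← hs3]; exact e5'
  have i45 : s3.iv 45 = 1 := by rw [← hs3]; rfl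
  have i20 : s3.iv 20 = s2.iv 20 := by rw [← hs3]; rfl
  have i31 : s3.iv 31 = 1 := by rw [← hs3]; exact g31'
  have t3 : s3.time = s2.time + 1 := by rw [← hs3]
  clear hs3
  refine (wp_reduceAll (m := 1) (Bd := Bd) c3 (by rw [k3]; exact hL) (by omega) hBd hNS i45 one_pos
    (Or.inr i31) (by omega) (by omega)).mono ?_
  rintro s4 hf ⟨c4, g20'', g31'', tm4⟩
  have k4 : s4.key = s.key := (St.key_congr (hf.ra 1 (by decide)) (hf.ra 2 (by decide))
    (hf.iv 5 (by decide))).trans k3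
  have e54 := (hf.iv 5 (by decide)).trans e53
  clear hf
  refine (wp_pick (Bd := Bd) c4 (by rw [k4]; exact hL) (by omega) hBd hNS (by omega)
    (by omega)).mono ?_
  rintro s5 - ⟨j1, j2, j3⟩
  refine ⟨j1, by rw [← k4]; exact j2, ?_⟩
  rw [Nat.mul_succ]
  omega

end MedConv

/-! ### Sorting the differences of a group of blocks -/

namespace MedConv

open Finset

variable {S n : ℕ} {c p q : Cmd} {s s' : St} {Q R : St → Prop}

/-- `B` results from `A` by moving the entries from `j` to `I` one place up. -/
theorem insert_sorted {A B : ℕ → ℝ} {I j : ℕ} {u : ℝ} (hj : j ≤ I)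
    (hA : ∀ i i', i < i' → i' < I → A i ≤ A i') (h1 : ∀ i, i < j → B i = A i)
    (h2 : B j = u) (h3 : ∀ i, j ≤ i → i < I → B (i + 1) = A i)
    (hlo : ∀ i, i < j → A i ≤ u) (hhi : ∀ i, j ≤ i → i < I → u ≤ A i) :
    ∀ i i', i < i' → i' < I + 1 → B i ≤ B i' := by
  intro i i' hii hi'
  rcases lt_trichotomy i j with hi | hi | hi
  · rw [h1 i hi]
    rcases lt_trichotomy i' j with h | h | h
    · rw [h1 i' h]; exact hA i i' hii (by omega)
    · rw [h, h2]; exact hlo i hi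
    · obtain ⟨l, rfl⟩ : ∃ l, i' = l + 1 := ⟨i' - 1, by omega⟩
      rw [h3 l (by omega) (by omega)]
      exact hA i l (by omega) (by omega)
  · obtain ⟨l, rfl⟩ : ∃ l, i' = l + 1 := ⟨i' - 1, by omega⟩
    rw [hi, h2, h3 l (by omega) (by omega)]
    exact hhi l (by omega) (by omega)
  · obtain ⟨l, rfl⟩ : ∃ l, i' = l + 1 := ⟨i' - 1, by omega⟩
    obtain ⟨l', rfl⟩ : ∃ l', i = l' + 1 := ⟨i - 1, by omega⟩
    rw [h3 l (by omega) (by omega), h3 l' (by omega) (by omega)]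
    exact hA l' l (by omega) (by omega)

theorem insert_count {A B : ℕ → ℝ} {I j : ℕ} {u : ℝ} (hj : j ≤ I)
    (h1 : ∀ i, i < j → B i = A i) (h2 : B j = u) (h3 : ∀ i, j ≤ i → i < I → B (i + 1) = A i)
    (P : ℝ → Prop) [DecidablePred P] :
    ((range (I + 1)).filter fun i => P (B i)).card =
      ((range I).filter fun i => P (A i)).card + if P u then 1 else 0 := by
  obtain ⟨t, rfl⟩ := Nat.exists_eq_add_of_le hj
  simp only [card_filter]
  rw [add_assoc j t 1, sum_range_add _ j (t + 1), sum_range_add _ j t, sum_range_succ' _ t,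
    add_zero, h2, add_assoc]
  congr 1
  · exact sum_congr rfl fun i hi => by rw [h1 i (mem_range.1 hi)]
  · rw [add_left_inj]
    refine sum_congr rfl fun i hi => ?_
    have := mem_range.1 hi
    rw [← add_assoc, h3 _ (by omega) (by omega)]

/-- The differences that are compared with `Y (τ - a) - Y (τ - b)`. -/
def blockDiff (X : ℕ → ℝ) (J d a b I : ℕ) : ℝ := X ((J + I) * d + a) - X ((J + I) * d + b)

/-- Insertion sort of the differences of entries `ν 58` and `ν 59` of the `ν 51` blocks from
`ν 57` on into row `ν 60` of array `3`. -/
def diffsCmd : Cmd :=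
  61 ≔ 0 ;; 62 ≔ ν 57 * ν 40 ;;
  .whl (.ilt (ν 61) (ν 51)) (
    .rset 1 (.ld 1 0 (ν 62 + ν 58) - .ld 1 0 (ν 62 + ν 59)) ;;
    63 ≔ ν 61 ;;
    .whl (.and (.ilt 0 (ν 63)) (.rlt (.var 1) (.ld 3 (ν 60) (ν 63 - 1)))) (
      .rput 3 (ν 60) (ν 63) (.ld 3 (ν 60) (ν 63 - 1)) ;;
      63 ≔ ν 63 - 1) ;;
    .rput 3 (ν 60) (ν 63) (.var 1) ;;
    61 ≔ ν 61 + 1 ;; 62 ≔ ν 62 + ν 40)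

/-- Row `e` of `U` is sorted and has the same entries as `w`. -/
structure SortedCopy (U : ℕ → ℝ) (w : ℕ → ℝ) (g : ℕ) : Prop where
  sorted : ∀ i i', i < i' → i' < g → U i ≤ U i'
  count : ∀ V : ℝ, ((range g).filter fun i => U i ≤ V).card = ((range g).filter fun i => w i ≤ V).card

theorem SortedCopy.insert {A B w : ℕ → ℝ} {I j : ℕ} {u : ℝ} (h : SortedCopy A w I) (hj : j ≤ I)
    (h1 : ∀ i, i < j → B i = A i) (h2 : B j = u) (h3 : ∀ i, j ≤ i → i < I → B (i + 1) = A i)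
    (hlo : 0 < j → A (j - 1) ≤ u) (hhi : ∀ i, j ≤ i → i < I → u ≤ A i) (hw : w I = u) :
    SortedCopy B w (I + 1) := by
  refine ⟨insert_sorted hj h.sorted h1 h2 h3 (fun i hi => ?_) hhi, fun V => ?_⟩
  · refine le_trans ?_ (hlo (by omega))
    rcases (by omega : i < j - 1 ∨ i = j - 1) with h' | h'
    · exact h.sorted i _ h' (by omega)
    · rw [h']
  · rw [insert_count hj h1 h2 h3 (fun x => x ≤ V), h.count, card_filter, card_filter,
      sum_range_succ, hw]

theorem wp_diffs {d g J e : ℕ} (h40 : s.iv 40 = d) (h51 : s.iv 51 = g) (h57 : s.iv 57 = J)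
    (h60 : s.iv 60 = e) (h58 : s.iv 58 < d) (h59 : s.iv 59 < d) (hS : (J + g) * d + d < S)
    (heS : e < S) (hgS : g < S) :
    wp S n diffsCmd (fun s' =>
      SortedCopy (s'.ra 3 e) (blockDiff (s.ra 1 0) J d (s.iv 58) (s.iv 59)) g ∧
      (∀ i, i ≠ e → s'.ra 3 i = s.ra 3 i) ∧ s'.time ≤ s.time + 10 * (g + 1) ^ 2) s := by
  have hJS : (J + g) * d = J * d + g * d := by ring
  simp only [diffsCmd, wp_seq, wp_iset]
  refine ⟨by simp, by simp [h57, h40]; omega, ?_⟩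
  refine wp_whl (fun s' => s'.iv 61 ≤ g ∧ s'.iv 62 = (J + s'.iv 61) * d ∧
    SortedCopy (s'.ra 3 e) (blockDiff (s.ra 1 0) J d (s.iv 58) (s.iv 59)) (s'.iv 61) ∧
    (∀ i, i ≠ e → s'.ra 3 i = s.ra 3 i) ∧ s'.time ≤ s.time + 2 + s'.iv 61 * (3 * g + 8))
    (fun s' => g - s'.iv 61)
    ⟨by simp, by simp [h57, h40], ⟨by simp, by simp⟩, fun _ _ => rfl, by simp⟩ ?_
  rintro s1 hf ⟨hI, h62, hso, hoth, tm⟩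
  have g40 : s1.iv 40 = d := by simpa [h40] using hf.iv 40 (by decide)
  have g51 : s1.iv 51 = g := by simpa [h51] using hf.iv 51 (by decide)
  have g60 : s1.iv 60 = e := by simpa [h60] using hf.iv 60 (by decide)
  have g58 : s1.iv 58 = s.iv 58 := by simpa using hf.iv 58 (by decide)
  have g59 : s1.iv 59 = s.iv 59 := by simpa using hf.iv 59 (by decide)
  have r1 : s1.ra 1 = s.ra 1 := by simpa using hf.ra 1 (by decide)
  clear hf
  generalize i61 : s1.iv 61 = I at *
  generalize ha : s.iv 58 = a at *
  generalize hb : s.iv 59 = b at *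
  refine ⟨by simp, fun hlt => ?_, fun hlt => ?_⟩
  · simp only [BE.val_ilt, IE.val_var, i61, g51] at hlt
    have hle : (J + I) * d + d ≤ (J + g) * d := by
      rw [← Nat.succ_mul]; exact Nat.mul_le_mul_right d (by omega)
    have b1 : (J + I) * d + a < S := by omega
    have b2 : (J + I) * d + b < S := by omega
    have b3 : (J + I) * d + d < S := by omega
    have b4 : 0 < S := by omega
    have b5 : I + 1 < S := by omega
    simp only [wp_seq, wp_iset, wp_rset, IE.ok_add, IE.ok_var, IE.ok_lit, RE.ok_sub, RE.ok_ld,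
      RE.val_sub, RE.val_ld, IE.val_add, IE.val_var, IE.val_lit, St.tick_iv, St.tick_ra,
      St.tick_rv, St.tick_time, h62, g58, g59, r1, i61, b1, b2, b4, true_and]
    -- There is a hole at place `ν 63`: the entries before it are untouched, those after it have
    -- moved up by one and are not below the new one.
    refine wp_whl (fun s' => s'.iv 63 ≤ I ∧ (∀ i, i < s'.iv 63 → s'.ra 3 e i = s1.ra 3 e i) ∧
      (∀ i, s'.iv 63 ≤ i → i < I → s'.ra 3 e (i + 1) = s1.ra 3 e i ∧
        blockDiff (s.ra 1 0) J d a b I ≤ s1.ra 3 e i) ∧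
      (∀ i, i ≠ e → s'.ra 3 i = s.ra 3 i) ∧ s'.time + 3 * s'.iv 63 ≤ s1.time + 3 + 3 * I)
      (fun s' => s'.iv 63) ⟨by simp, fun i _ => by simp, fun i hi1 hi2 => by simp at hi1; omega,
        by simpa using hoth, by simp⟩ ?_
    rintro s2 hf ⟨hj, q1, q2, q3, tm2⟩
    have k40 : s2.iv 40 = d := by simpa [g40] using hf.iv 40 (by decide)
    have k60 : s2.iv 60 = e := by simpa [g60] using hf.iv 60 (by decide)
    have k61 : s2.iv 61 = I := by simpa [i61] using hf.iv 61 (by decide)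
    have k62 : s2.iv 62 = (J + I) * d := by simpa [h62] using hf.iv 62 (by decide)
    have kv : s2.rv 1 = blockDiff (s.ra 1 0) J d a b I := by
      simpa [blockDiff] using hf.rv 1 (by decide)
    clear hf
    generalize i63 : s2.iv 63 = j at *
    have b6 : j < S := by omega
    have b7 : j - 1 < S := by omega
    refine ⟨by simp [k60, i63, b7, heS], fun hlt2 => ?_, fun hlt2 => ?_⟩
    · simp only [BE.val_and, BE.val_ilt, BE.val_rlt, RE.val_var, RE.val_ld, IE.val_sub, IE.val_var,
        IE.val_lit, i63, k60, kv] at hlt2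
      simp only [wp_seq, wp_iset, wp_rput, IE.ok_sub, IE.ok_var, IE.ok_lit, RE.ok_ld,
        RE.val_ld, IE.val_sub, IE.val_var, IE.val_lit, St.tick_iv, St.tick_ra,
        St.tick_time, Function.update_self, i63, k60, heS, b6, b7, true_and, and_true]
      refine ⟨⟨by omega, fun i hi => ?_, fun i hi1 hi2 => ?_, fun i hi => ?_, by omega⟩, by omega⟩
      · rw [upd2_apply, if_neg (by omega), q1 i (by omega)]
      · rw [upd2_apply]
        by_cases hij : i + 1 = j
        · have e1 : j - 1 = i := by omega
          rw [if_pos ⟨rfl, hij⟩, e1, q1 i (by omega)]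
          refine ⟨rfl, ?_⟩
          rw [e1, q1 i (by omega)] at hlt2
          exact hlt2.2.le
        · rw [if_neg (by omega)]
          exact q2 i (by omega) hi2
      · rw [← q3 i hi]
        funext x
        rw [upd2_apply, if_neg (by tauto)]
    · simp only [BE.val_and, BE.val_ilt, BE.val_rlt, RE.val_var, RE.val_ld, IE.val_sub, IE.val_var,
        IE.val_lit, i63, k60, kv] at hlt2
      simp only [wp_seq, wp_iset, wp_rput, IE.ok_add, IE.ok_var, IE.ok_lit, RE.ok_var,
        RE.val_var, IE.val_add, IE.val_var, IE.val_lit, St.tick_iv, St.tick_ra, St.tick_rv, ne_eq,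
        Nat.reduceEqDiff, not_false_eq_true, Function.update_of_ne,
        St.tick_time, Function.update_self, i63, k60, k61, k62, k40, kv, heS, b3, b5, b6, true_and]
      refine ⟨⟨by omega, by ring, ?_, fun i hi => ?_, ?_⟩, by omega⟩
      · refine hso.insert hj (fun i hi => ?_) ?_ (fun i hi1 hi2 => ?_) (fun h0 => ?_)
          (fun i hi1 hi2 => (q2 i hi1 hi2).2) rfl
        · rw [upd2_apply, if_neg (by omega), q1 i hi]
        · rw [upd2_apply, if_pos ⟨rfl, rfl⟩]
        · rw [upd2_apply, if_neg (by omega), (q2 i hi1 hi2).1]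
        · rw [← q1 _ (by omega)]
          by_contra hc
          exact hlt2 ⟨h0, not_le.1 hc⟩
      · rw [← q3 i hi]
        funext x
        rw [upd2_apply, if_neg (by tauto)]
      · rw [Nat.succ_mul]; omega
  · simp only [BE.val_ilt, IE.val_var, i61, g51] at hlt
    have : I = g := by omega
    subst this
    refine ⟨by simpa using hso, by simpa using hoth, ?_⟩
    simp only [St.tick_time]
    nlinarith

end MedConv

/-! ### Ranks of differences -/

namespace MedConv

open Finset

variable {S n : ℕ} {c p q : Cmd} {s s' : St} {Q R : St → Prop}

/-- The rank of `Y (τ - a) - Y (τ - b)` among the differences of `g` blocks, where the pair `(a, b)`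
has the number `e = a * d + b`. -/
noncomputable def diffRank (X Y : ℕ → ℝ) (J d g τ e : ℕ) : ℕ :=
  ((range g).filter fun I =>
    blockDiff X J d (e / d) (e % d) I ≤ Y (τ - e / d) - Y (τ - e % d)).card

theorem diffRank_le (X Y : ℕ → ℝ) (J d g τ e : ℕ) : diffRank X Y J d g τ e ≤ g :=
  (card_filter_le _ _).trans (card_range g).le

theorem SortedCopy.rank {U w : ℕ → ℝ} {g j : ℕ} {V : ℝ} (h : SortedCopy U w g) (hj : j ≤ g)
    (h1 : ∀ i, i < j → U i ≤ V) (h2 : ∀ i, j ≤ i → i < g → ¬ U i ≤ V) :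
    ((range g).filter fun i => w i ≤ V).card = j := by
  rw [← h.count]
  conv_rhs => rw [← card_range j]
  congr 1
  ext i
  simp only [mem_filter, mem_range]
  constructor
  · rintro ⟨a, b⟩
    by_contra hc
    exact h2 i (by omega) a b
  · intro hi
    exact ⟨by omega, h1 i hi⟩

/-- Goes to the next pair of numbers below `ν 40`. -/
def nextCmd : Cmd :=
  60 ≔ ν 60 + 1 ;; 59 ≔ ν 59 + 1 ;;
  .ite (.ilt (ν 59) (ν 40)) .skip (59 ≔ 0 ;; 58 ≔ ν 58 + 1)

/-- The pair with number `e` is `(e / d, e % d)`; the next one is found by counting with two digits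
in base `d`, without division. -/
theorem div_mod_succ {d e : ℕ} (hd : 0 < d) :
    (e % d + 1 < d → (e + 1) / d = e / d ∧ (e + 1) % d = e % d + 1) ∧
    (¬ e % d + 1 < d → (e + 1) / d = e / d + 1 ∧ (e + 1) % d = 0) := by
  have h1 := Nat.div_add_mod e d
  have h2 := Nat.mod_lt e hd
  constructor
  · intro h
    have e1 : e + 1 = d * (e / d) + (e % d + 1) := by omega
    constructor
    · rw [e1, Nat.mul_add_div hd, Nat.div_eq_of_lt h, add_zero]
    · conv_lhs => rw [e1]
      rw [Nat.mul_add_mod, Nat.mod_eq_of_lt h]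
  · intro h
    have e1 : e + 1 = d * (e / d + 1) := by rw [Nat.mul_succ]; omega
    rw [e1, Nat.mul_div_cancel_left _ hd, Nat.mul_mod_right]
    exact ⟨rfl, rfl⟩

theorem wp_next {d e : ℕ} (h40 : s.iv 40 = d) (hd : 0 < d) (h60 : s.iv 60 = e)
    (h58 : s.iv 58 = e / d) (h59 : s.iv 59 = e % d) (heS : e + 1 < S) :
    wp S n nextCmd (fun s' => s'.iv 60 = e + 1 ∧ s'.iv 58 = (e + 1) / d ∧
      s'.iv 59 = (e + 1) % d ∧ s'.time ≤ s.time + 5) s := by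
  obtain ⟨n1, n2⟩ := div_mod_succ (e := e) hd
  have h1 := Nat.div_le_self e d
  have h2 := Nat.mod_le e d
  have b1 : e % d + 1 < S := by omega
  have b2 : e / d + 1 < S := by omega
  simp only [nextCmd, wp_seq, wp_iset, wp_ite, wp_skip, BE.ok_ilt, BE.val_ilt, IE.ok_add,
    IE.ok_var, IE.ok_lit, IE.val_add, IE.val_var, IE.val_lit, St.tick_iv, St.tick_time, ne_eq,
    Nat.reduceEqDiff, not_false_eq_true, Function.update_of_ne, Function.update_self,
    h40, h60, h58, h59, heS, b1, b2, true_and]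
  refine ⟨fun h => ?_, fun h => ?_⟩
  · obtain ⟨q1, q2⟩ := n1 h
    exact ⟨q1.symm, q2.symm, by omega⟩
  · obtain ⟨q1, q2⟩ := n2 h
    exact ⟨q1.symm, q2.symm, by omega⟩

/-- Finds the rank of a difference in row `ν 60` of array `3`, with steps of length `ν 50`
first. -/
def rankCmd : Cmd :=
  .rset 2 (.ld 2 0 (ν 56 - ν 58) - .ld 2 0 (ν 56 - ν 59)) ;;
  64 ≔ 0 ;;
  .whl (.and (.ilt (ν 64) (ν 51)) (.not (.rlt (.var 2) (.ld 3 (ν 60) (ν 64 + ν 50 - 1)))))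
    (64 ≔ ν 64 + ν 50) ;;
  .whl (.and (.ilt (ν 64) (ν 51)) (.not (.rlt (.var 2) (.ld 3 (ν 60) (ν 64)))))
    (64 ≔ ν 64 + 1)

/-- In `g = h * h` sorted entries at most `h` strides of length `h` and then fewer than `h` single
steps are needed. The `h` pairs of one shift thus take `O(h²) = O(g)` steps, which the time bound
for the tables allows. -/
theorem wp_rank {d h g J e τ : ℕ} (h40 : s.iv 50 = h) (h51 : s.iv 51 = g) (hg : g = h * h)
    (h0 : 0 < h) (h56 : s.iv 56 = τ)
    (h60 : s.iv 60 = e) (h58 : s.iv 58 = e / d) (h59 : s.iv 59 = e % d)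
    (hU : SortedCopy (s.ra 3 e) (blockDiff (s.ra 1 0) J d (e / d) (e % d)) g)
    (hS : g + h < S) (heS : e < S) (hτ : τ < S) :
    wp S n rankCmd (fun s' => s'.iv 64 = diffRank (s.ra 1 0) (s.ra 2 0) J d g τ e ∧
      s'.time ≤ s.time + 4 * h + 4) s := by
  simp only [rankCmd, wp_seq, wp_rset, wp_iset]
  have b0 : 0 < S := by omega
  have b1 : τ - e / d < S := by omega
  have b2 : τ - e % d < S := by omega
  generalize hV : s.ra 2 0 (τ - e / d) - s.ra 2 0 (τ - e % d) = V
  refine ⟨by simp [h56, h58, h59, b0, b1, b2], by simp, ?_⟩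
  refine wp_whl (fun s' => ∃ c, c ≤ h ∧ s'.iv 64 = c * h ∧ (∀ i, i < c * h → s.ra 3 e i ≤ V) ∧
    s'.time = s.time + 2 + 2 * c) (fun s' => g - s'.iv 64)
    ⟨0, by simp⟩ ?_
  rintro s1 hf ⟨c, hc, i64, hle, tm⟩
  have g50 : s1.iv 50 = h := by simpa [h40] using hf.iv 50 (by decide)
  have g51 : s1.iv 51 = g := by simpa [h51] using hf.iv 51 (by decide)
  have g60 : s1.iv 60 = e := by simpa [h60] using hf.iv 60 (by decide)
  have r3 : s1.ra 3 = s.ra 3 := by simpa using hf.ra 3 (by decide)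
  have v2 : s1.rv 2 = V := by simpa [h56, h58, h59, hV] using hf.rv 2 (by decide)
  clear hf
  have hch : c < h → c * h + h ≤ g := fun hlt => by
    rw [hg, ← Nat.succ_mul]; exact Nat.mul_le_mul_right h hlt
  have hcg : c * h < g → c < h := fun hlt => by
    rw [hg] at hlt; exact Nat.lt_of_mul_lt_mul_right hlt
  refine ⟨?_, fun hb => ?_, fun hb => ?_⟩
  · simp only [BE.ok_and, BE.ok_ilt, BE.val_ilt, BE.ok_not, BE.ok_rlt, RE.ok_var, RE.ok_ld,
      IE.ok_sub, IE.ok_add, IE.ok_var, IE.ok_lit, IE.val_sub, IE.val_add, IE.val_var, IE.val_lit,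
      i64, g50, g51, g60, heS, true_and, and_true]
    intro hlt
    have := hch (hcg hlt)
    omega
  · simp only [BE.val_and, BE.val_ilt, BE.val_not, BE.val_rlt, RE.val_var, RE.val_ld,
      IE.val_sub, IE.val_add, IE.val_var, IE.val_lit, i64, g50, g51, g60, r3, v2, not_lt] at hb
    obtain ⟨hb1, hb2⟩ := hb
    have hb3 := hcg hb1
    have hb4 := hch hb3
    have b3 : c * h + h < S := by omega
    simp only [wp_iset, IE.ok_add, IE.ok_var, IE.val_add, IE.val_var, St.tick_iv, St.tick_time,
      Function.update_self, i64, g50, b3, true_and]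
    refine ⟨⟨c + 1, by omega, by rw [Nat.succ_mul], fun i hi => ?_, by omega⟩, by omega⟩
    rw [Nat.succ_mul] at hi
    refine le_trans ?_ hb2
    rcases (by omega : i < c * h + h - 1 ∨ i = c * h + h - 1) with h' | h'
    · exact hU.sorted i _ h' (by omega)
    · rw [h']
  · simp only [BE.val_and, BE.val_ilt, BE.val_not, BE.val_rlt, RE.val_var, RE.val_ld,
      IE.val_sub, IE.val_add, IE.val_var, IE.val_lit, i64, g50, g51, g60, r3, v2, not_lt,
      not_and] at hb
    refine wp_whl (fun s' => ∃ j, c * h ≤ j ∧ j ≤ g ∧ j < c * h + h ∧ s'.iv 64 = j ∧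
      (∀ i, i < j → s.ra 3 e i ≤ V) ∧
      s'.time + 2 * (c * h) ≤ s.time + 3 + 2 * c + 2 * j) (fun s' => g - s'.iv 64)
      ⟨c * h, le_rfl, by rw [hg]; exact Nat.mul_le_mul_right h hc, by omega, by simpa using i64,
        hle, by simp only [St.tick_time]; omega⟩ ?_
    rintro s2 hf ⟨j, hj1, hj2, hj3, j64, hle2, tm2⟩
    have k51 : s2.iv 51 = g := by simpa [g51] using hf.iv 51 (by decide)
    have k60 : s2.iv 60 = e := by simpa [g60] using hf.iv 60 (by decide)
    have k3 : s2.ra 3 = s.ra 3 := by simpa [r3] using hf.ra 3 (by decide)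
    have kv : s2.rv 2 = V := by simpa [v2] using hf.rv 2 (by decide)
    clear hf
    have b4 : j < S := by omega
    have b5 : j + 1 < S := by omega
    refine ⟨by simp [k60, j64, heS, b4], fun hb' => ?_, fun hb' => ?_⟩
    · simp only [BE.val_and, BE.val_ilt, BE.val_not, BE.val_rlt, RE.val_var, RE.val_ld,
        IE.val_var, j64, k51, k60, k3, kv, not_lt] at hb'
      obtain ⟨hb1, hb2⟩ := hb'
      simp only [wp_iset, IE.ok_add, IE.ok_var, IE.ok_lit, IE.val_add, IE.val_var, IE.val_lit,
        St.tick_iv, St.tick_time, Function.update_self, j64, b5, true_and]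
      refine ⟨⟨j + 1, by omega, by omega, ?_, rfl, fun i hi => ?_, by omega⟩, by omega⟩
      -- A whole stride of successful single steps would contradict the test that ended the strides.
      · by_contra hc'
        have hb3 := hb (by omega)
        have e1 : c * h + h - 1 = j := by omega
        rw [e1] at hb3
        exact hb3 hb2
      · rcases (by omega : i < j ∨ i = j) with h' | h'
        · exact hle2 i h'
        · rw [h']; exact hb2
    · simp only [BE.val_and, BE.val_ilt, BE.val_not, BE.val_rlt, RE.val_var, RE.val_ld,
        IE.val_var, j64, k51, k60, k3, kv, not_lt, not_and, not_le] at hb'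
      refine ⟨?_, ?_⟩
      · simp only [St.tick_iv, j64]
        rw [diffRank, hV, hU.rank hj2 hle2]
        intro i hi1 hi2
        rw [not_le]
        refine lt_of_lt_of_le (hb' (by omega)) ?_
        rcases (by omega : j < i ∨ j = i) with h' | h'
        · exact hU.sorted j i h' hi2
        · rw [h']
      · simp only [St.tick_time]
        omega

end MedConv

/-! ### A trie of rank lists -/

namespace MedConv

open Finset

variable {S n : ℕ} {c p q : Cmd} {s s' : St} {Q R : St → Prop}

/-- A forest with nodes `1, …, cnt`; the child `r` of the node `v` is `T v r` if this is not `0`. -/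
structure Trie (T : ℕ → ℕ → ℕ) (cnt : ℕ) : Prop where
  -- The value `0` stands for a missing child. It absorbs every further step of a walk, so a walk
  -- ends in a nonzero node only if all its nodes exist.
  zero : ∀ r, T 0 r = 0
  fresh : ∀ v r, cnt < v → T v r = 0
  le : ∀ v r, T v r ≤ cnt
  gt : ∀ v r, T v r ≠ 0 → v < T v r
  inj : ∀ v r v' r', T v r = T v' r' → T v r ≠ 0 → v = v' ∧ r = r'

def walk (T : ℕ → ℕ → ℕ) (v : ℕ) (l : List ℕ) : ℕ := l.foldl T v

theorem walk_concat (T : ℕ → ℕ → ℕ) (v : ℕ) (l : List ℕ) (a : ℕ) :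
    walk T v (l ++ [a]) = T (walk T v l) a := by simp [walk]

def TrieExt (T T' : ℕ → ℕ → ℕ) : Prop := ∀ v r, T v r ≠ 0 → T' v r = T v r

theorem TrieExt.refl (T : ℕ → ℕ → ℕ) : TrieExt T T := fun _ _ _ => rfl

theorem TrieExt.trans {T T' T'' : ℕ → ℕ → ℕ} (h : TrieExt T T') (h' : TrieExt T' T'') :
    TrieExt T T'' := fun v r hv => by
  have := h v r hv
  rw [h' v r (by rwa [this]), this]

theorem Trie.walk_ext {T T' : ℕ → ℕ → ℕ} {cnt v : ℕ} (hT : Trie T cnt) (h : TrieExt T T')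
    (l : List ℕ) (hl : walk T v l ≠ 0) : walk T' v l = walk T v l := by
  induction l using List.reverseRecOn with
  | nil => rfl
  | append_singleton l a ih =>
    rw [walk_concat] at hl
    have h0 : walk T v l ≠ 0 := fun h0 => hl (by rw [h0, hT.zero])
    rw [walk_concat, walk_concat, ih h0, h _ _ hl]

/-- A node determines its parent and the label of the edge to it, so the list can be read off
backwards from the end of the walk. -/
theorem Trie.walk_inj {T : ℕ → ℕ → ℕ} {cnt v : ℕ} (hT : Trie T cnt) (l : List ℕ) :
    ∀ l' : List ℕ, l.length = l'.length → walk T v l = walk T v l' → walk T v l ≠ 0 → l = l' := by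
  induction l using List.reverseRecOn with
  | nil => intro l' h _ _; exact (List.length_eq_zero_iff.1 h.symm).symm
  | append_singleton l a ih =>
    intro l' hlen he h0
    rcases List.eq_nil_or_concat l' with rfl | ⟨l', b, rfl⟩
    · simp at hlen
    rw [List.concat_eq_append] at hlen he ⊢
    rw [walk_concat] at he h0
    rw [walk_concat] at he
    obtain ⟨h1, rfl⟩ := hT.inj _ _ _ _ he h0
    rw [ih l' (by simpa using hlen) h1 fun h => h0 (by rw [h, hT.zero])]

/-- Children have larger numbers than their parents. So the nodes below a newly created root cannot
be confused with those of the earlier groups. -/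
theorem Trie.le_walk {T : ℕ → ℕ → ℕ} {cnt v : ℕ} (hT : Trie T cnt) (l : List ℕ)
    (hl : walk T v l ≠ 0) : v ≤ walk T v l := by
  induction l using List.reverseRecOn with
  | nil => rfl
  | append_singleton l a ih =>
    rw [walk_concat] at hl ⊢
    have h0 : walk T v l ≠ 0 := fun h0 => hl (by rw [h0, hT.zero])
    exact (ih h0).trans (hT.gt _ _ hl).le

theorem Trie.insert {T : ℕ → ℕ → ℕ} {cnt v r : ℕ} (hT : Trie T cnt) (h0 : T v r = 0) (hv0 : 0 < v)
    (hv : v ≤ cnt) : Trie (upd2 T v r (cnt + 1)) (cnt + 1) ∧ TrieExt T (upd2 T v r (cnt + 1)) := by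
  refine ⟨⟨fun a => ?_, fun w a hw => ?_, fun w a => ?_, fun w a hn => ?_,
    fun w a w' a' he hn => ?_⟩, fun w a hw => ?_⟩
  · rw [upd2_apply, if_neg (by omega), hT.zero]
  · rw [upd2_apply, if_neg (by omega), hT.fresh _ _ (by omega)]
  · rw [upd2_apply]
    split_ifs
    · exact le_rfl
    · exact (hT.le w a).trans (Nat.le_succ _)
  · rw [upd2_apply] at hn ⊢
    split_ifs at hn ⊢
    · omega
    · exact hT.gt w a hn
  · rw [upd2_apply] at he hn
    rw [upd2_apply] at he
    have l1 := hT.le w a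
    have l2 := hT.le w' a'
    split_ifs at he hn with h1 h2 h2
    · exact ⟨h1.1.trans h2.1.symm, h1.2.trans h2.2.symm⟩
    · omega
    · omega
    · exact hT.inj _ _ _ _ he hn
  · rw [upd2_apply, if_neg]
    rintro ⟨rfl, rfl⟩
    exact hw h0

/-- The ranks of all pairs. -/
noncomputable def rankList (X Y : ℕ → ℝ) (J d g τ e : ℕ) : List ℕ :=
  (List.range e).map (diffRank X Y J d g τ)

theorem rankList_succ (X Y : ℕ → ℝ) (J d g τ e : ℕ) : rankList X Y J d g τ (e + 1) =
    rankList X Y J d g τ e ++ [diffRank X Y J d g τ e] := by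
  simp [rankList, List.range_succ]

/-- Walks down the trie along the list of ranks, adding nodes where they are missing. -/
def walkCmd : Cmd :=
  65 ≔ ν 53 ;; 60 ≔ 0 ;; 58 ≔ 0 ;; 59 ≔ 0 ;;
  .whl (.ilt (ν 60) (ν 50)) (
    rankCmd ;;
    .ite (.ilt (.ld 0 (ν 65) (ν 64)) 1) (54 ≔ ν 54 + 1 ;; .iput 0 (ν 65) (ν 64) (ν 54)) .skip ;;
    65 ≔ .ld 0 (ν 65) (ν 64) ;;
    nextCmd)

/-- Each of the `h` steps adds at most one node, and existing edges are never changed, so walks made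
for earlier shifts keep their ends. -/
theorem wp_walk {d h g J τ cnt root : ℕ} (h40 : s.iv 40 = d) (hd : 0 < d) (h50 : s.iv 50 = h)
    (h51 : s.iv 51 = g) (hg : g = h * h) (h0 : 0 < h) (h56 : s.iv 56 = τ) (h53 : s.iv 53 = root)
    (h54 : s.iv 54 = cnt) (hT : Trie (s.ia 0) cnt) (hr0 : 0 < root) (hr : root ≤ cnt)
    (hU : ∀ e, e < h →
      SortedCopy (s.ra 3 e) (blockDiff (s.ra 1 0) J d (e / d) (e % d)) g)
    (hS : g + h < S) (hcS : cnt + h < S) (hτ : τ < S) :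
    wp S n walkCmd (fun s' => ∃ cnt', s'.iv 54 = cnt' ∧ cnt ≤ cnt' ∧ cnt' ≤ cnt + h ∧
      Trie (s'.ia 0) cnt' ∧ TrieExt (s.ia 0) (s'.ia 0) ∧ s'.iv 65 ≠ 0 ∧ s'.iv 65 ≤ cnt' ∧
      s'.iv 65 = walk (s'.ia 0) root (rankList (s.ra 1 0) (s.ra 2 0) J d g τ h) ∧
      s'.time ≤ s.time + h * (4 * h + 14) + 5) s := by
  simp only [walkCmd, wp_seq, wp_iset]
  refine ⟨trivial, trivial, trivial, trivial, ?_⟩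
  refine wp_whl (fun s' => ∃ e cnt', e ≤ h ∧ s'.iv 60 = e ∧ s'.iv 58 = e / d ∧ s'.iv 59 = e % d ∧
    s'.iv 54 = cnt' ∧ cnt ≤ cnt' ∧ cnt' ≤ cnt + e ∧
    Trie (s'.ia 0) cnt' ∧ TrieExt (s.ia 0) (s'.ia 0) ∧ s'.iv 65 ≠ 0 ∧ s'.iv 65 ≤ cnt' ∧
    s'.iv 65 = walk (s'.ia 0) root (rankList (s.ra 1 0) (s.ra 2 0) J d g τ e) ∧
    s'.time ≤ s.time + e * (4 * h + 14) + 4) (fun s' => h - s'.iv 60)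
    ⟨0, cnt, by simp, by simp, by simp, by simp, by simpa using h54, le_rfl, by simp, by simpa using hT,
      TrieExt.refl _, by simp [h53]; omega, by simp [h53]; omega,
      by simp [h53, rankList, walk], by simp⟩ ?_
  rintro s1 hf ⟨e, cnt1, he, i60, i58, i59, i54, hc1, hc2, hT1, hE1, h650, h65c, h65, tm⟩
  have g40 : s1.iv 40 = d := by simpa [h40] using hf.iv 40 (by decide)
  have g50 : s1.iv 50 = h := by simpa [h50] using hf.iv 50 (by decide)
  have g51 : s1.iv 51 = g := by simpa [h51] using hf.iv 51 (by decide)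
  have g56 : s1.iv 56 = τ := by simpa [h56] using hf.iv 56 (by decide)
  have r1 : s1.ra 1 = s.ra 1 := by simpa using hf.ra 1 (by decide)
  have r2 : s1.ra 2 = s.ra 2 := by simpa using hf.ra 2 (by decide)
  have r3 : s1.ra 3 = s.ra 3 := by simpa using hf.ra 3 (by decide)
  clear hf
  refine ⟨by simp, fun hb => ?_, fun hb => ?_⟩
  · simp only [BE.val_ilt, IE.val_var, i60, g50] at hb
    simp only [wp_seq]
    refine (wp_rank (s := s1.tick) (d := d) (J := J) (h := h) (g := g) (e := e) (τ := τ)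
      g50 g51 hg h0 g56 i60 i58 i59
      (by simp only [St.tick_ra, r1, r3]; exact hU e hb) hS (by omega) hτ).mono ?_
    rintro s2 hf ⟨j64, tm2⟩
    simp only [St.tick_ra, r1, r2, St.tick_time] at j64 tm2
    have k40 : s2.iv 40 = d := by simpa [g40] using hf.iv 40 (by decide)
    have k50 : s2.iv 50 = h := by simpa [g50] using hf.iv 50 (by decide)
    have k54 : s2.iv 54 = cnt1 := by simpa [i54] using hf.iv 54 (by decide)
    have k58 : s2.iv 58 = e / d := by simpa [i58] using hf.iv 58 (by decide)
    have k59 : s2.iv 59 = e % d := by simpa [i59] using hf.iv 59 (by decide)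
    have k60 : s2.iv 60 = e := by simpa [i60] using hf.iv 60 (by decide)
    have k65 : s2.iv 65 = s1.iv 65 := by simpa using hf.iv 65 (by decide)
    have k0 : s2.ia 0 = s1.ia 0 := by simpa using hf.ia 0 (by decide)
    clear hf
    have hrk := diffRank_le (s.ra 1 0) (s.ra 2 0) J d g τ e
    have b1 : diffRank (s.ra 1 0) (s.ra 2 0) J d g τ e < S := by omega
    have hw := rankList_succ (s.ra 1 0) (s.ra 2 0) J d g τ e
    generalize diffRank (s.ra 1 0) (s.ra 2 0) J d g τ e = r at *
    have b2 : s1.iv 65 < S := by omega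
    have b3 : cnt1 + 1 < S := by omega
    generalize i65 : s1.iv 65 = v at *
    rw [wp_seq, wp_ite]
    refine ⟨by simp [j64, k65, b1, b2], fun hb2 => ?_, fun hb2 => ?_⟩
    · simp only [BE.val_ilt, IE.val_ld, IE.val_var, IE.val_lit, j64, k65, k0] at hb2
      obtain ⟨t1, t2⟩ := hT1.insert (v := v) (r := r) (by omega) (by omega) h65c
      simp only [wp_seq, wp_iset, wp_iput, IE.ok_add, IE.ok_ld, IE.ok_var, IE.ok_lit,
        IE.val_add, IE.val_ld, IE.val_var, IE.val_lit, St.tick_iv, St.tick_ia, St.tick_time,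
        ne_eq, Nat.reduceEqDiff, not_false_eq_true, Function.update_of_ne, Function.update_self,
        j64, k65, k54, k0, b1, b2, b3, true_and]
      have e1 : upd2 (s1.ia 0) v r (cnt1 + 1) v r = cnt1 + 1 := by simp [upd2]
      refine (wp_next (d := d) (e := e) (by simpa using k40) hd (by simpa using k60)
        (by simpa using k58) (by simpa using k59) (by omega)).mono ?_
      rintro s3 hf ⟨m60, m58, m59, tm3⟩
      have m54 : s3.iv 54 = cnt1 + 1 := by simpa using hf.iv 54 (by decide)
      have m65 : s3.iv 65 = cnt1 + 1 := by simpa [e1] using hf.iv 65 (by decide)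
      have m0 : s3.ia 0 = upd2 (s1.ia 0) v r (cnt1 + 1) := by simpa using hf.ia 0 (by decide)
      simp only at tm3
      refine ⟨⟨e + 1, cnt1 + 1, by omega, m60, m58, m59, m54, by omega, by omega,
        by rw [m0]; exact t1, by rw [m0]; exact hE1.trans t2, by omega, by omega, ?_, ?_⟩,
        by omega⟩
      · rw [m65, m0, hw, walk_concat, hT1.walk_ext t2 _ (by rw [← h65]; exact h650), ← h65, e1]
      · rw [Nat.succ_mul]; omega
    · simp only [BE.val_ilt, IE.val_ld, IE.val_var, IE.val_lit, j64, k65, k0] at hb2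
      simp only [wp_skip, wp_seq, wp_iset, IE.ok_ld, IE.ok_var,
        IE.val_ld, IE.val_var, St.tick_iv, St.tick_ia, St.tick_time,
        j64, k65, k0, b1, b2, true_and]
      refine (wp_next (d := d) (e := e) (by simpa using k40) hd (by simpa using k60)
        (by simpa using k58) (by simpa using k59) (by omega)).mono ?_
      rintro s3 hf ⟨m60, m58, m59, tm3⟩
      have m54 : s3.iv 54 = cnt1 := by simpa [k54] using hf.iv 54 (by decide)
      have m65 : s3.iv 65 = s1.ia 0 v r := by simpa using hf.iv 65 (by decide)
      have m0 : s3.ia 0 = s1.ia 0 := by simpa [k0] using hf.ia 0 (by decide)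
      simp only at tm3
      have := hT1.le v r
      refine ⟨⟨e + 1, cnt1, by omega, m60, m58, m59, m54, by omega, by omega,
        by rw [m0]; exact hT1, by rw [m0]; exact hE1, by omega, by omega, ?_, ?_⟩,
        by omega⟩
      · rw [m65, m0, hw, walk_concat, ← h65]
      · rw [Nat.succ_mul]; omega
  · simp only [BE.val_ilt, IE.val_var, i60, g50] at hb
    have : e = h := by omega
    subst this
    exact ⟨cnt1, i54, hc1, hc2, hT1, hE1, h650, h65c, h65, by simp only [St.tick_time]; omega⟩

end MedConv

/-! ### Orders inside blocks, and their transfer between shifts -/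

namespace MedConv

open Finset

variable {S n : ℕ} {c p q : Cmd} {s s' : St} {Q R : St → Prop}

/-- The positions from `B` on of `P` hold the indices of the block in the order of their keys. -/
structure BlockOrder (X Y : ℕ → ℝ) (P : ℕ → ℕ) (B d τ : ℕ) : Prop where
  mem : ∀ t, t < d → B ≤ P (B + t) ∧ P (B + t) < B + d
  inc : ∀ t t', t < t' → t' < d → key X Y (τ + B) (P (B + t)) < key X Y (τ + B) (P (B + t'))

theorem BlockOrder.congr {X Y : ℕ → ℝ} {P P' : ℕ → ℕ} {B d τ : ℕ} (h : BlockOrder X Y P B d τ)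
    (hP : ∀ t, t < d → P' (B + t) = P (B + t)) : BlockOrder X Y P' B d τ := by
  refine ⟨fun t ht => by rw [hP t ht]; exact h.mem t ht, fun t t' htt ht' => ?_⟩
  rw [hP t (by omega), hP t' ht']
  exact h.inc t t' htt ht'

/-- Fredman's trick in the presence of ties. The comparison for `(a, b)` gives `≤`, the failure of
that for `(b, a)` gives strictness, and otherwise the indices decide. This is why the ranks of all
ordered pairs are used. -/
theorem key_lt_iff {X Y : ℕ → ℝ} {τ B a b : ℕ} : key X Y (τ + B) (B + a) < key X Y (τ + B) (B + b) ↔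
    X (B + a) - X (B + b) ≤ Y (τ - a) - Y (τ - b) ∧
      (¬ X (B + b) - X (B + a) ≤ Y (τ - b) - Y (τ - a) ∨ a < b) := by
  have e1 : τ + B - (B + a) = τ - a := by omega
  have e2 : τ + B - (B + b) = τ - b := by omega
  rw [key, key, Prod.Lex.toLex_lt_toLex, e1, e2]
  constructor
  · rintro (h | ⟨h1, h2⟩)
    · exact ⟨by linarith, Or.inl (by linarith)⟩
    · exact ⟨by linarith, Or.inr (by omega)⟩
  · rintro ⟨h1, h2 | h2⟩
    · left; linarith
    · rcases (by linarith : X (B + a) - Y (τ - a) ≤ X (B + b) - Y (τ - b)).lt_or_eq with h | h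
      · exact Or.inl h
      · exact Or.inr ⟨h, by omega⟩

/-- Equal ranks belong to equal sets. -/
theorem filter_le_eq {w : ℕ → ℝ} {g : ℕ} {V V' : ℝ}
    (h : ((range g).filter fun i => w i ≤ V).card = ((range g).filter fun i => w i ≤ V').card) :
    ∀ i, i < g → (w i ≤ V ↔ w i ≤ V') := by
  intro i hi
  wlog hV : V ≤ V' generalizing V V'
  · exact (this h.symm (le_of_not_ge hV)).symm
  have hs : (range g).filter (fun i => w i ≤ V) ⊆ (range g).filter fun i => w i ≤ V' :=
    monotone_filter_right _ fun j _ hj => le_trans hj hV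
  have he := eq_of_subset_of_card_le hs h.ge
  have : i ∈ (range g).filter (fun i => w i ≤ V) ↔ i ∈ (range g).filter fun i => w i ≤ V' := by
    rw [he]
  simpa [hi] using this

/-- Equal ranks mean equal outcomes of the comparison in every block of the group, and by
`key_lt_iff` the order of the keys depends on these outcomes only. -/
theorem BlockOrder.transfer {X Y : ℕ → ℝ} {P : ℕ → ℕ} {J d g τ τ' I : ℕ}
    (hr : rankList X Y J d g τ (d * d) = rankList X Y J d g τ' (d * d)) (hI : I < g)
    (h : BlockOrder X Y P ((J + I) * d) d τ) : BlockOrder X Y P ((J + I) * d) d τ' := by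
  have hc : ∀ a b, a < d → b < d → (blockDiff X J d a b I ≤ Y (τ - a) - Y (τ - b) ↔
      blockDiff X J d a b I ≤ Y (τ' - a) - Y (τ' - b)) := by
    intro a b ha hb
    have he : b + d * a < d * d := by
      calc b + d * a < d + d * a := by omega
        _ = d * (a + 1) := by ring
        _ ≤ d * d := Nat.mul_le_mul_left d ha
    have h1 : (b + d * a) / d = a := by
      rw [Nat.add_mul_div_left _ _ (by omega), Nat.div_eq_of_lt hb, zero_add]
    have h2 : (b + d * a) % d = b := by rw [Nat.add_mul_mod_self_left, Nat.mod_eq_of_lt hb]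
    have h3 := List.map_inj_left.1 hr (b + d * a) (List.mem_range.2 he)
    rw [diffRank, diffRank, h1, h2] at h3
    exact filter_le_eq h3 I hI
  refine ⟨h.mem, fun t t' htt ht' => ?_⟩
  have h1 := h.inc t t' htt ht'
  obtain ⟨u1, hu1⟩ := Nat.exists_eq_add_of_le (h.mem t (by omega)).1
  obtain ⟨u2, hu2⟩ := Nat.exists_eq_add_of_le (h.mem t' ht').1
  have l1 := (h.mem t (by omega)).2
  have l2 := (h.mem t' ht').2
  rw [hu1, hu2, key_lt_iff] at h1 ⊢
  have e1 := hc u1 u2 (by omega) (by omega)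
  have e2 := hc u2 u1 (by omega) (by omega)
  simp only [blockDiff] at e1 e2
  rwa [← e1, ← e2]

/-- Sorts the block at `ν 62` for the shift `ν 56` into row `ν 65` of array `1`. -/
def sortBlockCmd : Cmd :=
  5 ≔ ν 56 + ν 62 ;; 66 ≔ 0 ;;
  .whl (.ilt (ν 66) (ν 40)) (.iput 5 0 (ν 66) (ν 62 + ν 66) ;; 66 ≔ ν 66 + 1) ;;
  6 ≔ 0 ;; 7 ≔ ν 40 ;; 8 ≔ 0 ;; sortCmd ;; 66 ≔ 0 ;;
  .whl (.ilt (ν 66) (ν 40)) (.iput 1 (ν 65) (ν 62 + ν 66) (.ld 5 0 (ν 66)) ;; 66 ≔ ν 66 + 1)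

theorem wp_sortBlock {d B τ v : ℕ} (h40 : s.iv 40 = d) (h56 : s.iv 56 = τ) (h62 : s.iv 62 = B)
    (h65 : s.iv 65 = v) (hS : τ + B + d < S) (hv : v < S) :
    wp S n sortBlockCmd (fun s' => BlockOrder (s.ra 1 0) (s.ra 2 0) (s'.ia 1 v) B d τ ∧
      (∀ w, w ≠ v → s'.ia 1 w = s.ia 1 w) ∧
      (∀ x, ¬ (B ≤ x ∧ x < B + d) → s'.ia 1 v x = s.ia 1 v x) ∧
      s'.time ≤ s.time + 6 * d + 10 * (d + 1) ^ 2 + 8) s := by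
  have b0 : 0 < S := by omega
  simp only [sortBlockCmd, wp_seq, wp_iset]
  refine ⟨by simp [h56, h62]; omega, by simp, ?_⟩
  refine wp_whl (fun s' => s'.iv 66 ≤ d ∧ (∀ t, t < s'.iv 66 → s'.ia 5 0 t = B + t) ∧
    s'.time = s.time + 2 + 3 * s'.iv 66) (fun s' => d - s'.iv 66) (by simp) ?_
  rintro s1 hf ⟨ht, hA, tm⟩
  have g40 : s1.iv 40 = d := by simpa [h40] using hf.iv 40 (by decide)
  have g56 : s1.iv 56 = τ := by simpa [h56] using hf.iv 56 (by decide)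
  have g62 : s1.iv 62 = B := by simpa [h62] using hf.iv 62 (by decide)
  have g65 : s1.iv 65 = v := by simpa [h65] using hf.iv 65 (by decide)
  have g5 : s1.iv 5 = τ + B := by simpa [h56, h62] using hf.iv 5 (by decide)
  have r1 : s1.ra 1 = s.ra 1 := by simpa using hf.ra 1 (by decide)
  have r2 : s1.ra 2 = s.ra 2 := by simpa using hf.ra 2 (by decide)
  have a1 : s1.ia 1 = s.ia 1 := by simpa using hf.ia 1 (by decide)
  clear hf
  generalize i66 : s1.iv 66 = t at *
  refine ⟨by simp, fun hb => ?_, fun hb => ?_⟩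
  · simp only [BE.val_ilt, IE.val_var, i66, g40] at hb
    have b1 : B + t < S := by omega
    have b2 : t < S := by omega
    have b3 : t + 1 < S := by omega
    simp only [wp_seq, wp_iset, wp_iput, IE.ok_add, IE.ok_var, IE.ok_lit, IE.val_add, IE.val_var,
      IE.val_lit, St.tick_iv, St.tick_ia, St.tick_time, Function.update_self, i66, g62, b0, b1, b2,
      b3, true_and]
    refine ⟨⟨by omega, fun u hu => ?_, by omega⟩, by omega⟩
    rw [upd2_apply]
    split_ifs with h
    · rw [h.2]
    · exact hA u (by omega)
  · simp only [BE.val_ilt, IE.val_var, i66, g40] at hb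
    have htd : t = d := by omega
    subst htd
    simp only [wp_seq, wp_iset]
    refine ⟨by simp, by simp, by simp, ?_⟩
    refine (wp_sort (by simp [g5]; omega) (by simp [g40]; omega) (by simp [b0]) ?_).mono ?_
    · intro u hu
      simp only [ne_eq, Nat.reduceEqDiff, not_false_eq_true, Function.update_of_ne, IE.val_var,
        Function.update_self, IE.val_lit, zero_add, St.tick_ia, St.tick_iv, g40] at hu ⊢
      rw [hA u hu]
      omega
    rintro s2 hf ⟨-, hperm, hsort, tm2⟩
    have k40 : s2.iv 40 = t := by simpa [g40] using hf.iv 40 (by decide)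
    have k62 : s2.iv 62 = B := by simpa [g62] using hf.iv 62 (by decide)
    have k65 : s2.iv 65 = v := by simpa [g65] using hf.iv 65 (by decide)
    have k1 : s2.ia 1 = s.ia 1 := by simpa [a1] using hf.ia 1 (by decide)
    clear hf
    simp only [ne_eq, Nat.reduceEqDiff, not_false_eq_true, Function.update_of_ne, IE.val_var,
      Function.update_self, IE.val_lit, zero_add, St.tick_ia, St.tick_iv, St.tick_time, g40, St.key,
      St.tick_ra, r1, r2, g5] at hperm hsort tm2
    have hmem : ∀ u, u < t → B ≤ s2.ia 5 0 u ∧ s2.ia 5 0 u < B + t := by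
      intro u hu
      obtain ⟨i, hi, he⟩ := hperm.exists_eq (j := u) (by omega)
      rw [he, hA i (by omega)]
      omega
    -- The sort only yields `≤`. It is strict because keys are injective and the sorted entries are
    -- a permutation of distinct indices.
    have hinc : ∀ u u', u < u' → u' < t → key (s.ra 1 0) (s.ra 2 0) (τ + B) (s2.ia 5 0 u) <
        key (s.ra 1 0) (s.ra 2 0) (τ + B) (s2.ia 5 0 u') := by
      intro u u' huu hu'
      refine lt_of_le_of_ne (hsort u u' huu hu') fun he => ?_
      have he := key_injective _ _ _ he
      obtain ⟨σ, q1, q2⟩ := hperm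
      have p1 := perm_mem q1 (j := u) (by omega)
      have p2 := perm_mem q1 (j := u') (by omega)
      rw [q2, q2, hA _ (by omega), hA _ (by omega)] at he
      have := σ.injective (Nat.add_left_cancel he)
      omega
    clear hsort hperm
    simp only [wp_seq, wp_iset]
    refine ⟨trivial, ?_⟩
    refine wp_whl (fun s' => s'.iv 66 ≤ t ∧ (∀ u, u < s'.iv 66 → s'.ia 1 v (B + u) = s2.ia 5 0 u) ∧
      (∀ w, w ≠ v → s'.ia 1 w = s.ia 1 w) ∧
      (∀ x, ¬ (B ≤ x ∧ x < B + t) → s'.ia 1 v x = s.ia 1 v x) ∧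
      s'.time = s2.time + 1 + 3 * s'.iv 66) (fun s' => t - s'.iv 66) (by simp [k1]) ?_
    rintro s3 hf ⟨hu, hA2, hw, hx, tm3⟩
    have m40 : s3.iv 40 = t := by simpa [k40] using hf.iv 40 (by decide)
    have m62 : s3.iv 62 = B := by simpa [k62] using hf.iv 62 (by decide)
    have m65 : s3.iv 65 = v := by simpa [k65] using hf.iv 65 (by decide)
    have m5 : s3.ia 5 = s2.ia 5 := by simpa using hf.ia 5 (by decide)
    clear hf
    generalize j66 : s3.iv 66 = u at *
    refine ⟨by simp, fun hb => ?_, fun hb => ?_⟩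
    · simp only [BE.val_ilt, IE.val_var, j66, m40] at hb
      have b1 : B + u < S := by omega
      have b2 : u < S := by omega
      have b3 : u + 1 < S := by omega
      simp only [wp_seq, wp_iset, wp_iput, IE.ok_add, IE.ok_var, IE.ok_lit, IE.ok_ld, IE.val_add,
        IE.val_var, IE.val_ld, IE.val_lit, St.tick_iv, St.tick_ia, St.tick_time,
        Function.update_self, j66, m62, m65, m5, hv, b0, b1, b2, b3, true_and]
      refine ⟨⟨by omega, fun y hy => ?_, fun w hw' => ?_, fun x hx' => ?_, by omega⟩, by omega⟩
      · rw [upd2_apply]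
        split_ifs with h
        · rw [Nat.add_left_cancel h.2]
        · exact hA2 y (by omega)
      · rw [← hw w hw']
        funext x
        rw [upd2_apply, if_neg (by tauto)]
      · rw [upd2_apply, if_neg (by omega), hx x hx']
    · simp only [BE.val_ilt, IE.val_var, j66, m40] at hb
      have hut : u = t := by omega
      subst hut
      simp only [St.tick_ia, St.tick_time]
      refine ⟨⟨fun y hy => ?_, fun y y' hyy hy' => ?_⟩, hw, hx, by omega⟩
      · rw [hA2 y hy]; exact hmem y hy
      · rw [hA2 y (by omega), hA2 y' hy']; exact hinc y y' hyy hy'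

/-- Sorts all blocks of the group for the shift `ν 56`. -/
def sortGroupCmd : Cmd :=
  61 ≔ 0 ;; 62 ≔ ν 57 * ν 40 ;;
  .whl (.ilt (ν 61) (ν 51)) (sortBlockCmd ;; 61 ≔ ν 61 + 1 ;; 62 ≔ ν 62 + ν 40)

theorem wp_sortGroup {d g J τ v : ℕ} (h40 : s.iv 40 = d) (h51 : s.iv 51 = g) (h56 : s.iv 56 = τ)
    (h57 : s.iv 57 = J) (h65 : s.iv 65 = v) (hS : τ + (J + g) * d + d < S) (hv : v < S)
    (hgS : g < S) :
    wp S n sortGroupCmd (fun s' =>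
      (∀ I, I < g → BlockOrder (s.ra 1 0) (s.ra 2 0) (s'.ia 1 v) ((J + I) * d) d τ) ∧
      (∀ w, w ≠ v → s'.ia 1 w = s.ia 1 w) ∧
      s'.time ≤ s.time + g * (30 * (d + 1) ^ 2) + 3) s := by
  have hJS : (J + g) * d = J * d + g * d := by ring
  simp only [sortGroupCmd, wp_seq, wp_iset]
  refine ⟨by simp, by simp [h57, h40]; omega, ?_⟩
  refine wp_whl (fun s' => s'.iv 61 ≤ g ∧ s'.iv 62 = (J + s'.iv 61) * d ∧
    (∀ I, I < s'.iv 61 → BlockOrder (s.ra 1 0) (s.ra 2 0) (s'.ia 1 v) ((J + I) * d) d τ) ∧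
    (∀ w, w ≠ v → s'.ia 1 w = s.ia 1 w) ∧
    s'.time ≤ s.time + 2 + s'.iv 61 * (30 * (d + 1) ^ 2))
    (fun s' => g - s'.iv 61) (by simp [h57, h40]) ?_
  rintro s1 hf ⟨hI, h62, hso, hoth, tm⟩
  have g40 : s1.iv 40 = d := by simpa [h40] using hf.iv 40 (by decide)
  have g51 : s1.iv 51 = g := by simpa [h51] using hf.iv 51 (by decide)
  have g56 : s1.iv 56 = τ := by simpa [h56] using hf.iv 56 (by decide)
  have g65 : s1.iv 65 = v := by simpa [h65] using hf.iv 65 (by decide)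
  have r1 : s1.ra 1 = s.ra 1 := by simpa using hf.ra 1 (by decide)
  have r2 : s1.ra 2 = s.ra 2 := by simpa using hf.ra 2 (by decide)
  clear hf
  generalize i61 : s1.iv 61 = I at *
  refine ⟨by simp, fun hlt => ?_, fun hlt => ?_⟩
  · simp only [BE.val_ilt, IE.val_var, i61, g51] at hlt
    have hle : (J + I) * d + d ≤ (J + g) * d := by
      rw [← Nat.succ_mul]; exact Nat.mul_le_mul_right d (by omega)
    simp only [wp_seq]
    refine (wp_sortBlock (s := s1.tick) (d := d) (B := (J + I) * d) (τ := τ) (v := v) g40 g56 h62 g65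
      (by omega) hv).mono ?_
    rintro s2 hf ⟨ho, hw, hx, tm2⟩
    have k40 : s2.iv 40 = d := by simpa [g40] using hf.iv 40 (by decide)
    have k61 : s2.iv 61 = I := by simpa [i61] using hf.iv 61 (by decide)
    have k62 : s2.iv 62 = (J + I) * d := by simpa [h62] using hf.iv 62 (by decide)
    clear hf
    have b1 : I + 1 < S := by omega
    have b2 : (J + I) * d + d < S := by omega
    simp only [St.tick_ra, r1, r2, St.tick_ia, St.tick_time] at ho hw hx tm2
    simp only [wp_seq, wp_iset, IE.ok_add, IE.ok_var, IE.ok_lit, IE.val_add, IE.val_var, IE.val_lit, ne_eq,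
      Nat.reduceEqDiff, not_false_eq_true, Function.update_of_ne, Function.update_self, k40, k61,
      k62, b1, b2, true_and]
    refine ⟨⟨by omega, by ring, fun i hi => ?_, fun w hw' => (hw w hw').trans (hoth w hw'), ?_⟩,
      by omega⟩
    · rcases (by omega : i < I ∨ i = I) with h' | h'
      · refine (hso i h').congr fun t ht => hx _ ?_
        have : (J + i) * d + d ≤ (J + I) * d := by
          rw [← Nat.succ_mul]; exact Nat.mul_le_mul_right d (by omega)
        omega
      · rw [h']; exact ho
    · rw [Nat.succ_mul]
      have : 6 * d + 10 * (d + 1) ^ 2 + 8 + 3 ≤ 30 * (d + 1) ^ 2 := by nlinarith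
      omega
  · simp only [BE.val_ilt, IE.val_var, i61, g51] at hlt
    have : I = g := by omega
    subst this
    refine ⟨by simpa using hso, by simpa using hoth, by simp only [St.tick_time]; omega⟩

/-- Enters the row `ν 65` for all blocks of the group and the shift `ν 56`. -/
def enterCmd : Cmd :=
  61 ≔ 0 ;;
  .whl (.ilt (ν 61) (ν 51)) (.iput 3 (ν 57 + ν 61) (ν 56) (ν 65) ;; 61 ≔ ν 61 + 1)

theorem wp_enter {g J τ v : ℕ} (h51 : s.iv 51 = g) (h56 : s.iv 56 = τ)
    (h57 : s.iv 57 = J) (h65 : s.iv 65 = v) (hτ : τ < S) (hS : J + g < S) :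
    wp S n enterCmd (fun s' =>
      (∀ I t, s'.ia 3 I t = if J ≤ I ∧ I < J + g ∧ t = τ then v else s.ia 3 I t) ∧
      s'.time ≤ s.time + 3 * g + 2) s := by
  simp only [enterCmd, wp_seq, wp_iset]
  refine ⟨trivial, ?_⟩
  refine wp_whl (fun s' => s'.iv 61 ≤ g ∧
    (∀ I t, s'.ia 3 I t = if J ≤ I ∧ I < J + s'.iv 61 ∧ t = τ then v else s.ia 3 I t) ∧
    s'.time = s.time + 1 + 3 * s'.iv 61) (fun s' => g - s'.iv 61) ⟨by simp, fun I t => ?_, by simp⟩ ?_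
  · simp only [IE.val_lit, Function.update_self]
    rw [if_neg (by omega)]
  rintro s1 hf ⟨hI, hA, tm⟩
  have g51 : s1.iv 51 = g := by simpa [h51] using hf.iv 51 (by decide)
  have g56 : s1.iv 56 = τ := by simpa [h56] using hf.iv 56 (by decide)
  have g57 : s1.iv 57 = J := by simpa [h57] using hf.iv 57 (by decide)
  have g65 : s1.iv 65 = v := by simpa [h65] using hf.iv 65 (by decide)
  clear hf
  generalize i61 : s1.iv 61 = I at *
  refine ⟨by simp, fun hlt => ?_, fun hlt => ?_⟩
  · simp only [BE.val_ilt, IE.val_var, i61, g51] at hlt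
    have b1 : I + 1 < S := by omega
    have b2 : J + I < S := by omega
    simp only [wp_seq, wp_iset, wp_iput, IE.ok_add, IE.ok_var, IE.ok_lit, IE.val_add, IE.val_var,
      IE.val_lit, St.tick_iv, St.tick_ia, St.tick_time, Function.update_self, i61, g56, g57, g65,
      hτ, b1, b2, true_and]
    refine ⟨⟨by omega, fun i t => ?_, by omega⟩, by omega⟩
    rw [upd2_apply, hA]
    split_ifs <;> first | rfl | omega
  · simp only [BE.val_ilt, IE.val_var, i61, g51] at hlt
    have : I = g := by omega
    subst this
    exact ⟨hA, by simp only [St.tick_time]; omega⟩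

end MedConv

/-! ### Classes of shifts with the same orders -/

namespace MedConv

open Finset

variable {S n : ℕ} {c p q : Cmd} {s s' : St} {Q R : St → Prop}

/-- The leaves reached by the shifts in `A` below `root` are exactly the flagged ones, and their
rows hold sorted blocks. -/
structure Classes (X Y : ℕ → ℝ) (J d g root cnt : ℕ) (A : Finset ℕ) (s : St) : Prop where
  trie : Trie (s.ia 0) cnt
  root_pos : 0 < root
  root_le : root ≤ cnt
  flag : ∀ v, cnt < v → s.ia 2 0 v = 0
  walk_ne : ∀ τ ∈ A, walk (s.ia 0) root (rankList X Y J d g τ (d * d)) ≠ 0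
  flagged : ∀ τ ∈ A, s.ia 2 0 (walk (s.ia 0) root (rankList X Y J d g τ (d * d))) ≠ 0
  order : ∀ τ ∈ A, ∀ I, I < g → BlockOrder X Y
    (s.ia 1 (walk (s.ia 0) root (rankList X Y J d g τ (d * d)))) ((J + I) * d) d τ
  -- Flagged nodes below `root` in number are leaves of earlier groups.
  mem : ∀ v, root ≤ v → s.ia 2 0 v ≠ 0 →
    ∃ τ ∈ A, v = walk (s.ia 0) root (rankList X Y J d g τ (d * d))
  -- The set `A` contains one shift of each class, so `A.card` is the number of classes.
  inj : Set.InjOn (fun τ => rankList X Y J d g τ (d * d)) A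

/-- The table entries for the blocks and shifts in `D` lead to sorted blocks. -/
def Entries (X Y : ℕ → ℝ) (d cnt : ℕ) (D : ℕ → ℕ → Prop) (s : St) : Prop :=
  ∀ I τ, D I τ → s.ia 3 I τ ≤ cnt ∧ s.ia 2 0 (s.ia 3 I τ) ≠ 0 ∧
    BlockOrder X Y (s.ia 1 (s.ia 3 I τ)) (I * d) d τ

/-- Finds the class of the shift `ν 56`, sorting the blocks if it is new. -/
def classCmd : Cmd :=
  walkCmd ;;
  .ite (.ilt (.ld 2 0 (ν 65)) 1) (sortGroupCmd ;; .iput 2 0 (ν 65) 1) .skip ;;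
  enterCmd

theorem Classes.walk_eq {X Y : ℕ → ℝ} {J d g root cnt : ℕ} {A : Finset ℕ}
    (h : Classes X Y J d g root cnt A s) {T : ℕ → ℕ → ℕ} (hE : TrieExt (s.ia 0) T) {τ : ℕ}
    (hτ : τ ∈ A) : walk T root (rankList X Y J d g τ (d * d)) =
      walk (s.ia 0) root (rankList X Y J d g τ (d * d)) :=
  h.trie.walk_ext hE _ (h.walk_ne τ hτ)

theorem Classes.ext {X Y : ℕ → ℝ} {J d g root cnt cnt' : ℕ} {A : Finset ℕ}
    (h : Classes X Y J d g root cnt A s) (hc : cnt ≤ cnt') (hT : Trie (s'.ia 0) cnt')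
    (hE : TrieExt (s.ia 0) (s'.ia 0)) (h1 : s'.ia 1 = s.ia 1) (h2 : s'.ia 2 = s.ia 2) :
    Classes X Y J d g root cnt' A s' := by
  have hw := fun {τ : ℕ} (hτ : τ ∈ A) => h.walk_eq hE hτ
  refine ⟨hT, h.root_pos, h.root_le.trans hc, fun v hv => ?_, fun τ hτ => ?_, fun τ hτ => ?_,
    fun τ hτ I hI => ?_, fun v hv hv' => ?_, h.inj⟩
  · rw [h2]; exact h.flag v (by omega)
  · rw [hw hτ]; exact h.walk_ne τ hτ
  · rw [hw hτ, h2]; exact h.flagged τ hτ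
  · rw [hw hτ, h1]; exact h.order τ hτ I hI
  · rw [h2] at hv'
    obtain ⟨τ, hτ, he⟩ := h.mem v hv hv'
    exact ⟨τ, hτ, by rw [hw hτ, he]⟩

/-- The leaves of all representatives are flagged. An unflagged leaf therefore belongs to a new
class, which `τ` will represent. -/
theorem Classes.insert {X Y : ℕ → ℝ} {J d g root cnt v τ : ℕ} {A : Finset ℕ}
    (h : Classes X Y J d g root cnt A s) (hv0 : v ≠ 0) (hvc : v ≤ cnt)
    (hv : v = walk (s.ia 0) root (rankList X Y J d g τ (d * d))) (hf : s.ia 2 0 v = 0)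
    (h0 : s'.ia 0 = s.ia 0) (h1 : ∀ w, w ≠ v → s'.ia 1 w = s.ia 1 w)
    (ho : ∀ I, I < g → BlockOrder X Y (s'.ia 1 v) ((J + I) * d) d τ)
    (h2 : ∀ w, s'.ia 2 0 w = if w = v then 1 else s.ia 2 0 w) :
    τ ∉ A ∧ Classes X Y J d g root cnt (insert τ A) s' := by
  have hne : ∀ τ0 ∈ A, walk (s.ia 0) root (rankList X Y J d g τ0 (d * d)) ≠ v := by
    intro τ0 hτ0 he
    exact h.flagged τ0 hτ0 (by rw [he, hf])
  refine ⟨fun hτ => hne τ hτ hv.symm, by rw [h0]; exact h.trie, h.root_pos, h.root_le,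
    fun w hw => ?_, fun τ0 hτ0 => ?_, fun τ0 hτ0 => ?_, fun τ0 hτ0 I hI => ?_, fun w hw hw' => ?_, ?_⟩
  · rw [h2, if_neg (by omega), h.flag w hw]
  · rw [h0]
    rcases mem_insert.1 hτ0 with rfl | hτ0
    · rw [← hv]; exact hv0
    · exact h.walk_ne τ0 hτ0
  · rw [h0]
    rcases mem_insert.1 hτ0 with rfl | hτ0
    · rw [← hv, h2, if_pos rfl]; exact one_ne_zero
    · rw [h2, if_neg (hne τ0 hτ0)]; exact h.flagged τ0 hτ0
  · rw [h0]
    rcases mem_insert.1 hτ0 with rfl | hτ0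
    · rw [← hv]; exact ho I hI
    · rw [h1 _ (hne τ0 hτ0)]; exact h.order τ0 hτ0 I hI
  · rw [h0]
    rw [h2] at hw'
    split_ifs at hw' with he
    · exact ⟨τ, mem_insert_self τ A, he.trans hv⟩
    · obtain ⟨τ0, hτ0, he'⟩ := h.mem w hw hw'
      exact ⟨τ0, mem_insert_of_mem hτ0, he'⟩
  · rw [coe_insert, Set.injOn_insert (fun hτ => hne τ (mem_coe.1 hτ) hv.symm)]
    refine ⟨h.inj, ?_⟩
    rintro ⟨τ0, hτ0, he⟩
    refine hne τ0 hτ0 ?_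
    rw [hv]
    simp only at he
    rw [he]

/-- The flagged leaf is that of a representative. Two walks of equal length from the same root to
the same node have equal labels, so the rank lists agree and the order carries over. -/
theorem Classes.order_of_flag {X Y : ℕ → ℝ} {J d g root cnt v τ : ℕ} {A : Finset ℕ}
    (h : Classes X Y J d g root cnt A s) (hv0 : v ≠ 0)
    (hv : v = walk (s.ia 0) root (rankList X Y J d g τ (d * d))) (hf : s.ia 2 0 v ≠ 0) :
    ∀ I, I < g → BlockOrder X Y (s.ia 1 v) ((J + I) * d) d τ := by
  intro I hI
  have hrv : root ≤ v := by
    rw [hv] at hv0 ⊢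
    exact h.trie.le_walk _ hv0
  obtain ⟨τ0, hτ0, he⟩ := h.mem v hrv hf
  have hl := h.trie.walk_inj (rankList X Y J d g τ0 (d * d)) (rankList X Y J d g τ (d * d))
    (by simp [rankList]) (he.symm.trans hv) (by rw [← he]; exact hv0)
  have := h.order τ0 hτ0 I hI
  rw [← he] at this
  exact this.transfer hl hI

/-- Table entries point to flagged rows, and these are never rewritten, so old entries stay valid.
-/
theorem Entries.step {X Y : ℕ → ℝ} {d cnt cnt' v J g τ : ℕ} {D : ℕ → ℕ → Prop}
    (h : Entries X Y d cnt D s) (hc : cnt ≤ cnt') (hvc : v ≤ cnt') (hv : s'.ia 2 0 v ≠ 0)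
    (ho : ∀ I, I < g → BlockOrder X Y (s'.ia 1 v) ((J + I) * d) d τ)
    (h1 : ∀ w, s.ia 2 0 w ≠ 0 → s'.ia 1 w = s.ia 1 w)
    (h2 : ∀ w, s.ia 2 0 w ≠ 0 → s'.ia 2 0 w ≠ 0)
    (h3 : ∀ I t, s'.ia 3 I t = if J ≤ I ∧ I < J + g ∧ t = τ then v else s.ia 3 I t) :
    Entries X Y d cnt' (fun I t => D I t ∨ J ≤ I ∧ I < J + g ∧ t = τ) s' := by
  intro I t hD
  rw [h3]
  split_ifs with hI
  · obtain ⟨i1, i2, rfl⟩ := hI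
    refine ⟨hvc, hv, ?_⟩
    have := ho (I - J) (by omega)
    rwa [Nat.add_sub_cancel' i1] at this
  · obtain ⟨e1, e2, e3⟩ := h I t (hD.resolve_right hI)
    exact ⟨e1.trans hc, h2 _ e2, by rw [h1 _ e2]; exact e3⟩

/-- The time for sorting the group is charged to the growth of `A.card`. Summed over all shifts, it
is paid once per class. -/
theorem wp_class {X Y : ℕ → ℝ} {d h g J τ cnt root : ℕ} {A : Finset ℕ} {D : ℕ → ℕ → Prop}
    (hX : s.ra 1 0 = X) (hY : s.ra 2 0 = Y)
    (h40 : s.iv 40 = d) (hd : 0 < d) (h50 : s.iv 50 = h) (hh : h = d * d)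
    (h51 : s.iv 51 = g) (hg : g = h * h) (h56 : s.iv 56 = τ) (h53 : s.iv 53 = root)
    (h57 : s.iv 57 = J) (h54 : s.iv 54 = cnt)
    (hC : Classes X Y J d g root cnt A s) (hE : Entries X Y d cnt D s)
    (hU : ∀ e, e < h → SortedCopy (s.ra 3 e) (blockDiff X J d (e / d) (e % d)) g)
    (hS : g + h < S) (hcS : cnt + h < S) (hS2 : τ + (J + g) * d + d < S) :
    wp S n classCmd (fun s' => ∃ cnt' A', s'.iv 54 = cnt' ∧ cnt ≤ cnt' ∧ cnt' ≤ cnt + h ∧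
      Classes X Y J d g root cnt' A' s' ∧ A' ⊆ insert τ A ∧
      Entries X Y d cnt' (fun I t => D I t ∨ J ≤ I ∧ I < J + g ∧ t = τ) s' ∧
      s'.time + A.card * (g * (30 * (d + 1) ^ 2) + 4) ≤ s.time +
        A'.card * (g * (30 * (d + 1) ^ 2) + 4) + (h * (4 * h + 14) + 3 * g + 10)) s := by
  have h0 : 0 < h := by rw [hh]; exact Nat.mul_pos hd hd
  have hJg : J + g ≤ (J + g) * d := Nat.le_mul_of_pos_right _ hd
  simp only [classCmd, wp_seq]
  refine (wp_walk h40 hd h50 h51 hg h0 h56 h53 h54 hC.trie hC.root_pos hC.root_le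
    (by rw [hX]; exact hU) hS hcS (by omega)).mono ?_
  rintro s1 hf ⟨cnt', i54, hc1, hc2, hT1, hE1, h650, h65c, h65, tm1⟩
  rw [hX, hY, hh] at h65
  have g40 : s1.iv 40 = d := (hf.iv 40 (by decide)).trans h40
  have g51 : s1.iv 51 = g := (hf.iv 51 (by decide)).trans h51
  have g56 : s1.iv 56 = τ := (hf.iv 56 (by decide)).trans h56
  have g57 : s1.iv 57 = J := (hf.iv 57 (by decide)).trans h57
  have r1 : s1.ra 1 0 = X := by rw [hf.ra 1 (by decide), hX]
  have r2 : s1.ra 2 0 = Y := by rw [hf.ra 2 (by decide), hY]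
  have a1 : s1.ia 1 = s.ia 1 := hf.ia 1 (by decide)
  have a2 : s1.ia 2 = s.ia 2 := hf.ia 2 (by decide)
  have a3 : s1.ia 3 = s.ia 3 := hf.ia 3 (by decide)
  clear hf
  have hC1 := hC.ext hc1 hT1 hE1 a1 a2
  have b0 : 0 < S := by omega
  have b1 : s1.iv 65 < S := by omega
  rw [wp_seq, wp_ite]
  refine ⟨by simp [b0, b1], fun hb => ?_, fun hb => ?_⟩
  · simp only [BE.val_ilt, IE.val_ld, IE.val_var, IE.val_lit] at hb
    have hf0 : s1.ia 2 0 (s1.iv 65) = 0 := by omega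
    simp only [wp_seq]
    refine (wp_sortGroup (s := s1.tick) (d := d) (g := g) (J := J) (τ := τ) (v := s1.iv 65)
      g40 g51 g56 g57 rfl hS2 b1 (by omega)).mono ?_
    rintro s2 hf ⟨ho, hw, tm2⟩
    simp only [St.tick_ra, r1, r2, St.tick_ia, St.tick_time] at ho hw tm2
    have k51 : s2.iv 51 = g := by simpa [g51] using hf.iv 51 (by decide)
    have k54 : s2.iv 54 = cnt' := by simpa [i54] using hf.iv 54 (by decide)
    have k56 : s2.iv 56 = τ := by simpa [g56] using hf.iv 56 (by decide)
    have k57 : s2.iv 57 = J := by simpa [g57] using hf.iv 57 (by decide)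
    have k65 : s2.iv 65 = s1.iv 65 := by simpa using hf.iv 65 (by decide)
    have k0 : s2.ia 0 = s1.ia 0 := by simpa using hf.ia 0 (by decide)
    have k2 : s2.ia 2 = s1.ia 2 := by simpa using hf.ia 2 (by decide)
    have k3 : s2.ia 3 = s1.ia 3 := by simpa using hf.ia 3 (by decide)
    clear hf
    simp only [wp_iput, IE.ok_var, IE.ok_lit, IE.val_var, IE.val_lit, k65, k2, b0, b1, true_and]
    have b2 : τ < S := by omega
    have b3 : J + g < S := by omega
    refine (wp_enter (g := g) (J := J) (τ := τ) (v := s1.iv 65) (by exact k51)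
      (by exact k56) (by exact k57) (by exact k65) b2 b3).mono ?_
    rintro s3 hf ⟨h3, tm3⟩
    have m54 : s3.iv 54 = cnt' := by simpa [k54] using hf.iv 54 (by decide)
    have m0 : s3.ia 0 = s1.ia 0 := by simpa [k0] using hf.ia 0 (by decide)
    have m1 : s3.ia 1 = s2.ia 1 := by simpa using hf.ia 1 (by decide)
    have m2 : s3.ia 2 = upd2 (s1.ia 2) 0 (s1.iv 65) 1 := by simpa using hf.ia 2 (by decide)
    clear hf
    simp only [ne_eq, Nat.reduceEqDiff, not_false_eq_true, Function.update_of_ne, k3, a3] at h3 tm3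
    have m2' : ∀ w, s3.ia 2 0 w = if w = s1.iv 65 then 1 else s1.ia 2 0 w := fun w => by
      rw [m2, upd2_apply]; simp
    obtain ⟨hτ, hC2⟩ := hC1.insert (s' := s3) h650 h65c h65 hf0 m0 (by rw [m1]; exact hw)
      (by rw [m1]; exact ho) m2'
    refine ⟨cnt', insert τ A, m54, hc1, hc2, hC2, Subset.rfl, hE.step hc1 h65c ?_
      (by rw [m1]; exact ho) (fun w hw' => ?_) (fun w hw' => ?_) h3, ?_⟩
    · rw [m2', if_pos rfl]; exact one_ne_zero
    · rw [m1, hw w, a1]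
      rintro rfl
      exact hw' (by rw [← a2]; exact hf0)
    · rw [m2']
      split_ifs
      · exact one_ne_zero
      · rw [a2]; exact hw'
    · rw [card_insert_of_notMem hτ, Nat.succ_mul A.card]
      omega
  · simp only [BE.val_ilt, IE.val_ld, IE.val_var, IE.val_lit] at hb
    have hf0 : s1.ia 2 0 (s1.iv 65) ≠ 0 := by omega
    simp only [wp_skip]
    refine (wp_enter (g := g) (J := J) (τ := τ) (v := s1.iv 65) (s := s1.tick) g51 g56 g57 rfl
      (by omega) (by omega)).mono ?_
    rintro s3 hf ⟨h3, tm3⟩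
    have m54 : s3.iv 54 = cnt' := by simpa [i54] using hf.iv 54 (by decide)
    have m0 : s3.ia 0 = s1.ia 0 := by simpa using hf.ia 0 (by decide)
    have m1 : s3.ia 1 = s1.ia 1 := by simpa using hf.ia 1 (by decide)
    have m2 : s3.ia 2 = s1.ia 2 := by simpa using hf.ia 2 (by decide)
    clear hf
    simp only [St.tick_ia, a3, St.tick_time] at h3 tm3
    have ho := hC1.order_of_flag h650 h65 hf0
    refine ⟨cnt', A, m54, hc1, hc2, hC1.ext le_rfl (by rw [m0]; exact hT1)
      (by rw [m0]; exact TrieExt.refl _) m1 m2, subset_insert _ _, hE.step hc1 h65c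
      (by rw [m2]; exact hf0)
      (by rw [m1]; exact ho) (fun w hw' => ?_) (fun w hw' => ?_) h3, ?_⟩
    · rw [m1, a1]
    · rw [m2, a2]; exact hw'
    · omega

end MedConv

/-! ### Filling the tables -/

namespace MedConv

open Finset

variable {S n : ℕ} {c p q : Cmd} {s s' : St} {Q R : St → Prop}

/-- Sorts the differences of the group for all pairs. -/
def diffsAllCmd : Cmd :=
  60 ≔ 0 ;; 58 ≔ 0 ;; 59 ≔ 0 ;; .whl (.ilt (ν 60) (ν 50)) (diffsCmd ;; nextCmd)

theorem wp_diffsAll {d h g J : ℕ} (h40 : s.iv 40 = d) (hd : 0 < d) (h50 : s.iv 50 = h)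
    (hh : h = d * d) (h51 : s.iv 51 = g) (h57 : s.iv 57 = J) (hS : (J + g) * d + d < S)
    (hhS : h < S) (hgS : g < S) :
    wp S n diffsAllCmd (fun s' =>
      (∀ e, e < h → SortedCopy (s'.ra 3 e) (blockDiff (s.ra 1 0) J d (e / d) (e % d)) g) ∧
      s'.time ≤ s.time + h * (10 * (g + 1) ^ 2 + 6) + 4) s := by
  simp only [diffsAllCmd, wp_seq, wp_iset]
  refine ⟨trivial, trivial, trivial, ?_⟩
  refine wp_whl (fun s' => ∃ e, e ≤ h ∧ s'.iv 60 = e ∧ s'.iv 58 = e / d ∧ s'.iv 59 = e % d ∧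
    (∀ e', e' < e → SortedCopy (s'.ra 3 e') (blockDiff (s.ra 1 0) J d (e' / d) (e' % d)) g) ∧
    s'.time ≤ s.time + e * (10 * (g + 1) ^ 2 + 6) + 3) (fun s' => h - s'.iv 60)
    ⟨0, by simp⟩ ?_
  rintro s1 hf ⟨e, he, i60, i58, i59, hU, tm⟩
  have g40 : s1.iv 40 = d := by simpa [h40] using hf.iv 40 (by decide)
  have g50 : s1.iv 50 = h := by simpa [h50] using hf.iv 50 (by decide)
  have g51 : s1.iv 51 = g := by simpa [h51] using hf.iv 51 (by decide)
  have g57 : s1.iv 57 = J := by simpa [h57] using hf.iv 57 (by decide)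
  have r1 : s1.ra 1 = s.ra 1 := by simpa using hf.ra 1 (by decide)
  clear hf
  refine ⟨by simp, fun hb => ?_, fun hb => ?_⟩
  · simp only [BE.val_ilt, IE.val_var, i60, g50] at hb
    have b1 : e / d < d := by rw [Nat.div_lt_iff_lt_mul hd, ← hh]; exact hb
    have b2 : e % d < d := Nat.mod_lt _ hd
    simp only [wp_seq]
    refine (wp_diffs (s := s1.tick) (d := d) (g := g) (J := J) (e := e) g40 g51 g57 i60
      (by simpa [i58] using b1) (by simpa [i59] using b2) hS (by omega) hgS).mono ?_
    rintro s2 hf ⟨q1, q2, tm2⟩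
    simp only [St.tick_ra, r1, St.tick_iv, i58, i59, St.tick_time] at q1 q2 tm2
    have k40 : s2.iv 40 = d := by simpa [g40] using hf.iv 40 (by decide)
    have k58 : s2.iv 58 = e / d := by simpa [i58] using hf.iv 58 (by decide)
    have k59 : s2.iv 59 = e % d := by simpa [i59] using hf.iv 59 (by decide)
    have k60 : s2.iv 60 = e := by simpa [i60] using hf.iv 60 (by decide)
    clear hf
    refine (wp_next k40 hd k60 k58 k59 (by omega)).mono ?_
    rintro s3 hf ⟨m60, m58, m59, tm3⟩
    have m3 : s3.ra 3 = s2.ra 3 := hf.ra 3 (by decide)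
    refine ⟨⟨e + 1, by omega, m60, m58, m59, fun e' he' => ?_, ?_⟩, by omega⟩
    · rw [m3]
      rcases (by omega : e' < e ∨ e' = e) with h' | h'
      · rw [q2 e' (by omega)]; exact hU e' h'
      · rw [h']; exact q1
    · rw [Nat.succ_mul e]; omega
  · simp only [BE.val_ilt, IE.val_var, i60, g50] at hb
    have : e = h := by omega
    subst this
    exact ⟨hU, by simp only [St.tick_time]; omega⟩

theorem Trie.succ {T : ℕ → ℕ → ℕ} {cnt : ℕ} (h : Trie T cnt) : Trie T (cnt + 1) :=
  ⟨h.zero, fun v r hv => h.fresh v r (by omega), fun v r => (h.le v r).trans (Nat.le_succ _),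
    h.gt, h.inj⟩

/-- Finds the classes of all shifts for the blocks of the group. -/
def classesCmd : Cmd :=
  diffsAllCmd ;; 54 ≔ ν 54 + 1 ;; 53 ≔ ν 54 ;; 56 ≔ ν 40 ;;
  .whl (.ilt (ν 56) (ν 0 + ν 40)) (classCmd ;; 56 ≔ ν 56 + 1)

/-- Every group gets a root of its own, since ranks in different groups refer to different sets of
differences. Shifts from `d` to `N + d - 1` suffice: a block starting at `B ≤ k` is needed for `τ =
k + d - B`. -/
theorem wp_classes {X Y : ℕ → ℝ} {d h g J N cnt : ℕ} {D : ℕ → ℕ → Prop}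
    (hX : s.ra 1 0 = X) (hY : s.ra 2 0 = Y) (h0 : s.iv 0 = N)
    (h40 : s.iv 40 = d) (hd : 0 < d) (h50 : s.iv 50 = h) (hh : h = d * d)
    (h51 : s.iv 51 = g) (hg : g = h * h) (h57 : s.iv 57 = J) (h54 : s.iv 54 = cnt)
    (hT : Trie (s.ia 0) cnt) (hfl : ∀ v, cnt < v → s.ia 2 0 v = 0) (hE : Entries X Y d cnt D s)
    (hS : g + h < S) (hcS : cnt + 1 + N * h + h < S) (hS2 : N + d + (J + g) * d + d < S) :
    wp S n classesCmd (fun s' => ∃ cnt' A, s'.iv 54 = cnt' ∧ cnt' ≤ cnt + 1 + N * h ∧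
      Trie (s'.ia 0) cnt' ∧ (∀ v, cnt' < v → s'.ia 2 0 v = 0) ∧ A ⊆ Ico d (N + d) ∧
      Set.InjOn (fun τ => rankList X Y J d g τ (d * d)) (A : Finset ℕ) ∧
      Entries X Y d cnt' (fun I t => D I t ∨ J ≤ I ∧ I < J + g ∧ d ≤ t ∧ t < N + d) s' ∧
      s'.time ≤ s.time + A.card * (g * (30 * (d + 1) ^ 2) + 4) +
        N * (h * (4 * h + 14) + 3 * g + 12) + h * (10 * (g + 1) ^ 2 + 6) + 8) s := by
  simp only [classesCmd, wp_seq]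
  refine (wp_diffsAll h40 hd h50 hh h51 h57 (by omega) (by omega) (by omega)).mono ?_
  rintro s1 hf ⟨hU, tm1⟩
  rw [hX] at hU
  have g0 := (hf.iv 0 (by decide)).trans h0
  have g40 := (hf.iv 40 (by decide)).trans h40
  have g50 := (hf.iv 50 (by decide)).trans h50
  have g51 := (hf.iv 51 (by decide)).trans h51
  have g54 := (hf.iv 54 (by decide)).trans h54
  have g57 := (hf.iv 57 (by decide)).trans h57
  have r1 : s1.ra 1 0 = X := by rw [hf.ra 1 (by decide), hX]
  have r2 : s1.ra 2 0 = Y := by rw [hf.ra 2 (by decide), hY]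
  have a0 : s1.ia 0 = s.ia 0 := hf.ia 0 (by decide)
  have a1 : s1.ia 1 = s.ia 1 := hf.ia 1 (by decide)
  have a2 : s1.ia 2 = s.ia 2 := hf.ia 2 (by decide)
  have a3 : s1.ia 3 = s.ia 3 := hf.ia 3 (by decide)
  clear hf
  have b1 : cnt + 1 < S := by omega
  simp only [wp_seq, wp_iset]
  refine ⟨by simp [g54, b1], by simp, by simp, ?_⟩
  refine wp_whl (fun s' => ∃ i cnt' A, i ≤ N ∧ s'.iv 56 = d + i ∧ s'.iv 54 = cnt' ∧
    cnt' ≤ cnt + 1 + i * h ∧ Classes X Y J d g (cnt + 1) cnt' A s' ∧ A ⊆ Ico d (d + i) ∧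
    Entries X Y d cnt' (fun I t => D I t ∨ J ≤ I ∧ I < J + g ∧ d ≤ t ∧ t < d + i) s' ∧
    s'.time ≤ s1.time + 3 + A.card * (g * (30 * (d + 1) ^ 2) + 4) +
      i * (h * (4 * h + 14) + 3 * g + 12)) (fun s' => N + d - s'.iv 56)
    ⟨0, cnt + 1, ∅, Nat.zero_le _, by simp [g40], by simp [g54], by simp, ?_, by simp, ?_, by simp⟩ ?_
  · refine ⟨by simpa [a0] using hT.succ, by omega, le_rfl, fun v hv => ?_, by simp, by simp, by simp,
      fun v hv hv' => ?_, by simp⟩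
    · simpa [a2] using hfl v (by omega)
    · exact absurd (by simpa [a2] using hfl v (by omega)) hv'
  · intro I t hD
    have hD : D I t := by
      rcases hD with hD | hD
      · exact hD
      · omega
    obtain ⟨e1, e2, e3⟩ := hE I t hD
    simp only [a1, a2, a3]
    exact ⟨by omega, e2, e3⟩
  rintro s2 hf ⟨i, cnt', A, hi, i56, i54, hc, hC, hA, hE2, tm2⟩
  have k0 : s2.iv 0 = N := by simpa [g0] using hf.iv 0 (by decide)
  have k40 : s2.iv 40 = d := by simpa [g40] using hf.iv 40 (by decide)
  have k50 : s2.iv 50 = h := by simpa [g50] using hf.iv 50 (by decide)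
  have k51 : s2.iv 51 = g := by simpa [g51] using hf.iv 51 (by decide)
  have k53 : s2.iv 53 = cnt + 1 := by simpa [g54] using hf.iv 53 (by decide)
  have k57 : s2.iv 57 = J := by simpa [g57] using hf.iv 57 (by decide)
  have q1 : s2.ra 1 0 = X := by simpa [r1] using congrFun (hf.ra 1 (by decide)) 0
  have q2 : s2.ra 2 0 = Y := by simpa [r2] using congrFun (hf.ra 2 (by decide)) 0
  have q3 : s2.ra 3 = s1.ra 3 := by simpa using hf.ra 3 (by decide)
  clear hf
  refine ⟨by simp [k0, k40]; omega, fun hb => ?_, fun hb => ?_⟩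
  · simp only [BE.val_ilt, IE.val_add, IE.val_var, i56, k0, k40] at hb
    have hih : i * h ≤ N * h := Nat.mul_le_mul_right h hi
    have hih' : (i + 1) * h ≤ N * h := Nat.mul_le_mul_right h (by omega)
    rw [Nat.succ_mul] at hih'
    simp only [wp_seq]
    refine (wp_class (s := s2.tick) (X := X) (Y := Y) (d := d) (h := h) (g := g) (J := J)
      (τ := d + i) (cnt := cnt') (root := cnt + 1) (A := A)
      (D := fun I t => D I t ∨ J ≤ I ∧ I < J + g ∧ d ≤ t ∧ t < d + i)
      q1 q2 k40 hd k50 hh k51 hg i56 k53 k57 i54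
      (hC.ext le_rfl hC.trie (TrieExt.refl _) rfl rfl) hE2 (by simpa [q3] using hU) hS
      (by omega) (by omega)).mono ?_
    rintro s3 hf ⟨cnt2, A2, m54, c1, c2, hC2, hA2, hE3, tm3⟩
    have m56 : s3.iv 56 = d + i := by simpa [i56] using hf.iv 56 (by decide)
    clear hf
    have b2 : d + i + 1 < S := by omega
    simp only [St.tick_time] at tm3
    simp only [wp_iset, IE.ok_add, IE.ok_var, IE.ok_lit, IE.val_add, IE.val_var, IE.val_lit,
      Function.update_self, m56, b2, true_and]
    refine ⟨⟨i + 1, cnt2, A2, by omega, by omega, ?_, by rw [Nat.succ_mul]; omega,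
      hC2.ext le_rfl hC2.trie (TrieExt.refl _) rfl rfl, fun t ht => ?_, ?_, ?_⟩, by omega⟩
    · simpa using m54
    · rcases mem_insert.1 (hA2 ht) with rfl | ht'
      · rw [mem_Ico]; omega
      · have := mem_Ico.1 (hA ht')
        rw [mem_Ico]; omega
    · intro I t hD
      refine hE3 I t ?_
      rcases hD with hD | ⟨d1, d2, d3, d4⟩
      · exact Or.inl (Or.inl hD)
      · rcases (by omega : t < d + i ∨ t = d + i) with h' | h'
        · exact Or.inl (Or.inr ⟨d1, d2, d3, h'⟩)
        · exact Or.inr ⟨d1, d2, h'⟩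
    · rw [Nat.succ_mul i]
      omega
  · simp only [BE.val_ilt, IE.val_add, IE.val_var, i56, k0, k40] at hb
    have : i = N := by omega
    subst this
    refine ⟨cnt', A, i54, hc, hC.trie, hC.flag, by rw [add_comm i d]; exact hA, hC.inj,
      by rw [add_comm i d]; exact hE2, ?_⟩
    simp only [St.tick_time]
    omega

/-- Fills the tables for all blocks and shifts. -/
def tableCmd : Cmd :=
  57 ≔ 0 ;; 54 ≔ 0 ;;
  .whl (.ilt (ν 57 * ν 40) (ν 0)) (classesCmd ;; 57 ≔ ν 57 + ν 51)

/-- The number of classes enters through the hypothesis `hW`, which separates the program from the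
combinatorial bound. There are at most `N / (g * d) + 1` groups. -/
theorem wp_table {X Y : ℕ → ℝ} {d h g N W : ℕ}
    (hX : s.ra 1 0 = X) (hY : s.ra 2 0 = Y) (h0 : s.iv 0 = N)
    (h40 : s.iv 40 = d) (hd : 0 < d) (h50 : s.iv 50 = h) (hh : h = d * d)
    (h51 : s.iv 51 = g) (hg : g = h * h)
    (hz0 : ∀ v r, s.ia 0 v r = 0) (hz2 : ∀ v, s.ia 2 0 v = 0)
    (hW : ∀ J, ∀ A ⊆ Ico d (N + d),
      Set.InjOn (fun τ => rankList X Y J d g τ (d * d)) (A : Finset ℕ) → A.card ≤ W)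
    (hS : g + h < S) (hcS : (N + 1) * (1 + N * h) + h < S) (hS2 : 2 * N + 4 * d + 2 * (g * d) < S) :
    wp S n tableCmd (fun s' => ∃ cnt, cnt ≤ (N + 1) * (1 + N * h) ∧
      Entries X Y d cnt (fun I t => I * d < N ∧ d ≤ t ∧ t < N + d) s' ∧
      s'.time ≤ s.time + (N / (g * d) + 1) * (W * (g * (30 * (d + 1) ^ 2) + 4) +
        N * (h * (4 * h + 14) + 3 * g + 12) + h * (10 * (g + 1) ^ 2 + 6) + 10) + 3) s := by
  have hg0 : 0 < g := by rw [hg, hh]; positivity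
  have hgd0 : 0 < g * d := Nat.mul_pos hg0 hd
  simp only [tableCmd, wp_seq, wp_iset]
  refine ⟨trivial, trivial, ?_⟩
  refine wp_whl (fun s' => ∃ i cnt, i ≤ N / (g * d) + 1 ∧ s'.iv 57 = i * g ∧ s'.iv 54 = cnt ∧
    cnt ≤ i * (1 + N * h) ∧ Trie (s'.ia 0) cnt ∧ (∀ v, cnt < v → s'.ia 2 0 v = 0) ∧
    Entries X Y d cnt (fun I t => I < i * g ∧ d ≤ t ∧ t < N + d) s' ∧
    s'.time ≤ s.time + i * (W * (g * (30 * (d + 1) ^ 2) + 4) +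
        N * (h * (4 * h + 14) + 3 * g + 12) + h * (10 * (g + 1) ^ 2 + 6) + 10) + 2)
    (fun s' => N - s'.iv 57) ⟨0, 0, by simp, by simp, by simp, by simp,
      ⟨fun r => by simp [hz0], fun v r _ => by simp [hz0], fun v r => by simp [hz0],
        fun v r h => absurd (by simp [hz0]) h, fun v r v' r' _ h => absurd (by simp [hz0]) h⟩,
      fun v _ => by simp [hz2], fun I t h => by omega, by simp⟩ ?_
  rintro s1 hf ⟨i, cnt, hi, i57, i54, hc, hT, hfl, hE, tm⟩
  have g0 : s1.iv 0 = N := by simpa [h0] using hf.iv 0 (by decide)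
  have g40 : s1.iv 40 = d := by simpa [h40] using hf.iv 40 (by decide)
  have g50 : s1.iv 50 = h := by simpa [h50] using hf.iv 50 (by decide)
  have g51 : s1.iv 51 = g := by simpa [h51] using hf.iv 51 (by decide)
  have r1 : s1.ra 1 0 = X := by simpa [hX] using congrFun (hf.ra 1 (by decide)) 0
  have r2 : s1.ra 2 0 = Y := by simpa [hY] using congrFun (hf.ra 2 (by decide)) 0
  clear hf
  have hlt : ∀ j, j * g * d < N → j ≤ N / (g * d) ∧ j * (g * d) ≤ N := fun j hj => by
    have : j * (g * d) ≤ N := by rw [← mul_assoc]; exact hj.le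
    exact ⟨(Nat.le_div_iff_mul_le hgd0).2 this, this⟩
  have hdm := Nat.div_mul_le_self N (g * d)
  have hig : i * g * d ≤ N + g * d := by
    calc i * g * d = i * (g * d) := by ring
      _ ≤ (N / (g * d) + 1) * (g * d) := Nat.mul_le_mul_right _ hi
      _ = N / (g * d) * (g * d) + g * d := by ring
      _ ≤ N + g * d := by omega
  refine ⟨by simp [i57, g40]; omega, fun hb => ?_, fun hb => ?_⟩
  · simp only [BE.val_ilt, IE.val_mul, IE.val_var, i57, g40, g0] at hb
    obtain ⟨hi1, hi2⟩ := hlt i hb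
    have hiN : i + 1 ≤ N + 1 := by
      have := Nat.div_le_self N (g * d)
      omega
    have hcN : (i + 1) * (1 + N * h) ≤ (N + 1) * (1 + N * h) := Nat.mul_le_mul_right _ hiN
    rw [Nat.succ_mul i] at hcN
    have e1 : (i * g + g) * d = i * g * d + g * d := by ring
    simp only [wp_seq]
    refine (wp_classes (s := s1.tick) (X := X) (Y := Y) (d := d) (h := h) (g := g) (J := i * g)
      (N := N) (cnt := cnt) (D := fun I t => I < i * g ∧ d ≤ t ∧ t < N + d)
      r1 r2 g0 g40 hd g50 hh g51 hg i57 i54 hT hfl hE hS (by omega) (by omega)).mono ?_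
    rintro s2 hf ⟨cnt', A, k54, hc', hT', hfl', hA, hinj, hE', tm2⟩
    have k51 : s2.iv 51 = g := by simpa [g51] using hf.iv 51 (by decide)
    have k57 : s2.iv 57 = i * g := by simpa [i57] using hf.iv 57 (by decide)
    clear hf
    have hAW := Nat.mul_le_mul_right (g * (30 * (d + 1) ^ 2) + 4) (hW _ A hA hinj)
    have hgd : g ≤ g * d := Nat.le_mul_of_pos_right _ hd
    have higl : i * g ≤ i * g * d := Nat.le_mul_of_pos_right _ hd
    have b1 : i * g + g < S := by omega
    simp only [St.tick_time] at tm2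
    simp only [wp_iset, IE.ok_add, IE.ok_var, IE.val_add, IE.val_var,
      Function.update_self, k57, k51, b1, true_and]
    refine ⟨⟨i + 1, cnt', by omega, by ring, ?_, by rw [Nat.succ_mul i]; omega, hT', hfl', ?_, ?_⟩,
      ?_⟩
    · simpa using k54
    · intro I t hD
      refine hE' I t ?_
      rw [Nat.succ_mul] at hD
      rcases (by omega : I < i * g ∨ i * g ≤ I) with h' | h'
      · exact Or.inl ⟨h', hD.2⟩
      · exact Or.inr ⟨h', hD.1, hD.2⟩
    · rw [Nat.succ_mul i]
      omega
    · omega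
  · simp only [BE.val_ilt, IE.val_mul, IE.val_var, i57, g40, g0] at hb
    have hiN : i ≤ N + 1 := by
      have := Nat.div_le_self N (g * d)
      omega
    refine ⟨cnt, hc.trans (Nat.mul_le_mul_right _ hiN), fun I t hD => hE I t ⟨?_, hD.2⟩, ?_⟩
    · have : I * d < i * g * d := by omega
      exact Nat.lt_of_mul_lt_mul_right this
    · have := Nat.mul_le_mul_right (W * (g * (30 * (d + 1) ^ 2) + 4) +
        N * (h * (4 * h + 14) + 3 * g + 12) + h * (10 * (g + 1) ^ 2 + 6) + 10) hi
      simp only [St.tick_time]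
      omega

end MedConv

/-! ### Counting classes by VC dimension -/

namespace MedConv

open Finset

/-- Term by term, `m.choose k ≤ m ^ k ≤ m ^ k * D.choose k`, and the right sides sum to `(m + 1) ^
D`. -/
theorem sum_choose_le (m D : ℕ) : ∑ k ∈ Iic D, m.choose k ≤ (m + 1) ^ D := by
  rw [add_pow, ← Nat.range_succ_eq_Iic]
  refine sum_le_sum fun k hk => ?_
  have hk' : k ≤ D := Nat.lt_succ_iff.1 (mem_range.1 hk)
  rw [one_pow, mul_one]
  exact (Nat.choose_le_pow m k).trans (Nat.le_mul_of_pos_right _ (Nat.choose_pos hk'))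

/-- The vector of a pair and a block. -/
noncomputable def pairVec (X : ℕ → ℝ) (J : ℕ) {d g : ℕ} (p : Fin g × Fin d × Fin d) :
    (Fin d → ℝ) × ℝ :=
  (Pi.single p.2.1 1 - Pi.single p.2.2 1, blockDiff X J d p.2.1 p.2.2 p.1)

/-- The linear functional whose sign on `pairVec` is the result of the comparison. -/
noncomputable def shiftFun (Y : ℕ → ℝ) (d τ : ℕ) : ((Fin d → ℝ) × ℝ) →ₗ[ℝ] ℝ where
  toFun v := ∑ i : Fin d, Y (τ - i) * v.1 i - v.2
  map_add' v w := by
    simp only [Prod.fst_add, Prod.snd_add, Pi.add_apply, mul_add, sum_add_distrib]; ring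
  map_smul' r v := by
    simp only [Prod.smul_fst, Prod.smul_snd, Pi.smul_apply, smul_eq_mul, RingHom.id_apply, mul_sub,
      mul_sum]
    congr 1
    exact sum_congr rfl fun i _ => by ring

theorem shiftFun_pairVec (X Y : ℕ → ℝ) (J τ : ℕ) {d g : ℕ} (p : Fin g × Fin d × Fin d) :
    shiftFun Y d τ (pairVec X J p) =
      Y (τ - p.2.1) - Y (τ - p.2.2) - blockDiff X J d p.2.1 p.2.2 p.1 := by
  simp [shiftFun, pairVec, mul_sub, Pi.single_apply, sum_sub_distrib]

/-- The set of true comparisons. -/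
noncomputable def trueSet (X Y : ℕ → ℝ) (J d g τ : ℕ) : Finset (Fin g × Fin d × Fin d) :=
  univ.filter fun p => blockDiff X J d p.2.1 p.2.2 p.1 ≤ Y (τ - p.2.1) - Y (τ - p.2.2)

theorem mem_trueSet {X Y : ℕ → ℝ} {J d g τ : ℕ} {p : Fin g × Fin d × Fin d} :
    p ∈ trueSet X Y J d g τ ↔ 0 ≤ shiftFun Y d τ (pairVec X J p) := by
  rw [shiftFun_pairVec, trueSet, mem_filter, sub_nonneg]
  simp

/-- Comparisons with linear functionals in dimension `d + 1` shatter at most `d + 1` points. -/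
theorem vcDim_trueSet (X Y : ℕ → ℝ) (J d g : ℕ) (A : Finset ℕ) :
    (A.image (trueSet X Y J d g)).vcDim ≤ d + 1 := by
  classical
  refine Finset.sup_le fun s hs => ?_
  rw [mem_shatterer] at hs
  -- The vectors of a shattered set are linearly independent in a space of dimension `d + 1`.
  have hli : LinearIndependent ℝ fun p : s => pairVec X J p.1 := by
    rw [Fintype.linearIndependent_iff]
    -- In a linear relation with a negative coefficient `w p0`, shattering provides a shift whose
    -- functional is nonnegative exactly where `w` is. Applied to the relation, this functional
    -- gives a sum with no negative term and a positive term at `p0`, although the sum is zero.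
    have key : ∀ w : s → ℝ, ∑ p, w p • pairVec X J p.1 = 0 → ∀ p, 0 ≤ w p := by
      intro w hw p0
      by_contra hneg
      rw [not_le] at hneg
      obtain ⟨u, hu, hsu⟩ := hs (t := (univ.filter fun p : s => 0 ≤ w p).map ⟨_, Subtype.val_injective⟩)
        (by
          intro x hx
          simp only [mem_map, mem_filter, mem_univ, true_and, Function.Embedding.coeFn_mk] at hx
          obtain ⟨y, -, rfl⟩ := hx
          exact y.2)
      obtain ⟨τ, -, rfl⟩ := mem_image.1 hu
      have hmem : ∀ p : s, 0 ≤ shiftFun Y d τ (pairVec X J p.1) ↔ 0 ≤ w p := by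
        intro p
        have := congrArg (fun z => p.1 ∈ z) hsu
        simp only [mem_inter, p.2, true_and, mem_trueSet, mem_map, mem_filter, mem_univ,
          Function.Embedding.coeFn_mk, eq_iff_iff] at this
        rw [this]
        constructor
        · rintro ⟨y, hy, he⟩
          rwa [← Subtype.ext he]
        · intro h
          exact ⟨p, h, rfl⟩
      have h0 : ∑ p, w p * shiftFun Y d τ (pairVec X J p.1) = 0 := by
        have := congrArg (shiftFun Y d τ) hw
        simpa only [map_sum, map_smul, smul_eq_mul, map_zero] using this
      have hpos : 0 < ∑ p, w p * shiftFun Y d τ (pairVec X J p.1) := by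
        refine sum_pos' (fun p _ => ?_) ⟨p0, mem_univ _, ?_⟩
        · by_cases hp : 0 ≤ w p
          · exact mul_nonneg hp ((hmem p).2 hp)
          · have := mt (hmem p).1 hp
            exact mul_nonneg_of_nonpos_of_nonpos (le_of_not_ge hp) (le_of_not_ge this)
        · have := mt (hmem p0).1 (not_le.2 hneg)
          exact mul_pos_of_neg_of_neg hneg (not_le.1 this)
      exact hpos.ne' h0
    intro w hw p
    refine le_antisymm ?_ (key w hw p)
    -- The negated relation gives the opposite inequality.
    have := key (fun p => - w p) (by simp only [neg_smul, sum_neg_distrib, hw, neg_zero]) p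
    linarith
  have := hli.fintype_card_le_finrank
  simpa using this

/-- The set of true comparisons determines the rank list, so shifts with different lists have
different sets. The Sauer–Shelah lemma bounds the number of these sets, which live on `g * d²`
points. -/
theorem card_le_of_injOn_rankList (X Y : ℕ → ℝ) (J d g : ℕ) (A : Finset ℕ)
    (h : Set.InjOn (fun τ => rankList X Y J d g τ (d * d)) (A : Finset ℕ)) :
    A.card ≤ (g * (d * d) + 1) ^ (d + 1) := by
  classical
  have hinj : Set.InjOn (trueSet X Y J d g) (A : Finset ℕ) := by
    intro τ hτ τ' hτ' he
    refine h hτ hτ' ?_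
    refine List.map_inj_left.2 fun e hed => ?_
    have hed := List.mem_range.1 hed
    have hd : 0 < d := Nat.pos_of_ne_zero (by rintro rfl; simp at hed)
    have h1 : e / d < d := by rwa [Nat.div_lt_iff_lt_mul hd]
    have h2 : e % d < d := Nat.mod_lt _ hd
    rw [diffRank, diffRank]
    congr 1
    refine filter_congr fun I hI => ?_
    have := congrArg (fun z => ((⟨I, mem_range.1 hI⟩, ⟨e / d, h1⟩, ⟨e % d, h2⟩) :
      Fin g × Fin d × Fin d) ∈ z) he
    simpa [trueSet] using this
  rw [← card_image_of_injOn hinj]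
  refine (card_le_card_shatterer _).trans (card_shatterer_le_sum_vcDim.trans ?_)
  rw [Fintype.card_prod, Fintype.card_prod, Fintype.card_fin, Fintype.card_fin]
  calc _ ≤ ∑ k ∈ Iic (d + 1), (g * (d * d)).choose k :=
        sum_le_sum_of_subset (Iic_subset_Iic.2 (vcDim_trueSet X Y J d g A))
    _ ≤ _ := sum_choose_le _ _

end MedConv

/-! ### From the tables to order statistics -/

namespace MedConv

open Finset

variable {S n : ℕ} {s s' : St}

/-- Recognises an order statistic by counting alone, so the permutation `Tuple.sort` plays no role
afterwards. -/
theorem orderStat_eq {m : ℕ} {w : Fin m → ℝ} {r : Fin m} {u : ℝ}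
    (h1 : (univ.filter fun i => w i < u).card ≤ r) (h2 : r < (univ.filter fun i => w i ≤ u).card) :
    orderStat w r = u := by
  have hmono := Tuple.monotone_sort w
  rw [orderStat]
  refine le_antisymm ?_ ?_
  · by_contra hc
    rw [not_le] at hc
    refine absurd h2 (not_lt.2 ?_)
    calc _ ≤ ((Iio r).image (Tuple.sort w)).card := card_le_card fun i hi => ?_
      _ ≤ (Iio r).card := card_image_le
      _ = r := Fin.card_Iio r
    rw [mem_filter] at hi
    refine mem_image.2 ⟨(Tuple.sort w).symm i, ?_, by simp⟩
    rw [mem_Iio]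
    by_contra hle
    have := hmono (not_lt.1 hle)
    simp only [Function.comp, Equiv.apply_symm_apply] at this
    linarith [hi.2]
  · by_contra hc
    rw [not_le] at hc
    refine absurd h1 (not_le.2 ?_)
    calc (r : ℕ) < (Iic r).card := by rw [Fin.card_Iic]; omega
      _ = ((Iic r).image (Tuple.sort w)).card :=
        (card_image_of_injective _ (Tuple.sort w).injective).symm
      _ ≤ _ := card_le_card fun i hi => ?_
    obtain ⟨j, hj, rfl⟩ := mem_image.1 hi
    rw [mem_filter]
    exact ⟨mem_univ _, (hmono (mem_Iic.1 hj)).trans_lt hc⟩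

theorem exists_rank {α : Type*} [LinearOrder α] (T : Finset α) {r : ℕ} (hr : r < T.card) :
    ∃ v ∈ T, (T.filter fun x => x < v).card = r := by
  set e := T.orderEmbOfFin rfl
  refine ⟨e ⟨r, hr⟩, orderEmbOfFin_mem _ _ _, ?_⟩
  have : T.filter (fun x => x < e ⟨r, hr⟩) = (Iio (⟨r, hr⟩ : Fin T.card)).map e.toEmbedding := by
    ext x
    simp only [mem_filter, mem_map, mem_Iio, RelEmbedding.coe_toEmbedding]
    constructor
    · rintro ⟨hx, hlt⟩
      have hx' : x ∈ Set.range e := by rw [range_orderEmbOfFin]; exact hx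
      obtain ⟨j, rfl⟩ := hx'
      exact ⟨j, e.lt_iff_lt.1 hlt, rfl⟩
    · rintro ⟨j, hj, rfl⟩
      exact ⟨orderEmbOfFin_mem _ _ _, e.lt_iff_lt.2 hj⟩
  rw [this, card_map, Fin.card_Iio]

theorem exists_rank_range {α : Type*} [LinearOrder α] {f : ℕ → α} (hf : Function.Injective f)
    {N r : ℕ} (hr : r < N) : ∃ i, i < N ∧ ((range N).filter fun j => f j < f i).card = r := by
  obtain ⟨v, hv, he⟩ := exists_rank ((range N).map ⟨f, hf⟩) (r := r) (by simpa using hr)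
  obtain ⟨i, hi, rfl⟩ := mem_map.1 hv
  refine ⟨i, mem_range.1 hi, ?_⟩
  rw [filter_map, card_map] at he
  exact he

/-- An injective map of `range N` into itself is a permutation. It is applied to the lists read from
the tables, so ranks in the lists are ranks among all indices. -/
theorem card_filter_comp {N : ℕ} {F : ℕ → ℕ} (hinj : ∀ i j, i < N → j < N → F i = F j → i = j)
    (hF : ∀ i, i < N → F i < N) (P : ℕ → Prop) [DecidablePred P] :
    ((range N).filter fun i => P (F i)).card = ((range N).filter P).card := by
  have hio : Set.InjOn F (range N : Finset ℕ) := fun i hi j hj he =>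
    hinj i j (mem_range.1 hi) (mem_range.1 hj) he
  have himg : (range N).image F = range N := by
    refine eq_of_subset_of_card_le (fun x hx => ?_) (by rw [card_image_of_injOn hio])
    obtain ⟨i, hi, rfl⟩ := mem_image.1 hx
    exact mem_range.2 (hF i (mem_range.1 hi))
  conv_rhs => rw [← himg, filter_image]
  rw [card_image_of_injOn]
  exact hio.mono (coe_subset.2 (filter_subset _ _))

/-- The tables give lists that are sorted within blocks. -/
theorem Entries.lists {N d cnt k m : ℕ} {s : St}
    (h : Entries (s.ra 1 0) (s.ra 2 0) d cnt (fun I t => I * d < N ∧ d ≤ t ∧ t < N + d) s)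
    (hd : 0 < d) (hk : k < N) (hm : m * d ≤ k + d) (h5 : s.iv 5 = k + d) :
    Lists (s.list d) s.key d (m * d) (m * d) ∧
      (∀ i, i < m * d → s.ia 3 (i / d) (s.iv 5 - i / d * d) ≤ cnt) := by
  have hb : ∀ i, i < m * d → i / d * d ≤ k := by
    intro i hi
    have h1 : i / d < m := (Nat.div_lt_iff_lt_mul hd).2 hi
    have h2 : (i / d + 1) * d ≤ m * d := Nat.mul_le_mul_right d h1
    rw [Nat.succ_mul] at h2
    omega
  have hE := fun i (hi : i < m * d) => h (i / d) (k + d - i / d * d)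
    ⟨(hb i hi).trans_lt hk, by have := hb i hi; omega, by omega⟩
  have hpos : ∀ i, i / d * d + i % d = i := fun i => by rw [mul_comm]; exact Nat.div_add_mod i d
  have hlist : ∀ i, s.list d i = s.ia 1 (s.ia 3 (i / d) (k + d - i / d * d)) (i / d * d + i % d) := by
    intro i
    rw [St.list, h5, hpos]
  have hmem : ∀ i, i < m * d → i / d * d ≤ s.list d i ∧ s.list d i < i / d * d + d := by
    intro i hi
    rw [hlist]
    exact (hE i hi).2.2.mem (i % d) (Nat.mod_lt _ hd)
  have hkey : ∀ i, i < m * d → s.key =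
      key (s.ra 1 0) (s.ra 2 0) (k + d - i / d * d + i / d * d) := by
    intro i hi
    rw [St.key, h5, Nat.sub_add_cancel]
    have := hb i hi
    omega
  have hinc : ∀ i j, i < j → j < m * d → i / d = j / d → s.key (s.list d i) < s.key (s.list d j) := by
    intro i j hij hj he
    have h1 := (hE j hj).2.2.inc (i % d) (j % d) ?_ (Nat.mod_lt _ hd)
    · rw [hlist i, hlist j, he, hkey j hj]
      exact h1
    · have e1 := hpos i
      have e2 := hpos j
      rw [he] at e1
      omega
  refine ⟨⟨hd, fun i j hi hj he => ?_, hinc, fun i hi => ?_⟩, fun i hi => ?_⟩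
  · have he := key_injective _ _ _ he
    have m1 := hmem i hi
    have m2 := hmem j hj
    have hdiv : ∀ q x, q * d ≤ x → x < q * d + d → x / d = q := by
      intro q x h1 h2
      refine Nat.div_eq_of_lt_le h1 ?_
      rw [Nat.succ_mul]; exact h2
    -- An index lies in the block of its position, so equal indices come from the same block, and
    -- within a block the keys increase strictly.
    have hij : i / d = j / d := by
      rw [← hdiv _ _ m1.1 m1.2, ← hdiv _ _ m2.1 m2.2, he]
    rcases lt_trichotomy i j with hlt | heq | hgt
    · exact absurd (congrArg s.key he) (hinc i j hlt hj hij).ne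
    · exact heq
    · exact absurd (congrArg s.key he.symm) (hinc j i hgt hi hij.symm).ne
  · have h1 : i / d < m := (Nat.div_lt_iff_lt_mul hd).2 hi
    have h2 : (i / d + 1) * d ≤ m * d := Nat.mul_le_mul_right d h1
    rw [Nat.succ_mul] at h2
    have := (hmem i hi).2
    omega
  · rw [h5]
    exact (hE i hi).1

/-- `X` and `Y` contain the input vectors, `Y` being shifted by `d`; the differences for the first
`d` entries of `Y` are larger than all others. -/
structure Padded {n : ℕ} (x y : Fin n → ℝ) (d : ℕ) (X Y : ℕ → ℝ) : Prop where
  x_eq : ∀ i : Fin n, X i = x i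
  y_eq : ∀ j : Fin n, Y (j + d) = y j
  pad : ∀ i j : Fin n, ∀ i' t, t < d → x i - y j < X i' - Y t

/-- The order statistics of the convolution as ranks of keys. -/
theorem Padded.exists_key {n : ℕ} {x y : Fin n → ℝ} {d : ℕ} {X Y : ℕ → ℝ} (h : Padded x y d X Y)
    {N r : ℕ} (k : Fin n) (hr : r < k + 1) (hN1 : k < N) (hN2 : N ≤ k + d) :
    ∃ i, i < N ∧
      ((range N).filter fun j => key X Y (k + d) j < key X Y (k + d) i).card = r ∧
      X i - Y (k + d - i) =
        orderStat (fun i : Fin (k + 1) => x ⟨i, by omega⟩ - y ⟨k - i, by omega⟩) ⟨r, hr⟩ := by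
  obtain ⟨i, hi, hc⟩ := exists_rank_range (key_injective X Y (k + d)) (N := N) (r := r) (by omega)
  refine ⟨i, hi, hc, ?_⟩
  have hw : ∀ j : Fin (k + 1), X j - Y (k + d - j) = x ⟨j, by omega⟩ - y ⟨k - j, by omega⟩ := by
    intro j
    have e : (k : ℕ) + d - j = (⟨k - j, by omega⟩ : Fin n) + d := by
      have := j.2
      simp only
      omega
    rw [e, h.y_eq, ← h.x_eq]
  have hpad : ∀ j : ℕ, k < j → j < N → ∀ j' : Fin (k + 1),
      X j' - Y (k + d - j') < X j - Y (k + d - j) := by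
    intro j hj hjN j'
    rw [hw j']
    exact h.pad _ _ j _ (by omega)
  -- A padded position exceeds all `k + 1` genuine differences, so its rank would be at least `k + 1
  -- > r`.
  have hik : i < k + 1 := by
    by_contra hik
    have : (range (k + 1)).card ≤ r := by
      rw [← hc]
      refine card_le_card fun j hj => ?_
      have hj := mem_range.1 hj
      rw [mem_filter, mem_range]
      refine ⟨by omega, ?_⟩
      rw [key, key, Prod.Lex.toLex_lt_toLex]
      exact Or.inl (hpad i (by omega) hi ⟨j, hj⟩)
    rw [card_range] at this
    omega
  have hcard : ∀ P : ℕ → Prop, ∀ [DecidablePred P],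
      (univ.filter fun j : Fin (k + 1) => P j).card = ((range (k + 1)).filter P).card := by
    intro P _
    rw [card_filter, card_filter, sum_range]
  symm
  refine orderStat_eq ?_ ?_
  · simp only [← hw]
    rw [hcard (fun j => X j - Y (k + d - j) < X i - Y (k + d - i)), ← hc]
    refine card_le_card fun j hj => ?_
    rw [mem_filter, mem_range] at hj ⊢
    refine ⟨by omega, ?_⟩
    rw [key, key, Prod.Lex.toLex_lt_toLex]
    exact Or.inl hj.2
  · simp only [← hw]
    rw [hcard (fun j => X j - Y (k + d - j) ≤ X i - Y (k + d - i))]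
    have : (insert i ((range N).filter fun j => key X Y (k + d) j < key X Y (k + d) i)).card =
        r + 1 := by
      rw [card_insert_of_notMem (by simp), hc]
    rw [← Nat.succ_le_iff, Nat.succ_eq_add_one]
    rw [← this]
    refine card_le_card fun j hj => ?_
    rw [mem_filter, mem_range]
    rcases mem_insert.1 hj with rfl | hj
    · exact ⟨hik, le_rfl⟩
    · rw [mem_filter, mem_range, key, key, Prod.Lex.toLex_lt_toLex] at hj
      have hle : X j - Y (k + d - j) ≤ X i - Y (k + d - i) := by
        rcases hj.2 with h' | h'
        · exact h'.le
        · exact h'.1.le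
      refine ⟨?_, hle⟩
      by_contra hjk
      exact absurd hle (not_le.2 (hpad j (by omega) hj.1 ⟨i, hik⟩))

end MedConv

/-! ### Computing the entries of the convolution -/

namespace MedConv

open Finset

variable {S n : ℕ} {s s' : St}

/-- The tables are filled. -/
structure Ready {n : ℕ} (x y : Fin n → ℝ) (d L cnt : ℕ) (s : St) : Prop where
  i0 : s.iv 0 = n
  i40 : s.iv 40 = d
  i41 : s.iv 41 = L
  pow : d = 2 ^ L
  powers : ∀ i, i ≤ L → s.ia 4 0 i = 2 ^ i
  entries : Entries (s.ra 1 0) (s.ra 2 0) d cnt (fun I t => I * d < n ∧ d ≤ t ∧ t < n + d) s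
  padded : Padded x y d (s.ra 1 0) (s.ra 2 0)

theorem Ready.congr {x y : Fin n → ℝ} {d L cnt : ℕ} (h : Ready x y d L cnt s)
    (h0 : s'.iv 0 = s.iv 0) (h40 : s'.iv 40 = s.iv 40) (h41 : s'.iv 41 = s.iv 41)
    (a1 : s'.ia 1 = s.ia 1) (a2 : s'.ia 2 = s.ia 2) (a3 : s'.ia 3 = s.ia 3)
    (a4 : s'.ia 4 = s.ia 4) (r1 : s'.ra 1 = s.ra 1) (r2 : s'.ra 2 = s.ra 2) :
    Ready x y d L cnt s' := by
  refine ⟨h0.trans h.i0, h40.trans h.i40, h41.trans h.i41, h.pow, fun i hi => ?_, ?_, ?_⟩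
  · rw [a4]; exact h.powers i hi
  · rw [r1, r2]
    intro I t hD
    rw [a1, a2, a3]
    exact h.entries I t hD
  · rw [r1, r2]; exact h.padded

/-- Puts the difference of rank `ν a` into the real variable `b`. -/
def valueCmd (a b : ℕ) : Cmd := 30 ≔ ν a ;; selectCmd ;; .rset b (keyE (ν 49))

theorem wp_value {x y : Fin n → ℝ} {d L cnt a b r : ℕ} (h : Ready x y d L cnt s) (k : Fin n)
    (h42 : s.iv 42 = k) (h5 : s.iv 5 = k + d) (hr : r < k + 1) (ha : s.iv a = r)
    (hcS : cnt < S) (hLS : L < S) (hS : 2 ^ 15 + 12800 * n + 2 * d ≤ S) :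
    wp S n (valueCmd a b) (fun s' => s'.rv b =
        orderStat (fun i : Fin (k + 1) => x ⟨i, by omega⟩ - y ⟨k - i, by omega⟩) ⟨r, hr⟩ ∧
      s'.time ≤ s.time + 1000000000 * (n / d + 1) * (L + 1) + 2) s := by
  classical
  have hd : 0 < d := by rw [h.pow]; positivity
  have hk := k.2
  -- The blocks cover `0, …, k`, and `m * d ≤ k + d`, so each further position `i` has `k + d - i <
  -- d` and is padded.
  set m := (k : ℕ) / d + 1 with hm
  have hdm := Nat.div_add_mod (k : ℕ) d
  have hml := Nat.mod_lt (k : ℕ) hd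
  have hmd : m * d = d * ((k : ℕ) / d) + d := by rw [hm]; ring
  have hkm : (k : ℕ) / d ≤ n / d := Nat.div_le_div_right hk.le
  have hkk := Nat.div_le_self (k : ℕ) d
  simp only [valueCmd, wp_seq, wp_iset]
  refine ⟨trivial, ?_⟩
  simp only [IE.val_var, ha]
  generalize hs1 : ({ s with iv := Function.update s.iv 30 r, time := s.time + 1 } : St) = s1
  have hfr : ∀ i, i ≠ 30 → s1.iv i = s.iv i := fun i hi => by rw [← hs1]; simp [hi]
  have h30 : s1.iv 30 = r := by rw [← hs1]; simp
  have tm1 : s1.time = s.time + 1 := by rw [← hs1]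
  have hR : Ready x y d L cnt s1 := by
    rw [← hs1]
    exact h.congr (by simp) (by simp) (by simp) rfl rfl rfl rfl rfl rfl
  clear hs1
  have e5 : s1.iv 5 = k + d := (hfr 5 (by decide)).trans h5
  obtain ⟨hL, hrow⟩ := hR.entries.lists hd hk (m := m) (by omega) e5
  obtain ⟨i0, hi0, hc, hval⟩ := hR.padded.exists_key k hr (N := m * d) (by omega) (by omega)
  have hkey : ∀ i, key (s1.ra 1 0) (s1.ra 2 0) (k + d) i = s1.key i := fun i => by rw [St.key, e5]
  simp only [hkey] at hc
  have hLinj : ∀ i j, i < m * d → j < m * d → s1.list d i = s1.list d j → i = j :=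
    fun i j hi hj he => hL.inj i j hi hj (by rw [he])
  have hcnt := card_filter_comp hLinj hL.bd (fun i => s1.key i < s1.key i0)
  have hsurj : ∃ pos, pos < m * d ∧ s1.key (s1.list d pos) = s1.key i0 := by
    have h1 := card_filter_comp hLinj hL.bd (fun i => i = i0)
    have h2 : ((range (m * d)).filter fun i => i = i0).card = 1 := by
      rw [card_eq_one]
      refine ⟨i0, ?_⟩
      ext i
      simp only [mem_filter, mem_range, mem_singleton]
      exact ⟨fun h => h.2, fun h => ⟨h ▸ hi0, h⟩⟩
    obtain ⟨pos, hpos⟩ := card_pos.1 (by omega : 0 <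
      ((range (m * d)).filter fun i => s1.list d i = i0).card)
    rw [mem_filter, mem_range] at hpos
    exact ⟨pos, hpos.1, by rw [hpos.2]⟩
  refine (wp_select (v := s1.key i0) (m := m) (k := k) (Bd := m * d)
    ((hfr 42 (by decide)).trans h42) hR.i40 hR.i41
    hLS hR.pow hR.powers (by omega) (by omega) (by omega) (Nat.succ_pos _) (by omega) hL (by omega)
    hsurj ?_ (fun c hc => ?_) (by omega) (by omega)).mono ?_
  · rw [Nat.count_eq_card_filter_range, h30, ← hc, ← hcnt]
  · have h1 := hrow (c * d) (Nat.mul_lt_mul_of_pos_right hc hd)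
    rw [Nat.mul_div_cancel _ hd] at h1
    omega
  rintro s2 hf ⟨j1, j2, j3⟩
  have m5 : s2.iv 5 = k + d := (hf.iv 5 (by decide)).trans e5
  have m1 : s2.ra 1 = s1.ra 1 := hf.ra 1 (by decide)
  have m2 : s2.ra 2 = s1.ra 2 := hf.ra 2 (by decide)
  have hi : s2.iv 49 = i0 := key_injective _ _ _ j2
  have b0 : 0 < S := by omega
  have b1 : i0 < S := by omega
  have b2 : (k : ℕ) + d - i0 < S := by omega
  simp only [wp_rset, keyE, RE.ok_sub, RE.ok_ld, IE.ok_lit, IE.ok_sub, IE.ok_var, IE.val_lit,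
    IE.val_var, IE.val_sub, RE.val_sub, RE.val_ld, m5, m1, m2, hi, b0, b1, b2, true_and,
    Function.update_self]
  refine ⟨hval, ?_⟩
  have : 1000000000 * m * (L + 1) ≤ 1000000000 * (n / d + 1) * (L + 1) := by
    gcongr
    exact Nat.succ_le_succ hkm
  omega

/-- The output as an expression in the two middle values. -/
def outE : MedianRule → RE
  | .lower => .var 4
  | .upper => .var 5
  | .midpoint => .lit (1 / 2) * (.var 4 + .var 5)

/-- Computes one entry of the convolution. -/
def entryCmd (ρ : MedianRule) : Cmd :=
  5 ≔ ν 42 + ν 40 ;; valueCmd 70 4 ;; valueCmd 71 5 ;; .rawput (ν 42) (outE ρ) ;;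
  -- The pair `(k / 2, (k + 1) / 2)` becomes `((k + 1) / 2, k / 2 + 1)`, which avoids division by
  -- two.
  72 ≔ ν 70 ;; 70 ≔ ν 71 ;; 71 ≔ ν 72 + 1 ;; 42 ≔ ν 42 + 1

def entriesCmd (ρ : MedianRule) : Cmd :=
  42 ≔ 0 ;; 70 ≔ 0 ;; 71 ≔ 0 ;; .whl (.ilt (ν 42) (ν 0)) (entryCmd ρ)

theorem outE_ok (ρ : MedianRule) (s : St) : (outE ρ).ok S n s := by
  cases ρ <;> simp [outE, RE.ok]

theorem outE_val (ρ : MedianRule) (s : St) {k : ℕ} (w : Fin (k + 1) → ℝ)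
    (h4 : s.rv 4 = orderStat w ⟨k / 2, by omega⟩)
    (h5 : s.rv 5 = orderStat w ⟨(k + 1) / 2, by omega⟩) : (outE ρ).val s = median ρ w := by
  cases ρ
  · simpa [outE, median] using h4
  · simpa [outE, median] using h5
  · have : (RE.lit (1 / 2)).val s = 1 / 2 := by simp [RE.val]
    simp only [outE, median, RE.val_mul, RE.val_add, RE.val_var, h4, h5, this]
    ring

/-- The result overwrites an entry of `x`; this is harmless, because all later computations read the
copies in the real arrays `1` and `2`. -/
theorem wp_entry {ρ : MedianRule} {x y : Fin n → ℝ} {d L cnt : ℕ} (h : Ready x y d L cnt s)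
    (k : Fin n) (h42 : s.iv 42 = k) (h70 : s.iv 70 = k / 2) (h71 : s.iv 71 = (k + 1) / 2)
    (hcS : cnt < S) (hLS : L < S) (hS : 2 ^ 15 + 12800 * n + 2 * d ≤ S) :
    wp S n (entryCmd ρ) (fun s' => Ready x y d L cnt s' ∧ s'.iv 42 = k + 1 ∧
      s'.iv 70 = (k + 1) / 2 ∧ s'.iv 71 = (k + 1 + 1) / 2 ∧
      s'.raw k = medianConv ρ n x y k ∧ (∀ j : ℕ, j ≠ k → s'.raw j = s.raw j) ∧
      s'.time ≤ s.time + 2000000000 * (n / d + 1) * (L + 1) + 10) s := by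
  have hk := k.2
  simp only [entryCmd, wp_seq, wp_iset]
  have h40 := h.i40
  have b1 : (k : ℕ) + d < S := by omega
  refine ⟨by simp [h42, h40, b1], ?_⟩
  refine (wp_value (x := x) (y := y) (d := d) (L := L) (cnt := cnt) (r := k / 2)
    (h.congr (by simp) (by simp) (by simp) (by rfl) (by rfl) (by rfl) (by rfl) (by rfl) (by rfl)) k
    (by simpa using h42)
    (by simp [h42, h40]) (by omega) (by simpa using h70) hcS hLS hS).mono ?_
  rintro s1 hf ⟨v4, tm1⟩
  have g5 : s1.iv 5 = k + d := by simpa [h42, h40] using hf.iv 5 (by decide)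
  have g42 : s1.iv 42 = k := by simpa [h42] using hf.iv 42 (by decide)
  have g70 : s1.iv 70 = k / 2 := by simpa [h70] using hf.iv 70 (by decide)
  have g71 : s1.iv 71 = (k + 1) / 2 := by simpa [h71] using hf.iv 71 (by decide)
  have graw : s1.raw = s.raw := by simpa using hf.raw (by decide)
  have hR1 : Ready x y d L cnt s1 := h.congr (by simpa using hf.iv 0 (by decide))
    (by simpa using hf.iv 40 (by decide)) (by simpa using hf.iv 41 (by decide))
    (by simpa using hf.ia 1 (by decide)) (by simpa using hf.ia 2 (by decide))
    (by simpa using hf.ia 3 (by decide)) (by simpa using hf.ia 4 (by decide))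
    (by simpa using hf.ra 1 (by decide)) (by simpa using hf.ra 2 (by decide))
  clear hf
  rw [wp_seq]
  refine (wp_value (b := 5) (r := (k + 1) / 2) hR1 k g42 g5 (by omega) g71 hcS hLS hS).mono ?_
  rintro s2 hf ⟨v5, tm2⟩
  have k42 : s2.iv 42 = k := (hf.iv 42 (by decide)).trans g42
  have k70 : s2.iv 70 = k / 2 := (hf.iv 70 (by decide)).trans g70
  have k71 : s2.iv 71 = (k + 1) / 2 := (hf.iv 71 (by decide)).trans g71
  have kraw : s2.raw = s.raw := (hf.raw (by decide)).trans graw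
  have k4 : s2.rv 4 = s1.rv 4 := hf.rv 4 (by decide)
  have hR2 : Ready x y d L cnt s2 := hR1.congr (hf.iv 0 (by decide))
    (hf.iv 40 (by decide)) (hf.iv 41 (by decide))
    (hf.ia 1 (by decide)) (hf.ia 2 (by decide)) (hf.ia 3 (by decide)) (hf.ia 4 (by decide))
    (hf.ra 1 (by decide)) (hf.ra 2 (by decide))
  clear hf
  have b2 : (k : ℕ) / 2 + 1 < S := by omega
  have b3 : (k : ℕ) + 1 < S := by omega
  have b4 : (k : ℕ) < 2 * n := by omega
  have hval := outE_val ρ s2 _ (k4.trans v4) v5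
  simp only [wp_seq, wp_iset, wp_rawput, IE.ok_add, IE.ok_var, IE.ok_lit, IE.val_add, IE.val_var,
    IE.val_lit, ne_eq, Nat.reduceEqDiff, not_false_eq_true, Function.update_of_ne,
    Function.update_self, k42, k70, k71, b2, b3, b4, outE_ok, hval, true_and]
  refine ⟨hR2.congr (by simp) (by simp) (by simp) rfl rfl rfl rfl rfl rfl, by omega, rfl,
    fun j hj => by rw [Function.update_of_ne hj, kraw], ?_⟩
  simp only at tm1
  have e : 2000000000 * (n / d + 1) * (L + 1) = 1000000000 * (n / d + 1) * (L + 1) +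
    1000000000 * (n / d + 1) * (L + 1) := by ring
  omega

theorem wp_entries {ρ : MedianRule} {x y : Fin n → ℝ} {d L cnt : ℕ} (h : Ready x y d L cnt s)
    (hcS : cnt < S) (hLS : L < S) (hS : 2 ^ 15 + 12800 * n + 2 * d ≤ S) :
    wp S n (entriesCmd ρ) (fun s' => (∀ k : Fin n, s'.raw k = medianConv ρ n x y k) ∧
      s'.time ≤ s.time + n * (2000000000 * (n / d + 1) * (L + 1) + 11) + 4) s := by
  simp only [entriesCmd, wp_seq, wp_iset]
  refine ⟨trivial, trivial, trivial, ?_⟩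
  refine wp_whl (fun s' => ∃ k, k ≤ n ∧ s'.iv 42 = k ∧ s'.iv 70 = k / 2 ∧ s'.iv 71 = (k + 1) / 2 ∧
    Ready x y d L cnt s' ∧ (∀ j : Fin n, j < k → s'.raw j = medianConv ρ n x y j) ∧
    s'.time ≤ s.time + 3 + k * (2000000000 * (n / d + 1) * (L + 1) + 11))
    (fun s' => n - s'.iv 42)
    ⟨0, Nat.zero_le _, by simp, by simp, by simp,
      h.congr (by simp) (by simp) (by simp) rfl rfl rfl rfl rfl rfl, by simp, by simp⟩ ?_
  rintro s1 - ⟨k, hk, i42, i70, i71, hR, hout, tm⟩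
  refine ⟨by simp, fun hb => ?_, fun hb => ?_⟩
  · simp only [BE.val_ilt, IE.val_var, i42, hR.i0] at hb
    refine (wp_entry (s := s1.tick) (ρ := ρ)
      (hR.congr rfl rfl rfl rfl rfl rfl rfl rfl rfl) ⟨k, hb⟩ i42 i70 i71 hcS hLS hS).mono ?_
    rintro s2 - ⟨q1, q2, q3, q4, q5, q6, q7⟩
    simp only [St.tick_raw, St.tick_time] at q2 q3 q4 q5 q6 q7
    refine ⟨⟨k + 1, hb, q2, q3, q4, q1, fun j hj => ?_, ?_⟩, by omega⟩
    · by_cases hjk : (j : ℕ) = k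
      · obtain rfl : j = ⟨k, hb⟩ := Fin.ext hjk
        exact q5
      · rw [q6 _ hjk]
        exact hout j (by omega)
    · generalize 2000000000 * (n / d + 1) * (L + 1) = Z at *
      rw [Nat.succ_mul k]
      omega
  · simp only [BE.val_ilt, IE.val_var, i42, hR.i0] at hb
    have : k = n := by omega
    subst this
    exact ⟨fun j => hout j j.2, by simp only [St.tick_time]; omega⟩

end MedConv

/-! ### Block length, copies of the input, and padding -/

namespace MedConv

open Finset

variable {S n : ℕ} {s s' : St}

/-- Computes the binary logarithm of `ν 0`. -/
def logCmd : Cmd :=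
  73 ≔ 0 ;; 74 ≔ 1 ;; .whl (.ilt (2 * ν 74) (ν 0 + 1)) (73 ≔ ν 73 + 1 ;; 74 ≔ 2 * ν 74)

theorem wp_log {N : ℕ} (h0 : s.iv 0 = N) (hS : 2 * N + 2 < S) :
    wp S n logCmd (fun s' => s'.iv 73 = Nat.log 2 N ∧ s'.time ≤ s.time + 3 * N + 3) s := by
  simp only [logCmd, wp_seq, wp_iset]
  refine ⟨trivial, trivial, ?_⟩
  refine wp_whl (fun s' => ∃ c, s'.iv 73 = c ∧ s'.iv 74 = 2 ^ c ∧ (2 ^ c ≤ N ∨ c = 0) ∧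
    s'.time = s.time + 2 + 3 * c) (fun s' => N - s'.iv 73) ⟨0, by simp⟩ ?_
  rintro s1 hf ⟨c, i73, i74, hc, tm⟩
  have g0 : s1.iv 0 = N := by simpa [h0] using hf.iv 0 (by decide)
  clear hf
  have hp : 2 ^ (c + 1) = 2 * 2 ^ c := by rw [pow_succ']
  have hlt := Nat.lt_two_pow_self (n := c)
  have hlt' := Nat.lt_two_pow_self (n := c + 1)
  have b1 : 2 * 2 ^ c < S := by
    rcases hc with hc | rfl
    · omega
    · simp; omega
  have b2 : 2 < S := by omega
  have b3 : N + 1 < S := by omega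
  refine ⟨by simp [g0, i74, b1, b3], fun hb => ?_, fun hb => ?_⟩
  · simp only [BE.val_ilt, IE.val_mul, IE.val_add, IE.val_lit, IE.val_var, i74, g0] at hb
    have b4 : c + 1 < S := by omega
    simp only [wp_seq, wp_iset, IE.ok_add, IE.ok_mul, IE.ok_var, IE.ok_lit, IE.val_add, IE.val_mul,
      IE.val_var, IE.val_lit, St.tick_iv, St.tick_time, ne_eq, Nat.reduceEqDiff,
      not_false_eq_true, Function.update_of_ne, Function.update_self, i73, i74, b1, b2, b4,
      true_and]
    exact ⟨⟨c + 1, rfl, hp.symm, Or.inl (by omega), by omega⟩, by omega⟩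
  · simp only [BE.val_ilt, IE.val_mul, IE.val_add, IE.val_lit, IE.val_var, i74, g0] at hb
    have hcN : c ≤ N := by
      rcases hc with hc | rfl
      · omega
      · exact Nat.zero_le _
    refine ⟨?_, by simp only [St.tick_time]; omega⟩
    simp only [St.tick_iv, i73]
    rcases Nat.eq_zero_or_pos c with rfl | hc0
    · rw [pow_zero] at hb
      rw [Nat.log_of_lt (by omega)]
    · rcases hc with hc | hc
      · exact (Nat.log_eq_of_pow_le_of_lt_pow hc (by omega)).symm
      · omega

/-- Computes the block length `ν 40`, its logarithm `ν 41`, the powers of two up to it, and the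
group size. -/
def dimCmd : Cmd :=
  41 ≔ 0 ;; 40 ≔ 1 ;; .iput 4 0 0 1 ;;
  .whl (.ilt (40 * (ν 41 + 1) * (2 * ν 40)) (ν 73 + 1)) (
    41 ≔ ν 41 + 1 ;; 40 ≔ 2 * ν 40 ;; .iput 4 0 (ν 41) (ν 40)) ;;
  50 ≔ ν 40 * ν 40 ;; 51 ≔ ν 50 * ν 50

theorem wp_dim {l : ℕ} (h73 : s.iv 73 = l) (hS : (l + 40) * (2 * l + 2) < S)
    (hS4 : (l + 1) ^ 4 < S) :
    wp S n dimCmd (fun s' => ∃ L, 40 * L * 2 ^ L ≤ l ∧ l < 40 * (L + 1) * 2 ^ (L + 1) ∧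
      s'.iv 41 = L ∧ s'.iv 40 = 2 ^ L ∧ s'.iv 50 = 2 ^ L * 2 ^ L ∧
      s'.iv 51 = 2 ^ L * 2 ^ L * (2 ^ L * 2 ^ L) ∧ (∀ i, i ≤ L → s'.ia 4 0 i = 2 ^ i) ∧
      s'.time ≤ s.time + 4 * l + 6) s := by
  have hS1 : (l + 40) * 2 ≤ (l + 40) * (2 * l + 2) := Nat.mul_le_mul_left _ (by omega)
  have b0 : 0 < S := by omega
  have b1 : 1 < S := by omega
  have b2 : 2 < S := by omega
  have b40 : 40 < S := by omega
  simp only [dimCmd, wp_seq, wp_iset, wp_iput]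
  refine ⟨trivial, trivial, by simp [b0], ?_⟩
  refine wp_whl (fun s' => ∃ L, 40 * L * 2 ^ L ≤ l ∧ s'.iv 41 = L ∧ s'.iv 40 = 2 ^ L ∧
    (∀ i, i ≤ L → s'.ia 4 0 i = 2 ^ i) ∧ s'.time = s.time + 3 + 4 * L) (fun s' => l - s'.iv 41)
    ⟨0, by simp, by simp, by simp, fun i hi => by simp [upd2, Nat.le_zero.1 hi], by simp⟩ ?_
  rintro s1 hf ⟨L, hL, i41, i40, hpw, tm⟩
  have g73 : s1.iv 73 = l := by simpa [h73] using hf.iv 73 (by decide)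
  clear hf
  have hp : 2 ^ (L + 1) = 2 * 2 ^ L := by rw [pow_succ']
  have hp0 : 0 < 2 ^ L := by positivity
  have hLl : 40 * L ≤ l := (Nat.le_mul_of_pos_right _ hp0).trans hL
  have hdl : 2 ^ L ≤ l + 1 := by
    rcases Nat.eq_zero_or_pos L with rfl | h
    · simp
    · have : 1 * 2 ^ L ≤ 40 * L * 2 ^ L := Nat.mul_le_mul_right _ (by omega)
      omega
  generalize hd : 2 ^ L = d at *
  have c1 : 40 * (L + 1) < S := by omega
  have c2 : 2 * d < S := by omega
  have c3 : 40 * (L + 1) * (2 * d) < S := by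
    have : 40 * (L + 1) * (2 * d) ≤ (l + 40) * (2 * l + 2) :=
      Nat.mul_le_mul (by omega) (by omega)
    omega
  have c4 : L + 1 < S := by omega
  have c5 : l + 1 < S := by omega
  refine ⟨by simp [g73, i40, i41, c1, c2, c3, c4, c5], fun hb => ?_, fun hb => ?_⟩
  · simp only [BE.val_ilt, IE.val_mul, IE.val_add, IE.val_lit, IE.val_var, i40, i41, g73] at hb
    have hge : 40 * (L + 1) * 1 ≤ 40 * (L + 1) * (2 * d) := Nat.mul_le_mul_left _ (by omega)
    simp only [wp_seq, wp_iset, wp_iput, IE.ok_add, IE.ok_mul, IE.ok_var, IE.ok_lit, IE.val_add,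
      IE.val_mul, IE.val_var, IE.val_lit, St.tick_iv, St.tick_time, St.tick_ia, ne_eq,
      Nat.reduceEqDiff, not_false_eq_true, Function.update_of_ne, Function.update_self, i40, i41, b0,
      b2, c2, c4, true_and]
    refine ⟨⟨L + 1, by rw [hp]; omega, rfl, hp.symm, fun i hi => ?_, by omega⟩, by omega⟩
    rw [upd2_apply]
    split_ifs with h
    · rw [h.2, hp]
    · exact hpw i (by omega)
  · simp only [BE.val_ilt, IE.val_mul, IE.val_add, IE.val_lit, IE.val_var, i40, i41, g73] at hb
    have c6 : d * d < S := by
      have : d * d ≤ (l + 40) * (2 * l + 2) := Nat.mul_le_mul (by omega) (by omega)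
      omega
    have c7 : d * d * (d * d) < S := by
      refine lt_of_le_of_lt ?_ hS4
      have e : d * d * (d * d) = d ^ 4 := by ring
      rw [e]
      exact Nat.pow_le_pow_left (by omega) 4
    simp only [wp_seq, wp_iset, IE.ok_mul, IE.ok_var,
      IE.val_mul, IE.val_var, St.tick_iv, St.tick_time, St.tick_ia, ne_eq,
      Nat.reduceEqDiff, not_false_eq_true, Function.update_of_ne, Function.update_self, i40, i41,
      c6, c7, true_and]
    exact ⟨L, by rw [hd]; exact hL, by rw [hp]; omega, rfl, hd.symm, by rw [hd], by rw [hd], hpw,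
      by omega⟩

/-- Copies the input and computes the padding value. -/
def copyCmd : Cmd :=
  75 ≔ 0 ;; .rset 6 0 ;;
  .whl (.ilt (ν 75) (ν 0)) (
    .rput 1 0 (ν 75) (.raw (ν 75)) ;;
    .rput 2 0 (ν 75 + ν 40) (.raw (ν 0 + ν 75)) ;;
    .rset 6 (.var 6 - (2 * (.raw (ν 75) * .raw (ν 75)) +
      .raw (ν 0 + ν 75) * .raw (ν 0 + ν 75) + 3)) ;;
    75 ≔ ν 75 + 1)

theorem wp_copy {d : ℕ} (h0 : s.iv 0 = n) (h40 : s.iv 40 = d) (h1 : ∀ i, s.ra 1 0 i = 0)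
    (hS : 2 * n + d < S) :
    wp S n copyCmd (fun s' => (∀ i, s'.ra 1 0 i = if i < n then s.raw i else 0) ∧
      (∀ j, j < n → s'.ra 2 0 (j + d) = s.raw (n + j)) ∧
      s'.rv 6 = - ∑ i ∈ range n, (2 * (s.raw i * s.raw i) + s.raw (n + i) * s.raw (n + i) + 3) ∧
      s'.time ≤ s.time + 5 * n + 3) s := by
  simp only [copyCmd, wp_seq, wp_iset, wp_rset]
  refine ⟨trivial, trivial, ?_⟩
  refine wp_whl (fun s' => s'.iv 75 ≤ n ∧
    (∀ i, s'.ra 1 0 i = if i < s'.iv 75 then s.raw i else 0) ∧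
    (∀ j, j < s'.iv 75 → s'.ra 2 0 (j + d) = s.raw (n + j)) ∧
    s'.rv 6 = - ∑ i ∈ range (s'.iv 75),
      (2 * (s.raw i * s.raw i) + s.raw (n + i) * s.raw (n + i) + 3) ∧
    s'.time ≤ s.time + 2 + 5 * s'.iv 75) (fun s' => n - s'.iv 75) (by simp [h1]) ?_
  rintro s1 hf ⟨hc, hA, hB, hv, tm⟩
  have g0 : s1.iv 0 = n := by simpa [h0] using hf.iv 0 (by decide)
  have g40 : s1.iv 40 = d := by simpa [h40] using hf.iv 40 (by decide)
  have graw : s1.raw = s.raw := by simpa using hf.raw (by decide)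
  clear hf
  generalize i75 : s1.iv 75 = c at *
  refine ⟨by simp, fun hb => ?_, fun hb => ?_⟩
  · simp only [BE.val_ilt, IE.val_var, i75, g0] at hb
    have b0 : 0 < S := by omega
    have b1 : c < S := by omega
    have b2 : c + d < S := by omega
    have b3 : n + c < S := by omega
    have b4 : c + 1 < S := by omega
    have b5 : c < 2 * n := by omega
    have b6 : n + c < 2 * n := by omega
    simp only [wp_seq, wp_iset, wp_rput, wp_rset, IE.ok_add, IE.ok_var, IE.ok_lit, IE.val_add,
      IE.val_var, IE.val_lit, RE.ok_raw, RE.ok_sub, RE.ok_add, RE.ok_mul, RE.ok_var, RE.ok_lit,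
      RE.val_raw, RE.val_sub, RE.val_add, RE.val_mul, RE.val_var, RE.val_lit, St.tick_iv,
      St.tick_time, St.tick_ra, St.tick_rv, St.tick_raw, ne_eq, Nat.reduceEqDiff,
      not_false_eq_true, Function.update_of_ne, Function.update_self, i75, g0, g40, graw, b0, b1, b2,
      b3, b4, b5, b6, true_and]
    refine ⟨⟨by omega, fun i => ?_, fun j hj => ?_, ?_, by omega⟩, by omega⟩
    · rw [upd2_apply, hA]
      split_ifs with q1 q2 q3 <;> first | rfl | omega | (rw [q1.2])
    · rw [upd2_apply]
      split_ifs with q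
      · rw [show j = c by omega]
      · exact hB j (by omega)
    · rw [sum_range_succ, hv]
      push_cast
      ring
  · simp only [BE.val_ilt, IE.val_var, i75, g0] at hb
    have : c = n := by omega
    subst this
    exact ⟨hA, hB, hv, by simp only [St.tick_time]; omega⟩

/-- Fills the first `ν 40` entries of `Y`. -/
def padCmd : Cmd :=
  75 ≔ 0 ;; .whl (.ilt (ν 75) (ν 40)) (.rput 2 0 (ν 75) (.var 6) ;; 75 ≔ ν 75 + 1)

theorem wp_pad {d : ℕ} (h40 : s.iv 40 = d) (hS : d < S) :
    wp S n padCmd (fun s' => (∀ j, s'.ra 2 0 j = if j < d then s.rv 6 else s.ra 2 0 j) ∧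
      s'.time ≤ s.time + 3 * d + 2) s := by
  simp only [padCmd, wp_seq, wp_iset]
  refine ⟨trivial, ?_⟩
  refine wp_whl (fun s' => s'.iv 75 ≤ d ∧
    (∀ i, s'.ra 2 0 i = if i < s'.iv 75 then s.rv 6 else s.ra 2 0 i) ∧
    s'.time ≤ s.time + 1 + 3 * s'.iv 75) (fun s' => d - s'.iv 75) (by simp) ?_
  rintro s1 hf ⟨hc, hA, tm⟩
  have g40 : s1.iv 40 = d := by simpa [h40] using hf.iv 40 (by decide)
  have g6 : s1.rv 6 = s.rv 6 := by simpa using hf.rv 6 (by decide)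
  clear hf
  generalize i75 : s1.iv 75 = c at *
  refine ⟨by simp, fun hb => ?_, fun hb => ?_⟩
  · simp only [BE.val_ilt, IE.val_var, i75, g40] at hb
    have b0 : 0 < S := by omega
    have b1 : c < S := by omega
    have b4 : c + 1 < S := by omega
    simp only [wp_seq, wp_iset, wp_rput, IE.ok_add, IE.ok_var, IE.ok_lit, IE.val_add,
      IE.val_var, IE.val_lit, RE.ok_var, RE.val_var, St.tick_iv,
      St.tick_time, St.tick_ra, St.tick_rv, Function.update_self, i75, g6, b0, b1,
      b4, true_and]
    refine ⟨⟨by omega, fun i => ?_, by omega⟩, by omega⟩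
    rw [upd2_apply, hA]
    split_ifs <;> first | rfl | omega
  · simp only [BE.val_ilt, IE.val_var, i75, g40] at hb
    have : c = d := by omega
    subst this
    exact ⟨hA, by simp only [St.tick_time]; omega⟩

/-- Linear terms are dominated by squares through `2 * |u| ≤ u * u + 1`. The coefficient `2` pays
for both `x i` and `X i'`, which may be the same entry, and the constant `3` for the remaining
units. A sum of squares serves as a bound that needs no comparisons. -/
theorem padded_of {x y : Fin n → ℝ} {d : ℕ} {X Y : ℕ → ℝ} {b : ℝ}
    (hX : ∀ i : Fin n, X i = x i) (hX0 : ∀ i, n ≤ i → X i = 0) (hY : ∀ j : Fin n, Y (j + d) = y j)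
    (hb : ∀ t, t < d → Y t = b)
    (hbv : b = - ∑ i : Fin n, (2 * (x i * x i) + y i * y i + 3)) : Padded x y d X Y := by
  refine ⟨hX, hY, fun i j i' t ht => ?_⟩
  rw [hb t ht, hbv, sum_add_distrib, sum_add_distrib, ← mul_sum]
  have hn : (1 : ℝ) ≤ n := by exact_mod_cast (by have := i.2; omega : 1 ≤ n)
  have h1 : x i * x i ≤ ∑ l : Fin n, x l * x l :=
    single_le_sum (f := fun l => x l * x l) (fun l _ => mul_self_nonneg _) (mem_univ i)
  have h2 : y j * y j ≤ ∑ l : Fin n, y l * y l :=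
    single_le_sum (f := fun l => y l * y l) (fun l _ => mul_self_nonneg _) (mem_univ j)
  have h3 : X i' * X i' ≤ ∑ l : Fin n, x l * x l := by
    by_cases h : i' < n
    · have := single_le_sum (f := fun l : Fin n => x l * x l) (fun l _ => mul_self_nonneg _)
        (mem_univ ⟨i', h⟩)
      rw [← hX] at this
      exact this
    · rw [hX0 i' (by omega), mul_zero]
      exact sum_nonneg fun l _ => mul_self_nonneg _
  have h4 : ∑ _l : Fin n, (3 : ℝ) = n * 3 := by simp
  rw [h4]
  nlinarith [sq_nonneg (x i - 1), sq_nonneg (y j + 1), sq_nonneg (X i' + 1)]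

end MedConv

/-! ### The whole algorithm -/

namespace MedConv

open Finset

variable {S n : ℕ} {s s' : St}

/-- Dimensions, copies of the input, and padding. -/
def setupCmd : Cmd := logCmd ;; dimCmd ;; copyCmd ;; padCmd

/-- The whole algorithm. -/
def medianConvCmd (ρ : MedianRule) : Cmd := setupCmd ;; tableCmd ;; entriesCmd ρ

theorem medianConvCmd_wf (ρ : MedianRule) : (medianConvCmd ρ).wf = true := by
  cases ρ <;> decide

/-- The condition on `L` is made for this: `d ^ (40 * d) = 2 ^ (40 * L * 2 ^ L) ≤ n` for `d = 2 ^
L`. -/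
theorem block_pow_le {n L k : ℕ} (hn : 1 ≤ n) (hL : 40 * L * 2 ^ L ≤ Nat.log 2 n)
    (hk : k ≤ 40 * 2 ^ L) : (2 ^ L) ^ k ≤ n := by
  have h := Nat.pow_le_pow_right (n := 2) (by norm_num) hL
  refine le_trans ?_ (h.trans (Nat.pow_log_le_self 2 (by omega)))
  rw [← pow_mul]
  refine Nat.pow_le_pow_right (by norm_num) ?_
  calc L * k ≤ L * (40 * 2 ^ L) := Nat.mul_le_mul_left _ hk
    _ = 40 * L * 2 ^ L := by ring

theorem block_pow_le_succ {n L k : ℕ} (hL : 40 * L * 2 ^ L ≤ Nat.log 2 n) (hk : k ≤ 40) :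
    (2 ^ L) ^ k ≤ n + 1 := by
  rcases Nat.eq_zero_or_pos n with rfl | hn
  · have : L = 0 := by
      rw [Nat.log_zero_right, Nat.le_zero, mul_eq_zero] at hL
      rcases hL with h | h
      · omega
      · simp at h
    simp [this]
  · have := Nat.one_le_two_pow (n := L)
    exact (block_pow_le hn hL (by omega)).trans (Nat.le_succ n)

theorem wp_setup (x y : Fin n → ℝ) :
    wp ((n + 2) ^ 16) n setupCmd (fun s' => ∃ L, 40 * L * 2 ^ L ≤ Nat.log 2 n ∧
      Nat.log 2 n < 40 * (L + 1) * 2 ^ (L + 1) ∧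
      s'.iv 0 = n ∧ s'.iv 41 = L ∧ s'.iv 40 = 2 ^ L ∧ s'.iv 50 = 2 ^ L * 2 ^ L ∧
      s'.iv 51 = 2 ^ L * 2 ^ L * (2 ^ L * 2 ^ L) ∧ (∀ i, i ≤ L → s'.ia 4 0 i = 2 ^ i) ∧
      (∀ v r, s'.ia 0 v r = 0) ∧ (∀ v r, s'.ia 2 v r = 0) ∧
      Padded x y (2 ^ L) (s'.ra 1 0) (s'.ra 2 0) ∧
      s'.time ≤ 12 * n + 3 * 2 ^ L + 14) (init x y) := by
  have hl := Nat.log_le_self 2 n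
  have p1 : n + 2 < (n + 2) ^ 16 := by
    have := Nat.pow_lt_pow_right (a := n + 2) (by omega) (by norm_num : 1 < 16)
    rwa [pow_one] at this
  have p15 : 2 ^ 14 * ((n + 2) * (n + 2)) ≤ (n + 2) ^ 16 := by
    have : (n + 2) ^ 16 = (n + 2) ^ 14 * ((n + 2) * (n + 2)) := by ring
    rw [this]
    exact Nat.mul_le_mul_right _ (Nat.pow_le_pow_left (by omega) 14)
  have p2 : 2 * (n + 2) ≤ (n + 2) * (n + 2) := Nat.mul_le_mul_right _ (by omega)
  simp only [setupCmd, wp_seq]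
  refine (wp_log (N := n) (by rfl) (by omega)).mono ?_
  rintro s1 f1 ⟨h73, tm1⟩
  generalize hlog : Nat.log 2 n = l at *
  have q1 : (l + 40) * (2 * l + 2) ≤ 20 * (n + 2) * (2 * (n + 2)) :=
    Nat.mul_le_mul (by omega) (by omega)
  have e1 : 20 * (n + 2) * (2 * (n + 2)) = 40 * ((n + 2) * (n + 2)) := by ring
  have q2 : (l + 1) ^ 4 < (n + 2) ^ 16 :=
    (Nat.pow_le_pow_left (by omega : l + 1 ≤ n + 2) 4).trans_lt
      (Nat.pow_lt_pow_right (by omega) (by norm_num))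
  rw [wp_seq]
  refine (wp_dim h73 (by omega) q2).mono ?_
  rintro s2 f2 ⟨L, hL, hL', i41, i40, i50, i51, hpw, tm2⟩
  have hd : 2 ^ L ≤ n + 1 := by
    simpa using block_pow_le_succ (k := 1) (by rw [hlog]; exact hL) (by norm_num)
  have g0 : s2.iv 0 = n := by rw [f2.iv 0 (by decide), f1.iv 0 (by decide)]; rfl
  have gra : s2.ra = fun _ _ _ => 0 := by
    funext A
    rw [f2.ra A (by simp [dimCmd, Cmd.wRA]), f1.ra A (by simp [logCmd, Cmd.wRA])]; rfl
  have graw : s2.raw = (init x y).raw := by rw [f2.raw (by decide), f1.raw (by decide)]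
  rw [wp_seq]
  refine (wp_copy g0 i40 (by simp [gra]) (by omega)).mono ?_
  rintro s3 f3 ⟨hA, hB, hv, tm3⟩
  have g40 : s3.iv 40 = 2 ^ L := by rw [f3.iv 40 (by decide), i40]
  refine (wp_pad g40 (by omega)).mono ?_
  rintro s4 f4 ⟨hC, tm4⟩
  refine ⟨L, hL, hL', ?_, ?_, ?_, ?_, ?_, fun i hi => ?_, fun v r => ?_, fun v r => ?_, ?_, ?_⟩
  · rw [f4.iv 0 (by decide), f3.iv 0 (by decide), g0]
  · rw [f4.iv 41 (by decide), f3.iv 41 (by decide), i41]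
  · rw [f4.iv 40 (by decide), f3.iv 40 (by decide), i40]
  · rw [f4.iv 50 (by decide), f3.iv 50 (by decide), i50]
  · rw [f4.iv 51 (by decide), f3.iv 51 (by decide), i51]
  · rw [f4.ia 4 (by decide), f3.ia 4 (by decide), hpw i hi]
  · rw [f4.ia 0 (by decide), f3.ia 0 (by decide), f2.ia 0 (by decide), f1.ia 0 (by decide)]; rfl
  · rw [f4.ia 2 (by decide), f3.ia 2 (by decide), f2.ia 2 (by decide), f1.ia 2 (by decide)]; rfl
  · have hx : ∀ i : Fin n, s2.raw i = x i := fun i => by simp [graw, init, RealRAM.input]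
    have hy : ∀ i : Fin n, s2.raw (n + i) = y i := fun i => by simp [graw, init, RealRAM.input]
    rw [f4.ra 1 (by decide)]
    refine padded_of (b := s3.rv 6) (fun i => by rw [hA, if_pos i.2, hx])
      (fun i hi => by rw [hA, if_neg (by omega)])
      (fun j => by rw [hC, if_neg (by omega), hB j j.2, hy]) (fun t ht => by rw [hC, if_pos ht]) ?_
    rw [hv, sum_range]
    simp only [hx, hy]
  · have : (init x y).time = 0 := rfl
    omega

/-- The running time in terms of the length and the logarithm of the block length. -/
def blockTime (n L : ℕ) : ℕ :=
  let d := 2 ^ L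
  let h := d * d
  let g := h * h
  12 * n + 3 * d + 14 + ((n / (g * d) + 1) * ((g * (d * d) + 1) ^ (d + 1) *
    (g * (30 * (d + 1) ^ 2) + 4) + n * (h * (4 * h + 14) + 3 * g + 12) +
    h * (10 * (g + 1) ^ 2 + 6) + 10) + 3) + (n * (2000000000 * (n / d + 1) * (L + 1) + 11) + 4)

theorem wp_medianConvCmd (ρ : MedianRule) (x y : Fin n → ℝ) :
    wp ((n + 2) ^ 16) n (medianConvCmd ρ) (fun s' => ∃ L, 40 * L * 2 ^ L ≤ Nat.log 2 n ∧
      Nat.log 2 n < 40 * (L + 1) * 2 ^ (L + 1) ∧ s'.time ≤ blockTime n L ∧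
      ∀ k : Fin n, s'.raw k = medianConv ρ n x y k) (init x y) := by
  simp only [medianConvCmd, wp_seq]
  refine (wp_setup x y).mono ?_
  rintro s1 f1 ⟨L, hL, hL', i0, i41, i40, i50, i51, hpw, hz0, hz2, hpad, tm1⟩
  have b2 := block_pow_le_succ (k := 2) hL (by norm_num)
  have b4 := block_pow_le_succ (k := 4) hL (by norm_num)
  have b5 := block_pow_le_succ (k := 5) hL (by norm_num)
  have b1 := block_pow_le_succ (k := 1) hL (by norm_num)
  have hLl : L < 2 ^ L := Nat.lt_two_pow_self
  rw [pow_one] at b1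
  have p16 : 2 ^ 12 * ((n + 2) ^ 4) ≤ (n + 2) ^ 16 := by
    have : (n + 2) ^ 16 = (n + 2) ^ 12 * (n + 2) ^ 4 := by ring
    rw [this]
    exact Nat.mul_le_mul_right _ (Nat.pow_le_pow_left (by omega) 12)
  have p4 : 8 * (n + 2) ≤ (n + 2) ^ 4 := by
    have : (n + 2) ^ 4 = (n + 2) ^ 3 * (n + 2) := by ring
    rw [this]
    exact Nat.mul_le_mul_right _ (Nat.pow_le_pow_left (by omega : 2 ≤ n + 2) 3)
  have p5 : (n + 1) * (1 + n * (n + 1)) ≤ (n + 2) ^ 4 := by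
    calc (n + 1) * (1 + n * (n + 1)) ≤ (n + 2) ^ 2 * (n + 2) ^ 2 :=
          Nat.mul_le_mul (by nlinarith) (by nlinarith)
      _ = (n + 2) ^ 4 := by ring
  unfold blockTime
  generalize hd : 2 ^ L = d at *
  have hd0 : 0 < d := by omega
  have e2 : d * d ≤ n + 1 := by rw [← pow_two]; exact b2
  have e4 : d * d * (d * d) ≤ n + 1 := by
    have : d * d * (d * d) = d ^ 4 := by ring
    omega
  have e5 : d * d * (d * d) * d ≤ n + 1 := by
    have : d * d * (d * d) * d = d ^ 5 := by ring
    omega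
  have hc : (n + 1) * (1 + n * (d * d)) ≤ (n + 2) ^ 4 :=
    le_trans (Nat.mul_le_mul_left _ (Nat.add_le_add_left (Nat.mul_le_mul_left _ e2) _)) p5
  rw [wp_seq]
  refine (wp_table (S := (n + 2) ^ 16) (s := s1) rfl rfl i0 i40 hd0 i50 rfl i51 rfl hz0 (hz2 0)
    (fun J A _ h => card_le_of_injOn_rankList _ _ J d _ A h) (by omega) (by omega)
    (by omega)).mono ?_
  rintro s2 f2 ⟨cnt, hcnt, hent, tm2⟩
  have hr : Ready x y d L cnt s2 := by
    refine ⟨?_, ?_, ?_, hd.symm, fun i hi => ?_, ?_, ?_⟩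
    · rw [f2.iv 0 (by decide), i0]
    · rw [f2.iv 40 (by decide), i40]
    · rw [f2.iv 41 (by decide), i41]
    · rw [f2.ia 4 (by decide), hpw i hi]
    · rw [f2.ra 1 (by decide), f2.ra 2 (by decide)]; exact hent
    · rw [f2.ra 1 (by decide), f2.ra 2 (by decide)]; exact hpad
  have hS : 2 ^ 15 + 12800 * n + 2 * d ≤ (n + 2) ^ 16 := by
    omega
  refine (wp_entries (ρ := ρ) hr (by omega) (by omega) hS).mono ?_
  rintro s3 f3 ⟨hout, tm3⟩
  refine ⟨L, by rw [hd]; exact hL, hL', ?_, hout⟩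
  have key : ∀ {t1 t2 t3 A B E : ℕ}, t3 ≤ t2 + E + 4 → t2 ≤ t1 + A + 3 → t1 ≤ B →
      t3 ≤ B + (A + 3) + (E + 4) := by
    intros
    omega
  rw [hd]
  exact key tm3 tm2 tm1

end MedConv

/-! ### Asymptotic analysis -/

namespace MedConv

open Filter Real

/-- The logarithm of the block length for inputs of length `n`. -/
def blockLog (n : ℕ) : ℕ := Nat.findGreatest (fun L => 40 * L * 2 ^ L ≤ Nat.log 2 n) n

theorem blockLog_le (n : ℕ) : 40 * blockLog n * 2 ^ blockLog n ≤ Nat.log 2 n :=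
  Nat.findGreatest_spec (P := fun L => 40 * L * 2 ^ L ≤ Nat.log 2 n) (Nat.zero_le n) (by simp)

theorem mul_two_pow_mono {a b : ℕ} (h : a ≤ b) : 40 * a * 2 ^ a ≤ 40 * b * 2 ^ b :=
  Nat.mul_le_mul (by omega) (Nat.pow_le_pow_right (by norm_num) h)

/-- The specification of the program speaks of some `L` within these bounds. As they determine `L`,
the running time is bounded by a function of `n` alone. -/
theorem eq_blockLog {n L : ℕ} (h : 40 * L * 2 ^ L ≤ Nat.log 2 n)
    (h' : Nat.log 2 n < 40 * (L + 1) * 2 ^ (L + 1)) : L = blockLog n := by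
  refine le_antisymm (Nat.le_findGreatest ?_ h) ?_
  · have h1 : L * 1 ≤ L * (40 * 2 ^ L) := Nat.mul_le_mul_left _ (by
      have := Nat.one_le_two_pow (n := L); omega)
    have h2 : L * (40 * 2 ^ L) = 40 * L * 2 ^ L := by ring
    have h3 := Nat.log_le_self 2 n
    omega
  · by_contra hlt
    have := mul_two_pow_mono (by omega : L + 1 ≤ blockLog n)
    have := blockLog_le n
    omega

theorem log_lt_blockLog (n : ℕ) :
    Nat.log 2 n < 40 * (blockLog n + 1) * 2 ^ (blockLog n + 1) := by
  by_contra h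
  have h0 : blockLog n + 1 ≤ n := by
    have h1 : (blockLog n + 1) * 1 ≤ (blockLog n + 1) * (40 * 2 ^ (blockLog n + 1)) :=
      Nat.mul_le_mul_left _ (by have := Nat.one_le_two_pow (n := blockLog n + 1); omega)
    have h2 : (blockLog n + 1) * (40 * 2 ^ (blockLog n + 1)) =
      40 * (blockLog n + 1) * 2 ^ (blockLog n + 1) := by ring
    have h3 := Nat.log_le_self 2 n
    omega
  have := Nat.le_findGreatest (P := fun L => 40 * L * 2 ^ L ≤ Nat.log 2 n) h0 (by omega)
  unfold blockLog at this
  omega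

/-- The number of classes in a group is small. -/
theorem class_bound {n L d : ℕ} (hn : 1 ≤ n) (hL : 40 * L * 2 ^ L ≤ Nat.log 2 n)
    (hd : 2 ^ L = d) : (d * d * (d * d) * (d * d) + 1) ^ (d + 1) * (d * d) ≤ 4 * n := by
  rcases Nat.eq_zero_or_pos L with rfl | h
  -- For `d = 1` the left side is `2 ^ 2`, which is where the factor `4` is needed.
  · have : d = 1 := by simpa using hd.symm
    subst this
    norm_num
    omega
  · have h2 : 2 ≤ d := by
      rw [← hd]; exact Nat.le_self_pow (by omega) 2
    have h1 : d * d * (d * d) * (d * d) + 1 ≤ d ^ 7 := by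
      have e : d ^ 7 = d * d * (d * d) * (d * d) * d := by ring
      have : 1 ≤ d * d * (d * d) * (d * d) := Nat.pos_of_ne_zero (by positivity)
      rw [e]
      nlinarith
    calc (d * d * (d * d) * (d * d) + 1) ^ (d + 1) * (d * d) ≤ (d ^ 7) ^ (d + 1) * (d * d) :=
          Nat.mul_le_mul_right _ (Nat.pow_le_pow_left h1 _)
      _ = d ^ (7 * (d + 1) + 2) := by rw [← pow_mul, ← pow_two, ← pow_add]
      _ ≤ n := by
        rw [← hd]
        -- The exponent is `7 * d + 9`, at most `40 * d`.
        exact block_pow_le hn hL (by rw [hd]; omega)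
      _ ≤ 4 * n := by omega

theorem div_add_one_mul_le {n m : ℕ} (h : m ≤ n) : (n / m + 1) * m ≤ 2 * n := by
  have := Nat.div_mul_le_self n m
  rw [Nat.add_mul, Nat.one_mul]
  omega

/-- There are `q` groups with `q * (g * d) ≤ 2 * n`, and each may take `O(g * n)` steps. The
representatives of the classes fit because `W * h ≤ 4 * n`, the walks of all shifts because `h * h =
g`, and the sorting of the differences because `h * g ≤ n`. The constant is `2 * (496 + 33 + 56)`.
-/
theorem table_bound {n d h g q W : ℕ} (hd : 1 ≤ d) (hh : h = d * d) (hg : g = h * h)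
    (hq : q * (g * d) ≤ 2 * n) (hW : W * h ≤ 4 * n) (hn : h * g ≤ n) :
    q * (W * (g * (30 * (d + 1) ^ 2) + 4) + n * (h * (4 * h + 14) + 3 * g + 12) +
      h * (10 * (g + 1) ^ 2 + 6) + 10) * d ≤ 1170 * (n * n) := by
  have h1 : 1 ≤ h := by rw [hh]; exact Nat.mul_pos hd hd
  have hhg : h ≤ g := by rw [hg]; exact Nat.le_mul_of_pos_left _ h1
  have hg1 : 1 ≤ g := h1.trans hhg
  have hgh : g ≤ g * h := Nat.le_mul_of_pos_right _ h1
  have a1 : (d + 1) ^ 2 ≤ 4 * h := by rw [hh]; nlinarith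
  have a2 : W * (g * (30 * (d + 1) ^ 2) + 4) ≤ g * (496 * n) := by
    calc W * (g * (30 * (d + 1) ^ 2) + 4) ≤ W * (g * (30 * (4 * h)) + 4 * (g * h)) := by
          gcongr; omega
      _ = g * (124 * (W * h)) := by ring
      _ ≤ g * (124 * (4 * n)) := by gcongr
      _ = g * (496 * n) := by ring
  have a3 : n * (h * (4 * h + 14) + 3 * g + 12) ≤ g * (33 * n) := by
    have : h * (4 * h + 14) + 3 * g + 12 ≤ 33 * g := by
      have : h * (4 * h + 14) = 4 * g + 14 * h := by rw [hg]; ring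
      omega
    calc n * (h * (4 * h + 14) + 3 * g + 12) ≤ n * (33 * g) := Nat.mul_le_mul_left _ this
      _ = g * (33 * n) := by ring
  have a4 : h * (10 * (g + 1) ^ 2 + 6) + 10 ≤ g * (56 * n) := by
    have b1 : 10 * (g + 1) ^ 2 + 6 ≤ 46 * (g * g) := by nlinarith
    have b2 : 1 ≤ g * (h * g) := Nat.mul_pos hg1 (Nat.mul_pos h1 hg1)
    calc h * (10 * (g + 1) ^ 2 + 6) + 10 ≤ h * (46 * (g * g)) + 10 * (g * (h * g)) := by
          gcongr; omega
      _ = g * (56 * (h * g)) := by ring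
      _ ≤ g * (56 * n) := by gcongr
  calc q * (W * (g * (30 * (d + 1) ^ 2) + 4) + n * (h * (4 * h + 14) + 3 * g + 12) +
        h * (10 * (g + 1) ^ 2 + 6) + 10) * d
      ≤ q * (g * (496 * n) + g * (33 * n) + g * (56 * n)) * d := by
        gcongr q * ?_ * d
        omega
    _ = q * (g * d) * (585 * n) := by ring
    _ ≤ 2 * n * (585 * n) := Nat.mul_le_mul_right _ hq
    _ = 1170 * (n * n) := by ring

/-- Selection dominates: since `(n / d + 1) * d ≤ 2 * n`, it accounts for `4000000000 * (n * n) * (L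
+ 1)`, and everything else is far below the remainder. -/
theorem blockTime_mul_le {n L : ℕ} (hn : 1 ≤ n) (hL : 40 * L * 2 ^ L ≤ Nat.log 2 n) :
    blockTime n L * 2 ^ L ≤ 5000000000 * (n * n) * (L + 1) := by
  have b1 := block_pow_le (k := 1) hn hL (by have := Nat.one_le_two_pow (n := L); omega)
  have b5 := block_pow_le (k := 5) hn hL (by have := Nat.one_le_two_pow (n := L); omega)
  have b6 := block_pow_le (k := 6) hn hL (by have := Nat.one_le_two_pow (n := L); omega)
  have h1 := Nat.one_le_two_pow (n := L)
  unfold blockTime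
  generalize hd : 2 ^ L = d at *
  rw [pow_one] at b1
  have e5 : d * d * (d * d) * d ≤ n := by
    have : d * d * (d * d) * d = d ^ 5 := by ring
    omega
  have e6 : d * d * (d * d * (d * d)) ≤ n := by
    have : d * d * (d * d * (d * d)) = d ^ 6 := by ring
    omega
  have ht := table_bound h1 rfl rfl (div_add_one_mul_le e5)
    (class_bound hn (by rw [hd]; exact hL) hd) e6
  have hq := div_add_one_mul_le b1
  dsimp only
  generalize (n / (d * d * (d * d) * d) + 1) * _ = A at ht ⊢
  generalize n / d + 1 = q at hq ⊢
  have hn2 : n ≤ n * n := Nat.le_mul_of_pos_left _ hn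
  have hdn : n * d ≤ n * n := Nat.mul_le_mul_left _ b1
  have hdd : d * d ≤ n * n := Nat.mul_le_mul b1 b1
  have e : (12 * n + 3 * d + 14 + (A + 3) + (n * (2000000000 * q * (L + 1) + 11) + 4)) * d =
      23 * (n * d) + 3 * (d * d) + 21 * d + A * d + 2000000000 * (n * (q * d) * (L + 1)) := by ring
  have hm : n * (q * d) * (L + 1) ≤ n * (2 * n) * (L + 1) := by gcongr
  have hm2 : n * (2 * n) * (L + 1) = 2 * (n * n * (L + 1)) := by ring
  have hm3 : n * n ≤ n * n * (L + 1) := Nat.le_mul_of_pos_right _ (by omega)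
  rw [e, Nat.mul_assoc 5000000000]
  omega

/-- One factor `lg lg n` is the `L + 1` of the selection. The other comes from `d = 2 ^ L` being a
little smaller than `lg n`: maximality of `L` gives `lg n ≤ 80 (L + 1) 2 ^ L`. For `4 ≤ n` also `1 ≤
lg lg n`, hence `L + 1 ≤ 2 lg lg n`, and the constant is `5 * 10 ^ 9 * 80 * 4`. -/
theorem blockTime_real_le {n : ℕ} (hn : 4 ≤ n) : (blockTime n (blockLog n) : ℝ) ≤
    1600000000000 * ((n : ℝ) ^ 2 * (logb 2 (logb 2 n)) ^ 2 / logb 2 n) := by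
  have hb := blockTime_mul_le (by omega : 1 ≤ n) (blockLog_le n)
  have hl := blockLog_le n
  have hl' := log_lt_blockLog n
  generalize blockLog n = L at *
  generalize blockTime n L = T at *
  have hn0 : (0 : ℝ) < n := by exact_mod_cast (by omega : 0 < n)
  have hlg2 : 2 ≤ logb 2 (n : ℝ) := by
    rw [le_logb_iff_rpow_le (by norm_num) hn0]
    norm_num
    exact_mod_cast hn
  have hup : logb 2 (n : ℝ) ≤ 80 * (L + 1) * 2 ^ L := by
    rw [logb_le_iff_le_rpow (by norm_num) hn0]
    have h1 : n < 2 ^ (80 * (L + 1) * 2 ^ L) := by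
      refine (Nat.lt_pow_succ_log_self (by norm_num : 1 < 2) n).trans_le
        (Nat.pow_le_pow_right (by norm_num) ?_)
      have : 40 * (L + 1) * 2 ^ (L + 1) = 80 * (L + 1) * 2 ^ L := by rw [pow_succ]; ring
      omega
    have h2 : ((80 : ℝ) * (L + 1) * 2 ^ L) = ((80 * (L + 1) * 2 ^ L : ℕ) : ℝ) := by push_cast; ring
    rw [h2, rpow_natCast]
    exact_mod_cast h1.le
  have hlow : (2 : ℝ) ^ L ≤ logb 2 (n : ℝ) ∨ L = 0 := by
    rcases Nat.eq_zero_or_pos L with h | h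
    · exact Or.inr h
    · left
      rw [le_logb_iff_rpow_le (by norm_num) hn0]
      have h1 : 2 ^ L ≤ Nat.log 2 n := by
        have : 1 * 2 ^ L ≤ 40 * L * 2 ^ L := Nat.mul_le_mul_right _ (by omega)
        omega
      have h2 : 2 ^ (2 ^ L) ≤ n := (Nat.pow_le_pow_right (by norm_num) h1).trans
        (Nat.pow_log_le_self 2 (by omega))
      have h3 : (2 : ℝ) ^ L = ((2 ^ L : ℕ) : ℝ) := by push_cast; rfl
      rw [h3, rpow_natCast]
      exact_mod_cast h2
  generalize logb 2 (n : ℝ) = l at *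
  have hll1 : 1 ≤ logb 2 l := by
    rw [le_logb_iff_rpow_le (by norm_num) (by linarith), rpow_one]
    exact hlg2
  have hll : (L : ℝ) ≤ logb 2 l := by
    rcases hlow with h | rfl
    · rw [le_logb_iff_rpow_le (by norm_num) (by linarith), rpow_natCast]
      exact h
    · push_cast; linarith
  generalize logb 2 l = m at *
  have hbR : (T : ℝ) * 2 ^ L ≤ 5000000000 * (n * n) * (L + 1) := by exact_mod_cast hb
  have hd : (0 : ℝ) < 2 ^ L := by positivity
  have hL1 : (L : ℝ) + 1 ≤ 2 * m := by linarith
  have hL0 : (0 : ℝ) ≤ L := Nat.cast_nonneg _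
  rw [← mul_div_assoc, le_div_iff₀ (by linarith)]
  calc (T : ℝ) * l ≤ T * (80 * (L + 1) * 2 ^ L) := by gcongr
    _ = 80 * (L + 1) * (T * 2 ^ L) := by ring
    _ ≤ 80 * (L + 1) * (5000000000 * (n * n) * (L + 1)) := by gcongr
    _ = 400000000000 * (n : ℝ) ^ 2 * ((L + 1) * (L + 1)) := by ring
    _ ≤ 400000000000 * (n : ℝ) ^ 2 * ((2 * m) * (2 * m)) := by gcongr
    _ = 1600000000000 * ((n : ℝ) ^ 2 * m ^ 2) := by ring

theorem one_le_blockTime (n L : ℕ) : 1 ≤ blockTime n L := by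
  unfold blockTime
  dsimp only
  omega

theorem isBigO_blockTime (a b : ℕ) :
    (fun n : ℕ => ((a + b * blockTime n (blockLog n) : ℕ) : ℝ)) =O[atTop]
      fun n : ℕ => (n : ℝ) ^ 2 * (logb 2 (logb 2 n)) ^ 2 / logb 2 n := by
  refine Asymptotics.IsBigO.of_bound ((a + b) * 1600000000000) ?_
  filter_upwards [eventually_ge_atTop 4] with n hn
  have h := blockTime_real_le hn
  have h1 : (1 : ℝ) ≤ blockTime n (blockLog n) := by exact_mod_cast one_le_blockTime _ _
  generalize (n : ℝ) ^ 2 * (logb 2 (logb 2 n)) ^ 2 / logb 2 n = r at *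
  rw [Real.norm_of_nonneg (Nat.cast_nonneg _), Real.norm_of_nonneg (by linarith)]
  push_cast
  have ha : (0 : ℝ) ≤ a := Nat.cast_nonneg _
  have hb : (0 : ℝ) ≤ b := Nat.cast_nonneg _
  have h2 := mul_le_mul_of_nonneg_left (h1.trans h) ha
  have h3 := mul_le_mul_of_nonneg_left h hb
  linarith

end MedConv

theorem mainTheorem1 (ρ : MedianRule) :
    ∃ (p : RealRAM.Prog) (T : ℕ → ℕ),
      RealRAM.Computes p (medianConv ρ) T ∧
      Asymptotics.IsBigO Filter.atTop (fun n : ℕ => (T n : ℝ))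
        (fun n : ℕ => (n : ℝ) ^ 2 * (Real.logb 2 (Real.logb 2 n)) ^ 2 / Real.logb 2 n) := by
  refine ⟨.seq MedConv.prelude (MedConv.medianConvCmd ρ).comp,
    fun n => 7 + (MedConv.medianConvCmd ρ).kap * MedConv.blockTime n (MedConv.blockLog n),
    MedConv.computes_of_wp (MedConv.medianConvCmd_wf ρ) fun n x y => ?_,
    MedConv.isBigO_blockTime _ _⟩
  refine (MedConv.wp_medianConvCmd ρ x y).mono ?_
  rintro s - ⟨L, hL, hL', ht, hout⟩
  rw [← MedConv.eq_blockLog hL hL']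
  exact ⟨ht, hout⟩
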